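/- Let $P$ and $Q$ be polygonal curves in $\mathbb{R}^1$ with vertices $p_0,\dots,p_n$ and $q_0,\dots,q_m$, parametrized by arc length, of lengths $\ell_P,\ell_Q$, and let $\varepsilon>0$. Their free space diagram $D_\varepsilon(P,Q)$ is the rectangle $[0,\ell_P]\times[0,\ell_Q]$, subdivided into $n$ columns and $m$ rows by the vertical lines through the arc-length positions of the $p_i$ and the horizontal lines through those of the $q_j$, in which a point $(r,t)$ is white iff $|P(r)-Q(t)|\le\varepsilon$. The curves realize a given diagram $D$ (a grid with $n$ columns and $m$ rows and a set of white points in the rectangle it spans) if $D_\varepsilon(P,Q)=D$. A diagram is given to an algorithm by $n$, $m$, $\varepsilon$, the widths of its columns, the heights of its rows, and, for each closed cell, a slab bounded by two parallel lines of slope $+1$ or $-1$ (given by their equations) whose intersection with the cell is the white part of the cell; the slab misses empty cells and contains full cells. There are a single real RAM program (unit-cost arithmetic and comparisons on integers and reals, indirect addressing by integers, no rounding of reals) and a constant $C$ such that the following holds for all integers $n\ge m\ge 1$, $W\ge 1$ and $\varepsilon\ge 1$ and every diagram $D$ with $n$ columns and $m$ rows, given in this way, all of whose cells have positive integer width and height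 at most $W$. On this input the program halts after at most $C\cdot\max(n\varepsilon^2,\,n^2W)$ steps. If there are curves $P,Q$ in $\mathbb{R}^1$ that realize $D$, it outputs the vertices of two such curves; otherwise it answers \texttt{false}. -/

import Mathlib

/-! ### Polygonal curves on the line and their free space diagrams -/

/-- The arc length along the polygonal curve `p 0, …, p n` from its start to its `i`-th vertex. -/
noncomputable def arcLength {n : ℕ} (p : Fin (n + 1) → ℝ) (i : Fin (n + 1)) : ℝ :=
  ∑ k ∈ Finset.univ.filter (fun k : Fin n => k.castSucc < i), |p k.succ - p k.castSucc|

/-- The parametrization by arc length of the polygonal curve with vertices `p 0, …, p n` in `ℝ`: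
the point reached after travelling a distance `r`. The distance travelled on the `k`-th segment
is `r` minus the arc length up to that segment, clamped between `0` and the segment's length. -/
noncomputable def curvePoint {n : ℕ} (p : Fin (n + 1) → ℝ) (r : ℝ) : ℝ :=
  p 0 + ∑ k : Fin n, Real.sign (p k.succ - p k.castSucc) *
    min (max (r - arcLength p k.castSucc) 0) |p k.succ - p k.castSucc|

theorem arcLength_succ {n : ℕ} (p : Fin (n + 1) → ℝ) (i : Fin n) :
    arcLength p i.succ = arcLength p i.castSucc + |p i.succ - p i.castSucc| := by
  have h : Finset.univ.filter (fun k : Fin n => k.castSucc < i.succ) =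
      insert i (Finset.univ.filter (fun k : Fin n => k.castSucc < i.castSucc)) := by
    ext k
    simp only [Finset.mem_filter, Finset.mem_univ, true_and, Finset.mem_insert, Fin.lt_def,
      Fin.val_castSucc, Fin.val_succ, Fin.ext_iff]
    omega
  rw [arcLength, h, Finset.sum_insert (by simp), arcLength, add_comm]

theorem arcLength_mono {n : ℕ} (p : Fin (n + 1) → ℝ) : Monotone (arcLength p) :=
  Fin.monotone_iff_le_succ.2 fun i => by
    rw [arcLength_succ]
    linarith [abs_nonneg (p i.succ - p i.castSucc)]

/-- On its `i`-th segment the curve moves with unit speed from `p i` towards `p (i + 1)`. -/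
theorem curvePoint_eq {n : ℕ} (p : Fin (n + 1) → ℝ) (i : Fin n) {r : ℝ}
    (h1 : arcLength p i.castSucc ≤ r) (h2 : r ≤ arcLength p i.succ) :
    curvePoint p r = p i.castSucc +
      Real.sign (p i.succ - p i.castSucc) * (r - arcLength p i.castSucc) := by
  have tele : ∀ j : Fin (n + 1), ∑ k : Fin n,
      (if k.castSucc < j then p k.succ - p k.castSucc else 0) = p j - p 0 := by
    intro j
    induction j using Fin.induction with
    | zero => simp
    | succ j ih =>
      have : ∀ k : Fin n, (if k.castSucc < j.succ then p k.succ - p k.castSucc else 0) =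
          (if k.castSucc < j.castSucc then p k.succ - p k.castSucc else 0) +
          (if k = j then p k.succ - p k.castSucc else 0) := by
        intro k
        simp only [Fin.lt_def, Fin.val_castSucc, Fin.val_succ, Fin.ext_iff]
        rcases lt_trichotomy (k : ℕ) j with h | h | h
        · simp [h, h.ne, Nat.lt_succ_of_lt h]
        · simp [h]
        · rw [if_neg (by omega), if_neg (by omega), if_neg (by omega), add_zero]
      rw [Finset.sum_congr rfl fun k _ => this k, Finset.sum_add_distrib, ih]
      simp
  have key : ∀ k : Fin n, Real.sign (p k.succ - p k.castSucc) *
      min (max (r - arcLength p k.castSucc) 0) |p k.succ - p k.castSucc| =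
      (if k.castSucc < i.castSucc then p k.succ - p k.castSucc else 0) +
      (if k = i then Real.sign (p i.succ - p i.castSucc) * (r - arcLength p i.castSucc)
        else 0) := by
    intro k
    rcases lt_trichotomy k i with h | h | h
    · have h3 : arcLength p k.succ ≤ arcLength p i.castSucc :=
        arcLength_mono p (by simp only [Fin.le_def, Fin.val_castSucc, Fin.val_succ]; omega)
      rw [arcLength_succ] at h3
      rw [if_pos (by simpa using h), if_neg h.ne, add_zero, min_eq_right]
      · rcases lt_trichotomy (p k.succ - p k.castSucc) 0 with h | h | h
        · rw [Real.sign_of_neg h, abs_of_neg h]; ring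
        · simp [h]
        · rw [Real.sign_of_pos h, abs_of_pos h]; ring
      · exact le_max_of_le_left (by linarith)
    · subst h
      rw [arcLength_succ] at h2
      rw [if_neg (lt_irrefl _), if_pos rfl, zero_add, max_eq_left (by linarith),
        min_eq_left (by linarith)]
    · have h3 : arcLength p i.succ ≤ arcLength p k.castSucc :=
        arcLength_mono p (by simp only [Fin.le_def, Fin.val_castSucc, Fin.val_succ]; omega)
      rw [if_neg (by simpa using h.le), if_neg h.ne', max_eq_right (by linarith),
        min_eq_left (abs_nonneg _)]
      simp
  rw [curvePoint, Finset.sum_congr rfl fun k _ => key k, Finset.sum_add_distrib, tele]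
  simp only [Finset.sum_ite_eq', Finset.mem_univ, if_true]
  ring

/-- A (potential) free space diagram with `n` columns and `m` rows: the positions of the vertical
and horizontal grid lines and the set of white points. -/
@[ext]
structure FreeSpaceDiagram (n m : ℕ) where
  xs : Fin (n + 1) → ℝ
  ys : Fin (m + 1) → ℝ
  white : Set (ℝ × ℝ)

/-- The free space diagram for the distance `ε` of the polygonal curves in `ℝ` with vertices
`p 0, …, p n` and `q 0, …, q m`, parametrized by arc length. -/
noncomputable def freeSpaceDiagram {n m : ℕ} (ε : ℝ) (p : Fin (n + 1) → ℝ)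
    (q : Fin (m + 1) → ℝ) : FreeSpaceDiagram n m where
  xs := arcLength p
  ys := arcLength q
  white := {z | z.1 ∈ Set.Icc 0 (arcLength p (Fin.last n)) ∧
    z.2 ∈ Set.Icc 0 (arcLength q (Fin.last m)) ∧ |curvePoint p z.1 - curvePoint q z.2| ≤ ε}

/-- The curves `p`, `q` realize the diagram `D` for the distance `ε`. -/
def Realizes {n m : ℕ} (ε : ℝ) (p : Fin (n + 1) → ℝ) (q : Fin (m + 1) → ℝ)
    (D : FreeSpaceDiagram n m) : Prop :=
  freeSpaceDiagram ε p q = D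

/-! ### Input data -/

/-- The data by which a diagram with integer cell dimensions is given to an algorithm: the widths
of the columns, the heights of the rows, and for each cell a slab bounded by two lines of slope
`1` or `-1`, with respect to coordinates whose origin is the lower left corner of the cell.
Empty and full cells are given by a slab that misses, respectively contains, the cell. -/
structure DiagramData (n m : ℕ) where
  width : Fin n → ℕ
  height : Fin m → ℕ
  slope : Fin n × Fin m → ℤˣ
  lo : Fin n × Fin m → ℝ
  hi : Fin n × Fin m → ℝ

/-- `d` describes the diagram `D`: the grid has the given positive integer spacings and starts at
the origin, white points lie in the rectangle spanned by the grid, and in each (closed) cell the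
white points are those in the given slab. -/
structure DiagramData.Describes {n m : ℕ} (d : DiagramData n m) (D : FreeSpaceDiagram n m) :
    Prop where
  xs_zero : D.xs 0 = 0
  ys_zero : D.ys 0 = 0
  width_pos : ∀ i, 0 < d.width i
  height_pos : ∀ j, 0 < d.height j
  xs_succ : ∀ i : Fin n, D.xs i.succ = D.xs i.castSucc + d.width i
  ys_succ : ∀ j : Fin m, D.ys j.succ = D.ys j.castSucc + d.height j
  white_subset : D.white ⊆
    Set.Icc (0 : ℝ) (D.xs (Fin.last n)) ×ˢ Set.Icc (0 : ℝ) (D.ys (Fin.last m))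
  white_cell : ∀ (i : Fin n) (j : Fin m),
    ∀ x ∈ Set.Icc (D.xs i.castSucc) (D.xs i.succ), ∀ y ∈ Set.Icc (D.ys j.castSucc) (D.ys j.succ),
      ((x, y) ∈ D.white ↔
        d.lo (i, j) ≤ (y - D.ys j.castSucc) - ((d.slope (i, j) : ℤ) : ℝ) * (x - D.xs i.castSucc) ∧
        (y - D.ys j.castSucc) - ((d.slope (i, j) : ℤ) : ℝ) * (x - D.xs i.castSucc) ≤ d.hi (i, j))

/-! ### The real RAM

Programs have a fixed finite number of integer arrays and real arrays (named by numerals in the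
program text), with indirect addressing. Arithmetic and comparisons take unit time. There is no
rounding and no conversion of reals to integers, and the only constants are integers. -/

namespace RealRAM

/-- The memory: cell `k` of the integer array `A` holds `ints A k`, and similarly for reals. -/
structure Memory where
  ints : ℕ → ℤ → ℤ
  reals : ℕ → ℤ → ℝ

def Memory.setInt (s : Memory) (A : ℕ) (k v : ℤ) : Memory where
  ints := fun B l => if B = A ∧ l = k then v else s.ints B l
  reals := s.reals

noncomputable def Memory.setReal (s : Memory) (A : ℕ) (k : ℤ) (v : ℝ) : Memory where
  ints := s.ints
  reals := fun B l => if B = A ∧ l = k then v else s.reals B l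

/-- Integer expressions. `get A e` is the content of cell `e` of the integer array `A`. -/
inductive IExpr : Type where
  | const (z : ℤ)
  | get (A : ℕ) (e : IExpr)
  | add (e f : IExpr)
  | sub (e f : IExpr)
  | mul (e f : IExpr)

def IExpr.eval (s : Memory) : IExpr → ℤ
  | const z => z
  | get A e => s.ints A (e.eval s)
  | add e f => e.eval s + f.eval s
  | sub e f => e.eval s - f.eval s
  | mul e f => e.eval s * f.eval s

/-- The number of operations in the evaluation of an integer expression. -/
def IExpr.cost : IExpr → ℕ
  | const _ => 1
  | get _ e => 1 + e.cost
  | add e f => 1 + e.cost + f.cost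
  | sub e f => 1 + e.cost + f.cost
  | mul e f => 1 + e.cost + f.cost

/-- Real expressions. `get A e` is the content of cell `e` of the real array `A`. -/
inductive RExpr : Type where
  | ofInt (e : IExpr)
  | get (A : ℕ) (e : IExpr)
  | add (a b : RExpr)
  | sub (a b : RExpr)
  | mul (a b : RExpr)
  | div (a b : RExpr)

noncomputable def RExpr.eval (s : Memory) : RExpr → ℝ
  | ofInt e => (e.eval s : ℝ)
  | get A e => s.reals A (e.eval s)
  | add a b => a.eval s + b.eval s
  | sub a b => a.eval s - b.eval s
  | mul a b => a.eval s * b.eval s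
  | div a b => a.eval s / b.eval s

/-- The number of operations in the evaluation of a real expression. -/
def RExpr.cost : RExpr → ℕ
  | ofInt e => 1 + e.cost
  | get _ e => 1 + e.cost
  | add a b => 1 + a.cost + b.cost
  | sub a b => 1 + a.cost + b.cost
  | mul a b => 1 + a.cost + b.cost
  | div a b => 1 + a.cost + b.cost

/-- Tests. -/
inductive Cond : Type where
  | ile (e f : IExpr)
  | rle (a b : RExpr)
  | not (b : Cond)
  | and (b c : Cond)
  | or (b c : Cond)

def Cond.Holds (s : Memory) : Cond → Prop
  | ile e f => e.eval s ≤ f.eval s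
  | rle a b => a.eval s ≤ b.eval s
  | not b => ¬ b.Holds s
  | and b c => b.Holds s ∧ c.Holds s
  | or b c => b.Holds s ∨ c.Holds s

/-- The number of operations in the evaluation of a test. -/
def Cond.cost : Cond → ℕ
  | ile e f => 1 + e.cost + f.cost
  | rle a b => 1 + a.cost + b.cost
  | not b => 1 + b.cost
  | and b c => 1 + b.cost + c.cost
  | or b c => 1 + b.cost + c.cost

/-- Programs. `setInt A e f` stores the value of `f` in cell `e` of the integer array `A`, and
`setReal A e a` stores the value of `a` in cell `e` of the real array `A`. -/
inductive Program : Type where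
  | skip
  | setInt (A : ℕ) (e f : IExpr)
  | setReal (A : ℕ) (e : IExpr) (a : RExpr)
  | seq (c d : Program)
  | ite (b : Cond) (c d : Program)
  | loop (b : Cond) (c : Program)

/-- `Runs c s t s'`: started in the memory `s`, the program `c` halts after exactly `t` steps,
in the memory `s'`. `loop b c` executes `c` as long as the test `b` holds. -/
inductive Runs : Program → Memory → ℕ → Memory → Prop where
  | skip (s : Memory) : Runs Program.skip s 1 s
  | setInt (A : ℕ) (e f : IExpr) (s : Memory) :
      Runs (Program.setInt A e f) s (1 + e.cost + f.cost) (s.setInt A (e.eval s) (f.eval s))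
  | setReal (A : ℕ) (e : IExpr) (a : RExpr) (s : Memory) :
      Runs (Program.setReal A e a) s (1 + e.cost + a.cost) (s.setReal A (e.eval s) (a.eval s))
  | seq {c d : Program} {s s₁ s₂ : Memory} {t₁ t₂ : ℕ} (h₁ : Runs c s t₁ s₁)
      (h₂ : Runs d s₁ t₂ s₂) : Runs (Program.seq c d) s (t₁ + t₂) s₂
  | ite_pos {b : Cond} {c d : Program} {s s₁ : Memory} {t : ℕ} (hb : b.Holds s)
      (h : Runs c s t s₁) : Runs (Program.ite b c d) s (1 + b.cost + t) s₁
  | ite_neg {b : Cond} {c d : Program} {s s₁ : Memory} {t : ℕ} (hb : ¬ b.Holds s)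
      (h : Runs d s t s₁) : Runs (Program.ite b c d) s (1 + b.cost + t) s₁
  | loop_pos {b : Cond} {c : Program} {s s₁ s₂ : Memory} {t₁ t₂ : ℕ} (hb : b.Holds s)
      (h₁ : Runs c s t₁ s₁) (h₂ : Runs (Program.loop b c) s₁ t₂ s₂) :
      Runs (Program.loop b c) s (1 + b.cost + t₁ + t₂) s₂
  | loop_neg {b : Cond} {c : Program} {s : Memory} (hb : ¬ b.Holds s) :
      Runs (Program.loop b c) s (1 + b.cost) s

/-- Programs are deterministic: the running time and the result are unique. -/
theorem Runs.unique {c : Program} {s s₁ s₂ : Memory} {t₁ t₂ : ℕ} (h₁ : Runs c s t₁ s₁)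
    (h₂ : Runs c s t₂ s₂) : t₁ = t₂ ∧ s₁ = s₂ := by
  induction h₁ generalizing t₂ s₂ with
  | skip => cases h₂; exact ⟨rfl, rfl⟩
  | setInt => cases h₂; exact ⟨rfl, rfl⟩
  | setReal => cases h₂; exact ⟨rfl, rfl⟩
  | seq _ _ ih₁ ih₂ =>
    cases h₂ with
    | seq k₁ k₂ =>
      obtain ⟨rfl, rfl⟩ := ih₁ k₁
      obtain ⟨rfl, rfl⟩ := ih₂ k₂
      exact ⟨rfl, rfl⟩
  | ite_pos hb _ ih =>
    cases h₂ with
    | ite_pos _ k => obtain ⟨rfl, rfl⟩ := ih k; exact ⟨rfl, rfl⟩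
    | ite_neg hb' _ => exact absurd hb hb'
  | ite_neg hb _ ih =>
    cases h₂ with
    | ite_pos hb' _ => exact absurd hb' hb
    | ite_neg _ k => obtain ⟨rfl, rfl⟩ := ih k; exact ⟨rfl, rfl⟩
  | loop_pos hb _ _ ih₁ ih₂ =>
    cases h₂ with
    | loop_pos _ k₁ k₂ =>
      obtain ⟨rfl, rfl⟩ := ih₁ k₁
      obtain ⟨rfl, rfl⟩ := ih₂ k₂
      exact ⟨rfl, rfl⟩
    | loop_neg hb' => exact absurd hb hb'
  | loop_neg hb =>
    cases h₂ with
    | loop_pos hb' _ _ => exact absurd hb' hb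
    | loop_neg _ => exact ⟨rfl, rfl⟩

end RealRAM

/-- The contents of an array that holds the finite sequence `f` in the cells `0, …, N - 1` and
zeros elsewhere. -/
def arrayOf {α : Type} [Zero α] {N : ℕ} (f : Fin N → α) (k : ℤ) : α :=
  if h : 0 ≤ k ∧ k.toNat < N then f ⟨k.toNat, h.2⟩ else 0

/-- The initial memory for the diagram data `d` and the distance `ε`. The integer array `0` starts
with `n`, `m`, `ε`; the integer arrays `1` and `2` hold the widths of the columns and the heights
of the rows. Cell `j + m * i` of the integer array `3` and of the real arrays `0` and `1` holds
the slope and the two intercepts of the slab for column `i` and row `j`. The remaining memory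
is zero. -/
noncomputable def DiagramData.initialMemory {n m : ℕ} (d : DiagramData n m) (ε : ℕ) :
    RealRAM.Memory where
  ints := fun A => match A with
    | 0 => arrayOf ![(n : ℤ), (m : ℤ), (ε : ℤ)]
    | 1 => arrayOf fun i : Fin n => (d.width i : ℤ)
    | 2 => arrayOf fun j : Fin m => (d.height j : ℤ)
    | 3 => arrayOf fun k : Fin (n * m) => (d.slope (finProdFinEquiv.symm k) : ℤ)
    | _ => fun _ => 0
  reals := fun A => match A with
    | 0 => arrayOf fun k : Fin (n * m) => d.lo (finProdFinEquiv.symm k)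
    | 1 => arrayOf fun k : Fin (n * m) => d.hi (finProdFinEquiv.symm k)
    | _ => fun _ => 0

/-- The answer is cell `0` of the integer array `4`: `1` stands for success and `0` for `false`. -/
def RealRAM.Memory.answer (s : RealRAM.Memory) : ℤ := s.ints 4 0

/-- The vertices of the first output curve, read from the real array `2`. -/
def RealRAM.Memory.curveP (s : RealRAM.Memory) (n : ℕ) (i : Fin (n + 1)) : ℝ := s.reals 2 (i : ℕ)

/-- The vertices of the second output curve, read from the real array `3`. -/
def RealRAM.Memory.curveQ (s : RealRAM.Memory) (m : ℕ) (j : Fin (m + 1)) : ℝ := s.reals 3 (j : ℕ)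

/-! Call a cell mixed if a boundary of its slab is visible in it. In a mixed cell the data determine
both curves up to one sign and one translation: the product of the two directions is the slope, and
the intercept is the relative position of the two segments (`CellMatch.upper`, `CellMatch.lower`).
Let the mixed cells be the edges of a bipartite graph on columns and rows. Along a component of this
graph directions and positions propagate (`Sol.next`).

For an actual pair of curves, a mixed cell contains points with `q - p = ε` and points beyond, or
points with `p - q = ε` and points beyond. The cells of each of these two kinds are connected in the
graph, by a continuity argument (`boundaryCell_connected`). So there are at most two components to
mark; after a reflection and a translation of the curves, class 1 contains all cells of the first
kind, and class 2, if there is one, all those of the second kind. A column or row without mixed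
cells is wholly full (class 0) or wholly empty (class 3), by `line_cases`.

What is left open is where the unmarked segments go and how the two classes lie relative to each
other. `Marked.complete` shows that a realizable diagram falls under one of three cases. If every
cell is empty, curves that move apart will do. In the short case both curves have extent at most
`2ε` and all cells outside the two classes are full. There the conditions on pairs of segments
decouple: with the lowest point of `p`, the highest point of `q` and the two opposite ends known,
each segment only has to stay between walls (`OneSide`). A single integer `t`, the extent of `p`,
fixes the ends that are not known, and there are `2ε + 1` candidates for it. In the long case there
is one class only, and its extent provides walls for everything else. An empty segment may a priori
lie on either side, but no admissible path can change the side on which it passes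
(`LongLine.sides`).

All segment lengths are integers, so for each curve the vertices lie in one translate of `ℤ`, and
curves between walls are lattice paths. They are found by dynamic programming in a table with one
row per vertex and one column per position. In the long case the table has width linear in the
length of the curve, which is at most `nW`; this gives `n²W`. In the short case it has width `2ε +
1`, once for each `t`; this gives `nε²`. Marking and checking cost `O(n²)`.

Soundness is not an issue, since a pair of curves is output only after a check of every cell
(`cellOK_iff`). Completeness needs more than the existence of admissible paths, because the search
returns arbitrary ones: `Fits.short_sol` and `Fits.long_sol` show that as soon as one solution of
the given type exists, every pair of admissible paths is a solution. -/

namespace FreeSpace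

/-! ### Slabs in a cell -/

/-- The minimum of `y - s * x` on a cell of width `w`, for a slope `s = 1` or `s = -1`. -/
noncomputable def slabMin (s w : ℝ) : ℝ := -(w * (1 + s)) / 2

/-- The maximum of `y - s * x` on a cell of width `w` and height `h`. -/
noncomputable def slabMax (s w h : ℝ) : ℝ := h + w * (1 - s) / 2

/-- The upper boundary of the slab is visible in the cell. -/
def UpperVisible (s w h lo hi : ℝ) : Prop := lo ≤ hi ∧ slabMin s w ≤ hi ∧ hi < slabMax s w h

/-- The lower boundary of the slab is visible in the cell. -/
def LowerVisible (s w h lo hi : ℝ) : Prop := lo ≤ hi ∧ slabMin s w < lo ∧ lo ≤ slabMax s w h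

/-- The slab contains the cell. -/
def SlabFull (s w h lo hi : ℝ) : Prop := lo ≤ slabMin s w ∧ slabMax s w h ≤ hi

def IsUnit1 (s : ℝ) : Prop := s = 1 ∨ s = -1

theorem IsUnit1.neg {s : ℝ} (h : IsUnit1 s) : IsUnit1 (-s) := by
  rcases h with rfl | rfl
  · exact Or.inr rfl
  · exact Or.inl (by norm_num)

theorem slab_bounds {s w h x y : ℝ} (hs : IsUnit1 s) (hx : 0 ≤ x ∧ x ≤ w) (hy : 0 ≤ y ∧ y ≤ h) :
    slabMin s w ≤ y - s * x ∧ y - s * x ≤ slabMax s w h := by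
  unfold slabMin slabMax
  rcases hs with rfl | rfl <;> constructor <;> linarith [hx.1, hx.2, hy.1, hy.2]

/-- Together with `slab_bounds` this makes `y - s * x` a coordinate of the cell with range exactly
`[slabMin, slabMax]`, so that questions about slabs become questions about intervals. The witness
runs along two adjacent edges of the cell. -/
theorem slab_surj {s w h v : ℝ} (hs : IsUnit1 s) (hw : 0 < w) (hh : 0 < h)
    (h1 : slabMin s w ≤ v) (h2 : v ≤ slabMax s w h) :
    ∃ x y, (0 ≤ x ∧ x ≤ w) ∧ (0 ≤ y ∧ y ≤ h) ∧ y - s * x = v := by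
  unfold slabMin at h1
  unfold slabMax at h2
  rcases hs with rfl | rfl
  · rcases le_total 0 v with hv | hv
    · exact ⟨0, v, ⟨le_rfl, hw.le⟩, ⟨hv, by linarith⟩, by ring⟩
    · exact ⟨-v, 0, ⟨by linarith, by linarith⟩, ⟨le_rfl, hh.le⟩, by ring⟩
  · rcases le_total v w with hv | hv
    · exact ⟨v, 0, ⟨by linarith, hv⟩, ⟨le_rfl, hh.le⟩, by ring⟩
    · exact ⟨w, v - w, ⟨hw.le, le_rfl⟩, ⟨by linarith, by linarith⟩, by ring⟩

/-- The white part `|c + τ y - σ x| ≤ ε` of a cell of width `w` and height `h` is the part in the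
slab `lo ≤ y - s x ≤ hi`. -/
def CellMatch (ε w h c σ τ s lo hi : ℝ) : Prop :=
  ∀ x y, (0 ≤ x ∧ x ≤ w) → (0 ≤ y ∧ y ≤ h) →
    (|c + τ * y - σ * x| ≤ ε ↔ lo ≤ y - s * x ∧ y - s * x ≤ hi)

theorem CellMatch.neg {ε w h c σ τ s lo hi : ℝ} (H : CellMatch ε w h c σ τ s lo hi) :
    CellMatch ε w h (-c) (-σ) (-τ) s lo hi := by
  intro x y hx hy
  rw [← H x y hx hy, show -c + -τ * y - -σ * x = -(c + τ * y - σ * x) by ring, abs_neg]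

/-- Traversing the segment of `p` backwards. This reduces slope `-1` to slope `1`. -/
theorem CellMatch.reflect {ε w h c σ τ s lo hi : ℝ} (H : CellMatch ε w h c σ τ s lo hi) :
    CellMatch ε w h (c - σ * w) (-σ) τ (-s) (lo + s * w) (hi + s * w) := by
  intro x y hx hy
  have := H (w - x) y ⟨by linarith, by linarith⟩ hy
  rw [show c - σ * w + τ * y - -σ * x = c + τ * y - σ * (w - x) by ring, this]
  constructor <;> rintro ⟨h1, h2⟩ <;> constructor <;> linarith

/-- A half turn of the cell preserves the slope and exchanges the two boundaries of the slab, so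
that results on upper boundaries carry over to lower ones. -/
theorem CellMatch.rotate {ε w h c σ τ s lo hi : ℝ} (H : CellMatch ε w h c σ τ s lo hi) :
    CellMatch ε w h (c + τ * h - σ * w) (-σ) (-τ) s (h - s * w - hi) (h - s * w - lo) := by
  intro x y hx hy
  have := H (w - x) (h - y) ⟨by linarith, by linarith⟩ ⟨by linarith, by linarith⟩
  rw [show c + τ * h - σ * w + -τ * y - -σ * x = c + τ * (h - y) - σ * (w - x) by ring, this]
  constructor <;> rintro ⟨h1, h2⟩ <;> constructor <;> linarith

/-- If `σ = 1`, the signed distance is `c + v` in the slab coordinate `v`, and the white interval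
can end at `hi` inside the cell only because `c + hi = ε`. If `σ = -1`, the level lines of the
distance cross the slab, and some white point lies outside it. -/
theorem upper_aux {ε w h c σ lo hi : ℝ} (hw : 0 < w) (hh : 0 < h)
    (hσ : IsUnit1 σ) (H : CellMatch ε w h c σ 1 1 lo hi)
    (hv : UpperVisible 1 w h lo hi) : σ = 1 ∧ c = ε - hi := by
  obtain ⟨h1, h2, h3⟩ := hv
  rcases hσ with rfl | rfl
  · refine ⟨rfl, ?_⟩
    have key : ∀ v, slabMin 1 w ≤ v → v ≤ slabMax 1 w h → (|c + v| ≤ ε ↔ lo ≤ v ∧ v ≤ hi) := by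
      intro v hv1 hv2
      obtain ⟨x, y, hx, hy, hxy⟩ := slab_surj (Or.inl rfl) hw hh hv1 hv2
      have := H x y hx hy
      rwa [show c + 1 * y - 1 * x = c + (y - 1 * x) by ring, hxy] at this
    have h4 := abs_le.1 ((key hi h2 h3.le).2 ⟨h1, le_rfl⟩)
    by_contra hne
    have hlt : hi < ε - c := lt_of_le_of_ne (by linarith) (fun h => hne (by linarith))
    -- If `hi < ε - c`, then a value of `v` slightly beyond `hi` would still be white.
    have h5 : hi < min (slabMax 1 w h) (ε - c) := lt_min h3 hlt
    have h6 := (key (min (slabMax 1 w h) (ε - c)) (by linarith) (min_le_left _ _)).1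
      (abs_le.2 ⟨by linarith, by linarith [min_le_right (slabMax 1 w h) (ε - c)]⟩)
    linarith [h6.2]
  · exfalso
    have e1 : -w ≤ hi := by unfold slabMin at h2; linarith
    have e2 : hi < h := by unfold slabMax at h3; linarith
    -- For `hi = -w` the slab meets the cell in the corner `(w, 0)` only; moving from there along a
    -- level line of `y + x` stays white and leaves the slab.
    rcases e1.eq_or_lt with e | e
    · have d1 : 0 < min w h := lt_min hw hh
      have d2 := min_le_left w h
      have d3 := min_le_right w h
      have a := (H w 0 ⟨hw.le, le_rfl⟩ ⟨le_rfl, hh.le⟩).2 ⟨by linarith, by linarith⟩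
      have b := (H (w - min w h) (min w h) ⟨by linarith, by linarith⟩ ⟨d1.le, d3⟩).1
        (by rw [show c + 1 * min w h - -1 * (w - min w h) = c + 1 * 0 - -1 * w by ring]; exact a)
      linarith [b.2]
    -- `[x1, x2]` is the range of abscissas of the boundary line `y = x + hi` within the cell. Both
    -- ends of this piece are white. The distance at `((x1 + x2) / 2, x2 + hi)` lies between those
    -- at the two ends, but this point is above the line.
    · set x1 := max 0 (-hi) with hx1
      set x2 := min w (h - hi) with hx2
      have b1 : 0 ≤ x1 := le_max_left _ _
      have b2 : -hi ≤ x1 := le_max_right _ _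
      have b3 : x2 ≤ w := min_le_left _ _
      have b4 : x2 ≤ h - hi := min_le_right _ _
      have b5 : x1 < x2 := max_lt (lt_min hw (by linarith)) (lt_min (by linarith) (by linarith))
      have a1 := abs_le.1 ((H x1 (x1 + hi) ⟨b1, by linarith⟩ ⟨by linarith, by linarith⟩).2
        ⟨by linarith, by linarith⟩)
      have a2 := abs_le.1 ((H x2 (x2 + hi) ⟨by linarith, b3⟩ ⟨by linarith, by linarith⟩).2
        ⟨by linarith, by linarith⟩)
      have a3 := (H ((x1 + x2) / 2) (x2 + hi) ⟨by linarith, by linarith⟩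
        ⟨by linarith, by linarith⟩).1 (abs_le.2 ⟨by linarith, by linarith⟩)
      linarith [a3.2]

/-- A visible upper boundary determines the slope and the position. -/
theorem CellMatch.upper {ε w h c σ τ s lo hi : ℝ} (hw : 0 < w) (hh : 0 < h)
    (hσ : IsUnit1 σ) (hτ : IsUnit1 τ) (hs : IsUnit1 s) (H : CellMatch ε w h c σ τ s lo hi)
    (hv : UpperVisible s w h lo hi) : σ * τ = s ∧ τ * c = ε - hi := by
  wlog hs1 : s = 1 generalizing s lo hi c σ
  · have hs2 : s = -1 := hs.resolve_left hs1
    have := this hσ.neg hs.neg H.reflect (by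
      unfold UpperVisible slabMin slabMax at hv ⊢
      subst hs2
      refine ⟨by linarith [hv.1], by linarith [hv.2.1], by linarith [hv.2.2]⟩)
        (by rw [hs2]; norm_num)
    refine ⟨by linarith [this.1], ?_⟩
    have e1 : σ * τ = s := by linarith [this.1]
    have e2 := this.2
    rw [mul_sub, show τ * (σ * w) = (σ * τ) * w by ring, e1] at e2
    linarith
  subst hs1
  rcases hτ with rfl | rfl
  · have := upper_aux hw hh hσ H hv
    exact ⟨by linarith [this.1], by linarith [this.2]⟩
  · have := upper_aux hw hh hσ.neg (by simpa using H.neg) hv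
    exact ⟨by linarith [this.1], by linarith [this.2]⟩

/-- A visible lower boundary determines the slope and the position. -/
theorem CellMatch.lower {ε w h c σ τ s lo hi : ℝ} (hw : 0 < w) (hh : 0 < h)
    (hσ : IsUnit1 σ) (hτ : IsUnit1 τ) (hs : IsUnit1 s) (H : CellMatch ε w h c σ τ s lo hi)
    (hv : LowerVisible s w h lo hi) : σ * τ = s ∧ τ * c = -ε - lo := by
  have := H.rotate.upper hw hh hσ.neg hτ.neg hs (by
    obtain ⟨h1, h2, h3⟩ := hv
    unfold UpperVisible
    unfold slabMin at *
    unfold slabMax at *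
    refine ⟨by linarith, by linarith, by linarith⟩)
  have e1 : σ * τ = s := by linarith [this.1]
  refine ⟨e1, ?_⟩
  have e2 := this.2
  have e3 : τ * τ = 1 := by rcases hτ with rfl | rfl <;> norm_num
  have : -τ * (c + τ * h - σ * w) = -(τ * c) - (τ * τ) * h + (σ * τ) * w := by ring
  rw [this, e3, e1] at e2
  linarith

/-! ### Segments of a curve -/

noncomputable def segMin (p : ℕ → ℝ) (i : ℕ) : ℝ := min (p i) (p (i + 1))

noncomputable def segMax (p : ℕ → ℝ) (i : ℕ) : ℝ := max (p i) (p (i + 1))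

theorem segMin_le_segMax (p : ℕ → ℝ) (i : ℕ) : segMin p i ≤ segMax p i :=
  (min_le_left _ _).trans (le_max_left _ _)

theorem segMin_le_left (p : ℕ → ℝ) (i : ℕ) : segMin p i ≤ p i := min_le_left _ _
theorem segMin_le_right (p : ℕ → ℝ) (i : ℕ) : segMin p i ≤ p (i + 1) := min_le_right _ _
theorem le_segMax_left (p : ℕ → ℝ) (i : ℕ) : p i ≤ segMax p i := le_max_left _ _
theorem le_segMax_right (p : ℕ → ℝ) (i : ℕ) : p (i + 1) ≤ segMax p i := le_max_right _ _

/-- The points of the `i`-th segment. -/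
theorem seg_iff {p : ℕ → ℝ} {i : ℕ} {σ w : ℝ} (hσ : IsUnit1 σ) (hw : 0 ≤ w)
    (hp : p (i + 1) = p i + σ * w) (v : ℝ) :
    (segMin p i ≤ v ∧ v ≤ segMax p i) ↔ ∃ x, (0 ≤ x ∧ x ≤ w) ∧ v = p i + σ * x := by
  unfold segMin segMax
  rw [hp]
  rcases hσ with rfl | rfl
  · rw [min_eq_left (by linarith), max_eq_right (by linarith)]
    constructor
    · rintro ⟨h1, h2⟩; exact ⟨v - p i, ⟨by linarith, by linarith⟩, by ring⟩
    · rintro ⟨x, ⟨h1, h2⟩, rfl⟩; exact ⟨by linarith, by linarith⟩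
  · rw [min_eq_right (by linarith), max_eq_left (by linarith)]
    constructor
    · rintro ⟨h1, h2⟩; exact ⟨p i - v, ⟨by linarith, by linarith⟩, by ring⟩
    · rintro ⟨x, ⟨h1, h2⟩, rfl⟩; exact ⟨by linarith, by linarith⟩

/-- Consecutive segments share a vertex, so they cannot lie on different sides of the gap between
`x` and `y`. -/
theorem segs_split {N : ℕ} {p : ℕ → ℝ} {x y : ℝ} (hxy : x ≤ y)
    (h : ∀ i < N, segMax p i < x ∨ y ≤ segMin p i) :
    (∀ i < N, segMax p i < x) ∨ (∀ i < N, y ≤ segMin p i) := by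
  induction N with
  | zero => left; intro i hi; omega
  | succ N ih =>
    have step : ∀ i < N + 1, ∀ k, i = k + 1 → (segMax p k < x → segMax p i < x) ∧
        (y ≤ segMin p k → y ≤ segMin p i) := by
      rintro i hi k rfl
      have h1 := le_segMax_right p k
      have h2 := segMin_le_right p k
      have h3 := le_segMax_left p (k + 1)
      have h4 := segMin_le_left p (k + 1)
      rcases h (k + 1) hi with h' | h'
      · exact ⟨fun _ => h', fun _ => by linarith⟩
      · exact ⟨fun _ => by linarith, fun _ => h'⟩
    rcases Nat.eq_zero_or_pos N with rfl | hN
    · rcases h 0 (by omega) with h' | h'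
      · left; intro i hi; obtain rfl : i = 0 := by omega
        exact h'
      · right; intro i hi; obtain rfl : i = 0 := by omega
        exact h'
    · obtain ⟨M, rfl⟩ : ∃ M, N = M + 1 := ⟨N - 1, by omega⟩
      rcases ih (fun i hi => h i (by omega)) with h' | h'
      · left
        intro i hi
        rcases Nat.lt_succ_iff_lt_or_eq.1 hi with hi' | rfl
        · exact h' i hi'
        · exact (step _ hi M rfl).1 (h' M (by omega))
      · right
        intro i hi
        rcases Nat.lt_succ_iff_lt_or_eq.1 hi with hi' | rfl
        · exact h' i hi'
        · exact (step _ hi M rfl).2 (h' M (by omega))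

theorem segMin_neg (p : ℕ → ℝ) (i : ℕ) : segMin (fun k => -p k) i = -segMax p i := by
  simp [segMin, segMax, min_neg_neg]

theorem segMax_neg (p : ℕ → ℝ) (i : ℕ) : segMax (fun k => -p k) i = -segMin p i := by
  simp [segMin, segMax, max_neg_neg]

theorem segs_split' {N : ℕ} {p : ℕ → ℝ} {x y : ℝ} (hxy : x ≤ y)
    (h : ∀ i < N, segMax p i ≤ x ∨ y < segMin p i) :
    (∀ i < N, segMax p i ≤ x) ∨ (∀ i < N, y < segMin p i) := by
  have := segs_split (N := N) (p := fun k => -p k) (x := -y) (y := -x) (by linarith)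
    (fun i hi => by
      rw [segMin_neg, segMax_neg]
      rcases h i hi with h | h
      · right; linarith
      · left; linarith)
  simp only [segMin_neg, segMax_neg, neg_lt_neg_iff, neg_le_neg_iff] at this
  tauto

/-- A value between two values of a curve is attained. -/
theorem exists_seg {N : ℕ} {p : ℕ → ℝ} {v : ℝ} (h1 : ∃ i < N, segMin p i ≤ v)
    (h2 : ∃ i < N, v ≤ segMax p i) : ∃ i < N, segMin p i ≤ v ∧ v ≤ segMax p i := by
  by_contra hc
  push Not at hc
  obtain ⟨i, hi, h1⟩ := h1
  obtain ⟨k, hk, h2⟩ := h2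
  rcases segs_split (N := N) (p := p) (x := v) (y := v) le_rfl (fun i hi => by
    by_contra h'
    push Not at h'
    exact absurd (hc i hi h'.2.le) (by linarith [h'.1])) with h | h
  · linarith [h k hk]
  · linarith [hc i hi h1, h i hi, segMin_le_segMax p i]

/-! ### Boundary cells -/

/-- The `i`-th segment of `p` and the `j`-th segment of `q` contain points `x`, `y` with
`y - x = ε`, and also points with `y - x > ε`. -/
def BoundaryCell (ε : ℝ) (p q : ℕ → ℝ) (i j : ℕ) : Prop :=
  segMin q j ≤ segMax p i + ε ∧ segMin p i + ε < segMax q j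

theorem exists_pos_lt_of_pos (F : Finset ℝ) : ∃ η : ℝ, 0 < η ∧ ∀ z ∈ F, 0 < z → η < z := by
  induction F using Finset.induction with
  | empty => exact ⟨1, one_pos, by simp⟩
  | insert a F _ ih =>
    obtain ⟨η, h1, h2⟩ := ih
    rcases le_or_gt a 0 with ha | ha
    · refine ⟨η, h1, fun z hz hz0 => ?_⟩
      rcases Finset.mem_insert.1 hz with rfl | hz
      · linarith
      · exact h2 z hz hz0
    · refine ⟨min η (a / 2), lt_min h1 (by linarith), fun z hz hz0 => ?_⟩
      rcases Finset.mem_insert.1 hz with rfl | hz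
      · linarith [min_le_right η (z / 2)]
      · exact (min_le_left _ _).trans_lt (h2 z hz hz0)

/-- The boundary cells are connected. -/
theorem boundaryCell_connected {n m : ℕ} {ε : ℝ} {p q : ℕ → ℝ} {C R : ℕ → Prop}
    (hcl : ∀ i < n, ∀ j < m, BoundaryCell ε p q i j → (C i ↔ R j))
    {i₀ j₀ : ℕ} (hi₀ : i₀ < n) (hj₀ : j₀ < m) (h₀ : BoundaryCell ε p q i₀ j₀) (hC : C i₀)
    {i j : ℕ} (hi : i < n) (hj : j < m) (h : BoundaryCell ε p q i j) : C i := by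
  by_contra hCi
  -- `BoundaryCell` mixes a strict and a weak inequality. Lowering `q` by an `η` smaller than all
  -- relevant positive differences turns it into the condition that two closed intervals meet.
  obtain ⟨η, hη, hF⟩ := exists_pos_lt_of_pos
    (((Finset.range n ×ˢ Finset.range m).image fun k => segMax q k.2 - (segMin p k.1 + ε)) ∪
      ((Finset.range n ×ˢ Finset.range m).image fun k => segMin q k.2 - (segMax p k.1 + ε)))
  have hF1 : ∀ i < n, ∀ j < m, segMin p i + ε < segMax q j → segMin p i + ε ≤ segMax q j - η := by
    intro i hi j hj h
    have := hF (segMax q j - (segMin p i + ε)) (Finset.mem_union_left _ (Finset.mem_image.2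
      ⟨(i, j), by simp [hi, hj], rfl⟩)) (by linarith)
    linarith
  have hF2 : ∀ i < n, ∀ j < m, segMin q j - η ≤ segMax p i + ε → segMin q j ≤ segMax p i + ε := by
    intro i hi j hj h
    by_contra h'
    have := hF (segMin q j - (segMax p i + ε)) (Finset.mem_union_right _ (Finset.mem_image.2
      ⟨(i, j), by simp [hi, hj], rfl⟩)) (by linarith)
    linarith
  -- A cell is a boundary cell iff `I i` meets `J j` (`hIJ`, `hJI`). Each of the two families covers
  -- an interval, since a curve attains intermediate values.
  let I : ℕ → Set ℝ := fun i => Set.Icc (segMin p i + ε) (segMax p i + ε)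
  let J : ℕ → Set ℝ := fun j => Set.Icc (segMin q j - η) (segMax q j - η)
  have hIJ : ∀ i < n, ∀ j < m, ∀ x, x ∈ I i → x ∈ J j → BoundaryCell ε p q i j := by
    rintro i hi j hj x ⟨h1, h2⟩ ⟨h3, h4⟩
    exact ⟨hF2 i hi j hj (by linarith), by linarith⟩
  have hJI : ∀ i < n, ∀ j < m, BoundaryCell ε p q i j → ∃ x, x ∈ I i ∧ x ∈ J j := by
    rintro i hi j hj ⟨h1, h2⟩
    have a1 := segMin_le_segMax p i
    have a2 := segMin_le_segMax q j
    have a3 := hF1 i hi j hj h2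
    exact ⟨max (segMin p i + ε) (segMin q j - η),
      ⟨le_max_left _ _, max_le (by linarith) (by linarith)⟩,
      ⟨le_max_right _ _, max_le (by linarith) (by linarith)⟩⟩
  let A : Set ℝ := ⋃ i ∈ {i | i < n ∧ C i}, ⋃ j ∈ {j | j < m ∧ R j}, I i ∩ J j
  let B : Set ℝ := ⋃ i ∈ {i | i < n ∧ ¬ C i}, ⋃ j ∈ {j | j < m ∧ ¬ R j}, I i ∩ J j
  have fin1 : ∀ P : ℕ → Prop, Set.Finite {i | i < n ∧ P i} := fun P =>
    (Set.finite_lt_nat n).subset fun i hi => hi.1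
  have fin2 : ∀ P : ℕ → Prop, Set.Finite {i | i < m ∧ P i} := fun P =>
    (Set.finite_lt_nat m).subset fun i hi => hi.1
  have hA : IsClosed A := (fin1 _).isClosed_biUnion fun i _ =>
    (fin2 _).isClosed_biUnion fun j _ => isClosed_Icc.inter isClosed_Icc
  have hB : IsClosed B := (fin1 _).isClosed_biUnion fun i _ =>
    (fin2 _).isClosed_biUnion fun j _ => isClosed_Icc.inter isClosed_Icc
  have memA : ∀ x, x ∈ A ↔ ∃ i < n, C i ∧ ∃ j < m, R j ∧ x ∈ I i ∧ x ∈ J j := by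
    intro x
    simp only [A, Set.mem_iUnion, Set.mem_inter_iff, Set.mem_ofPred_eq, exists_prop, and_assoc]
  have memB : ∀ x, x ∈ B ↔ ∃ i < n, ¬ C i ∧ ∃ j < m, ¬ R j ∧ x ∈ I i ∧ x ∈ J j := by
    intro x
    simp only [B, Set.mem_iUnion, Set.mem_inter_iff, Set.mem_ofPred_eq, exists_prop, and_assoc]
  obtain ⟨x, hx1, hx2⟩ := hJI i₀ hi₀ j₀ hj₀ h₀
  obtain ⟨y, hy1, hy2⟩ := hJI i hi j hj h
  have hxA : x ∈ A := (memA x).2 ⟨i₀, hi₀, hC, j₀, hj₀, (hcl _ hi₀ _ hj₀ h₀).1 hC, hx1, hx2⟩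
  have hyB : y ∈ B := (memB y).2 ⟨i, hi, hCi, j, hj, fun hR => hCi ((hcl _ hi _ hj h).2 hR), hy1,
      hy2⟩
  -- A point between `x` and `y` lies in some `I i'` and some `J j'`; that cell is a boundary cell,
  -- so `C i'` and `R j'` hold or fail together.
  have cover : Set.uIcc x y ⊆ A ∪ B := by
    intro z hz
    have hz' : (x ≤ z ∧ z ≤ y) ∨ (y ≤ z ∧ z ≤ x) := by
      rcases Set.mem_uIcc.1 hz with h | h
      · exact Or.inl h
      · exact Or.inr h
    obtain ⟨i', hi', c1, c2⟩ : ∃ i' < n, segMin p i' ≤ z - ε ∧ z - ε ≤ segMax p i' := by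
      rcases hz' with ⟨a, b⟩ | ⟨a, b⟩
      · exact exists_seg ⟨i₀, hi₀, by linarith [hx1.1]⟩ ⟨i, hi, by linarith [hy1.2]⟩
      · exact exists_seg ⟨i, hi, by linarith [hy1.1]⟩ ⟨i₀, hi₀, by linarith [hx1.2]⟩
    obtain ⟨j', hj', d1, d2⟩ : ∃ j' < m, segMin q j' ≤ z + η ∧ z + η ≤ segMax q j' := by
      rcases hz' with ⟨a, b⟩ | ⟨a, b⟩
      · exact exists_seg ⟨j₀, hj₀, by linarith [hx2.1]⟩ ⟨j, hj, by linarith [hy2.2]⟩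
      · exact exists_seg ⟨j, hj, by linarith [hy2.1]⟩ ⟨j₀, hj₀, by linarith [hx2.2]⟩
    have zI : z ∈ I i' := ⟨by linarith, by linarith⟩
    have zJ : z ∈ J j' := ⟨by linarith, by linarith⟩
    have := hcl i' hi' j' hj' (hIJ i' hi' j' hj' z zI zJ)
    by_cases hc : C i'
    · exact Or.inl ((memA z).2 ⟨i', hi', hc, j', hj', this.1 hc, zI, zJ⟩)
    · exact Or.inr ((memB z).2 ⟨i', hi', hc, j', hj', fun hR => hc (this.2 hR), zI, zJ⟩)
  -- By connectedness the closed sets `A` and `B` share a point. It lies in `I i1` with `C i1` and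
  -- in `J j2` without `R j2`, so the boundary cell `(i1, j2)` violates the closure hypothesis.
  obtain ⟨z, _, hzA, hzB⟩ := isPreconnected_closed_iff.1 (isPreconnected_uIcc (a := x) (b := y))
    A B hA hB cover ⟨x, Set.left_mem_uIcc, hxA⟩ ⟨y, Set.right_mem_uIcc, hyB⟩
  obtain ⟨i1, hi1, c1, j1, hj1, r1, a1, b1⟩ := (memA z).1 hzA
  obtain ⟨i2, hi2, c2, j2, hj2, r2, a2, b2⟩ := (memB z).1 hzB
  exact r2 ((hcl i1 hi1 j2 hj2 (hIJ i1 hi1 j2 hj2 z a1 b2)).1 c1)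

end FreeSpace

namespace FreeSpace

/-! ### Cells of a pair of curves -/

/-- All distances in the cell are at most `ε`. -/
def CellFull (ε : ℝ) (p q : ℕ → ℝ) (i j : ℕ) : Prop :=
  segMax q j ≤ segMin p i + ε ∧ segMax p i ≤ segMin q j + ε

/-- The `i`-th segment of `p` lies more than `ε` below the `j`-th segment of `q`. -/
def Below (ε : ℝ) (p q : ℕ → ℝ) (i j : ℕ) : Prop := segMax p i + ε < segMin q j

theorem cell_cases (ε : ℝ) (p q : ℕ → ℝ) (i j : ℕ) :
    CellFull ε p q i j ∨ Below ε p q i j ∨ Below ε q p j i ∨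
      BoundaryCell ε p q i j ∨ BoundaryCell ε q p j i := by
  unfold CellFull Below BoundaryCell
  by_contra h
  push Not at h
  obtain ⟨h1, h2, h3, h4, h5⟩ := h
  have h4 := h4 h2
  have h5 := h5 h3
  linarith [h1 h4]

/-- The vertices of a curve whose segments have the directions `σ` and the lengths `len`. -/
def Chain (N : ℕ) (len : ℕ → ℕ) (p : ℕ → ℝ) (σ : ℕ → ℤ) : Prop :=
  ∀ i < N, (σ i = 1 ∨ σ i = -1) ∧ p (i + 1) = p i + σ i * len i

theorem isUnit1_cast {z : ℤ} (h : z = 1 ∨ z = -1) : IsUnit1 (z : ℝ) := by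
  rcases h with rfl | rfl <;> simp [IsUnit1]

/-- The data of a diagram, indexed by natural numbers. -/
structure Input where
  n : ℕ
  m : ℕ
  e : ℕ
  w : ℕ → ℕ
  h : ℕ → ℕ
  sl : ℕ → ℕ → ℤ
  lo : ℕ → ℕ → ℝ
  hi : ℕ → ℕ → ℝ
  m_pos : 0 < m
  n_pos : 0 < n
  e_pos : 0 < e
  w_pos : ∀ i < n, 0 < w i
  h_pos : ∀ j < m, 0 < h j
  sl_unit : ∀ i < n, ∀ j < m, sl i j = 1 ∨ sl i j = -1

namespace Input

variable (I : Input)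

def Upper (i j : ℕ) : Prop := UpperVisible (I.sl i j) (I.w i) (I.h j) (I.lo i j) (I.hi i j)
def Lower (i j : ℕ) : Prop := LowerVisible (I.sl i j) (I.w i) (I.h j) (I.lo i j) (I.hi i j)
def Mixed (i j : ℕ) : Prop := I.Upper i j ∨ I.Lower i j
def Full (i j : ℕ) : Prop := SlabFull (I.sl i j) (I.w i) (I.h j) (I.lo i j) (I.hi i j)

/-- The curves with vertices `p`, `q` and directions `σ`, `τ` realize the diagram. -/
structure Sol (p q : ℕ → ℝ) (σ τ : ℕ → ℤ) : Prop where
  chain_p : Chain I.n I.w p σ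
  chain_q : Chain I.m I.h q τ
  cell : ∀ i < I.n, ∀ j < I.m, CellMatch I.e (I.w i) (I.h j) (q j - p i) (σ i) (τ j) (I.sl i j)
    (I.lo i j) (I.hi i j)

theorem white_iff {s w h lo hi : ℝ} (hs : IsUnit1 s) (hw : 0 < w) (hh : 0 < h) :
    (∃ x y, (0 ≤ x ∧ x ≤ w) ∧ (0 ≤ y ∧ y ≤ h) ∧ lo ≤ y - s * x ∧ y - s * x ≤ hi) ↔
      lo ≤ hi ∧ slabMin s w ≤ hi ∧ lo ≤ slabMax s w h := by
  constructor
  · rintro ⟨x, y, hx, hy, h1, h2⟩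
    have := slab_bounds hs hx hy
    exact ⟨h1.trans h2, this.1.trans h2, h1.trans this.2⟩
  · rintro ⟨h1, h2, h3⟩
    have hle : slabMin s w ≤ slabMax s w h := by
      have := slab_bounds (w := w) (h := h) hs ⟨le_refl 0, hw.le⟩ ⟨le_refl 0, hh.le⟩
      linarith
    obtain ⟨x, y, hx, hy, hxy⟩ := slab_surj (v := max lo (slabMin s w)) hs hw hh (le_max_right _ _)
      (max_le h3 hle)
    refine ⟨x, y, hx, hy, ?_, ?_⟩ <;> rw [hxy]
    · exact le_max_left _ _
    · exact max_le h1 h2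

theorem full_iff_white {s w h lo hi : ℝ} (hs : IsUnit1 s) (hw : 0 < w) (hh : 0 < h) :
    SlabFull s w h lo hi ↔
      ∀ x y, (0 ≤ x ∧ x ≤ w) → (0 ≤ y ∧ y ≤ h) → lo ≤ y - s * x ∧ y - s * x ≤ hi := by
  have hle : slabMin s w ≤ slabMax s w h := by
    have := slab_bounds (w := w) (h := h) hs ⟨le_refl 0, hw.le⟩ ⟨le_refl 0, hh.le⟩
    linarith
  constructor
  · rintro ⟨h1, h2⟩ x y hx hy
    have := slab_bounds hs hx hy
    exact ⟨h1.trans this.1, this.2.trans h2⟩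
  · intro H
    obtain ⟨x, y, hx, hy, hxy⟩ := slab_surj hs hw hh le_rfl hle
    obtain ⟨x', y', hx', hy', hxy'⟩ := slab_surj hs hw hh hle le_rfl
    have h1 := H x y hx hy
    have h2 := H x' y' hx' hy'
    rw [hxy] at h1
    rw [hxy'] at h2
    exact ⟨h1.1, h2.2⟩

variable {I}
variable {p q : ℕ → ℝ} {σ τ : ℕ → ℤ}

theorem Sol.neg (S : I.Sol p q σ τ) :
    I.Sol (fun k => -p k) (fun k => -q k) (fun k => -σ k) (fun k => -τ k) where
  chain_p i hi := by
    obtain ⟨h1, h2⟩ := S.chain_p i hi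
    refine ⟨by change -σ i = 1 ∨ -σ i = -1; omega, ?_⟩
    simp only [h2]; push_cast; ring
  chain_q i hi := by
    obtain ⟨h1, h2⟩ := S.chain_q i hi
    refine ⟨by change -τ i = 1 ∨ -τ i = -1; omega, ?_⟩
    simp only [h2]; push_cast; ring
  cell i hi j hj := by
    have := (S.cell i hi j hj).neg
    push_cast
    rwa [show -q j - -p i = -(q j - p i) by ring]

theorem Sol.shift (S : I.Sol p q σ τ) (a : ℝ) :
    I.Sol (fun k => p k + a) (fun k => q k + a) σ τ where
  chain_p i hi := by
    obtain ⟨h1, h2⟩ := S.chain_p i hi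
    exact ⟨h1, by simp only [h2]; ring⟩
  chain_q i hi := by
    obtain ⟨h1, h2⟩ := S.chain_q i hi
    exact ⟨h1, by simp only [h2]; ring⟩
  cell i hi j hj := by
    have := S.cell i hi j hj
    rwa [show q j + a - (p i + a) = q j - p i by ring]

theorem Chain.col_iff {N : ℕ} {len : ℕ → ℕ} {p : ℕ → ℝ} {σ : ℕ → ℤ} (H : Chain N len p σ) {i : ℕ}
    (hi : i < N) (v : ℝ) :
    (segMin p i ≤ v ∧ v ≤ segMax p i) ↔ ∃ x, (0 ≤ x ∧ x ≤ (len i : ℝ)) ∧ v = p i + σ i * x :=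
  seg_iff (isUnit1_cast (H i hi).1) (Nat.cast_nonneg _) (H i hi).2 v

theorem forall_white_iff (hp : Chain I.n I.w p σ) (hq : Chain I.m I.h q τ) {i j : ℕ}
    (hi : i < I.n) (hj : j < I.m) :
    (∀ x y, (0 ≤ x ∧ x ≤ (I.w i : ℝ)) → (0 ≤ y ∧ y ≤ (I.h j : ℝ)) →
      |q j - p i + τ j * y - σ i * x| ≤ I.e) ↔ CellFull I.e p q i j := by
  constructor
  · intro H
    have key : ∀ a b, (segMin p i ≤ a ∧ a ≤ segMax p i) → (segMin q j ≤ b ∧ b ≤ segMax q j) →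
        |b - a| ≤ I.e := by
      intro a b ha hb
      obtain ⟨x, hx, rfl⟩ := (Chain.col_iff hp hi a).1 ha
      obtain ⟨y, hy, rfl⟩ := (Chain.col_iff hq hj b).1 hb
      have := H x y hx hy
      rwa [show q j + τ j * y - (p i + σ i * x) = q j - p i + τ j * y - σ i * x by ring]
    have a1 := segMin_le_segMax p i
    have a2 := segMin_le_segMax q j
    have h1 := abs_le.1 (key (segMin p i) (segMax q j) ⟨le_rfl, a1⟩ ⟨a2, le_rfl⟩)
    have h2 := abs_le.1 (key (segMax p i) (segMin q j) ⟨a1, le_rfl⟩ ⟨le_rfl, a2⟩)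
    exact ⟨by linarith, by linarith⟩
  · rintro ⟨h1, h2⟩ x y hx hy
    have h3 := (Chain.col_iff hp hi (p i + σ i * x)).2 ⟨x, hx, rfl⟩
    have h4 := (Chain.col_iff hq hj (q j + τ j * y)).2 ⟨y, hy, rfl⟩
    exact abs_le.2 ⟨by linarith, by linarith⟩

theorem exists_white_iff (hp : Chain I.n I.w p σ) (hq : Chain I.m I.h q τ) {i j : ℕ}
    (hi : i < I.n) (hj : j < I.m) :
    (∃ x y, (0 ≤ x ∧ x ≤ (I.w i : ℝ)) ∧ (0 ≤ y ∧ y ≤ (I.h j : ℝ)) ∧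
      |q j - p i + τ j * y - σ i * x| ≤ I.e) ↔ ¬ (Below I.e p q i j ∨ Below I.e q p j i) := by
  have he : (0 : ℝ) < I.e := by exact_mod_cast I.e_pos
  unfold Below
  constructor
  · rintro ⟨x, y, hx, hy, h⟩ hc
    have h3 := (Chain.col_iff hp hi (p i + σ i * x)).2 ⟨x, hx, rfl⟩
    have h4 := (Chain.col_iff hq hj (q j + τ j * y)).2 ⟨y, hy, rfl⟩
    have := abs_le.1 h
    rcases hc with hc | hc <;> linarith
  · intro hc
    push Not at hc
    obtain ⟨c1, c2⟩ := hc
    have a1 := segMin_le_segMax p i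
    have a2 := segMin_le_segMax q j
    suffices ∃ a b, (segMin p i ≤ a ∧ a ≤ segMax p i) ∧ (segMin q j ≤ b ∧ b ≤ segMax q j) ∧
        |b - a| ≤ I.e by
      obtain ⟨a, b, ha, hb, hab⟩ := this
      obtain ⟨x, hx, rfl⟩ := (Chain.col_iff hp hi a).1 ha
      obtain ⟨y, hy, rfl⟩ := (Chain.col_iff hq hj b).1 hb
      refine ⟨x, y, hx, hy, ?_⟩
      rwa [show q j - p i + τ j * y - σ i * x = q j + τ j * y - (p i + σ i * x) by ring]
    -- Either the two segments overlap and have a common point, or their nearest end points are at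
    -- distance at most `ε`.
    rcases le_or_gt (segMin q j) (segMax p i) with h1 | h1
    · rcases le_or_gt (segMin p i) (segMax q j) with h2 | h2
      · exact ⟨max (segMin p i) (segMin q j), max (segMin p i) (segMin q j),
          ⟨le_max_left _ _, max_le a1 h1⟩, ⟨le_max_right _ _, max_le h2 a2⟩, by simp [he.le]⟩
      · exact ⟨segMin p i, segMax q j, ⟨le_rfl, a1⟩, ⟨a2, le_rfl⟩,
          abs_le.2 ⟨by linarith, by linarith⟩⟩
    · exact ⟨segMax p i, segMin q j, ⟨a1, le_rfl⟩, ⟨le_rfl, a2⟩,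
        abs_le.2 ⟨by linarith, by linarith⟩⟩

theorem w_pos' {i : ℕ} (hi : i < I.n) : (0 : ℝ) < I.w i := by exact_mod_cast I.w_pos i hi
theorem h_pos' {j : ℕ} (hj : j < I.m) : (0 : ℝ) < I.h j := by exact_mod_cast I.h_pos j hj
theorem e_pos' : (0 : ℝ) < I.e := by exact_mod_cast I.e_pos
theorem sl_unit' {i j : ℕ} (hi : i < I.n) (hj : j < I.m) : IsUnit1 (I.sl i j : ℝ) :=
  isUnit1_cast (I.sl_unit i hi j hj)

theorem Sol.full_iff (S : I.Sol p q σ τ) {i j : ℕ} (hi : i < I.n) (hj : j < I.m) :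
    I.Full i j ↔ CellFull I.e p q i j := by
  rw [← forall_white_iff S.chain_p S.chain_q hi hj, Full,
    full_iff_white (sl_unit' hi hj) (w_pos' hi) (h_pos' hj)]
  exact ⟨fun H x y hx hy => (S.cell i hi j hj x y hx hy).2 (H x y hx hy),
    fun H x y hx hy => (S.cell i hi j hj x y hx hy).1 (H x y hx hy)⟩

theorem Sol.empty_iff (S : I.Sol p q σ τ) {i j : ℕ} (hi : i < I.n) (hj : j < I.m) :
    (I.hi i j < I.lo i j ∨ I.hi i j < slabMin (I.sl i j) (I.w i) ∨
      slabMax (I.sl i j) (I.w i) (I.h j) < I.lo i j) ↔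
      (Below I.e p q i j ∨ Below I.e q p j i) := by
  rw [← not_iff_not, ← exists_white_iff S.chain_p S.chain_q hi hj]
  have := white_iff (lo := I.lo i j) (hi := I.hi i j) (sl_unit' hi hj) (w_pos' hi) (h_pos' hj)
  push Not
  rw [← this]
  constructor
  · rintro ⟨x, y, hx, hy, H⟩; exact ⟨x, y, hx, hy, (S.cell i hi j hj x y hx hy).2 H⟩
  · rintro ⟨x, y, hx, hy, H⟩; exact ⟨x, y, hx, hy, (S.cell i hi j hj x y hx hy).1 H⟩

theorem not_boundary {ε : ℝ} {p q : ℕ → ℝ} {i j : ℕ} (hε : 0 < ε)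
    (h : BoundaryCell ε p q i j ∨ BoundaryCell ε q p j i) :
    ¬ CellFull ε p q i j ∧ ¬ (Below ε p q i j ∨ Below ε q p j i) := by
  have a1 := segMin_le_segMax p i
  have a2 := segMin_le_segMax q j
  unfold BoundaryCell at h
  unfold CellFull Below
  rcases h with ⟨h1, h2⟩ | ⟨h1, h2⟩
  · exact ⟨fun h => by linarith [h.1], fun h => by rcases h with h | h <;> linarith⟩
  · exact ⟨fun h => by linarith [h.2], fun h => by rcases h with h | h <;> linarith⟩

theorem mixed_iff_data (i j : ℕ) :
    I.Mixed i j ↔ ¬ I.Full i j ∧ ¬ (I.hi i j < I.lo i j ∨ I.hi i j < slabMin (I.sl i j) (I.w i) ∨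
      slabMax (I.sl i j) (I.w i) (I.h j) < I.lo i j) := by
  unfold Mixed Full Upper Lower UpperVisible LowerVisible SlabFull
  push Not
  constructor
  · rintro (⟨h1, h2, h3⟩ | ⟨h1, h2, h3⟩)
    · exact ⟨fun _ => h3, h1, h2, by linarith⟩
    · exact ⟨fun h => by linarith, h1, by linarith, h3⟩
  · rintro ⟨h1, h2, h3, h4⟩
    rcases le_or_gt (I.lo i j) (slabMin (I.sl i j) (I.w i)) with h | h
    · exact Or.inl ⟨h2, h3, h1 h⟩
    · exact Or.inr ⟨h2, h, h4⟩

/-- The data show whether a cell is full, empty or neither. For the curves, a cell that is neither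
contains distance `ε` and larger distances, of one sign or the other. This is the bridge between the
graph of the algorithm and `BoundaryCell`. -/
theorem Sol.mixed_iff (S : I.Sol p q σ τ) {i j : ℕ} (hi : i < I.n) (hj : j < I.m) :
    I.Mixed i j ↔ BoundaryCell I.e p q i j ∨ BoundaryCell I.e q p j i := by
  rw [mixed_iff_data, S.full_iff hi hj, S.empty_iff hi hj]
  constructor
  · rintro ⟨h1, h2⟩
    rcases cell_cases I.e p q i j with h | h | h | h | h <;> tauto
  · exact not_boundary e_pos'

theorem boundary_of_gt (hp : Chain I.n I.w p σ) (hq : Chain I.m I.h q τ) {i j : ℕ} {x y : ℝ}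
    (hi : i < I.n) (hj : j < I.m) (hx : 0 ≤ x ∧ x ≤ (I.w i : ℝ)) (hy : 0 ≤ y ∧ y ≤ (I.h j : ℝ))
    (h1 : (I.e : ℝ) < q j - p i + τ j * y - σ i * x)
    (h2 : ¬ (Below I.e p q i j)) :
    BoundaryCell I.e p q i j := by
  have h3 := (Chain.col_iff hp hi (p i + σ i * x)).2 ⟨x, hx, rfl⟩
  have h4 := (Chain.col_iff hq hj (q j + τ j * y)).2 ⟨y, hy, rfl⟩
  unfold Below at h2
  exact ⟨by linarith, by linarith⟩

theorem boundary_of_lt (hp : Chain I.n I.w p σ) (hq : Chain I.m I.h q τ) {i j : ℕ} {x y : ℝ}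
    (hi : i < I.n) (hj : j < I.m) (hx : 0 ≤ x ∧ x ≤ (I.w i : ℝ)) (hy : 0 ≤ y ∧ y ≤ (I.h j : ℝ))
    (h1 : q j - p i + τ j * y - σ i * x < -(I.e : ℝ))
    (h2 : ¬ (Below I.e q p j i)) :
    BoundaryCell I.e q p j i := by
  have h3 := (Chain.col_iff hp hi (p i + σ i * x)).2 ⟨x, hx, rfl⟩
  have h4 := (Chain.col_iff hq hj (q j + τ j * y)).2 ⟨y, hy, rfl⟩
  unfold Below at h2
  exact ⟨by linarith, by linarith⟩

/-- At a point where `y - s * x` is maximal the slab has been left through its upper boundary, so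
the distance exceeds `ε` there. The direction `τ j` tells whether `q` or `p` is the higher curve at
that point, hence the kind of the boundary cell. -/
theorem Sol.upper (S : I.Sol p q σ τ) {i j : ℕ} (hi : i < I.n) (hj : j < I.m) (h : I.Upper i j) :
    σ i * τ j = I.sl i j ∧ τ j * (q j - p i) = I.e - I.hi i j ∧
      (τ j = 1 → BoundaryCell I.e p q i j) ∧ (τ j = -1 → BoundaryCell I.e q p j i) := by
  have hτ := (S.chain_q j hj).1
  have hU := (S.cell i hi j hj).upper (w_pos' hi) (h_pos' hj) (isUnit1_cast (S.chain_p i hi).1)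
    (isUnit1_cast hτ) (sl_unit' hi hj) h
  have hne : ¬ (Below I.e p q i j ∨ Below I.e q p j i) := by
    rw [← S.empty_iff hi hj]
    exact ((mixed_iff_data i j).1 (Or.inl h)).2
  push Not at hne
  refine ⟨by exact_mod_cast hU.1, hU.2, ?_⟩
  obtain ⟨h1, h2, h3⟩ := h
  obtain ⟨x, y, hx, hy, hxy⟩ := slab_surj (sl_unit' hi hj) (w_pos' hi) (h_pos' hj)
    (h2.trans h3.le) le_rfl
  have e1 : (τ j : ℝ) * τ j = 1 := by rcases hτ with h | h <;> simp [h]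
  have key : (τ j : ℝ) * (q j - p i + τ j * y - σ i * x) =
      I.e - I.hi i j + slabMax (I.sl i j) (I.w i) (I.h j) := by
    rw [← hxy, ← hU.2, ← hU.1]; linear_combination e1 * y
  constructor
  · intro ht
    refine boundary_of_gt S.chain_p S.chain_q hi hj hx hy ?_ hne.1
    rw [ht] at key ⊢
    push_cast at key ⊢
    linarith
  · intro ht
    refine boundary_of_lt S.chain_p S.chain_q hi hj hx hy ?_ hne.2
    rw [ht] at key ⊢
    push_cast at key ⊢
    linarith

theorem Sol.lower (S : I.Sol p q σ τ) {i j : ℕ} (hi : i < I.n) (hj : j < I.m) (h : I.Lower i j) :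
    σ i * τ j = I.sl i j ∧ τ j * (q j - p i) = -I.e - I.lo i j ∧
      (τ j = -1 → BoundaryCell I.e p q i j) ∧ (τ j = 1 → BoundaryCell I.e q p j i) := by
  have hτ := (S.chain_q j hj).1
  have hU := (S.cell i hi j hj).lower (w_pos' hi) (h_pos' hj) (isUnit1_cast (S.chain_p i hi).1)
    (isUnit1_cast hτ) (sl_unit' hi hj) h
  have hne : ¬ (Below I.e p q i j ∨ Below I.e q p j i) := by
    rw [← S.empty_iff hi hj]
    exact ((mixed_iff_data i j).1 (Or.inr h)).2
  push Not at hne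
  refine ⟨by exact_mod_cast hU.1, hU.2, ?_⟩
  obtain ⟨h1, h2, h3⟩ := h
  obtain ⟨x, y, hx, hy, hxy⟩ := slab_surj (sl_unit' hi hj) (w_pos' hi) (h_pos' hj)
    le_rfl (h2.le.trans h3)
  have e1 : (τ j : ℝ) * τ j = 1 := by rcases hτ with h | h <;> simp [h]
  have key : (τ j : ℝ) * (q j - p i + τ j * y - σ i * x) =
      -I.e - I.lo i j + slabMin (I.sl i j) (I.w i) := by
    rw [← hxy, ← hU.2, ← hU.1]; linear_combination e1 * y
  constructor
  · intro ht
    refine boundary_of_gt S.chain_p S.chain_q hi hj hx hy ?_ hne.1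
    rw [ht] at key ⊢
    push_cast at key ⊢
    linarith
  · intro ht
    refine boundary_of_lt S.chain_p S.chain_q hi hj hx hy ?_ hne.2
    rw [ht] at key ⊢
    push_cast at key ⊢
    linarith

/-- Curves that agree with a solution cell by cell are a solution. -/
theorem Sol.of_cells (S : I.Sol p q σ τ) {p' q' : ℕ → ℝ} {σ' τ' : ℕ → ℤ}
    (hp : Chain I.n I.w p' σ') (hq : Chain I.m I.h q' τ')
    (H : ∀ i < I.n, ∀ j < I.m, (q' j - p' i = q j - p i ∧ σ' i = σ i ∧ τ' j = τ j) ∨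
      (CellFull I.e p q i j ∧ CellFull I.e p' q' i j) ∨
      ((Below I.e p q i j ∨ Below I.e q p j i) ∧ (Below I.e p' q' i j ∨ Below I.e q' p' j i))) :
    I.Sol p' q' σ' τ' where
  chain_p := hp
  chain_q := hq
  cell i hi j hj := by
    rcases H i hi j hj with ⟨h1, h2, h3⟩ | ⟨h1, h2⟩ | ⟨h1, h2⟩
    · rw [h1, h2, h3]; exact S.cell i hi j hj
    · intro x y hx hy
      rw [← S.cell i hi j hj x y hx hy]
      exact ⟨fun _ => (forall_white_iff S.chain_p S.chain_q hi hj).2 h1 x y hx hy,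
        fun _ => (forall_white_iff hp hq hi hj).2 h2 x y hx hy⟩
    · intro x y hx hy
      rw [← S.cell i hi j hj x y hx hy]
      constructor
      · intro h
        exact absurd h2 ((exists_white_iff hp hq hi hj).1 ⟨x, y, hx, hy, h⟩)
      · intro h
        exact absurd h1 ((exists_white_iff S.chain_p S.chain_q hi hj).1 ⟨x, y, hx, hy, h⟩)

end Input

end FreeSpace

namespace FreeSpace

/-! ### Wholly empty columns and rows -/

/-- A column outside `C` has no cell of this kind, so by `segs_split'` the curve `q` stays on one
side of it; `hcol` excludes the wrong side. Rows are treated in the same way. -/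
theorem le_of_no_boundary {n m : ℕ} {ε : ℝ} {p q : ℕ → ℝ} {C R : ℕ → Prop}
    (hb : ∀ i < n, ∀ j < m, BoundaryCell ε p q i j → C i ∧ R j)
    (hcol : ∀ i < n, ¬ ∀ j < m, Below ε p q i j) (hrow : ∀ j < m, ¬ ∀ i < n, Below ε p q i j) :
    ∀ i < n, ∀ j < m, ¬ (C i ∧ R j) → segMax q j ≤ segMin p i + ε := by
  intro i hi j hj h
  have a1 := segMin_le_segMax p i
  have a2 := segMin_le_segMax q j
  rw [not_and_or] at h
  rcases h with h | h
  · rcases segs_split' (N := m) (p := q) (x := segMin p i + ε) (y := segMax p i + ε)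
      (by linarith) (fun j' hj' => by
        by_contra hc
        push Not at hc
        exact h (hb i hi j' hj' ⟨hc.2, hc.1⟩).1) with H | H
    · exact H j hj
    · exact absurd H (hcol i hi)
  · rcases segs_split (N := n) (p := p) (x := segMin q j - ε) (y := segMax q j - ε)
      (by linarith) (fun i' hi' => by
        by_contra hc
        push Not at hc
        exact h (hb i' hi' j hj ⟨by linarith [hc.1], by linarith [hc.2]⟩).2) with H | H
    · exact absurd (fun i' hi' => by have := H i' hi'; unfold Below; linarith) (hrow j hj)
    · linarith [H i hi]

/-- If no column or row contains boundary cells of both kinds, the second curve is short. -/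
theorem range_le_of_disjoint {n m : ℕ} {ε : ℝ} {p q : ℕ → ℝ} {C R C' R' : ℕ → Prop}
    (hε : 0 < ε) (hb : ∀ i < n, ∀ j < m, BoundaryCell ε p q i j → C i ∧ R j)
    (hb' : ∀ i < n, ∀ j < m, BoundaryCell ε q p j i → C' i ∧ R' j)
    (hd : ∀ i < n, C i → C' i → False)
    (h1 : ∃ i < n, ∃ j < m, BoundaryCell ε p q i j)
    (h2 : ∃ i < n, ∃ j < m, BoundaryCell ε q p j i) :
    ∀ j < m, ∀ j' < m, segMax q j ≤ segMin q j' + 2 * ε := by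
  obtain ⟨i1, hi1, j1, hj1, b1, b1'⟩ := h1
  obtain ⟨i2, hi2, j2, hj2, b2, b2'⟩ := h2
  have hne : (Finset.range m).Nonempty := ⟨j1, by simpa using hj1⟩
  obtain ⟨J, hJ, hJmax⟩ := Finset.exists_max_image (Finset.range m) (segMax q) hne
  obtain ⟨J', hJ', hJmin⟩ := Finset.exists_min_image (Finset.range m) (segMin q) hne
  simp only [Finset.mem_range] at hJ hJmax hJ' hJmin
  suffices hJJ : segMax q J ≤ segMin q J' + 2 * ε by
    intro j hj j' hj'
    linarith [hJmax j hj, hJmin j' hj']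
  by_contra hlt
  push Not at hlt
  -- The two given boundary cells provide points of `p` less than `ε` under the top of `q` by the
  -- margin and more than `ε` over its bottom, in the sense that `p` gets below `max q - ε` and
  -- above `min q + ε`. As `min q + ε < max q - ε`, one segment must do both, and its column then
  -- contains boundary cells of both kinds.
  have hex : ∃ i < n, segMin p i < segMax q J - ε ∧ segMin q J' + ε < segMax p i := by
    by_contra hc
    push Not at hc
    rcases segs_split' (N := n) (p := p) (x := segMin q J' + ε) (y := segMin q J' + ε) le_rfl
      (fun i hi => by
        by_contra h
        push Not at h
        linarith [hc i hi (by linarith)]) with H | H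
    · linarith [H i2 hi2, hJmin j2 hj2]
    · have := hc i1 hi1 (by linarith [hJmax j1 hj1])
      linarith [H i1 hi1, segMin_le_segMax p i1]
  obtain ⟨i, hi, c1, c2⟩ := hex
  have a1 := segMin_le_segMax p i
  have hC : C i := by
    by_contra h
    rcases segs_split' (N := m) (p := q) (x := segMin p i + ε) (y := segMax p i + ε)
      (by linarith) (fun j' hj' => by
        by_contra hc
        push Not at hc
        exact h (hb i hi j' hj' ⟨hc.2, hc.1⟩).1) with H | H
    · linarith [H J hJ]
    · linarith [H J' hJ']
  have hC' : C' i := by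
    by_contra h
    rcases segs_split (N := m) (p := q) (x := segMin p i - ε) (y := segMax p i - ε)
      (by linarith) (fun j' hj' => by
        by_contra hc
        push Not at hc
        exact h (hb' i hi j' hj' ⟨by linarith [hc.1], by linarith [hc.2]⟩).1) with H | H
    · linarith [H J hJ]
    · linarith [H J' hJ']
  exact hd i hi hC hC'

/-- A column without boundary cells is wholly full or wholly empty. -/
theorem line_cases {m : ℕ} {ε : ℝ} {p q : ℕ → ℝ} {i : ℕ}
    (h : ∀ j < m, ¬ (BoundaryCell ε p q i j ∨ BoundaryCell ε q p j i)) :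
    (∀ j < m, CellFull ε p q i j) ∨ (∀ j < m, Below ε p q i j) ∨ (∀ j < m, Below ε q p j i) := by
  have a1 := segMin_le_segMax p i
  rcases segs_split' (N := m) (p := q) (x := segMin p i + ε) (y := segMax p i + ε)
    (by linarith) (fun j hj => by
      by_contra hc
      push Not at hc
      exact h j hj (Or.inl ⟨hc.2, hc.1⟩)) with H | H
  · rcases segs_split (N := m) (p := q) (x := segMin p i - ε) (y := segMax p i - ε)
      (by linarith) (fun j hj => by
        by_contra hc
        push Not at hc
        exact h j hj (Or.inr ⟨by linarith [hc.1], by linarith [hc.2]⟩)) with H' | H'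
    · exact Or.inr (Or.inr fun j hj => by have := H' j hj; unfold Below; linarith)
    · exact Or.inl fun j hj => ⟨H j hj, by linarith [H' j hj]⟩
  · exact Or.inr (Or.inl H)

/-! ### Lattice paths between walls -/

/-- For each class of segments, the walls between which, or beyond which, they must stay, and
the shift of the prescribed positions. -/
structure Walls where
  wl : ℤ → ℝ
  wu : ℤ → ℝ
  el : ℤ → ℝ
  eu : ℤ → ℝ
  sh : ℤ → ℝ

/-- One test serves all classes. `Walls.Interval` disables the two outer options by placing them
beyond the lattice, and `Walls.Outside` disables the first one by an empty interval. -/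
def Walls.Allows (W : Walls) (c : ℤ) (y y' : ℝ) : Prop :=
  (W.wl c ≤ y ∧ y ≤ W.wu c ∧ W.wl c ≤ y' ∧ y' ≤ W.wu c) ∨ (y < W.el c ∧ y' < W.el c) ∨
    (W.eu c < y ∧ W.eu c < y')

/-- The segments of a curve with their lengths and classes. A segment with `sg i ≠ 0` has a
prescribed direction and position. -/
structure Line where
  N : ℕ
  len : ℕ → ℕ
  cls : ℕ → ℤ
  sg : ℕ → ℤ
  pos : ℕ → ℝ

namespace Line

variable (L : Line)

/-- Positions are integers relative to `base`. Only the end of the step is confined to the window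
here; its start is confined by the preceding step, or by `IsPath.range`. -/
def Move (W : Walls) (base : ℝ) (M : ℤ) (i : ℕ) (x s : ℤ) : Prop :=
  0 ≤ x + s * L.len i ∧ x + s * L.len i < M ∧
    (L.sg i = 0 ∨ (L.sg i = s ∧ base + x = L.pos i + W.sh (L.cls i))) ∧
    W.Allows (L.cls i) (base + x) (base + ((x + s * L.len i : ℤ) : ℝ))

structure IsPath (W : Walls) (base : ℝ) (M : ℤ) (x s : ℕ → ℤ) : Prop where
  range : ∀ i ≤ L.N, 0 ≤ x i ∧ x i < M
  move : ∀ i < L.N, (s i = 1 ∨ s i = -1) ∧ L.Move W base M i (x i) (s i) ∧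
    x (i + 1) = x i + s i * L.len i

/-- The least and the greatest vertex of the segments of class `c`, if there are any. -/
def Extremes (c : ℤ) (mn mx d₁ d₂ : ℝ) : Prop :=
  ((∃ i < L.N, L.cls i = c) →
    (∀ i < L.N, L.cls i = c → (mn ≤ L.pos i ∧ mn ≤ L.pos i + L.sg i * L.len i) ∧
      (L.pos i ≤ mx ∧ L.pos i + L.sg i * L.len i ≤ mx)) ∧
    (∃ i < L.N, L.cls i = c ∧ (mn = L.pos i ∨ mn = L.pos i + L.sg i * L.len i)) ∧
    (∃ i < L.N, L.cls i = c ∧ (mx = L.pos i ∨ mx = L.pos i + L.sg i * L.len i))) ∧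
  ((∀ i < L.N, L.cls i ≠ c) → mn = d₁ ∧ mx = d₂)

variable {L} {W : Walls} {base : ℝ} {M : ℤ} {x s : ℕ → ℤ}

theorem IsPath.chain (H : L.IsPath W base M x s) :
    Chain L.N L.len (fun k => base + x k) s := fun i hi => by
  obtain ⟨h1, _, h3⟩ := H.move i hi
  refine ⟨h1, ?_⟩
  simp only [h3]; push_cast; ring

theorem IsPath.known (H : L.IsPath W base M x s) {i : ℕ} (hi : i < L.N) (h : L.sg i ≠ 0) :
    s i = L.sg i ∧ base + x i = L.pos i + W.sh (L.cls i) := by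
  obtain ⟨_, h2, _⟩ := H.move i hi
  rcases h2.2.2.1 with h' | h'
  · exact absurd h' h
  · exact ⟨h'.1.symm, h'.2⟩

theorem IsPath.allows (H : L.IsPath W base M x s) {i : ℕ} (hi : i < L.N) :
    W.Allows (L.cls i) (base + x i) (base + x (i + 1)) := by
  obtain ⟨_, h2, h3⟩ := H.move i hi
  have := h2.2.2.2
  rwa [← h3] at this

/-- The completeness half of the search: an actual curve is a lattice path as soon as its vertices
differ from `base` by integers and lie in the window. -/
theorem exists_path {p : ℕ → ℝ} {σ : ℕ → ℤ} (hc : Chain L.N L.len p σ)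
    (hz : ∀ k ≤ L.N, ∃ z : ℤ, p k = base + z)
    (hr : ∀ k ≤ L.N, base ≤ p k ∧ p k < base + M)
    (hk : ∀ i < L.N, L.sg i = 0 ∨ (L.sg i = σ i ∧ p i = L.pos i + W.sh (L.cls i)))
    (ha : ∀ i < L.N, W.Allows (L.cls i) (p i) (p (i + 1))) :
    ∃ x s, L.IsPath W base M x s := by
  choose! z hz using hz
  have hstep : ∀ i < L.N, z (i + 1) = z i + σ i * L.len i := by
    intro i hi
    have h1 := (hc i hi).2
    rw [hz i hi.le, hz (i + 1) hi] at h1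
    have : (z (i + 1) : ℝ) = z i + σ i * L.len i := by linarith
    exact_mod_cast this
  have hrange : ∀ k ≤ L.N, 0 ≤ z k ∧ z k < M := by
    intro k hk
    have := hr k hk
    rw [hz k hk] at this
    constructor
    · have : (0 : ℝ) ≤ z k := by linarith [this.1]
      exact_mod_cast this
    · have : (z k : ℝ) < M := by linarith [this.2]
      exact_mod_cast this
  refine ⟨z, σ, hrange, fun i hi => ⟨(hc i hi).1, ⟨?_, ?_, ?_, ?_⟩, hstep i hi⟩⟩
  · rw [← hstep i hi]; exact (hrange (i + 1) hi).1
  · rw [← hstep i hi]; exact (hrange (i + 1) hi).2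
  · have := hk i hi
    rwa [hz i hi.le] at this
  · have := ha i hi
    rwa [hz i hi.le, hz (i + 1) hi, hstep i hi] at this

end Line

/-- Class `c` has to stay in the interval from `l` to `u`; positions are at least `base` and less
than `t`. -/
def Walls.Interval (W : Walls) (c : ℤ) (l u s base t : ℝ) : Prop :=
  W.wl c = l ∧ W.wu c = u ∧ W.sh c = s ∧ W.el c = base ∧ W.eu c = t

/-- Class `c` has to stay below `a` or to stay above `b`. -/
def Walls.Outside (W : Walls) (c : ℤ) (a b : ℝ) : Prop :=
  W.wu c < W.wl c ∧ W.el c = a ∧ W.eu c = b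

theorem Walls.Interval.allows {W : Walls} {c : ℤ} {l u s base t : ℝ}
    (H : W.Interval c l u s base t) {p : ℕ → ℝ} {i : ℕ} (h1 : l ≤ segMin p i)
    (h2 : segMax p i ≤ u) : W.Allows c (p i) (p (i + 1)) := by
  obtain ⟨e1, e2, _⟩ := H
  left
  rw [e1, e2]
  exact ⟨h1.trans (segMin_le_left p i), (le_segMax_left p i).trans h2,
    h1.trans (segMin_le_right p i), (le_segMax_right p i).trans h2⟩

theorem Walls.Outside.allows {W : Walls} {c : ℤ} {a b : ℝ}
    (H : W.Outside c a b) {p : ℕ → ℝ} {i : ℕ} (h : segMax p i < a ∨ b < segMin p i) :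
    W.Allows c (p i) (p (i + 1)) := by
  obtain ⟨_, e1, e2⟩ := H
  right
  rw [e1, e2]
  rcases h with h | h
  · exact Or.inl ⟨(le_segMax_left p i).trans_lt h, (le_segMax_right p i).trans_lt h⟩
  · exact Or.inr ⟨h.trans_le (segMin_le_left p i), h.trans_le (segMin_le_right p i)⟩

theorem Line.IsPath.interval {L : Line} {W : Walls} {base : ℝ} {M : ℤ} {x s : ℕ → ℤ}
    (H : L.IsPath W base M x s) {i : ℕ} (hi : i < L.N) {l u sh : ℝ}
    (hW : W.Interval (L.cls i) l u sh base (base + M)) :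
    l ≤ segMin (fun k => base + (x k : ℝ)) i ∧ segMax (fun k => base + (x k : ℝ)) i ≤ u := by
  obtain ⟨e1, e2, _, e4, e5⟩ := hW
  have h1 : (0 : ℝ) ≤ x i := by exact_mod_cast (H.range i hi.le).1
  have h2 : (x i : ℝ) < M := by exact_mod_cast (H.range i hi.le).2
  rcases H.allows hi with ⟨a, b, c, d⟩ | ⟨a, _⟩ | ⟨a, _⟩
  · rw [e1] at a c
    rw [e2] at b d
    exact ⟨le_min a c, max_le b d⟩
  · rw [e4] at a; linarith
  · rw [e5] at a; linarith

theorem Line.IsPath.outside {L : Line} {W : Walls} {base : ℝ} {M : ℤ} {x s : ℕ → ℤ}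
    (H : L.IsPath W base M x s) {i : ℕ} (hi : i < L.N) {a b : ℝ}
    (hW : W.Outside (L.cls i) a b) :
    segMax (fun k => base + (x k : ℝ)) i < a ∨ b < segMin (fun k => base + (x k : ℝ)) i := by
  obtain ⟨e1, e2, e3⟩ := hW
  rcases H.allows hi with ⟨c, d, _⟩ | ⟨c, d⟩ | ⟨c, d⟩
  · linarith
  · rw [e2] at c d; exact Or.inl (max_lt c d)
  · rw [e3] at c d; exact Or.inr (lt_min c d)

theorem Chain.exists_int {N : ℕ} {len : ℕ → ℕ} {p : ℕ → ℝ} {σ : ℕ → ℤ} (H : Chain N len p σ) :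
    ∀ k ≤ N, ∃ z : ℤ, p k = p 0 + z := by
  intro k
  induction k with
  | zero => intro _; exact ⟨0, by simp⟩
  | succ k ih =>
    intro hk
    obtain ⟨z, hz⟩ := ih (by omega)
    exact ⟨z + σ k * len k, by rw [(H k hk).2, hz]; push_cast; ring⟩

theorem Chain.exists_int' {N : ℕ} {len : ℕ → ℕ} {p : ℕ → ℝ} {σ : ℕ → ℤ} (H : Chain N len p σ)
    {k l : ℕ} (hk : k ≤ N) (hl : l ≤ N) : ∃ z : ℤ, p k = p l + z := by
  obtain ⟨a, ha⟩ := H.exists_int k hk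
  obtain ⟨b, hb⟩ := H.exists_int l hl
  exact ⟨a - b, by rw [ha, hb]; push_cast; ring⟩

theorem Chain.abs_sub_le {N : ℕ} {len : ℕ → ℕ} {p : ℕ → ℝ} {σ : ℕ → ℤ} (H : Chain N len p σ) :
    ∀ l k, k ≤ l → l ≤ N → |p l - p k| ≤ ∑ i ∈ Finset.range N, (len i : ℝ) := by
  have key : ∀ l k, k ≤ l → l ≤ N → |p l - p k| ≤ ∑ i ∈ Finset.Ico k l, (len i : ℝ) := by
    intro l
    induction l with
    | zero =>
      intro k hk _
      obtain rfl : k = 0 := by omega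
      simp
    | succ l ih =>
      intro k hk hl
      rcases hk.eq_or_lt with rfl | hk'
      · simp
      · have h1 := ih k (by omega) (by omega)
        rw [Finset.sum_Ico_succ_top (by omega)]
        have h2 : |(σ l : ℝ) * len l| = len l := by
          rcases (H l (by omega)).1 with h | h <;> simp [h]
        calc |p (l + 1) - p k| = |(p l - p k) + σ l * len l| := by
              rw [(H l (by omega)).2]; congr 1; ring
          _ ≤ _ := (abs_add_le _ _).trans (by rw [h2]; linarith)
  intro l k hk hl
  refine (key l k hk hl).trans (Finset.sum_le_sum_of_subset_of_nonneg ?_ fun _ _ _ =>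
      Nat.cast_nonneg _)
  intro i hi
  simp only [Finset.mem_Ico, Finset.mem_range] at hi ⊢
  omega

end FreeSpace

/-! ### Marks that fit a solution, and bounds that decouple the two curves -/

namespace FreeSpace

/-- Classes, directions and positions of the columns and the rows of a diagram. -/
structure Marks where
  cC : ℕ → ℤ
  cR : ℕ → ℤ
  sC : ℕ → ℤ
  sR : ℕ → ℤ
  xC : ℕ → ℝ
  xR : ℕ → ℝ

namespace Input

variable (I : Input) (K : Marks)

def colLine : Line := ⟨I.n, I.w, K.cC, K.sC, K.xC⟩
def rowLine : Line := ⟨I.m, I.h, K.cR, K.sR, K.xR⟩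

/-- The marks describe the solution: class `1` contains the boundary cells with `q - p = ε` and is
marked with the true positions, class `2` contains the remaining boundary cells and is marked with
the positions up to a translation, and class `3` consists of the empty columns and rows. -/
structure Fits (p q : ℕ → ℝ) (σ τ : ℕ → ℤ) (κ : ℝ) : Prop where
  sol : I.Sol p q σ τ
  col1 : ∀ i < I.n, K.cC i = 1 → K.sC i = σ i ∧ K.xC i + 0 = p i
  row1 : ∀ j < I.m, K.cR j = 1 → K.sR j = τ j ∧ K.xR j + 0 = q j
  col2 : ∀ i < I.n, K.cC i = 2 → K.sC i = σ i ∧ K.xC i + κ = p i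
  row2 : ∀ j < I.m, K.cR j = 2 → K.sR j = τ j ∧ K.xR j + κ = q j
  col0 : ∀ i < I.n, K.cC i = 0 ∨ K.cC i = 3 → K.sC i = 0
  row0 : ∀ j < I.m, K.cR j = 0 ∨ K.cR j = 3 → K.sR j = 0
  col_cls : ∀ i < I.n, K.cC i = 0 ∨ K.cC i = 1 ∨ K.cC i = 2 ∨ K.cC i = 3
  row_cls : ∀ j < I.m, K.cR j = 0 ∨ K.cR j = 1 ∨ K.cR j = 2 ∨ K.cR j = 3
  mixed : ∀ i < I.n, ∀ j < I.m, I.Mixed i j →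
    (K.cC i = 1 ∧ K.cR j = 1) ∨ (K.cC i = 2 ∧ K.cR j = 2)
  plus : ∀ i < I.n, ∀ j < I.m, BoundaryCell I.e p q i j → K.cC i = 1 ∧ K.cR j = 1
  one : (∃ i < I.n, K.cC i = 1) ∨ (∃ j < I.m, K.cR j = 1) →
    ∃ i < I.n, ∃ j < I.m, K.cC i = 1 ∧ K.cR j = 1 ∧ BoundaryCell I.e p q i j
  two : (∃ i < I.n, K.cC i = 2) ∨ (∃ j < I.m, K.cR j = 2) →
    (∃ i < I.n, ∃ j < I.m, K.cC i = 2 ∧ K.cR j = 2 ∧ BoundaryCell I.e q p j i) ∧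
      ∀ i < I.n, ∀ j < I.m, BoundaryCell I.e q p j i → K.cC i = 2 ∧ K.cR j = 2
  col3 : ∀ i < I.n, (K.cC i = 0 → I.Full i 0) ∧ (K.cC i = 3 → ¬ I.Full i 0)
  row3 : ∀ j < I.m, (K.cR j = 0 → I.Full 0 j) ∧ (K.cR j = 3 → ¬ I.Full 0 j)

end Input

/-- The marks of a class are correct up to the translation `κ`, so their extremes are those of the
true segments up to `κ`. -/
theorem Line.Extremes.spec {L : Line} {c : ℤ} {mn mx d₁ d₂ κ : ℝ} (H : L.Extremes c mn mx d₁ d₂)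
    {p : ℕ → ℝ} {σ : ℕ → ℤ} (hc : Chain L.N L.len p σ)
    (hk : ∀ i < L.N, L.cls i = c → L.sg i = σ i ∧ L.pos i + κ = p i)
    (hex : ∃ i < L.N, L.cls i = c) :
    (∀ i < L.N, L.cls i = c → mn + κ ≤ segMin p i ∧ segMax p i ≤ mx + κ) ∧
      (∃ i < L.N, L.cls i = c ∧ segMin p i = mn + κ) ∧
      (∃ i < L.N, L.cls i = c ∧ segMax p i = mx + κ) := by
  obtain ⟨h1, ⟨i, hi, hic, h2⟩, ⟨j, hj, hjc, h3⟩⟩ := H.1 hex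
  have key : ∀ i < L.N, L.cls i = c → p i = L.pos i + κ ∧
      p (i + 1) = L.pos i + L.sg i * L.len i + κ := by
    intro i hi hic
    obtain ⟨a, b⟩ := hk i hi hic
    refine ⟨b.symm, ?_⟩
    rw [(hc i hi).2, a, ← b]; ring
  have h4 : ∀ i < L.N, L.cls i = c → mn + κ ≤ segMin p i ∧ segMax p i ≤ mx + κ := by
    intro i hi hic
    obtain ⟨a, b⟩ := key i hi hic
    obtain ⟨⟨b1, b2⟩, b3, b4⟩ := h1 i hi hic
    exact ⟨le_min (by linarith) (by linarith), max_le (by linarith) (by linarith)⟩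
  refine ⟨h4, ⟨i, hi, hic, le_antisymm ?_ (h4 i hi hic).1⟩, ⟨j, hj, hjc, le_antisymm (h4 j hj
      hjc).2 ?_⟩⟩
  · obtain ⟨a, b⟩ := key i hi hic
    rcases h2 with h2 | h2
    · rw [h2, ← a]; exact segMin_le_left p i
    · rw [h2, ← b]; exact segMin_le_right p i
  · obtain ⟨a, b⟩ := key j hj hjc
    rcases h3 with h3 | h3
    · rw [h3, ← a]; exact le_segMax_left p j
    · rw [h3, ← b]; exact le_segMax_right p j

theorem exists_vertex_min (p : ℕ → ℝ) {N i : ℕ} (hi : i < N) : ∃ k ≤ N, p k = segMin p i := by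
  rcases min_choice (p i) (p (i + 1)) with h | h
  · exact ⟨i, hi.le, h.symm⟩
  · exact ⟨i + 1, hi, h.symm⟩

theorem exists_vertex_max (p : ℕ → ℝ) {N i : ℕ} (hi : i < N) : ∃ k ≤ N, p k = segMax p i := by
  rcases max_choice (p i) (p (i + 1)) with h | h
  · exact ⟨i, hi.le, h.symm⟩
  · exact ⟨i + 1, hi, h.symm⟩

theorem exists_seg_vertex (p : ℕ → ℝ) {N k : ℕ} (hN : 0 < N) (hk : k ≤ N) :
    ∃ i < N, segMin p i ≤ p k ∧ p k ≤ segMax p i := by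
  rcases Nat.lt_or_ge k N with h | h
  · exact ⟨k, h, segMin_le_left p k, le_segMax_left p k⟩
  · obtain ⟨i, rfl⟩ : ∃ i, k = i + 1 := ⟨k - 1, by omega⟩
    exact ⟨i, by omega, segMin_le_right p i, le_segMax_right p i⟩

/-- The lower end `al` of `p` and the upper end `b` of `q` are such that everything outside `C`
and `R` keeps within the distance `ε` of them. -/
structure OneSide (ε : ℝ) (n m : ℕ) (p q : ℕ → ℝ) (C R : ℕ → Prop) (al b : ℝ) : Prop where
  le_p : ∀ i < n, al ≤ segMin p i
  q_le : ∀ j < m, segMax q j ≤ b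
  gap : al + ε ≤ b
  col : ∀ i < n, ¬ C i → b - ε ≤ segMin p i
  row : ∀ j < m, ¬ R j → segMax q j ≤ al + ε

/-- A condition on pairs becomes a condition on single segments: a column outside `C` is compared
with the row that attains `b`, and a row outside `R` with the column that attains `al`. Conversely,
`col`, `row` and the bounds give back the inequality for every cell outside the class. -/
theorem OneSide.of_class {ε : ℝ} {n m : ℕ} {p q : ℕ → ℝ} {C R : ℕ → Prop} {al b : ℝ}
    (h : ∀ i < n, ∀ j < m, ¬ (C i ∧ R j) → segMax q j ≤ segMin p i + ε)
    (h0 : ∃ i < n, ∃ j < m, C i ∧ R j ∧ BoundaryCell ε p q i j)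
    (hal : ∀ i < n, C i → al ≤ segMin p i) (hal' : ∃ i < n, C i ∧ segMin p i = al)
    (hb : ∀ j < m, R j → segMax q j ≤ b) (hb' : ∃ j < m, R j ∧ segMax q j = b) :
    OneSide ε n m p q C R al b := by
  obtain ⟨i0, hi0, j0, hj0, hC, hR, b1, b2⟩ := h0
  obtain ⟨ia, hia, hCa, ha⟩ := hal'
  obtain ⟨jb, hjb, hRb, hb2⟩ := hb'
  refine ⟨fun i hi => ?_, fun j hj => ?_, ?_, fun i hi hCi => ?_, fun j hj hRj => ?_⟩
  · by_cases hCi : C i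
    · exact hal i hi hCi
    · linarith [h i hi j0 hj0 (fun hc => hCi hc.1), hal i0 hi0 hC]
  · by_cases hRj : R j
    · exact hb j hj hRj
    · linarith [h i0 hi0 j hj (fun hc => hRj hc.2), hb j0 hj0 hR]
  · linarith [hal i0 hi0 hC, hb j0 hj0 hR]
  · linarith [h i hi jb hjb (fun hc => hCi hc.1)]
  · linarith [h ia hia j hj (fun hc => hRj hc.2)]

/-! ### Short curves -/

/-- The walls for the columns, when the curve `p` stays between `al` and `al + t`. -/
def ColWalls (e : ℕ) (al b be₂ a₂ : ℝ) (t : ℕ) (W : Walls) : Prop :=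
  W.Interval 1 al (a₂ + (al + t - be₂) + e) 0 al (al + ((2 * e + 1 : ℤ) : ℝ)) ∧
  W.Interval 2 (b - e) (al + t) (al + t - be₂) al (al + ((2 * e + 1 : ℤ) : ℝ)) ∧
  W.Interval 0 (b - e) (a₂ + (al + t - be₂) + e) 0 al (al + ((2 * e + 1 : ℤ) : ℝ))

/-- The walls for the rows, when the curve `p` stays between `al` and `al + t`. -/
def RowWalls (e : ℕ) (al b be₂ a₂ : ℝ) (t : ℕ) (W : Walls) : Prop :=
  W.Interval 1 (al + t - e) b 0 (b - 2 * e) (b - 2 * e + ((2 * e + 1 : ℤ) : ℝ)) ∧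
  W.Interval 2 (a₂ + (al + t - be₂)) (al + e) (al + t - be₂)
    (b - 2 * e) (b - 2 * e + ((2 * e + 1 : ℤ) : ℝ)) ∧
  W.Interval 0 (al + t - e) (al + e) 0 (b - 2 * e) (b - 2 * e + ((2 * e + 1 : ℤ) : ℝ))

namespace Input

variable {I : Input} {K : Marks} {p q : ℕ → ℝ} {σ τ : ℕ → ℤ} {κ : ℝ}

/-- Both curves are short, and all cells outside the two classes are full. -/
structure Short (I : Input) (K : Marks) (p q : ℕ → ℝ) : Prop where
  le1 : ∀ i < I.n, ∀ j < I.m, ¬ (K.cC i = 1 ∧ K.cR j = 1) → segMax q j ≤ segMin p i + I.e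
  le2 : ∀ i < I.n, ∀ j < I.m, ¬ (K.cC i = 2 ∧ K.cR j = 2) → segMax p i ≤ segMin q j + I.e
  rp : ∀ i < I.n, ∀ i' < I.n, segMax p i ≤ segMin p i' + 2 * I.e
  rq : ∀ j < I.m, ∀ j' < I.m, segMax q j ≤ segMin q j' + 2 * I.e
  one : (∃ i < I.n, K.cC i = 1) ∨
    ((∀ i < I.n, K.cC i ≠ 1) ∧ (∀ j < I.m, K.cR j ≠ 1) ∧
      (∀ i < I.n, 0 ≤ segMin p i) ∧ (∃ i < I.n, segMin p i = 0) ∧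
      (∀ j < I.m, segMax q j ≤ I.e) ∧ (∃ j < I.m, segMax q j = I.e))

theorem Fits.short_not_three (F : I.Fits K p q σ τ κ) (T : I.Short K p q) :
    (∀ i < I.n, K.cC i ≠ 3) ∧ (∀ j < I.m, K.cR j ≠ 3) := by
  constructor
  · intro i hi h
    refine (F.col3 i hi).2 h ((F.sol.full_iff hi I.m_pos).2 ⟨?_, ?_⟩)
    · exact T.le1 i hi 0 I.m_pos (by omega)
    · exact T.le2 i hi 0 I.m_pos (by omega)
  · intro j hj h
    refine (F.row3 j hj).2 h ((F.sol.full_iff I.n_pos hj).2 ⟨?_, ?_⟩)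
    · exact T.le1 0 I.n_pos j hj (by omega)
    · exact T.le2 0 I.n_pos j hj (by omega)

/-- `OneSide` is used twice, with the curves exchanged for class 2. There `B` is the top of `p` and
`a₂ + (B - be₂)` is a lower bound of `q`. If class 2 is not empty, its highest column reaches `B`,
so `B - be₂` is the unknown translation `κ`. Hence guessing `B` amounts to guessing `κ`. -/
theorem Fits.short_sides (F : I.Fits K p q σ τ κ) (T : I.Short K p q) {al be a b x be₂ a₂ y : ℝ}
    (E1 : (I.colLine K).Extremes 1 al be 0 0) (E2 : (I.rowLine K).Extremes 1 a b 0 I.e)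
    (E3 : (I.colLine K).Extremes 2 x be₂ 0 0) (E4 : (I.rowLine K).Extremes 2 a₂ y (-I.e) (-I.e)) :
    OneSide I.e I.n I.m p q (K.cC · = 1) (K.cR · = 1) al b ∧
    (∃ i < I.n, segMin p i = al) ∧ (∃ j < I.m, segMax q j = b) ∧ a₂ + I.e ≤ be₂ ∧
    ∃ B, (∃ i < I.n, segMax p i = B) ∧
      ((∃ i < I.n, K.cC i = 2) ∨ (∃ j < I.m, K.cR j = 2) → B - be₂ = κ) ∧
      OneSide I.e I.m I.n q p (K.cR · = 2) (K.cC · = 2) (a₂ + (B - be₂)) B := by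
  have side1 : OneSide I.e I.n I.m p q (K.cC · = 1) (K.cR · = 1) al b ∧
      (∃ i < I.n, segMin p i = al) ∧ (∃ j < I.m, segMax q j = b) := by
    rcases T.one with h | ⟨h1, h2, h3, h4, h5, h6⟩
    · obtain ⟨i0, hi0, j0, hj0, hC, hR, hb⟩ := F.one (Or.inl h)
      obtain ⟨c1, c2, _⟩ := E1.spec F.sol.chain_p F.col1 ⟨i0, hi0, hC⟩
      obtain ⟨d1, _, d2⟩ := E2.spec F.sol.chain_q F.row1 ⟨j0, hj0, hR⟩
      simp only [add_zero, colLine, rowLine] at c1 c2 d1 d2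
      refine ⟨OneSide.of_class T.le1 ⟨i0, hi0, j0, hj0, hC, hR, hb⟩ (fun i hi h => (c1 i hi h).1) c2
        (fun j hj h => (d1 j hj h).2) d2, ?_, ?_⟩
      · obtain ⟨i, hi, _, h⟩ := c2; exact ⟨i, hi, h⟩
      · obtain ⟨i, hi, _, h⟩ := d2; exact ⟨i, hi, h⟩
    -- Without class 1 the defaults `al = 0` and `b = ε` agree with the normalization in
    -- `Short.one`.
    · obtain ⟨rfl, _⟩ := E1.2 h1
      obtain ⟨_, rfl⟩ := E2.2 h2
      exact ⟨⟨h3, h5, by simp, fun i hi _ => by simpa using h3 i hi,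
        fun j hj _ => by simpa using h5 j hj⟩, h4, h6⟩
  refine ⟨side1.1, side1.2.1, side1.2.2, ?_⟩
  by_cases h : (∃ i < I.n, K.cC i = 2) ∨ (∃ j < I.m, K.cR j = 2)
  · obtain ⟨⟨i0, hi0, j0, hj0, hC, hR, hb⟩, _⟩ := F.two h
    obtain ⟨c1, _, c2⟩ := E3.spec F.sol.chain_p F.col2 ⟨i0, hi0, hC⟩
    obtain ⟨d1, d2, _⟩ := E4.spec F.sol.chain_q F.row2 ⟨j0, hj0, hR⟩
    simp only [colLine, rowLine] at c1 c2 d1 d2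
    have O : OneSide I.e I.m I.n q p (K.cR · = 2) (K.cC · = 2) (a₂ + κ) (be₂ + κ) :=
      OneSide.of_class (fun j hj i hi hn => T.le2 i hi j hj (fun hc => hn ⟨hc.2, hc.1⟩))
        ⟨j0, hj0, i0, hi0, hR, hC, hb⟩ (fun j hj h => (d1 j hj h).1) d2
        (fun i hi h => (c1 i hi h).2) c2
    refine ⟨by linarith [O.gap], be₂ + κ, ?_, fun _ => by ring, ?_⟩
    · obtain ⟨i, hi, _, h⟩ := c2; exact ⟨i, hi, h⟩
    · rwa [show be₂ + κ - be₂ = κ by ring]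
  · push Not at h
    -- Without class 2 the defaults `be₂ = 0` and `a₂ = -ε` turn the lower bound of `q` into `B -
    -- ε`, which is what fullness requires.
    obtain ⟨-, rfl⟩ := E3.2 h.1
    obtain ⟨rfl, -⟩ := E4.2 h.2
    refine ⟨by simp, ?_⟩
    obtain ⟨i, hi, hmax⟩ := Finset.exists_max_image (Finset.range I.n) (segMax p)
      ⟨0, by simpa using I.n_pos⟩
    simp only [Finset.mem_range] at hi hmax
    refine ⟨segMax p i, ⟨i, hi, rfl⟩, fun hc => ?_, ?_⟩
    · rcases hc with ⟨i, hi, hc⟩ | ⟨j, hj, hc⟩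
      · exact absurd hc (h.1 i hi)
      · exact absurd hc (h.2 j hj)
    · have key : ∀ j < I.m, segMax p i - I.e ≤ segMin q j := fun j hj => by
        linarith [T.le2 i hi j hj (fun hc => h.1 i hi hc.1)]
      exact ⟨fun j hj => by linarith [key j hj], hmax, by linarith, fun j hj _ => key j hj,
        fun i' hi' _ => by linarith [hmax i' hi']⟩

/-- The true curves are themselves admissible for the value of `t` for which `al + t` is the top of
`p`. The number `t` is an integer because all lengths are, and it is at most `2ε` because `p` is
short. -/
theorem Fits.short_exists (F : I.Fits K p q σ τ κ) (T : I.Short K p q) {al be a b x be₂ a₂ y : ℝ}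
    (E1 : (I.colLine K).Extremes 1 al be 0 0) (E2 : (I.rowLine K).Extremes 1 a b 0 I.e)
    (E3 : (I.colLine K).Extremes 2 x be₂ 0 0) (E4 : (I.rowLine K).Extremes 2 a₂ y (-I.e) (-I.e)) :
    ∃ t < 2 * I.e + 1, ∀ W W', ColWalls I.e al b be₂ a₂ t W → RowWalls I.e al b be₂ a₂ t W' →
      (∃ z s, (I.colLine K).IsPath W al (2 * I.e + 1) z s) ∧
      (∃ z s, (I.rowLine K).IsPath W' (b - 2 * I.e) (2 * I.e + 1) z s) := by
  obtain ⟨O1, ⟨ia, hia, hal⟩, ⟨jb, hjb, hb⟩, _, B, ⟨iB, hiB, hB⟩, hκ, O2⟩ :=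
    F.short_sides T E1 E2 E3 E4
  obtain ⟨n3, n3'⟩ := F.short_not_three T
  obtain ⟨ka, hka, hpa⟩ := exists_vertex_min p hia
  obtain ⟨kb, hkb, hqb⟩ := exists_vertex_max q hjb
  obtain ⟨kB, hkB, hpB⟩ := exists_vertex_max p hiB
  obtain ⟨t', ht'⟩ := F.sol.chain_p.exists_int' hkB hka
  have hBal : B = al + t' := by rw [← hB, ← hpB, ht', hpa, hal]
  have t0 : 0 ≤ t' := by
    have : al ≤ B := by rw [← hB]; exact (O1.le_p iB hiB).trans (segMin_le_segMax p iB)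
    have : (0 : ℝ) ≤ t' := by linarith
    exact_mod_cast this
  obtain ⟨t, rfl⟩ := Int.eq_ofNat_of_zero_le t0
  have t1 : (t : ℝ) ≤ 2 * I.e := by
    have := T.rp iB hiB ia hia
    rw [hB, hal, hBal] at this
    push_cast at this
    linarith
  have t2 : t ≤ 2 * I.e := by exact_mod_cast t1
  have hBt : al + (t : ℝ) = B := by rw [hBal]; push_cast; ring
  have hB' : ∀ i < I.n, segMax p i ≤ B := O2.q_le
  refine ⟨t, by omega, fun W W' hW hW' => ⟨?_, ?_⟩⟩
  · obtain ⟨w1, w2, w0⟩ := hW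
    rw [hBt] at w1 w2 w0
    obtain ⟨z, s, H⟩ := Line.exists_path (L := I.colLine K) (W := W) (base := al)
      (M := 2 * I.e + 1) F.sol.chain_p
      (fun k hk => by
        obtain ⟨z, hz⟩ := F.sol.chain_p.exists_int' hk hka
        exact ⟨z, by rw [hz, hpa, hal]⟩)
      (fun k hk => by
        obtain ⟨i, hi, h1, h2⟩ := exists_seg_vertex p I.n_pos hk
        have := O1.le_p i hi
        have := hB' i hi
        push_cast
        constructor <;> linarith)
      (fun i hi => by
        rcases F.col_cls i hi with h | h | h | h
        · exact Or.inl (F.col0 i hi (Or.inl h))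
        · obtain ⟨c1, c2⟩ := F.col1 i hi h
          refine Or.inr ⟨c1, ?_⟩
          change p i = K.xC i + W.sh (K.cC i)
          rw [h, w1.2.2.1, c2]
        · obtain ⟨c1, c2⟩ := F.col2 i hi h
          refine Or.inr ⟨c1, ?_⟩
          change p i = K.xC i + W.sh (K.cC i)
          rw [h, w2.2.2.1, hκ (Or.inl ⟨i, hi, h⟩), c2]
        · exact absurd h (n3 i hi))
      (fun i hi => by
        change W.Allows (K.cC i) _ _
        rcases F.col_cls i hi with h | h | h | h
        · rw [h]; exact w0.allows (O1.col i hi (by omega)) (O2.row i hi (by omega))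
        · rw [h]; exact w1.allows (O1.le_p i hi) (O2.row i hi (by omega))
        · rw [h]; exact w2.allows (O1.col i hi (by omega)) (hB' i hi)
        · exact absurd h (n3 i hi))
    exact ⟨z, s, H⟩
  · obtain ⟨w1, w2, w0⟩ := hW'
    rw [hBt] at w1 w2 w0
    obtain ⟨z, s, H⟩ := Line.exists_path (L := I.rowLine K) (W := W') (base := b - 2 * I.e)
      (M := 2 * I.e + 1) F.sol.chain_q
      (fun k hk => by
        obtain ⟨z, hz⟩ := F.sol.chain_q.exists_int' hk hkb
        exact ⟨z + 2 * I.e, by rw [hz, hqb, hb]; push_cast; ring⟩)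
      (fun k hk => by
        obtain ⟨j, hj, h1, h2⟩ := exists_seg_vertex q I.m_pos hk
        have := O1.q_le j hj
        have := T.rq jb hjb j hj
        push_cast
        constructor <;> linarith)
      (fun j hj => by
        rcases F.row_cls j hj with h | h | h | h
        · exact Or.inl (F.row0 j hj (Or.inl h))
        · obtain ⟨c1, c2⟩ := F.row1 j hj h
          refine Or.inr ⟨c1, ?_⟩
          change q j = K.xR j + W'.sh (K.cR j)
          rw [h, w1.2.2.1, c2]
        · obtain ⟨c1, c2⟩ := F.row2 j hj h
          refine Or.inr ⟨c1, ?_⟩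
          change q j = K.xR j + W'.sh (K.cR j)
          rw [h, w2.2.2.1, hκ (Or.inr ⟨j, hj, h⟩), c2]
        · exact absurd h (n3' j hj))
      (fun j hj => by
        change W'.Allows (K.cR j) _ _
        rcases F.row_cls j hj with h | h | h | h
        · rw [h]; exact w0.allows (O2.col j hj (by omega)) (O1.row j hj (by omega))
        · rw [h]; exact w1.allows (O2.col j hj (by omega)) (O1.q_le j hj)
        · rw [h]; exact w2.allows (O2.le_p j hj) (O1.row j hj (by omega))
        · exact absurd h (n3' j hj))
    exact ⟨z, s, H⟩

/-- Here `t` need not be the extent of the given solution. Cells of class 1 keep their absolute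
position. In cells of class 2 both segments are shifted by the same amount, so their relative
position is right whatever `t` is. All other cells are full for the given solution, and the walls
make them full for the new curves. -/
theorem Fits.short_sol (F : I.Fits K p q σ τ κ) (T : I.Short K p q) {al be a b x be₂ a₂ y : ℝ}
    (E1 : (I.colLine K).Extremes 1 al be 0 0) (E2 : (I.rowLine K).Extremes 1 a b 0 I.e)
    (E3 : (I.colLine K).Extremes 2 x be₂ 0 0) (E4 : (I.rowLine K).Extremes 2 a₂ y (-I.e) (-I.e))
    {t : ℕ} {W W' : Walls} (hW : ColWalls I.e al b be₂ a₂ t W)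
    (hW' : RowWalls I.e al b be₂ a₂ t W') {z s z' s' : ℕ → ℤ}
    (H : (I.colLine K).IsPath W al (2 * I.e + 1) z s)
    (H' : (I.rowLine K).IsPath W' (b - 2 * I.e) (2 * I.e + 1) z' s') :
    I.Sol (fun k => al + z k) (fun k => b - 2 * I.e + z' k) s s' := by
  obtain ⟨O1, _, _, gap2, _⟩ := F.short_sides T E1 E2 E3 E4
  obtain ⟨n3, n3'⟩ := F.short_not_three T
  have gap1 := O1.gap
  obtain ⟨w1, w2, w0⟩ := hW
  obtain ⟨v1, v2, v0⟩ := hW'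
  refine F.sol.of_cells H.chain H'.chain fun i hi j hj => ?_
  have su := F.sol.chain_p i hi
  have tu := F.sol.chain_q j hj
  have known : ∀ c, K.cC i = c → (c = 1 ∨ c = 2) → s i = σ i ∧ al + z i = K.xC i + W.sh c := by
    intro c hc h12
    have h1 : K.sC i = σ i := by
      rcases h12 with rfl | rfl
      · exact (F.col1 i hi hc).1
      · exact (F.col2 i hi hc).1
    have := H.known hi (show K.sC i ≠ 0 by rw [h1]; rcases su.1 with h | h <;> omega)
    exact ⟨this.1.trans h1, by rw [← hc]; exact this.2⟩
  have known' : ∀ c, K.cR j = c → (c = 1 ∨ c = 2) →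
      s' j = τ j ∧ b - 2 * I.e + z' j = K.xR j + W'.sh c := by
    intro c hc h12
    have h1 : K.sR j = τ j := by
      rcases h12 with rfl | rfl
      · exact (F.row1 j hj hc).1
      · exact (F.row2 j hj hc).1
    have := H'.known hj (show K.sR j ≠ 0 by rw [h1]; rcases tu.1 with h | h <;> omega)
    exact ⟨this.1.trans h1, by rw [← hc]; exact this.2⟩
  by_cases h11 : K.cC i = 1 ∧ K.cR j = 1
  · left
    obtain ⟨k1, k2⟩ := known 1 h11.1 (Or.inl rfl)
    obtain ⟨k3, k4⟩ := known' 1 h11.2 (Or.inl rfl)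
    refine ⟨?_, k1, k3⟩
    simp only [k2, k4, w1.2.2.1, v1.2.2.1, (F.col1 i hi h11.1).2, (F.row1 j hj h11.2).2]
  by_cases h22 : K.cC i = 2 ∧ K.cR j = 2
  · left
    obtain ⟨k1, k2⟩ := known 2 h22.1 (Or.inr rfl)
    obtain ⟨k3, k4⟩ := known' 2 h22.2 (Or.inr rfl)
    refine ⟨?_, k1, k3⟩
    simp only [k2, k4, w2.2.2.1, v2.2.2.1, ← (F.col2 i hi h22.1).2, ← (F.row2 j hj h22.2).2]
    ring
  right; left
  refine ⟨⟨T.le1 i hi j hj h11, T.le2 i hi j hj h22⟩, ?_⟩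
  have colB : ∀ c l u sh, K.cC i = c →
      W.Interval c l u sh al (al + ((2 * I.e + 1 : ℤ) : ℝ)) →
      l ≤ segMin (fun k => al + (z k : ℝ)) i ∧ segMax (fun k => al + (z k : ℝ)) i ≤ u :=
    fun c l u sh hc hWc => H.interval hi (by change W.Interval (K.cC i) _ _ _ _ _; rw [hc]; exact
        hWc)
  have rowB : ∀ c l u sh, K.cR j = c →
      W'.Interval c l u sh (b - 2 * I.e) (b - 2 * I.e + ((2 * I.e + 1 : ℤ) : ℝ)) →
      l ≤ segMin (fun k => b - 2 * I.e + (z' k : ℝ)) j ∧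
        segMax (fun k => b - 2 * I.e + (z' k : ℝ)) j ≤ u :=
    fun c l u sh hc hWc =>
      H'.interval hj (by change W'.Interval (K.cR j) _ _ _ _ _; rw [hc]; exact hWc)
  -- In the seven pairs of classes that remain, fullness consists of two linear inequalities that
  -- follow from the walls of the column, those of the row, and `gap1` and `gap2`.
  rcases F.col_cls i hi with h | h | h | h <;> rcases F.row_cls j hj with h' | h' | h' | h' <;>
    first
    | exact (n3 i hi h).elim
    | exact (n3' j hj h').elim
    | exact (h11 (And.intro h h')).elim
    | exact (h22 (And.intro h h')).elim
    | skip
  · have c := colB _ _ _ _ h w0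
    have r := rowB _ _ _ _ h' v0
    constructor <;> linarith
  · have c := colB _ _ _ _ h w0
    have r := rowB _ _ _ _ h' v1
    constructor <;> linarith
  · have c := colB _ _ _ _ h w0
    have r := rowB _ _ _ _ h' v2
    constructor <;> linarith
  · have c := colB _ _ _ _ h w1
    have r := rowB _ _ _ _ h' v0
    constructor <;> linarith
  · have c := colB _ _ _ _ h w1
    have r := rowB _ _ _ _ h' v2
    constructor <;> linarith
  · have c := colB _ _ _ _ h w2
    have r := rowB _ _ _ _ h' v0
    constructor <;> linarith
  · have c := colB _ _ _ _ h w2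
    have r := rowB _ _ _ _ h' v1
    constructor <;> linarith

end Input

end FreeSpace

namespace FreeSpace

/-! ### Long curves -/

/-- The walls for one of the curves, when the marked part of the other curve stretches from `a`
to `b`. -/
def LongWalls (e mn mx a b base t : ℝ) (W : Walls) : Prop :=
  W.Interval 1 mn mx 0 base t ∧ W.Interval 0 (b - e) (a + e) 0 base t ∧ W.Outside 3 (a - e) (b + e)

/-- The segments outside class `1` are near to, or far from, everything between `a` and `b`. -/
structure LongLine (L : Line) (e : ℝ) (p : ℕ → ℝ) (σ : ℕ → ℤ) (mn mx a b : ℝ) : Prop where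
  e_pos : 0 < e
  chain : Chain L.N L.len p σ
  known : ∀ i < L.N, L.cls i = 1 → L.sg i = σ i ∧ L.pos i + 0 = p i
  cls : ∀ i < L.N, L.cls i = 0 ∨ L.cls i = 1 ∨ L.cls i = 3
  sg0 : ∀ i < L.N, L.cls i = 0 ∨ L.cls i = 3 → L.sg i = 0
  bounds : ∀ i < L.N, L.cls i = 1 → mn ≤ segMin p i ∧ segMax p i ≤ mx
  attained : ∃ i < L.N, L.cls i = 1 ∧ segMin p i = mn
  full : ∀ i < L.N, L.cls i = 0 → b - e ≤ segMin p i ∧ segMax p i ≤ a + e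
  empty : ∀ i < L.N, L.cls i = 3 → segMax p i < a - e ∨ b + e < segMin p i
  le : a ≤ b

variable {L : Line} {e : ℝ} {p : ℕ → ℝ} {σ : ℕ → ℤ} {mn mx a b : ℝ} {W : Walls}

/-- The position of a lowest vertex of class 1 is known, and no vertex is farther from it than the
total length `LP`. So a window of `2 * LP + 1` lattice points around it contains the whole curve. -/
theorem LongLine.exists_path (H : LongLine L e p σ mn mx a b) {LP : ℕ}
    (hLP : LP = ∑ i ∈ Finset.range L.N, L.len i)
    (hW : LongWalls e mn mx a b (mn - LP) (mn - LP + ((2 * LP + 1 : ℤ) : ℝ)) W) :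
    ∃ x s, L.IsPath W (mn - LP) (2 * LP + 1) x s := by
  obtain ⟨w1, w0, w3⟩ := hW
  obtain ⟨i0, hi0, hc0, hmn⟩ := H.attained
  obtain ⟨k0, hk0, hpk⟩ := exists_vertex_min p hi0
  rw [hmn] at hpk
  have hLP' : (LP : ℝ) = ∑ i ∈ Finset.range L.N, (L.len i : ℝ) := by rw [hLP]; push_cast; rfl
  refine Line.exists_path (σ := σ) H.chain ?_ ?_ ?_ ?_
  · intro k hk
    obtain ⟨z, hz⟩ := H.chain.exists_int' hk hk0
    exact ⟨z + LP, by rw [hz, hpk]; push_cast; ring⟩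
  · intro k hk
    have : |p k - p k0| ≤ LP := by
      rw [hLP']
      rcases le_total k0 k with h | h
      · exact H.chain.abs_sub_le k k0 h hk
      · rw [abs_sub_comm]; exact H.chain.abs_sub_le k0 k h hk0
    rw [hpk] at this
    have := abs_le.1 this
    push_cast
    constructor <;> linarith
  · intro i hi
    rcases H.cls i hi with h | h | h
    · exact Or.inl (H.sg0 i hi (Or.inl h))
    · refine Or.inr ⟨(H.known i hi h).1, ?_⟩
      rw [h, w1.2.2.1, (H.known i hi h).2]
    · exact Or.inl (H.sg0 i hi (Or.inr h))
  · intro i hi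
    rcases H.cls i hi with h | h | h <;> rw [h]
    · exact w0.allows (H.full i hi h).1 (H.full i hi h).2
    · exact w1.allows (H.bounds i hi h).1 (H.bounds i hi h).2
    · exact w3.allows (H.empty i hi h)

theorem iff_of_forall_step {N : ℕ} {P : ℕ → Prop} (h : ∀ k < N, P k ↔ P (k + 1)) :
    ∀ k ≤ N, P k ↔ P 0 := by
  intro k
  induction k with
  | zero => intro _; rfl
  | succ k ih => intro hk; rw [← h k (by omega), ih (by omega)]

section
variable {base : ℝ} {M : ℤ} {x s : ℕ → ℤ} (H : LongLine L e p σ mn mx a b)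
  (hW : LongWalls e mn mx a b base (base + M) W) (hx : L.IsPath W base M x s)

include hW hx

theorem Line.IsPath.long_full {i : ℕ} (hi : i < L.N) (h : L.cls i = 0) :
    b - e ≤ segMin (fun k => base + (x k : ℝ)) i ∧ segMax (fun k => base + (x k : ℝ)) i ≤ a + e :=
  hx.interval hi (by rw [h]; exact hW.2.1)

theorem Line.IsPath.long_empty {i : ℕ} (hi : i < L.N) (h : L.cls i = 3) :
    segMax (fun k => base + (x k : ℝ)) i < a - e ∨ b + e < segMin (fun k => base + (x k : ℝ)) i :=
  hx.outside hi (by rw [h]; exact hW.2.2)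

include H

theorem LongLine.path_known {i : ℕ} (hi : i < L.N) (h : L.cls i = 1) :
    s i = σ i ∧ base + x i = p i ∧ base + x (i + 1) = p (i + 1) := by
  obtain ⟨k1, k2⟩ := H.known i hi h
  obtain ⟨c1, c2⟩ := H.chain i hi
  obtain ⟨d1, d2⟩ := hx.known hi (by rw [k1]; rcases c1 with h | h <;> omega)
  have d3 := (hx.chain i hi).2
  rw [h, hW.1.2.2.1, k2] at d2
  refine ⟨d1.trans k1, d2, ?_⟩
  simp only at d3
  rw [c2, d3, d2, d1, k1]

/-- Whether a vertex is in the low or in the high outer region is compared for the path and the true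
curve. A full segment has no vertex in these regions, a segment of class 1 is the same for both, and
an empty segment stays within one region. So agreement at one end of a segment is equivalent to
agreement at the other. -/
theorem LongLine.sides_step {i : ℕ} (hi : i < L.N) :
    ((base + x i < a - e ↔ p i < a - e) ↔ (base + x (i + 1) < a - e ↔ p (i + 1) < a - e)) ∧
    ((b + e < base + x i ↔ b + e < p i) ↔ (b + e < base + x (i + 1) ↔ b + e < p (i + 1))) := by
  have e0 := H.e_pos
  have ab := H.le
  rcases H.cls i hi with h | h | h
  · obtain ⟨c1, c2⟩ := H.full i hi h
    obtain ⟨d1, d2⟩ := hx.long_full hW hi h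
    have := segMin_le_left p i
    have := segMin_le_right p i
    have := le_segMax_left p i
    have := le_segMax_right p i
    have := segMin_le_left (fun k => base + (x k : ℝ)) i
    have := segMin_le_right (fun k => base + (x k : ℝ)) i
    have := le_segMax_left (fun k => base + (x k : ℝ)) i
    have := le_segMax_right (fun k => base + (x k : ℝ)) i
    have a1 : ¬ base + (x i : ℝ) < a - e := by linarith
    have a2 : ¬ p i < a - e := by linarith
    have a3 : ¬ base + (x (i + 1) : ℝ) < a - e := by linarith
    have a4 : ¬ p (i + 1) < a - e := by linarith
    have b1 : ¬ b + e < base + (x i : ℝ) := by linarith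
    have b2 : ¬ b + e < p i := by linarith
    have b3 : ¬ b + e < base + (x (i + 1) : ℝ) := by linarith
    have b4 : ¬ b + e < p (i + 1) := by linarith
    tauto
  · obtain ⟨_, h1, h2⟩ := H.path_known hW hx hi h
    rw [h1, h2]
    tauto
  · have key : ∀ u v : ℝ, (max u v < a - e ∨ b + e < min u v) →
        (u < a - e ↔ v < a - e) ∧ (b + e < u ↔ b + e < v) := by
      intro u v huv
      rcases huv with huv | huv
      · obtain ⟨h1, h2⟩ := max_lt_iff.1 huv
        exact ⟨by tauto, ⟨fun h => by linarith, fun h => by linarith⟩⟩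
      · obtain ⟨h1, h2⟩ := lt_min_iff.1 huv
        exact ⟨⟨fun h => by linarith, fun h => by linarith⟩, by tauto⟩
    have k1 := key _ _ (H.empty i hi h)
    have k2 := key _ _ (hx.long_empty hW hi h)
    tauto

/-- An empty segment lies on the same side for every path. -/
theorem LongLine.sides {i : ℕ} (hi : i < L.N) (h : L.cls i = 3) :
    (segMax p i < a - e → segMax (fun k => base + (x k : ℝ)) i < a - e) ∧
    (b + e < segMin p i → b + e < segMin (fun k => base + (x k : ℝ)) i) := by
  have e0 := H.e_pos
  have ab := H.le
  obtain ⟨i0, hi0, hc0, _⟩ := H.attained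
  have h0 := (H.path_known hW hx hi0 hc0).2.1
  have low := iff_of_forall_step (N := L.N)
    (P := fun k => (base + (x k : ℝ) < a - e ↔ p k < a - e))
    (fun k hk => (H.sides_step hW hx hk).1)
  have high := iff_of_forall_step (N := L.N)
    (P := fun k => (b + e < base + (x k : ℝ) ↔ b + e < p k))
    (fun k hk => (H.sides_step hW hx hk).2)
  -- Agreement spreads over the whole curve from a vertex of class 1, where the path and the true
  -- curve coincide.
  have low' := (low i hi.le).2 ((low i0 hi0.le).1 (by simp only [h0]))
  have high' := (high i hi.le).2 ((high i0 hi0.le).1 (by simp only [h0]))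
  have k2 := hx.long_empty hW hi h
  constructor
  · intro hs
    refine k2.resolve_right fun hc => ?_
    have c1 := low'.2 ((le_segMax_left p i).trans_lt hs)
    have c2 := hc.trans_le (segMin_le_left (fun k => base + (x k : ℝ)) i)
    linarith
  · intro hs
    refine k2.resolve_left fun hc => ?_
    have c1 := high'.2 (hs.trans_le (segMin_le_left p i))
    have c2 := (le_segMax_left (fun k => base + (x k : ℝ)) i).trans_lt hc
    linarith

end

namespace Input

variable {I : Input} {K : Marks} {p q : ℕ → ℝ} {σ τ : ℕ → ℤ} {κ : ℝ}

/-- All boundary cells are in class `1`, and the cells outside it cannot interfere. -/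
structure Long (I : Input) (K : Marks) (p q : ℕ → ℝ) : Prop where
  plus : ∃ i < I.n, ∃ j < I.m, K.cC i = 1 ∧ K.cR j = 1 ∧ BoundaryCell I.e p q i j
  col2 : ∀ i < I.n, K.cC i ≠ 2
  row2 : ∀ j < I.m, K.cR j ≠ 2
  cond : (∃ i < I.n, ∃ j < I.m, BoundaryCell I.e q p j i) ∨ (∀ i < I.n, K.cC i ≠ 0) ∨
    (∀ j < I.m, K.cR j ≠ 0)

/-- A column of class 0 or 3 has no mixed cell, so `line_cases` applies and its cell in row 0
decides about the whole column. -/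
theorem Fits.col_type (F : I.Fits K p q σ τ κ) {i : ℕ} (hi : i < I.n) :
    (K.cC i = 0 → ∀ j < I.m, CellFull I.e p q i j) ∧
    (K.cC i = 3 → (∀ j < I.m, Below I.e p q i j) ∨ (∀ j < I.m, Below I.e q p j i)) := by
  have e0 : (0 : ℝ) < I.e := e_pos'
  have key : K.cC i = 0 ∨ K.cC i = 3 → _ := fun h => line_cases (m := I.m) (ε := I.e) (p := p)
      (q := q) (i := i)
    (fun j hj hb => by
      have := F.mixed i hi j hj ((F.sol.mixed_iff hi hj).2 hb)
      omega)
  have excl : ∀ ⦃j⦄, CellFull I.e p q i j → ¬ Below I.e p q i j ∧ ¬ Below I.e q p j i := by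
    intro j h
    have := segMin_le_segMax p i
    have := segMin_le_segMax q j
    obtain ⟨h1, h2⟩ := h
    unfold Below
    constructor <;> intro h <;> linarith
  have hfull := F.sol.full_iff hi I.m_pos
  constructor
  · intro h
    have h0 := hfull.1 ((F.col3 i hi).1 h)
    rcases key (Or.inl h) with H | H | H
    · exact H
    · exact absurd (H 0 I.m_pos) (excl h0).1
    · exact absurd (H 0 I.m_pos) (excl h0).2
  · intro h
    rcases key (Or.inr h) with H | H | H
    · exact absurd (hfull.2 (H 0 I.m_pos)) ((F.col3 i hi).2 h)
    · exact Or.inl H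
    · exact Or.inr H

theorem cellFull_swap {ε : ℝ} {p q : ℕ → ℝ} {i j : ℕ} : CellFull ε q p j i ↔ CellFull ε p q i j :=
  and_comm

theorem Fits.row_type (F : I.Fits K p q σ τ κ) {j : ℕ} (hj : j < I.m) :
    (K.cR j = 0 → ∀ i < I.n, CellFull I.e p q i j) ∧
    (K.cR j = 3 → (∀ i < I.n, Below I.e p q i j) ∨ (∀ i < I.n, Below I.e q p j i)) := by
  have e0 : (0 : ℝ) < I.e := e_pos'
  have key : K.cR j = 0 ∨ K.cR j = 3 → _ := fun h => line_cases (m := I.n) (ε := I.e) (p := q)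
      (q := p) (i := j)
    (fun i hi hb => by
      have := F.mixed i hi j hj ((F.sol.mixed_iff hi hj).2 hb.symm)
      omega)
  have excl : ∀ ⦃i⦄, CellFull I.e p q i j → ¬ Below I.e p q i j ∧ ¬ Below I.e q p j i := by
    intro i h
    have := segMin_le_segMax p i
    have := segMin_le_segMax q j
    obtain ⟨h1, h2⟩ := h
    unfold Below
    constructor <;> intro h <;> linarith
  have hfull := F.sol.full_iff I.n_pos hj
  constructor
  · intro h
    have h0 := hfull.1 ((F.row3 j hj).1 h)
    rcases key (Or.inl h) with H | H | H
    · exact fun i hi => cellFull_swap.1 (H i hi)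
    · exact absurd (H 0 I.n_pos) (excl h0).2
    · exact absurd (H 0 I.n_pos) (excl h0).1
  · intro h
    rcases key (Or.inr h) with H | H | H
    · exact absurd (hfull.2 (cellFull_swap.1 (H 0 I.n_pos))) ((F.row3 j hj).2 h)
    · exact Or.inr H
    · exact Or.inl H

theorem Fits.long_lines (F : I.Fits K p q σ τ κ) (T : I.Long K p q) {al be a b d₁ d₂ d₃ d₄ : ℝ}
    (E1 : (I.colLine K).Extremes 1 al be d₁ d₂) (E2 : (I.rowLine K).Extremes 1 a b d₃ d₄) :
    LongLine (I.colLine K) I.e p σ al be a b ∧ LongLine (I.rowLine K) I.e q τ a b al be ∧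
      al + I.e ≤ b ∧ a ≤ be + I.e ∧
      ((∃ i < I.n, ∃ j < I.m, BoundaryCell I.e q p j i) → a + I.e ≤ be) := by
  obtain ⟨i0, hi0, j0, hj0, hC, hR, b1, b2⟩ := T.plus
  obtain ⟨c1, c2, c3⟩ := E1.spec F.sol.chain_p F.col1 ⟨i0, hi0, hC⟩
  obtain ⟨d1, d2, d3⟩ := E2.spec F.sol.chain_q F.row1 ⟨j0, hj0, hR⟩
  simp only [add_zero] at c1 c2 c3 d1 d2 d3
  obtain ⟨ia, hia, -, ha⟩ := c2
  obtain ⟨ib, hib, -, hb⟩ := c3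
  obtain ⟨ja, hja, -, hja'⟩ := d2
  obtain ⟨jb, hjb, -, hjb'⟩ := d3
  have ab : a ≤ b := (d1 j0 hj0 hR).1.trans ((segMin_le_segMax q j0).trans (d1 j0 hj0 hR).2)
  have albe : al ≤ be := (c1 i0 hi0 hC).1.trans ((segMin_le_segMax p i0).trans (c1 i0 hi0 hC).2)
  refine ⟨⟨e_pos', F.sol.chain_p, F.col1, fun i hi => ?_, F.col0, c1, E1.spec F.sol.chain_p F.col1
      ⟨i0, hi0, hC⟩ |>.2.1.imp fun i h => by simpa using h, fun i hi h => ?_, fun i hi h => ?_, ab⟩,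
    ⟨e_pos', F.sol.chain_q, F.row1, fun j hj => ?_, F.row0, d1, E2.spec F.sol.chain_q F.row1
      ⟨j0, hj0, hR⟩ |>.2.1.imp fun i h => by simpa using h, fun j hj h => ?_, fun j hj h => ?_,
          albe⟩,
    by linarith [(c1 i0 hi0 hC).1, (d1 j0 hj0 hR).2],
    by linarith [(c1 i0 hi0 hC).2, (d1 j0 hj0 hR).1], ?_⟩
  · have := T.col2 i hi
    have := F.col_cls i hi
    change K.cC i = 0 ∨ K.cC i = 1 ∨ K.cC i = 3
    tauto
  · have H := (F.col_type hi).1 h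
    exact ⟨by linarith [(H jb hjb).1], by linarith [(H ja hja).2]⟩
  · rcases (F.col_type hi).2 h with H | H
    · left; have := H ja hja; unfold Below at this; linarith
    · right; have := H jb hjb; unfold Below at this; linarith
  · have := T.row2 j hj
    have := F.row_cls j hj
    change K.cR j = 0 ∨ K.cR j = 1 ∨ K.cR j = 3
    tauto
  · have H := (F.row_type hj).1 h
    exact ⟨by linarith [(H ib hib).2], by linarith [(H ia hia).1]⟩
  · rcases (F.row_type hj).2 h with H | H
    · right; have := H ib hib; unfold Below at this; linarith
    · left; have := H ia hia; unfold Below at this; linarith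
  · rintro ⟨i, hi, j, hj, hm⟩
    have hc : K.cC i = 1 ∧ K.cR j = 1 := by
      have := F.mixed i hi j hj ((F.sol.mixed_iff hi hj).2 (Or.inr hm))
      have := T.col2 i hi
      tauto
    linarith [(c1 i hi hc.1).2, (d1 j hj hc.2).1, hm.2]

/-- Cells with a column or row of class 1 are settled by the walls, since the part of class 1 is the
same for all paths. Two combinations need more: for two full lines `T.cond` is required, and for two
empty lines it matters that they are on opposite sides, which `LongLine.sides` transfers from the
true curves. -/
theorem Fits.long_sol (F : I.Fits K p q σ τ κ) (T : I.Long K p q) {al be a b d₁ d₂ d₃ d₄ : ℝ}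
    (E1 : (I.colLine K).Extremes 1 al be d₁ d₂) (E2 : (I.rowLine K).Extremes 1 a b d₃ d₄)
    {base base' : ℝ} {M M' : ℤ} {W W' : Walls}
    (hW : LongWalls I.e al be a b base (base + M) W)
    (hW' : LongWalls I.e a b al be base' (base' + M') W') {z s z' s' : ℕ → ℤ}
    (H : (I.colLine K).IsPath W base M z s) (H' : (I.rowLine K).IsPath W' base' M' z' s') :
    I.Sol (fun k => base + z k) (fun k => base' + z' k) s s' := by
  obtain ⟨L1, L2, g1, g2, g3⟩ := F.long_lines T E1 E2
  refine F.sol.of_cells H.chain H'.chain fun i hi j hj => ?_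
  have e0 : (0 : ℝ) < I.e := e_pos'
  have A1 : K.cC i = 1 → segMin (fun k => base + (z k : ℝ)) i = segMin p i ∧
      segMax (fun k => base + (z k : ℝ)) i = segMax p i := by
    intro h
    obtain ⟨_, h1, h2⟩ := L1.path_known hW H hi h
    exact ⟨by unfold segMin; simp only [h1, h2], by unfold segMax; simp only [h1, h2]⟩
  have A2 : K.cR j = 1 → segMin (fun k => base' + (z' k : ℝ)) j = segMin q j ∧
      segMax (fun k => base' + (z' k : ℝ)) j = segMax q j := by
    intro h
    obtain ⟨_, h1, h2⟩ := L2.path_known hW' H' hj h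
    exact ⟨by unfold segMin; simp only [h1, h2], by unfold segMax; simp only [h1, h2]⟩
  have hcol := L1.cls i hi
  have hrow := L2.cls j hj
  change K.cC i = 0 ∨ K.cC i = 1 ∨ K.cC i = 3 at hcol
  change K.cR j = 0 ∨ K.cR j = 1 ∨ K.cR j = 3 at hrow
  have hp := segMin_le_segMax p i
  have hq := segMin_le_segMax q j
  unfold Below
  rcases hcol with h | h | h
  · have cf := (F.col_type hi).1 h j hj
    have pf := H.long_full hW hi h
    rcases hrow with h' | h' | h'
    · have pf' := H'.long_full hW' hj h'
      right; left
      refine ⟨cf, by linarith, ?_⟩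
      -- A boundary cell of the second kind lies in class 1 and gives `a + ε ≤ be`, which bounds `p
      -- - q` by `ε`. In the other cases the combination does not occur.
      rcases T.cond with hc | hc | hc
      · linarith [g3 hc]
      · exact absurd h (hc i hi)
      · exact absurd h' (hc j hj)
    · obtain ⟨a1, a2⟩ := A2 h'
      obtain ⟨b1, b2⟩ := L2.bounds j hj h'
      right; left
      exact ⟨cf, by rw [a2]; linarith, by rw [a1]; linarith⟩
    · exfalso
      obtain ⟨c1, c2⟩ := cf
      rcases (F.row_type hj).2 h' with hB | hB <;>
        (have := hB i hi; unfold Below at this; linarith)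
  · obtain ⟨a1, a2⟩ := A1 h
    obtain ⟨b1, b2⟩ := L1.bounds i hi h
    rcases hrow with h' | h' | h'
    · have pf' := H'.long_full hW' hj h'
      right; left
      exact ⟨(F.row_type hj).1 h' i hi, by rw [a1]; linarith, by rw [a2]; linarith⟩
    · left
      obtain ⟨s1, h1, _⟩ := L1.path_known hW H hi h
      obtain ⟨s2, h2, _⟩ := L2.path_known hW' H' hj h'
      exact ⟨by rw [h1, h2], s1, s2⟩
    · right; right
      refine ⟨?_, ?_⟩
      · exact ((F.row_type hj).2 h').imp (fun hB => hB i hi) (fun hB => hB i hi)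
      · rw [a1, a2]
        rcases H'.long_empty hW' hj h' with h | h
        · right; linarith
        · left; linarith
  · have ct := (F.col_type hi).2 h
    rcases hrow with h' | h' | h'
    · exfalso
      obtain ⟨c1, c2⟩ := (F.row_type hj).1 h' i hi
      rcases ct with hB | hB <;> (have := hB j hj; unfold Below at this; linarith)
    · obtain ⟨a1, a2⟩ := A2 h'
      obtain ⟨b1, b2⟩ := L2.bounds j hj h'
      right; right
      refine ⟨ct.imp (fun hB => hB j hj) (fun hB => hB j hj), ?_⟩
      rw [a1, a2]
      rcases H.long_empty hW hi h with h | h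
      · left; linarith
      · right; linarith
    · right; right
      refine ⟨ct.imp (fun hB => hB j hj) (fun hB => hB j hj), ?_⟩
      have sC := L1.sides hW H hi h
      have sR := L2.sides hW' H' hj h'
      have tC := L1.empty i hi h
      have tR := L2.empty j hj h'
      have rt := (F.row_type hj).2 h'
      rcases tC with tC | tC <;> rcases tR with tR | tR
      -- In the true solution the column and the row cannot both be low, nor both be high: the cell
      -- where they meet is empty, so one of the two lies above the other.
      · exfalso
        rcases ct with hB | hB
        · have := hB j hj
          rcases rt with hB' | hB'
          · obtain ⟨i1, hi1, hc1, hm1⟩ := L1.attained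
            have := hB' i1 hi1
            unfold Below at this
            have := segMin_le_segMax p i1
            linarith
          · have := hB' i hi
            unfold Below at *
            linarith
        · obtain ⟨j1, hj1, hc1, hm1⟩ := L2.attained
          have := hB j1 hj1
          unfold Below at this
          have := segMin_le_segMax q j1
          linarith
      · have := sC.1 tC
        have := sR.2 tR
        left; linarith
      · have := sC.2 tC
        have := sR.1 tR
        right; linarith
      · exfalso
        have := L1.le
        have := L2.le
        rcases ct with hB | hB
        · obtain ⟨j1, hj1, hc1, hm1⟩ := L2.attained
          have := hB j1 hj1
          unfold Below at this
          linarith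
        · have := hB j hj
          rcases rt with hB' | hB'
          · have := hB' i hi
            unfold Below at *
            linarith
          · obtain ⟨i1, hi1, hc1, hm1⟩ := L1.attained
            have := hB' i1 hi1
            unfold Below at this
            linarith [(L1.bounds i1 hi1 hc1).2]

end Input

end FreeSpace

/-! ### From marks to the three cases: all cells empty, short curves, long curves -/

namespace FreeSpace

namespace Input

open Classical in
/-- `1` if the upper boundary of the slab is visible in the cell, `-1` otherwise. -/
noncomputable def upSign (I : Input) (i j : ℕ) : ℤ := if I.Upper i j then 1 else -1

/-- The marks of class `c` are those of the curves `p`, `q`, up to the translation by `κ`. -/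
def Agrees (I : Input) (K : Marks) (c : ℤ) (p q : ℕ → ℝ) (σ τ : ℕ → ℤ) (κ : ℝ) : Prop :=
  (∀ i < I.n, K.cC i = c → K.sC i = σ i ∧ K.xC i + κ = p i) ∧
    ∀ j < I.m, K.cR j = c → K.sR j = τ j ∧ K.xR j + κ = q j

/-- Class `c` contains a cell from which all marks of this class have been derived, under the
assumption that the row of this cell has the direction given by `s`. -/
def Seeded (I : Input) (K : Marks) (c s : ℤ) : Prop :=
  ∃ i < I.n, ∃ j < I.m, I.Mixed i j ∧ K.cC i = c ∧ K.cR j = c ∧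
    ∀ p q σ τ, I.Sol p q σ τ → τ j = s * I.upSign i j → I.Agrees K c p q σ τ (q j)

/-- Marks as obtained by propagation along the mixed cells. -/
structure Marked (I : Input) (K : Marks) : Prop where
  col_cls : ∀ i < I.n, K.cC i = 0 ∨ K.cC i = 1 ∨ K.cC i = 2 ∨ K.cC i = 3
  row_cls : ∀ j < I.m, K.cR j = 0 ∨ K.cR j = 1 ∨ K.cR j = 2 ∨ K.cR j = 3
  col0 : ∀ i < I.n, K.cC i = 0 ∨ K.cC i = 3 → K.sC i = 0
  row0 : ∀ j < I.m, K.cR j = 0 ∨ K.cR j = 3 → K.sR j = 0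
  col3 : ∀ i < I.n, (K.cC i = 0 → I.Full i 0) ∧ (K.cC i = 3 → ¬ I.Full i 0)
  row3 : ∀ j < I.m, (K.cR j = 0 → I.Full 0 j) ∧ (K.cR j = 3 → ¬ I.Full 0 j)
  closed : ∀ i < I.n, ∀ j < I.m, I.Mixed i j →
    (K.cC i = 1 ↔ K.cR j = 1) ∧ (K.cC i = 2 ↔ K.cR j = 2)
  one : ((∀ i < I.n, K.cC i ≠ 1) ∧ (∀ j < I.m, K.cR j ≠ 1) ∧ ∀ i < I.n, ∀ j < I.m, ¬ I.Mixed i j) ∨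
    I.Seeded K 1 1
  two : ((∀ i < I.n, K.cC i ≠ 2) ∧ (∀ j < I.m, K.cR j ≠ 2) ∧
      ∀ i < I.n, ∀ j < I.m, I.Mixed i j → K.cC i = 1) ∨
    I.Seeded K 2 (-1)

variable {I : Input} {K : Marks} {p q : ℕ → ℝ} {σ τ : ℕ → ℤ}

/-- An upper boundary traversed with `τ j = 1` and a lower boundary traversed with `τ j = -1` both
belong to `q - p = ε`. So fixing the direction of the row of a seed amounts to fixing the kind of
its boundary. -/
theorem Sol.seed_boundary (S : I.Sol p q σ τ) {i j : ℕ} (hi : i < I.n) (hj : j < I.m)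
    (h : I.Mixed i j) :
    (τ j = I.upSign i j → BoundaryCell I.e p q i j) ∧
    (τ j = -I.upSign i j → BoundaryCell I.e q p j i) := by
  unfold upSign
  by_cases hU : I.Upper i j
  · rw [if_pos hU]
    obtain ⟨_, _, h1, h2⟩ := S.upper hi hj hU
    exact ⟨h1, h2⟩
  · rw [if_neg hU]
    obtain ⟨_, _, h1, h2⟩ := S.lower hi hj (h.resolve_left hU)
    exact ⟨h1, fun h => h2 (by simpa using h)⟩

theorem upSign_unit (I : Input) (i j : ℕ) : I.upSign i j = 1 ∨ I.upSign i j = -1 := by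
  unfold upSign; split_ifs <;> simp

/-- The two kinds of boundary cells lie in disjoint sets of columns and rows, so
`range_le_of_disjoint` applies to both curves. A wholly empty column or row is then impossible,
because it would make one of the curves longer than `2ε`. Hence `le_of_no_boundary` applies in both
directions. -/
theorem Fits.short_of_two (F : I.Fits K p q σ τ κ) (h1 : ∃ i < I.n, K.cC i = 1)
    (h2 : ∃ i < I.n, K.cC i = 2) : I.Short K p q := by
  obtain ⟨⟨i2, hi2, j2, hj2, -, -, b2⟩, minus⟩ := F.two (Or.inl h2)
  obtain ⟨i1, hi1, j1, hj1, -, -, b1⟩ := F.one (Or.inl h1)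
  have e0 : (0 : ℝ) < I.e := e_pos'
  have rq := range_le_of_disjoint (C := (K.cC · = 1)) (R := (K.cR · = 1)) (C' := (K.cC · = 2))
    (R' := (K.cR · = 2)) e0 F.plus minus (fun i _ h h' => by omega)
    ⟨i1, hi1, j1, hj1, b1⟩ ⟨i2, hi2, j2, hj2, b2⟩
  have rp := range_le_of_disjoint (C := (K.cR · = 2)) (R := (K.cC · = 2)) (C' := (K.cR · = 1))
    (R' := (K.cC · = 1)) e0 (fun j hj i hi h => (minus i hi j hj h).symm)
    (fun j hj i hi h => (F.plus i hi j hj h).symm) (fun i _ h h' => by omega)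
    ⟨j2, hj2, i2, hi2, b2⟩ ⟨j1, hj1, i1, hi1, b1⟩
  have hp := segMin_le_segMax p
  have hq := segMin_le_segMax q
  have b1' := b1
  have b2' := b2
  obtain ⟨c1, c2⟩ := b1
  obtain ⟨d1, d2⟩ := b2
  refine ⟨le_of_no_boundary F.plus ?_ ?_, ?_, rp, rq, Or.inl h1⟩
  · intro i hi hB
    have := hB j2 hj2
    unfold Below at this
    linarith [rp i2 hi2 i hi, hp i]
  · intro j hj hB
    have := hB i2 hi2
    unfold Below at this
    linarith [rq j hj j2 hj2, hq j]
  · have := le_of_no_boundary (n := I.m) (m := I.n) (C := (K.cR · = 2)) (R := (K.cC · = 2))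
      (fun j hj i hi h => (minus i hi j hj h).symm) (fun j hj hB => by
        have := hB i1 hi1
        unfold Below at this
        linarith [rq j1 hj1 j hj, hq j])
      (fun i hi hB => by
        have := hB j1 hj1
        unfold Below at this
        linarith [rp i hi i1 hi1, hp i])
    exact fun i hi j hj h => this j hj i hi (fun hc => h hc.symm)

/-- A full column keeps all of `q` within `ε` of one point of `p`, which bounds the extent of `q` by
`2ε`; a full row does the same for `p`. These two lines also exclude wholly empty rows and columns.
-/
theorem Fits.short_of_full (F : I.Fits K p q σ τ κ)
    (hm : ∀ i < I.n, ∀ j < I.m, ¬ BoundaryCell I.e q p j i)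
    (hc : ∃ i < I.n, ∀ j < I.m, CellFull I.e p q i j)
    (hr : ∃ j < I.m, ∀ i < I.n, CellFull I.e p q i j)
    (h1 : (∃ i < I.n, K.cC i = 1) ∨
      ((∀ i < I.n, K.cC i ≠ 1) ∧ (∀ j < I.m, K.cR j ≠ 1) ∧
        (∀ i < I.n, 0 ≤ segMin p i) ∧ (∃ i < I.n, segMin p i = 0) ∧
        (∀ j < I.m, segMax q j ≤ I.e) ∧ (∃ j < I.m, segMax q j = I.e))) : I.Short K p q := by
  obtain ⟨c, hcn, hc⟩ := hc
  obtain ⟨r, hrm, hr⟩ := hr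
  have hp := segMin_le_segMax p
  have hq := segMin_le_segMax q
  have e0 : (0 : ℝ) < I.e := e_pos'
  refine ⟨le_of_no_boundary F.plus ?_ ?_, ?_, ?_, ?_, h1⟩
  · intro i hi hB
    have := hB r hrm
    have := hr i hi
    unfold Below at *
    linarith [this.1, hp i, hq r]
  · intro j hj hB
    have := hB c hcn
    have := hc j hj
    unfold Below at *
    linarith [this.1, hp c, hq j]
  · have := le_of_no_boundary (n := I.m) (m := I.n) (p := q) (q := p) (ε := I.e)
      (C := fun _ => False) (R := fun _ => False)
      (fun j hj i hi h => (hm i hi j hj h).elim) (fun j hj hB => by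
        have := hB c hcn
        have := hc j hj
        unfold Below at *
        linarith [this.2, hp c, hq j])
      (fun i hi hB => by
        have := hB r hrm
        have := hr i hi
        unfold Below at *
        linarith [this.2, hp i, hq r])
    exact fun i hi j hj h => this j hj i hi (fun hc => hc.1)
  · intro i hi i' hi'
    linarith [(hr i hi).2, (hr i' hi').1, hq r]
  · intro j hj j' hj'
    linarith [(hc j hj).1, (hc j' hj').2, hp c]

/-- Without mixed cells a single cell decides whether everything is full or everything is empty.
With one class, the curves are long if `Long.cond` holds; otherwise there are a full column and a
full row and no boundary cell of the second kind, so the curves are short. With two classes they are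
short. The solution that is returned need not be the given one: it is normalized so as to fit the
marks. -/
theorem Marked.complete (H : I.Marked K) (S : I.Sol p q σ τ) :
    (∃ p q σ τ, I.Sol p q σ τ ∧
      ∀ i < I.n, ∀ j < I.m, Below I.e p q i j ∨ Below I.e q p j i) ∨
    (∃ p q σ τ κ, I.Fits K p q σ τ κ ∧ I.Short K p q) ∨
    (∃ p q σ τ κ, I.Fits K p q σ τ κ ∧ I.Long K p q) := by
  have e0 : (0 : ℝ) < I.e := e_pos'
  rcases H.one with ⟨n1, n1', nm⟩ | ⟨i1, hi1, j1, hj1, hm1, hc1, hr1, hagree⟩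
  · have two : (∀ i < I.n, K.cC i ≠ 2) ∧ (∀ j < I.m, K.cR j ≠ 2) := by
      rcases H.two with ⟨h1, h2, _⟩ | ⟨i, hi, j, hj, hm, _⟩
      · exact ⟨h1, h2⟩
      · exact absurd hm (nm i hi j hj)
    have nb : ∀ i < I.n, ∀ j < I.m, ¬ (BoundaryCell I.e p q i j ∨ BoundaryCell I.e q p j i) :=
      fun i hi j hj h => nm i hi j hj ((S.mixed_iff hi hj).2 h)
    have excl : ∀ ⦃i j⦄, CellFull I.e p q i j → ¬ (Below I.e p q i j ∨ Below I.e q p j i) := by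
      intro i j h
      have := segMin_le_segMax p i
      have := segMin_le_segMax q j
      obtain ⟨h1, h2⟩ := h
      unfold Below
      rintro (h | h) <;> linarith
    have col : ∀ i < I.n, (∀ j < I.m, CellFull I.e p q i j) ∨
        ∀ j < I.m, Below I.e p q i j ∨ Below I.e q p j i := by
      intro i hi
      rcases line_cases (nb i hi) with h | h | h
      · exact Or.inl h
      · exact Or.inr fun j hj => Or.inl (h j hj)
      · exact Or.inr fun j hj => Or.inr (h j hj)
    have row : ∀ j < I.m, (∀ i < I.n, CellFull I.e p q i j) ∨
        ∀ i < I.n, Below I.e p q i j ∨ Below I.e q p j i := by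
      intro j hj
      rcases line_cases (m := I.n) (p := q) (q := p) (i := j)
        (fun i hi h => nb i hi j hj h.symm) with h | h | h
      · exact Or.inl fun i hi => cellFull_swap.1 (h i hi)
      · exact Or.inr fun i hi => Or.inr (h i hi)
      · exact Or.inr fun i hi => Or.inl (h i hi)
    rcases col 0 I.n_pos with h0 | h0
    · right; left
      have full : ∀ i < I.n, ∀ j < I.m, CellFull I.e p q i j := by
        intro i hi j hj
        rcases row j hj with h | h
        · exact h i hi
        · exact absurd (h 0 I.n_pos) (excl (h0 j hj))
      obtain ⟨ia, hia, hmin⟩ := Finset.exists_min_image (Finset.range I.n) (segMin p)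
        ⟨0, by simpa using I.n_pos⟩
      obtain ⟨jb, hjb, hmax⟩ := Finset.exists_max_image (Finset.range I.m) (segMax q)
        ⟨0, by simpa using I.m_pos⟩
      simp only [Finset.mem_range] at hia hmin hjb hmax
      have sh : ∀ (f : ℕ → ℝ) (a : ℝ) (k : ℕ), segMin (fun k => f k + a) k = segMin f k + a ∧
          segMax (fun k => f k + a) k = segMax f k + a := by
        intro f a k
        exact ⟨min_add_add_right _ _ _, max_add_add_right _ _ _⟩
      -- When all cells are full, the curves may be translated independently: moving `p` and `q` to
      -- the normalization of `Short.one` preserves fullness, because `max q - min p ≤ ε`.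
      let p' : ℕ → ℝ := fun k => p k + -segMin p ia
      let q' : ℕ → ℝ := fun k => q k + (I.e - segMax q jb)
      have full' : ∀ i < I.n, ∀ j < I.m, CellFull I.e p' q' i j := by
        intro i hi j hj
        have := hmin i hi
        have := hmax j hj
        have := (full ia hia jb hjb).1
        have := (full i hi j hj).2
        constructor
        · rw [(sh q _ j).2, (sh p _ i).1]; linarith
        · rw [(sh q _ j).1, (sh p _ i).2]; linarith
      have S' : I.Sol p' q' σ τ := S.of_cells
        (fun i hi => ⟨(S.chain_p i hi).1, by simp only [p', (S.chain_p i hi).2]; ring⟩)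
        (fun i hi => ⟨(S.chain_q i hi).1, by simp only [q', (S.chain_q i hi).2]; ring⟩)
        (fun i hi j hj => Or.inr (Or.inl ⟨full i hi j hj, full' i hi j hj⟩))
      have nb' : ∀ i < I.n, ∀ j < I.m,
          ¬ (BoundaryCell I.e p' q' i j ∨ BoundaryCell I.e q' p' j i) :=
        fun i hi j hj h => nm i hi j hj ((S'.mixed_iff hi hj).2 h)
      have F : I.Fits K p' q' σ τ 0 := {
        sol := S'
        col1 := fun i hi h => absurd h (n1 i hi)
        row1 := fun i hi h => absurd h (n1' i hi)
        col2 := fun i hi h => absurd h (two.1 i hi)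
        row2 := fun i hi h => absurd h (two.2 i hi)
        col0 := H.col0
        row0 := H.row0
        col_cls := H.col_cls
        row_cls := H.row_cls
        mixed := fun i hi j hj h => absurd h (nm i hi j hj)
        plus := fun i hi j hj h => absurd (Or.inl h) (nb' i hi j hj)
        one := fun h => by
          rcases h with ⟨i, hi, h⟩ | ⟨i, hi, h⟩
          · exact absurd h (n1 i hi)
          · exact absurd h (n1' i hi)
        two := fun h => by
          rcases h with ⟨i, hi, h⟩ | ⟨i, hi, h⟩
          · exact absurd h (two.1 i hi)
          · exact absurd h (two.2 i hi)
        col3 := H.col3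
        row3 := H.row3 }
      refine ⟨p', q', σ, τ, 0, F, F.short_of_full (fun i hi j hj h => nb' i hi j hj (Or.inr h))
        ⟨0, I.n_pos, full' 0 I.n_pos⟩ ⟨0, I.m_pos, fun i hi => full' i hi 0 I.m_pos⟩
        (Or.inr ⟨n1, n1', fun i hi => ?_, ⟨ia, hia, ?_⟩, fun j hj => ?_, ⟨jb, hjb, ?_⟩⟩)⟩
      · rw [(sh p _ i).1]; linarith [hmin i hi]
      · rw [(sh p _ ia).1]; ring
      · rw [(sh q _ j).2]; linarith [hmax j hj]
      · rw [(sh q _ jb).2]; ring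
    · left
      refine ⟨p, q, σ, τ, S, fun i hi j hj => ?_⟩
      rcases row j hj with h | h
      · exact absurd (h0 j hj) (excl (h 0 I.n_pos))
      · exact h i hi
  · right
    -- Reflecting both curves preserves the diagram and reverses `τ j1`. So the seed can be assumed
    -- to be of the kind `q - p = ε`, and a translation puts its row at `0`.
    obtain ⟨p, q, σ, τ, S, hτ, hq0⟩ : ∃ p q σ τ, I.Sol p q σ τ ∧ τ j1 = 1 * I.upSign i1 j1 ∧
        q j1 = 0 := by
      rw [one_mul]
      have hu := upSign_unit I i1 j1
      have ht := (S.chain_q j1 hj1).1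
      by_cases h : τ j1 = I.upSign i1 j1
      · exact ⟨_, _, _, _, S.shift (-q j1), h, by ring⟩
      · refine ⟨_, _, _, _, S.neg.shift (q j1), ?_, by ring⟩
        omega
    have ag1 := hagree p q σ τ S hτ
    rw [hq0] at ag1
    rw [one_mul] at hτ
    have hb1 := (S.seed_boundary hi1 hj1 hm1).1 hτ
    have plus : ∀ i < I.n, ∀ j < I.m, BoundaryCell I.e p q i j → K.cC i = 1 ∧ K.cR j = 1 := by
      intro i hi j hj hb
      have := boundaryCell_connected (C := (K.cC · = 1)) (R := (K.cR · = 1))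
        (fun i hi j hj hb => (H.closed i hi j hj ((S.mixed_iff hi hj).2 (Or.inl hb))).1)
        hi1 hj1 hb1 hc1 hi hj hb
      exact ⟨this, (H.closed i hi j hj ((S.mixed_iff hi hj).2 (Or.inl hb))).1.1 this⟩
    rcases H.two with ⟨n2, n2', hall⟩ | ⟨i2, hi2, j2, hj2, hm2, hc2, hr2, hagree2⟩
    · have F : I.Fits K p q σ τ 0 := {
        sol := S
        col1 := ag1.1
        row1 := ag1.2
        col2 := fun i hi h => absurd h (n2 i hi)
        row2 := fun i hi h => absurd h (n2' i hi)
        col0 := H.col0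
        row0 := H.row0
        col_cls := H.col_cls
        row_cls := H.row_cls
        mixed := fun i hi j hj h =>
          Or.inl ⟨hall i hi j hj h, (H.closed i hi j hj h).1.1 (hall i hi j hj h)⟩
        plus := plus
        one := fun _ => ⟨i1, hi1, j1, hj1, hc1, hr1, hb1⟩
        two := fun h => by
          rcases h with ⟨i, hi, h⟩ | ⟨i, hi, h⟩
          · exact absurd h (n2 i hi)
          · exact absurd h (n2' i hi)
        col3 := H.col3
        row3 := H.row3 }
      by_cases hcond : (∃ i < I.n, ∃ j < I.m, BoundaryCell I.e q p j i) ∨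
          (∀ i < I.n, K.cC i ≠ 0) ∨ (∀ j < I.m, K.cR j ≠ 0)
      · right
        exact ⟨p, q, σ, τ, 0, F, ⟨i1, hi1, j1, hj1, hc1, hr1, hb1⟩, n2, n2', hcond⟩
      · left
        push Not at hcond
        obtain ⟨hm, ⟨c, hc, hc0⟩, ⟨r, hr, hr0⟩⟩ := hcond
        exact ⟨p, q, σ, τ, 0, F, F.short_of_full hm ⟨c, hc, (F.col_type hc).1 hc0⟩
          ⟨r, hr, (F.row_type hr).1 hr0⟩ (Or.inl ⟨i1, hi1, hc1⟩)⟩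
    · left
      -- All boundary cells of the first kind are in class 1, so the seed of class 2 is of the
      -- second kind. This is why class 2 is seeded with the opposite sign.
      have hnb : ¬ BoundaryCell I.e p q i2 j2 := fun hb => by
        have := (plus i2 hi2 j2 hj2 hb).1
        omega
      have hτ2 : τ j2 = -I.upSign i2 j2 := by
        have hu := upSign_unit I i2 j2
        have ht := (S.chain_q j2 hj2).1
        by_contra h
        exact hnb ((S.seed_boundary hi2 hj2 hm2).1 (by omega))
      have hb2 := (S.seed_boundary hi2 hj2 hm2).2 hτ2
      have ag2 := hagree2 p q σ τ S (by rw [hτ2]; ring)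
      have minus : ∀ i < I.n, ∀ j < I.m, BoundaryCell I.e q p j i →
          K.cC i = 2 ∧ K.cR j = 2 := by
        intro i hi j hj hb
        have := boundaryCell_connected (C := (K.cR · = 2)) (R := (K.cC · = 2))
          (fun j hj i hi hb => (H.closed i hi j hj ((S.mixed_iff hi hj).2 (Or.inr hb))).2.symm)
          hj2 hi2 hb2 hr2 hj hi hb
        exact ⟨(H.closed i hi j hj ((S.mixed_iff hi hj).2 (Or.inr hb))).2.2 this, this⟩
      have F : I.Fits K p q σ τ (q j2) := {
        sol := S
        col1 := ag1.1
        row1 := ag1.2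
        col2 := ag2.1
        row2 := ag2.2
        col0 := H.col0
        row0 := H.row0
        col_cls := H.col_cls
        row_cls := H.row_cls
        mixed := fun i hi j hj h => by
          rcases (S.mixed_iff hi hj).1 h with h | h
          · exact Or.inl (plus i hi j hj h)
          · exact Or.inr (minus i hi j hj h)
        plus := plus
        one := fun _ => ⟨i1, hi1, j1, hj1, hc1, hr1, hb1⟩
        two := fun _ => ⟨⟨i2, hi2, j2, hj2, hc2, hr2, hb2⟩, minus⟩
        col3 := H.col3
        row3 := H.row3 }
      exact ⟨p, q, σ, τ, _, F, F.short_of_two ⟨i1, hi1, hc1⟩ ⟨i2, hi2, hc2⟩⟩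

end Input

end FreeSpace

namespace RealRAM

/-! ### Reasoning about programs -/

@[simp] theorem Memory.setInt_reals (s : Memory) (A : ℕ) (k v : ℤ) :
    (s.setInt A k v).reals = s.reals := rfl

@[simp] theorem Memory.setReal_ints (s : Memory) (A : ℕ) (k : ℤ) (v : ℝ) :
    (s.setReal A k v).ints = s.ints := rfl

@[simp] theorem Memory.setInt_ints (s : Memory) (A B : ℕ) (k v : ℤ) :
    (s.setInt A k v).ints B = if B = A then Function.update (s.ints A) k v else s.ints B := by
  funext l
  unfold Memory.setInt
  by_cases h : B = A
  · subst h; by_cases h' : l = k <;> simp [Function.update, h']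
  · simp [h]

@[simp] theorem Memory.setReal_reals (s : Memory) (A B : ℕ) (k : ℤ) (v : ℝ) :
    (s.setReal A k v).reals B = if B = A then Function.update (s.reals A) k v else s.reals B := by
  funext l
  unfold Memory.setReal
  by_cases h : B = A
  · subst h; by_cases h' : l = k <;> simp [Function.update, h']
  · simp [h]

/-- Started in `s`, the program halts after at most `T` steps in a memory with the property `Q`. -/
def Ev (c : Program) (s : Memory) (T : ℕ) (Q : Memory → Prop) : Prop :=
  ∃ t s', Runs c s t s' ∧ t ≤ T ∧ Q s'

/-- The integer arrays that a program may write. -/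
def Program.wI : Program → List ℕ
  | skip => []
  | setInt A _ _ => [A]
  | setReal _ _ _ => []
  | seq c d => c.wI ++ d.wI
  | ite _ c d => c.wI ++ d.wI
  | loop _ c => c.wI

/-- The real arrays that a program may write. -/
def Program.wR : Program → List ℕ
  | skip => []
  | setInt _ _ _ => []
  | setReal A _ _ => [A]
  | seq c d => c.wR ++ d.wR
  | ite _ c d => c.wR ++ d.wR
  | loop _ c => c.wR

/-- The memories agree outside the integer arrays in `W` and the real arrays in `R`. -/
structure Agree (W R : List ℕ) (s s' : Memory) : Prop where
  ints : ∀ A, A ∉ W → s'.ints A = s.ints A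
  reals : ∀ A, A ∉ R → s'.reals A = s.reals A

theorem Agree.refl (W R : List ℕ) (s : Memory) : Agree W R s s := ⟨fun _ _ => rfl, fun _ _ => rfl⟩

theorem Agree.trans {W R : List ℕ} {s s' s'' : Memory} (h : Agree W R s s')
    (h' : Agree W R s' s'') : Agree W R s s'' :=
  ⟨fun A hA => (h'.ints A hA).trans (h.ints A hA),
    fun A hA => (h'.reals A hA).trans (h.reals A hA)⟩

theorem Agree.mono {W R W' R' : List ℕ} {s s' : Memory} (h : Agree W R s s') (hW : W ⊆ W')
    (hR : R ⊆ R') : Agree W' R' s s' :=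
  ⟨fun A hA => h.ints A fun h => hA (hW h), fun A hA => h.reals A fun h => hA (hR h)⟩

theorem Agree.widen {W R W' R' : List ℕ} {s s' : Memory} (h : Agree W R s s')
    (hW : (W.all fun A => W'.contains A) = true := by rfl)
    (hR : (R.all fun A => R'.contains A) = true := by rfl) : Agree W' R' s s' :=
  h.mono (fun A hA => by simpa using List.all_eq_true.1 hW A hA)
    (fun A hA => by simpa using List.all_eq_true.1 hR A hA)

theorem Agree.int {W R : List ℕ} {s s' : Memory} (h : Agree W R s s') (A : ℕ)
    (hA : W.contains A = false := by rfl) : s'.ints A = s.ints A :=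
  h.ints A fun h => by simp_all

theorem Agree.real {W R : List ℕ} {s s' : Memory} (h : Agree W R s s') (A : ℕ)
    (hA : R.contains A = false := by rfl) : s'.reals A = s.reals A :=
  h.reals A fun h => by simp_all

/-- A frame rule that is read off from the program text. It allows a specification to speak only of
the arrays it is concerned with; everything else is recovered from `Program.wI` and `Program.wR` by
computation. -/
theorem Runs.agree {c : Program} {s s' : Memory} {t : ℕ} (h : Runs c s t s') :
    Agree c.wI c.wR s s' := by
  induction h with
  | skip => exact Agree.refl _ _ _
  | setInt A e f s =>
    refine ⟨fun B hB => ?_, fun B _ => rfl⟩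
    simp only [Program.wI, List.mem_singleton] at hB
    simp [hB]
  | setReal A e a s =>
    refine ⟨fun B _ => rfl, fun B hB => ?_⟩
    simp only [Program.wR, List.mem_singleton] at hB
    simp [hB]
  | seq _ _ h1 h2 =>
    exact (h1.mono (List.subset_append_left _ _) (List.subset_append_left _ _)).trans
      (h2.mono (List.subset_append_right _ _) (List.subset_append_right _ _))
  | ite_pos _ _ h => exact h.mono (List.subset_append_left _ _) (List.subset_append_left _ _)
  | ite_neg _ _ h => exact h.mono (List.subset_append_right _ _) (List.subset_append_right _ _)
  | loop_pos _ _ _ h1 h2 => exact h1.trans h2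
  | loop_neg _ => exact Agree.refl _ _ _

theorem Ev.agree {c : Program} {s : Memory} {T : ℕ} {Q : Memory → Prop} (h : Ev c s T Q) :
    Ev c s T (fun s' => Q s' ∧ Agree c.wI c.wR s s') := by
  obtain ⟨t, s', h1, h2, h3⟩ := h
  exact ⟨t, s', h1, h2, h3, h1.agree⟩

theorem Ev.mono {c : Program} {s : Memory} {T T' : ℕ} {Q Q' : Memory → Prop} (h : Ev c s T Q)
    (hT : T ≤ T') (hQ : ∀ s', Q s' → Q' s') : Ev c s T' Q' := by
  obtain ⟨t, s', h1, h2, h3⟩ := h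
  exact ⟨t, s', h1, h2.trans hT, hQ s' h3⟩

theorem Ev.seq {c d : Program} {s : Memory} {T T' : ℕ} {Q : Memory → Prop}
    (h : Ev c s T (fun s' => Ev d s' T' Q)) : Ev (Program.seq c d) s (T + T') Q := by
  obtain ⟨t, s', h1, h2, t', s'', h3, h4, h5⟩ := h
  exact ⟨t + t', s'', Runs.seq h1 h3, by omega, h5⟩

/-- Sequential composition, with the information on the arrays that are not written. -/
theorem Ev.seq' {c d : Program} {s : Memory} {T T' U : ℕ} {P Q : Memory → Prop} (h : Ev c s T P)
    (h' : ∀ s', Agree c.wI c.wR s s' → P s' → Ev d s' T' Q) (hU : T + T' ≤ U) :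
    Ev (Program.seq c d) s U Q :=
  (Ev.seq (h.agree.mono le_rfl fun s' hs' => h' s' hs'.2 hs'.1)).mono hU fun _ h => h

theorem Ev.ite {b : Cond} {c d : Program} {s : Memory} {T U : ℕ} {Q : Memory → Prop}
    (h1 : b.Holds s → Ev c s T Q) (h2 : ¬ b.Holds s → Ev d s T Q) (hU : 1 + b.cost + T ≤ U) :
    Ev (Program.ite b c d) s U Q := by
  by_cases hb : b.Holds s
  · obtain ⟨t, s', a1, a2, a3⟩ := h1 hb
    exact ⟨_, s', Runs.ite_pos hb a1, by omega, a3⟩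
  · obtain ⟨t, s', a1, a2, a3⟩ := h2 hb
    exact ⟨_, s', Runs.ite_neg hb a1, by omega, a3⟩

/-- Programs without loops. -/
def Program.straight : Program → Bool
  | seq c d => c.straight && d.straight
  | ite _ c d => c.straight && d.straight
  | loop _ _ => false
  | _ => true

open Classical in
/-- The effect of a program without loops. -/
noncomputable def Program.exec : Program → Memory → Memory
  | skip, s => s
  | setInt A e f, s => s.setInt A (e.eval s) (f.eval s)
  | setReal A e a, s => s.setReal A (e.eval s) (a.eval s)
  | seq c d, s => d.exec (c.exec s)
  | ite b c d, s => if b.Holds s then c.exec s else d.exec s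
  | loop _ _, s => s

/-- A bound for the number of steps of a program without loops. -/
def Program.bound : Program → ℕ
  | skip => 1
  | setInt _ e f => 1 + e.cost + f.cost
  | setReal _ e a => 1 + e.cost + a.cost
  | seq c d => c.bound + d.bound
  | ite b c d => 1 + b.cost + (c.bound + d.bound)
  | loop _ _ => 0

theorem Program.exec_ite_pos {b : Cond} {c d : Program} {s : Memory} (h : b.Holds s) :
    (ite b c d).exec s = c.exec s := if_pos h

theorem Program.exec_ite_neg {b : Cond} {c d : Program} {s : Memory} (h : ¬ b.Holds s) :
    (ite b c d).exec s = d.exec s := if_neg h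

/-- Loop-free programs are handled by evaluating their final memory. `Program.bound` adds up both
branches of each test, so that the time bound does not depend on the memory. -/
theorem Ev.straight {c : Program} (hc : c.straight = true) {s : Memory} {T : ℕ}
    {Q : Memory → Prop} (h : Q (c.exec s)) (hT : c.bound ≤ T) : Ev c s T Q := by
  suffices ∃ t, Runs c s t (c.exec s) ∧ t ≤ c.bound by
    obtain ⟨t, h1, h2⟩ := this
    exact ⟨t, _, h1, h2.trans hT, h⟩
  clear h hT
  induction c generalizing s with
  | skip => exact ⟨_, Runs.skip s, le_rfl⟩
  | setInt A e f => exact ⟨_, Runs.setInt A e f s, le_rfl⟩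
  | setReal A e a => exact ⟨_, Runs.setReal A e a s, le_rfl⟩
  | seq c d ih1 ih2 =>
    simp only [Program.straight, Bool.and_eq_true] at hc
    obtain ⟨t, h1, h2⟩ := ih1 hc.1 (s := s)
    obtain ⟨t', h3, h4⟩ := ih2 hc.2 (s := c.exec s)
    exact ⟨_, Runs.seq h1 h3, by simp only [Program.bound]; omega⟩
  | ite b c d ih1 ih2 =>
    simp only [Program.straight, Bool.and_eq_true] at hc
    simp only [Program.exec]
    split_ifs with hb
    · obtain ⟨t, h1, h2⟩ := ih1 hc.1 (s := s)
      exact ⟨_, Runs.ite_pos hb h1, by simp only [Program.bound]; omega⟩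
    · obtain ⟨t, h1, h2⟩ := ih2 hc.2 (s := s)
      exact ⟨_, Runs.ite_neg hb h1, by simp only [Program.bound]; omega⟩
  | loop => simp [Program.straight] at hc

/-- The integer variable held in cell `0` of the array `v`. -/
abbrev IExpr.var (v : ℕ) : IExpr := .get v (.const 0)

/-- The real variable held in cell `0` of the array `v`. -/
abbrev RExpr.var (v : ℕ) : RExpr := .get v (.const 0)

/-- Executes `c` with the values `0, …, N - 1` of the variable `v`. -/
def forLoop (v : ℕ) (N : IExpr) (c : Program) : Program :=
  .seq (.setInt v (.const 0) (.const 0))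
    (.loop (.not (.ile N (.var v)))
      (.seq c (.setInt v (.const 0) (.add (.var v) (.const 1)))))

/-- The loop resets and increments its own counter outside `c`, hence the invariant has to be
insensitive to the cell of the counter (`hInv`) and `c` must not write the array of the counter
(`hv`). The constant in `hT` covers the test, the increment and the initialization. -/
theorem forLoop_ev {v : ℕ} {N : IExpr} {c : Program} {s : Memory} {Q : Memory → Prop} {T : ℕ} (K B
    : ℕ)
    (Inv : ℕ → Memory → Prop)
    (hN : ∀ s', Agree (v :: c.wI) c.wR s s' → N.eval s' = K)
    (hInv : ∀ k s z, Inv k s → Inv k (s.setInt v 0 z))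
    (h0 : Inv 0 s)
    (hstep : ∀ k < K, ∀ s', Agree (v :: c.wI) c.wR s s' → s'.ints v 0 = k → Inv k s' →
      Ev c s' B (fun s'' => Inv (k + 1) s''))
    (hQ : ∀ s', Agree (v :: c.wI) c.wR s s' → Inv K s' → Q s')
    (hT : (K + 1) * (B + N.cost + 20) ≤ T) (hv : c.wI.contains v = false := by rfl) :
    Ev (forLoop v N c) s T Q := by
  have hv' : v ∉ c.wI := fun h => by simp_all
  have hset : ∀ (s : Memory) z, Agree (v :: c.wI) c.wR s (s.setInt v 0 z) := by
    intro s z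
    refine ⟨fun A hA => ?_, fun A _ => rfl⟩
    simp only [List.mem_cons, not_or] at hA
    simp [hA.1]
  -- Induction on the number `d` of rounds that are still to be done.
  have key : ∀ d k s', k + d = K → Agree (v :: c.wI) c.wR s s' → s'.ints v 0 = k → Inv k s' →
      Ev (.loop (.not (.ile N (.var v)))
        (.seq c (.setInt v (.const 0) (.add (.var v) (.const 1))))) s'
        ((d + 1) * (B + N.cost + 14)) Q := by
    intro d
    induction d with
    | zero =>
      intro k s' hk ha hvk hi
      have hb : ¬ (Cond.not (.ile N (.var v))).Holds s' := by
        simp only [Cond.Holds, not_not, IExpr.eval, hN s' ha, hvk]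
        have : K = k := by omega
        subst this; exact le_rfl
      refine ⟨_, s', Runs.loop_neg hb, ?_, hQ s' ha ?_⟩
      · simp only [Cond.cost, IExpr.cost]; omega
      · have : K = k := by omega
        subst this; exact hi
    | succ d ih =>
      intro k s' hk ha hvk hi
      have hb : (Cond.not (.ile N (.var v))).Holds s' := by
        simp only [Cond.Holds, IExpr.eval, hN s' ha, hvk, not_le]
        exact_mod_cast (by omega : k < K)
      obtain ⟨t, s1, r1, ht, hi1⟩ := hstep k (by omega) s' ha hvk hi
      have a1 := r1.agree
      have hv1 : s1.ints v 0 = k := by rw [a1.ints v hv', hvk]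
      have a2 : Agree (v :: c.wI) c.wR s (s1.setInt v 0 (k + 1)) :=
        (ha.trans (a1.mono (List.subset_cons_self _ _) (List.Subset.refl _))).trans (hset _ _)
      have r2 := Runs.setInt v (.const 0) (.add (.var v) (.const 1)) s1
      simp only [IExpr.eval, hv1] at r2
      obtain ⟨t', s2, r3, ht', hq⟩ := ih (k + 1) (s1.setInt v 0 (k + 1)) (by omega) a2
        (by simp) (hInv _ _ _ hi1)
      refine ⟨_, s2, Runs.loop_pos hb (Runs.seq r1 r2) r3, ?_, hq⟩
      have e : (d + 1 + 1) * (B + N.cost + 14) = (d + 1) * (B + N.cost + 14) + (B + N.cost + 14) :=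
          by
        ring
      rw [e]
      simp only [Cond.cost, IExpr.cost]
      omega
  have r0 := Runs.setInt v (.const 0) (.const 0) s
  simp only [IExpr.eval] at r0
  obtain ⟨t, s', r, ht, hq⟩ := key K 0 (s.setInt v 0 0) (by omega) (hset _ _) (by simp)
    (hInv _ _ _ h0)
  refine ⟨_, s', Runs.seq r0 r, le_trans ?_ hT, hq⟩
  have e : (K + 1) * (B + N.cost + 20) = (K + 1) * (B + N.cost + 14) + (K + 1) * 6 := by ring
  rw [e]
  simp only [IExpr.cost]
  omega

/-! ### Expressions for the cells of the diagram -/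

open IExpr RExpr Cond in
section

abbrev numN : IExpr := get 0 (const 0)
abbrev numM : IExpr := get 0 (const 1)
abbrev numE : IExpr := get 0 (const 2)
abbrev real (e : IExpr) : RExpr := .ofInt e
abbrev cellAddr (i j : IExpr) : IExpr := .add j (.mul numM i)
abbrev slopeE (i j : IExpr) : IExpr := .get 3 (cellAddr i j)
abbrev loE (i j : IExpr) : RExpr := .get 0 (cellAddr i j)
abbrev hiE (i j : IExpr) : RExpr := .get 1 (cellAddr i j)
abbrev slabMinE (i j : IExpr) : RExpr :=
  .div (.sub (real (.const 0)) (.mul (real (.get 1 i)) (.add (real (.const 1)) (real (slopeE i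
      j)))))
    (real (.const 2))
abbrev slabMaxE (i j : IExpr) : RExpr :=
  .add (real (.get 2 j)) (.div (.mul (real (.get 1 i)) (.sub (real (.const 1)) (real (slopeE i j))))
    (real (.const 2)))
abbrev rlt (a b : RExpr) : Cond := .not (.rle b a)
abbrev upperC (i j : IExpr) : Cond :=
  .and (.rle (loE i j) (hiE i j)) (.and (.rle (slabMinE i j) (hiE i j)) (rlt (hiE i j) (slabMaxE i
      j)))
abbrev lowerC (i j : IExpr) : Cond :=
  .and (.rle (loE i j) (hiE i j)) (.and (rlt (slabMinE i j) (loE i j)) (.rle (loE i j) (slabMaxE i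
      j)))
abbrev fullC (i j : IExpr) : Cond :=
  .and (.rle (loE i j) (slabMinE i j)) (.rle (slabMaxE i j) (hiE i j))

end

abbrev mixedC (i j : IExpr) : Cond := .or (upperC i j) (lowerC i j)
abbrev ieq (e f : IExpr) : Cond := .and (.ile e f) (.ile f e)
abbrev ilt (e f : IExpr) : Cond := .not (.ile f e)
abbrev req (a b : RExpr) : Cond := .and (.rle a b) (.rle b a)

/-- The input is stored in the memory. -/
structure Loaded (I : FreeSpace.Input) (s : Memory) : Prop where
  n : s.ints 0 0 = I.n
  m : s.ints 0 1 = I.m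
  e : s.ints 0 2 = I.e
  w : ∀ i < I.n, s.ints 1 i = I.w i
  h : ∀ j < I.m, s.ints 2 j = I.h j
  sl : ∀ i < I.n, ∀ j < I.m, s.ints 3 (j + I.m * i) = I.sl i j
  lo : ∀ i < I.n, ∀ j < I.m, s.reals 0 (j + I.m * i) = I.lo i j
  hi : ∀ i < I.n, ∀ j < I.m, s.reals 1 (j + I.m * i) = I.hi i j

theorem Loaded.agree {I : FreeSpace.Input} {s s' : Memory} (H : Loaded I s)
    (hI : ∀ A < 4, s'.ints A = s.ints A) (hR : ∀ A < 2, s'.reals A = s.reals A) : Loaded I s' := by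
  have h0 := hI 0 (by omega)
  have h1 := hI 1 (by omega)
  have h2 := hI 2 (by omega)
  have h3 := hI 3 (by omega)
  have g0 := hR 0 (by omega)
  have g1 := hR 1 (by omega)
  constructor <;> simp only [h0, h1, h2, h3, g0, g1]
  · exact H.n
  · exact H.m
  · exact H.e
  · exact H.w
  · exact H.h
  · exact H.sl
  · exact H.lo
  · exact H.hi

theorem Loaded.of_agree {I : FreeSpace.Input} {s s' : Memory} {W R : List ℕ} (H : Loaded I s)
    (ha : Agree W R s s') (hW : (W.all fun A => 4 ≤ A) = true := by rfl)
    (hR : (R.all fun A => 2 ≤ A) = true := by rfl) : Loaded I s' := by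
  rw [List.all_eq_true] at hW hR
  exact H.agree (fun A hA => ha.ints A fun h => by have := of_decide_eq_true (hW A h); omega)
    (fun A hA => ha.reals A fun h => by have := of_decide_eq_true (hR A h); omega)

section
variable {I : FreeSpace.Input} {s : Memory} (H : Loaded I s) {i j : ℕ} (hi : i < I.n) (hj : j < I.m)
  {ei ej : IExpr} (hei : ei.eval s = i) (hej : ej.eval s = j)
include H hi hj hei hej

theorem upperC_holds : (upperC ei ej).Holds s ↔ I.Upper i j := by
  simp only [Cond.Holds, RExpr.eval, IExpr.eval, hei, hej, H.m, H.sl i hi j hj, H.lo i hi j hj,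
    H.hi i hi j hj, H.w i hi, H.h j hj, FreeSpace.Input.Upper, FreeSpace.UpperVisible,
    FreeSpace.slabMin, FreeSpace.slabMax, not_le]
  push_cast
  simp only [zero_sub]

theorem lowerC_holds : (lowerC ei ej).Holds s ↔ I.Lower i j := by
  simp only [Cond.Holds, RExpr.eval, IExpr.eval, hei, hej, H.m, H.sl i hi j hj, H.lo i hi j hj,
    H.hi i hi j hj, H.w i hi, H.h j hj, FreeSpace.Input.Lower, FreeSpace.LowerVisible,
    FreeSpace.slabMin, FreeSpace.slabMax, not_le]
  push_cast
  simp only [zero_sub]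

theorem fullC_holds : (fullC ei ej).Holds s ↔ I.Full i j := by
  simp only [Cond.Holds, RExpr.eval, IExpr.eval, hei, hej, H.m, H.sl i hi j hj, H.lo i hi j hj,
    H.hi i hi j hj, H.w i hi, H.h j hj, FreeSpace.Input.Full, FreeSpace.SlabFull,
    FreeSpace.slabMin, FreeSpace.slabMax]
  push_cast
  simp only [zero_sub]

theorem mixedC_holds : (mixedC ei ej).Holds s ↔ I.Mixed i j :=
  or_congr (upperC_holds H hi hj hei hej) (lowerC_holds H hi hj hei hej)

end

end RealRAM

/-! ### The graph of the mixed cells -/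

namespace FreeSpace.Input

variable (I : Input)

open Classical in
/-- The distance between a column and a row with a mixed cell, up to the direction of the row. -/
noncomputable def offset (i j : ℕ) : ℝ := if I.Upper i j then I.e - I.hi i j else -I.e - I.lo i j

/-- The nodes `u < n` are the columns and the nodes `n + j` are the rows; mixed cells are edges. -/
def Edge (u v : ℕ) : Prop :=
  (u < I.n ∧ I.n ≤ v ∧ I.Mixed u (v - I.n)) ∨ (I.n ≤ u ∧ v < I.n ∧ I.Mixed v (u - I.n))

def nodeSign (σ τ : ℕ → ℤ) (u : ℕ) : ℤ := if u < I.n then σ u else τ (u - I.n)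

noncomputable def nodePos (p q : ℕ → ℝ) (u : ℕ) : ℝ := if u < I.n then p u else q (u - I.n)

/-- The direction of the node `v`, derived from the direction `sg` of the node `u`. -/
def nextSign (u v : ℕ) (sg : ℤ) : ℤ :=
  if u < I.n then sg * I.sl u (v - I.n) else sg * I.sl v (u - I.n)

/-- The position of the node `v`, derived from the position and the direction of the node `u`. -/
noncomputable def nextPos (u v : ℕ) (x : ℝ) (sg : ℤ) : ℝ :=
  if u < I.n then x + ((sg * I.sl u (v - I.n) : ℤ) : ℝ) * I.offset u (v - I.n)
  else x - (sg : ℝ) * I.offset v (u - I.n)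

variable {I} {p q : ℕ → ℝ} {σ τ : ℕ → ℤ}

theorem Sol.offset (S : I.Sol p q σ τ) {i j : ℕ} (hi : i < I.n) (hj : j < I.m)
    (h : I.Mixed i j) : σ i * τ j = I.sl i j ∧ τ j * (q j - p i) = I.offset i j := by
  unfold Input.offset
  by_cases hU : I.Upper i j
  · rw [if_pos hU]; exact ⟨(S.upper hi hj hU).1, (S.upper hi hj hU).2.1⟩
  · rw [if_neg hU]
    have := S.lower hi hj (h.resolve_left hU)
    exact ⟨this.1, this.2.1⟩

/-- Directions are their own inverses, so `σ i * τ j = sl i j` gives either direction from the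
other, and `τ j * (q j - p i)` gives either position from the other. The translation `κ` is passed
on unchanged. -/
theorem Sol.next (S : I.Sol p q σ τ) {u v : ℕ} (hu : u < I.n + I.m) (hv : v < I.n + I.m)
    (h : I.Edge u v) {x κ : ℝ} {sg : ℤ} (h1 : sg = I.nodeSign σ τ u)
    (h2 : x + κ = I.nodePos p q u) :
    I.nextSign u v sg = I.nodeSign σ τ v ∧ I.nextPos u v x sg + κ = I.nodePos p q v := by
  unfold nodeSign nodePos nextSign nextPos at *
  rcases h with ⟨a, b, hm⟩ | ⟨a, b, hm⟩
  · rw [if_pos a] at h1 h2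
    rw [if_pos a, if_pos a, if_neg (by omega), if_neg (by omega)]
    obtain ⟨c1, c2⟩ := S.offset a (by omega) hm
    have c3 : sg * I.sl u (v - I.n) = τ (v - I.n) := by
      rw [← c1, h1]
      rcases (S.chain_p u a).1 with h | h <;> rw [h] <;> ring
    refine ⟨c3, ?_⟩
    rw [c3, ← c2]
    rcases (S.chain_q (v - I.n) (by omega)).1 with h | h <;> rw [h] <;> push_cast <;> linarith
  · rw [if_neg (by omega)] at h1 h2
    have hu' : ¬ u < I.n := by omega
    simp only [if_neg hu', if_pos b]
    obtain ⟨c1, c2⟩ := S.offset b (by omega) hm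
    constructor
    · rw [← c1, h1]
      rcases (S.chain_q (u - I.n) (by omega)).1 with h | h <;> rw [h] <;> ring
    · rw [← c2, h1]
      rcases (S.chain_q (u - I.n) (by omega)).1 with h | h <;> rw [h] <;> push_cast <;> linarith

end FreeSpace.Input

namespace RealRAM

open FreeSpace

/-! ### Propagation along the mixed cells -/

/-- The integer arrays `6`, `7`, `8` hold the directions, the classes and the flags of the nodes
that have been visited; the real array `4` holds the positions. -/
def marks (I : Input) (s : Memory) : Marks where
  cC i := s.ints 7 i
  cR j := s.ints 7 ((I.n + j : ℕ) : ℤ)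
  sC i := s.ints 6 i
  sR j := s.ints 6 ((I.n + j : ℕ) : ℤ)
  xC i := s.reals 4 i
  xR j := s.reals 4 ((I.n + j : ℕ) : ℤ)

theorem agrees_iff {I : Input} {s : Memory} {c : ℤ} {p q : ℕ → ℝ} {σ τ : ℕ → ℤ} {κ : ℝ} :
    I.Agrees (marks I s) c p q σ τ κ ↔ ∀ u : ℕ, u < I.n + I.m → s.ints 7 u = c →
      s.ints 6 u = I.nodeSign σ τ u ∧ s.reals 4 u + κ = I.nodePos p q u := by
  unfold Input.Agrees Input.nodeSign Input.nodePos marks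
  constructor
  · rintro ⟨h1, h2⟩ u hu hc
    by_cases h : u < I.n
    · rw [if_pos h, if_pos h]; exact h1 u h hc
    · rw [if_neg h, if_neg h]
      have := h2 (u - I.n) (by omega)
      simp only [show I.n + (u - I.n) = u by omega] at this
      exact this hc
  · intro H
    refine ⟨fun i hi hc => ?_, fun j hj hc => ?_⟩
    · have := H i (by omega) hc
      rwa [if_pos hi, if_pos hi] at this
    · have := H (I.n + j) (by omega) hc
      rwa [if_neg (by omega), if_neg (by omega), show I.n + j - I.n = j by omega] at this

/-- From `s` to `s'`, nodes have been added to the class `c`. -/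
structure Grow (I : Input) (c : ℤ) (s s' : Memory) : Prop where
  old : ∀ u : ℕ, u < I.n + I.m → s.ints 6 u ≠ 0 →
    s'.ints 6 u = s.ints 6 u ∧ s'.ints 7 u = s.ints 7 u ∧ s'.reals 4 u = s.reals 4 u
  new : ∀ u : ℕ, u < I.n + I.m → s.ints 6 u = 0 →
    (s'.ints 6 u = 0 ∧ s'.ints 7 u = s.ints 7 u) ∨ (s'.ints 6 u ≠ 0 ∧ s'.ints 7 u = c)
  agrees : ∀ p q σ τ κ, I.Sol p q σ τ → I.Agrees (marks I s) c p q σ τ κ →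
    I.Agrees (marks I s') c p q σ τ κ

theorem Grow.of_eq {I : Input} {c : ℤ} {s s' : Memory} (h6 : s'.ints 6 = s.ints 6)
    (h7 : s'.ints 7 = s.ints 7) (h4 : s'.reals 4 = s.reals 4) : Grow I c s s' where
  old u _ _ := by rw [h6, h7, h4]; exact ⟨rfl, rfl, rfl⟩
  new u _ h := Or.inl (by rw [h6, h7]; exact ⟨h, rfl⟩)
  agrees p q σ τ κ _ h := by
    rw [agrees_iff] at h ⊢
    rwa [h6, h7, h4]

theorem Grow.trans {I : Input} {c : ℤ} {s s' s'' : Memory} (h : Grow I c s s')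
    (h' : Grow I c s' s'') : Grow I c s s'' where
  old u hu h0 := by
    obtain ⟨a, b, d⟩ := h.old u hu h0
    obtain ⟨a', b', d'⟩ := h'.old u hu (by rwa [a])
    exact ⟨a'.trans a, b'.trans b, d'.trans d⟩
  new u hu h0 := by
    rcases h.new u hu h0 with ⟨a, b⟩ | ⟨a, b⟩
    · rcases h'.new u hu a with ⟨a', b'⟩ | h
      · exact Or.inl ⟨a', b'.trans b⟩
      · exact Or.inr h
    · obtain ⟨a', b', _⟩ := h'.old u hu a
      exact Or.inr ⟨by rwa [a'], b'.trans b⟩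
  agrees p q σ τ κ hS ha := h'.agrees _ _ _ _ _ hS (h.agrees _ _ _ _ _ hS ha)

def setMarks (v : IExpr) (c : ℤ) (sg : IExpr) (x : RExpr) : Program :=
  .seq (.setReal 4 v x) (.seq (.setInt 7 v (.const c)) (.setInt 6 v sg))

abbrev upperOffset (i j : IExpr) : RExpr := .sub (real numE) (hiE i j)
abbrev lowerOffset (i j : IExpr) : RExpr := .sub (.sub (real (.const 0)) (real numE)) (loE i j)

/-- Marks the node `v` in the class `c` if it is unmarked and adjacent to the node `u`. -/
def relax (c : ℤ) : Program :=
  let u : IExpr := .var 12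
  let v : IExpr := .var 13
  let j : IExpr := .sub v numN
  let i : IExpr := .sub u numN
  let sg : IExpr := .mul (.get 6 u) (slopeE u j)
  let sg' : IExpr := .mul (.get 6 u) (slopeE v i)
  .ite (ieq (.get 6 v) (.const 0))
    (.ite (.and (ilt u numN) (.and (.ile numN v) (mixedC u j)))
      (.ite (upperC u j)
        (setMarks v c sg (.add (.get 4 u) (.mul (real sg) (upperOffset u j))))
        (setMarks v c sg (.add (.get 4 u) (.mul (real sg) (lowerOffset u j)))))
      (.ite (.and (.ile numN u) (.and (ilt v numN) (mixedC v i)))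
        (.ite (upperC v i)
          (setMarks v c sg' (.sub (.get 4 u) (.mul (real (.get 6 u)) (upperOffset v i))))
          (setMarks v c sg' (.sub (.get 4 u) (.mul (real (.get 6 u)) (lowerOffset v i)))))
        .skip))
    .skip

theorem relax_exec {I : Input} {c : ℤ} {s : Memory} (H : Loaded I s) {u v : ℕ}
    (hu : u < I.n + I.m) (hv : v < I.n + I.m) (h12 : s.ints 12 0 = u) (h13 : s.ints 13 0 = v) :
    (s.ints 6 v = 0 ∧ I.Edge u v →
      ((relax c).exec s).ints 6 = Function.update (s.ints 6) v (I.nextSign u v (s.ints 6 u)) ∧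
      ((relax c).exec s).ints 7 = Function.update (s.ints 7) v c ∧
      ((relax c).exec s).reals 4 =
        Function.update (s.reals 4) v (I.nextPos u v (s.reals 4 u) (s.ints 6 u))) ∧
    (¬ (s.ints 6 v = 0 ∧ I.Edge u v) → (relax c).exec s = s) := by
  have b0 : (ieq (.get 6 (.var 13)) (.const 0)).Holds s ↔ s.ints 6 v = 0 := by
    simp only [Cond.Holds, IExpr.eval, h13]; omega
  by_cases h0 : s.ints 6 v = 0
  swap
  · constructor
    · intro h; exact absurd h.1 h0
    · intro _
      simp only [relax, Program.exec]
      rw [if_neg (by rwa [b0])]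
  by_cases hun : u < I.n
  · by_cases hvn : I.n ≤ v
    · have hej : (IExpr.sub (.var 13) numN).eval s = ((v - I.n : ℕ) : ℤ) := by
        simp only [IExpr.eval, h13, H.n]; omega
      have hei : (IExpr.var 12).eval s = (u : ℤ) := by simp only [IExpr.eval, h12]
      have hj : v - I.n < I.m := by omega
      have hmx := mixedC_holds H hun hj hei hej
      have hup := upperC_holds H hun hj hei hej
      have b1 : (Cond.and (ilt (.var 12) numN) (.and (.ile numN (.var 13))
          (mixedC (.var 12) (.sub (.var 13) numN)))).Holds s ↔ I.Mixed u (v - I.n) := by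
        rw [← hmx]
        simp only [Cond.Holds, IExpr.eval, h12, h13, H.n]
        constructor
        · rintro ⟨_, _, h⟩; exact h
        · intro h; exact ⟨by omega, by omega, h⟩
      have b2 : ¬ (Cond.and (.ile numN (.var 12)) (.and (ilt (.var 13) numN)
          (mixedC (.var 13) (.sub (.var 12) numN)))).Holds s := by
        simp only [Cond.Holds, IExpr.eval, h12, h13, H.n]
        rintro ⟨h, _⟩; omega
      have hE : I.Edge u v ↔ I.Mixed u (v - I.n) := by
        unfold Input.Edge
        constructor
        · rintro (⟨_, _, h⟩ | ⟨h, _⟩)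
          · exact h
          · omega
        · intro h; exact Or.inl ⟨hun, hvn, h⟩
      rw [hE]
      have hne : (v : ℤ) ≠ u := by omega
      simp only [relax, Program.exec]
      rw [if_pos (b0.2 h0)]
      by_cases hM : I.Mixed u (v - I.n)
      · refine ⟨fun _ => ?_, fun h => absurd ⟨h0, hM⟩ h⟩
        rw [if_pos (b1.2 hM)]
        have hej' : (v : ℤ) - I.n = ((v - I.n : ℕ) : ℤ) := by omega
        unfold Input.nextSign Input.nextPos Input.offset
        rw [if_pos hun, if_pos hun]
        by_cases hU : I.Upper u (v - I.n)
        · rw [if_pos (hup.2 hU), if_pos hU]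
          simp [setMarks, Program.exec, IExpr.eval, RExpr.eval, h12, h13, H.n, H.m, H.e, hej',
            H.sl u hun _ hj, H.hi u hun _ hj]
        · rw [if_neg (by rwa [hup]), if_neg hU]
          simp [setMarks, Program.exec, IExpr.eval, RExpr.eval, h12, h13, H.n, H.m, H.e, hej',
            H.sl u hun _ hj, H.lo u hun _ hj]
      · refine ⟨fun h => absurd h.2 hM, fun _ => ?_⟩
        rw [if_neg (by rwa [b1]), if_neg b2]
    · refine ⟨fun h => ?_, fun _ => ?_⟩
      · rcases h.2 with ⟨_, h, _⟩ | ⟨h, _⟩ <;> omega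
      · simp only [relax, Program.exec]
        rw [if_pos (b0.2 h0), if_neg, if_neg]
        · simp only [Cond.Holds, IExpr.eval, h12, h13, H.n]
          rintro ⟨h, _⟩; omega
        · simp only [Cond.Holds, IExpr.eval, h12, h13, H.n]
          rintro ⟨_, h, _⟩; omega
  · by_cases hvn : v < I.n
    · have hej : (IExpr.sub (.var 12) numN).eval s = ((u - I.n : ℕ) : ℤ) := by
        simp only [IExpr.eval, h12, H.n]; omega
      have hei : (IExpr.var 13).eval s = (v : ℤ) := by simp only [IExpr.eval, h13]
      have hj : u - I.n < I.m := by omega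
      have hmx := mixedC_holds H hvn hj hei hej
      have hup := upperC_holds H hvn hj hei hej
      have b2 : (Cond.and (.ile numN (.var 12)) (.and (ilt (.var 13) numN)
          (mixedC (.var 13) (.sub (.var 12) numN)))).Holds s ↔ I.Mixed v (u - I.n) := by
        rw [← hmx]
        simp only [Cond.Holds, IExpr.eval, h12, h13, H.n]
        constructor
        · rintro ⟨_, _, h⟩; exact h
        · intro h; exact ⟨by omega, by omega, h⟩
      have b1 : ¬ (Cond.and (ilt (.var 12) numN) (.and (.ile numN (.var 13))
          (mixedC (.var 12) (.sub (.var 13) numN)))).Holds s := by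
        simp only [Cond.Holds, IExpr.eval, h12, h13, H.n]
        rintro ⟨h, _⟩; omega
      have hE : I.Edge u v ↔ I.Mixed v (u - I.n) := by
        unfold Input.Edge
        constructor
        · rintro (⟨h, _⟩ | ⟨_, _, h⟩)
          · omega
          · exact h
        · intro h; exact Or.inr ⟨by omega, hvn, h⟩
      rw [hE]
      have hne : (v : ℤ) ≠ u := by omega
      have hne' : (u : ℤ) ≠ v := by omega
      simp only [relax, Program.exec]
      rw [if_pos (b0.2 h0), if_neg b1]
      by_cases hM : I.Mixed v (u - I.n)
      · refine ⟨fun _ => ?_, fun h => absurd ⟨h0, hM⟩ h⟩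
        rw [if_pos (b2.2 hM)]
        have hej' : (u : ℤ) - I.n = ((u - I.n : ℕ) : ℤ) := by omega
        unfold Input.nextSign Input.nextPos Input.offset
        rw [if_neg hun, if_neg hun]
        by_cases hU : I.Upper v (u - I.n)
        · rw [if_pos (hup.2 hU), if_pos hU]
          simp [setMarks, Program.exec, IExpr.eval, RExpr.eval, h12, h13, H.n, H.m, H.e, hej',
            H.sl v hvn _ hj, H.hi v hvn _ hj]
        · rw [if_neg (by rwa [hup]), if_neg hU]
          simp [setMarks, Program.exec, IExpr.eval, RExpr.eval, h12, h13, H.n, H.m, H.e, hej',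
            H.sl v hvn _ hj, H.lo v hvn _ hj]
      · refine ⟨fun h => absurd h.2 hM, fun _ => ?_⟩
        rw [if_neg (by rwa [b2])]
    · refine ⟨fun h => ?_, fun _ => ?_⟩
      · rcases h.2 with ⟨h, _⟩ | ⟨_, h, _⟩ <;> omega
      · simp only [relax, Program.exec]
        rw [if_pos (b0.2 h0), if_neg, if_neg]
        · simp only [Cond.Holds, IExpr.eval, h12, h13, H.n]
          rintro ⟨_, h, _⟩; omega
        · simp only [Cond.Holds, IExpr.eval, h12, h13, H.n]
          rintro ⟨h, _⟩; omega

theorem Edge.nextSign_ne {I : Input} {u v : ℕ} (hu : u < I.n + I.m) (hv : v < I.n + I.m)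
    (h : I.Edge u v) {sg : ℤ} (hsg : sg ≠ 0) : I.nextSign u v sg ≠ 0 := by
  have key : ∀ i < I.n, ∀ j < I.m, I.sl i j ≠ 0 := fun i hi j hj => by
    rcases I.sl_unit i hi j hj with h | h <;> omega
  unfold Input.nextSign
  rcases h with ⟨a, b, _⟩ | ⟨a, b, _⟩
  · rw [if_pos a]; exact mul_ne_zero hsg (key _ a _ (by omega))
  · rw [if_neg (by omega)]; exact mul_ne_zero hsg (key _ b _ (by omega))

/-- `Input.Sol.next` is what preserves agreement with every solution at once. A marked node is never
overwritten, and a new direction is nonzero, so `0` can serve as the value for an unmarked node. -/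
theorem relax_grow {I : Input} {c : ℤ} {s : Memory} (H : Loaded I s) {u v : ℕ}
    (hu : u < I.n + I.m) (hv : v < I.n + I.m) (h12 : s.ints 12 0 = u) (h13 : s.ints 13 0 = v)
    (hk : s.ints 6 u ≠ 0) (hc : s.ints 7 u = c) :
    Grow I c s ((relax c).exec s) ∧ (I.Edge u v → ((relax c).exec s).ints 6 v ≠ 0) := by
  obtain ⟨h1, h2⟩ := relax_exec (c := c) H hu hv h12 h13
  by_cases h : s.ints 6 v = 0 ∧ I.Edge u v
  · obtain ⟨e6, e7, e4⟩ := h1 h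
    have hn := Edge.nextSign_ne hu hv h.2 hk
    refine ⟨⟨fun x hx hx0 => ?_, fun x hx hx0 => ?_, fun p q σ τ κ hS ha => ?_⟩, fun _ => ?_⟩
    · have hxv : (x : ℤ) ≠ v := fun he => hx0 (by rw [he]; exact h.1)
      rw [e6, e7, e4, Function.update_of_ne hxv, Function.update_of_ne hxv,
        Function.update_of_ne hxv]
      exact ⟨rfl, rfl, rfl⟩
    · by_cases hxv : (x : ℤ) = v
      · right; rw [e6, e7, hxv, Function.update_self, Function.update_self]; exact ⟨hn, rfl⟩
      · left; rw [e6, e7, Function.update_of_ne hxv, Function.update_of_ne hxv]; exact ⟨hx0, rfl⟩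
    · rw [agrees_iff] at ha ⊢
      intro x hx hxc
      by_cases hxv : x = v
      · subst hxv
        rw [e6, e4, Function.update_self, Function.update_self]
        obtain ⟨a1, a2⟩ := ha u hu hc
        exact hS.next hu hv h.2 a1 a2
      · have hxv' : (x : ℤ) ≠ v := by exact_mod_cast hxv
        rw [e7, Function.update_of_ne hxv'] at hxc
        rw [e6, e4, Function.update_of_ne hxv', Function.update_of_ne hxv']
        exact ha x hx hxc
    · rw [e6, Function.update_self]; exact hn
  · rw [h2 h]
    refine ⟨Grow.of_eq rfl rfl rfl, fun hE h0 => h ⟨h0, hE⟩⟩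

/-- Marks all neighbours of the node `u`. -/
def visit (c : ℤ) : Program :=
  .seq (forLoop 13 (.add numN numM) (relax c)) (.setInt 8 (.var 12) (.const 1))

theorem visit_spec (c : ℤ) : ∃ C, ∀ (I : Input) (s : Memory) (u : ℕ), Loaded I s → u < I.n + I.m →
    s.ints 12 0 = u → s.ints 6 u ≠ 0 → s.ints 7 u = c →
    Ev (visit c) s (C * (I.n + I.m + 1)) (fun s' => Grow I c s s' ∧
      s'.ints 8 = Function.update (s.ints 8) u 1 ∧
      ∀ v : ℕ, v < I.n + I.m → I.Edge u v → s'.ints 6 v ≠ 0) := by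
  refine ⟨(relax c).bound + 40, fun I s u H hu h12 hk hc => ?_⟩
  have hload : ∀ s', Agree (13 :: (relax c).wI) (relax c).wR s s' → Loaded I s' := fun s' ha =>
    H.of_agree ha
  refine Ev.seq' (T := (I.n + I.m + 1) * ((relax c).bound + 27)) (T' := 4)
    (P := fun s' => Grow I c s s' ∧ ∀ v : ℕ, v < I.n + I.m → I.Edge u v → s'.ints 6 v ≠ 0)
    (forLoop_ev (I.n + I.m) (relax c).bound
    (fun k s' => Grow I c s s' ∧ ∀ v : ℕ, v < k → v < I.n + I.m → I.Edge u v → s'.ints 6 v ≠ 0)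
    (fun s' ha => by simp [IExpr.eval, (hload s' ha).n, (hload s' ha).m])
    (fun k s' z h => ⟨h.1.trans (Grow.of_eq (by simp) (by simp) (by simp)), by simpa using h.2⟩)
    ⟨Grow.of_eq rfl rfl rfl, fun v hv => by omega⟩
    (fun k hk' s' ha h13 hi => ?_)
    (fun s' ha hi => ⟨hi.1, fun v hv => hi.2 v hv hv⟩) (Nat.mul_le_mul_left _
        (by simp only [IExpr.cost]; omega)))
    (fun s' ha h => ?_) ?_
  · refine Ev.straight (by rfl) ?_ le_rfl
    have e12 : s'.ints 12 0 = u := by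
      rw [ha.int 12]; exact h12
    obtain ⟨o1, o2, o3⟩ := hi.1.old u hu hk
    obtain ⟨g, hE⟩ := relax_grow (c := c) (hload s' ha) hu hk' e12 h13 (by rwa [o1])
      (by rw [o2]; exact hc)
    refine ⟨hi.1.trans g, fun v hv hv' hvE => ?_⟩
    rcases Nat.lt_succ_iff_lt_or_eq.1 hv with h | rfl
    · have := hi.2 v h hv' hvE
      rw [(g.old v hv' this).1]; exact this
    · exact hE hvE
  · have h8 : s'.ints 8 = s.ints 8 := ha.int 8
    have e12 : s'.ints 12 0 = u := by
      rw [ha.int 12]; exact h12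
    refine Ev.straight (by rfl) ?_ (by decide)
    simp only [Program.exec, IExpr.eval, e12]
    exact ⟨h.1.trans (Grow.of_eq (by simp) (by simp) (by simp)), by simp [h8], by simpa using h.2⟩
  · nlinarith

end RealRAM

namespace RealRAM

open FreeSpace

/-- Looks for a visited node whose neighbours have not been visited. -/
def findNode : Program :=
  .seq (.setInt 12 (.const 0) (.const (-1)))
    (forLoop 13 (.add numN numM)
      (.ite (.and (.not (ieq (.get 6 (.var 13)) (.const 0))) (ieq (.get 8 (.var 13)) (.const 0)))
        (.setInt 12 (.const 0) (.var 13)) .skip))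

theorem findNode_spec : ∃ C, ∀ (I : Input) (s : Memory), Loaded I s →
    Ev findNode s (C * (I.n + I.m + 1)) (fun s' =>
      (s'.ints 12 0 = -1 ∧ ∀ u : ℕ, u < I.n + I.m → s.ints 6 u ≠ 0 → s.ints 8 u ≠ 0) ∨
      ∃ u : ℕ, u < I.n + I.m ∧ s'.ints 12 0 = u ∧ s.ints 6 u ≠ 0 ∧ s.ints 8 u = 0) := by
  refine ⟨100, fun I s H => ?_⟩
  refine Ev.seq' (P := fun s' => s'.ints 12 0 = -1) (T := 10) (T' := (I.n + I.m + 1) * 80)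
    (Ev.straight (by rfl) (by simp [Program.exec, IExpr.eval]) (by decide))
    (fun s1 ha h1 => ?_) (by nlinarith)
  have H1 : Loaded I s1 := H.of_agree ha
  have e6 : s1.ints 6 = s.ints 6 := ha.int 6
  have e8 : s1.ints 8 = s.ints 8 := ha.int 8
  refine forLoop_ev (I.n + I.m) 40 (fun k s' =>
    (s'.ints 12 0 = -1 ∧ ∀ u : ℕ, u < k → s.ints 6 u ≠ 0 → s.ints 8 u ≠ 0) ∨
    ∃ u : ℕ, u < I.n + I.m ∧ s'.ints 12 0 = u ∧ s.ints 6 u ≠ 0 ∧ s.ints 8 u = 0)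
    (fun s' h => by simp [IExpr.eval, (H1.of_agree h).n, (H1.of_agree h).m])
    (fun k s z h => by simpa using h) (Or.inl ⟨h1, by simp⟩) ?_ (fun s' _ h => h)
    (Nat.mul_le_mul_left _ (by decide))
  intro k hk s' h h13 hi
  have f6 : s'.ints 6 = s.ints 6 := (h.int 6).trans e6
  have f8 : s'.ints 8 = s.ints 8 := (h.int 8).trans e8
  refine Ev.straight (by rfl) ?_ (by decide)
  have hb : (Cond.and (.not (ieq (.get 6 (.var 13)) (.const 0)))
      (ieq (.get 8 (.var 13)) (.const 0))).Holds s' ↔ s.ints 6 k ≠ 0 ∧ s.ints 8 k = 0 := by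
    simp only [Cond.Holds, IExpr.eval, h13, f6, f8]; omega
  by_cases hb' : s.ints 6 k ≠ 0 ∧ s.ints 8 k = 0
  · rw [Program.exec_ite_pos (hb.2 hb')]
    exact Or.inr ⟨k, hk, by simp [Program.exec, IExpr.eval, h13], hb'⟩
  · rw [Program.exec_ite_neg (by rwa [hb])]
    rcases hi with ⟨a, b⟩ | h
    · refine Or.inl ⟨a, fun u hu h0 => ?_⟩
      rcases Nat.lt_succ_iff_lt_or_eq.1 hu with h | rfl
      · exact b u h h0
      · exact fun h => hb' ⟨h0, h⟩
    · exact Or.inr h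

/-- Marks in the class `c` everything that can be reached from the marked nodes. -/
def propagate (c : ℤ) : Program :=
  forLoop 15 (.add numN numM) (.seq findNode (.ite (.ile (.const 0) (.var 12)) (visit c) .skip))

/-- The nodes with all neighbours marked are flagged, the other marked nodes are in class `c`. -/
structure Pending (I : Input) (c : ℤ) (s : Memory) : Prop where
  cls : ∀ u : ℕ, u < I.n + I.m → s.ints 6 u ≠ 0 → s.ints 8 u = 0 → s.ints 7 u = c
  done : ∀ u : ℕ, u < I.n + I.m → s.ints 8 u ≠ 0 →
    s.ints 6 u ≠ 0 ∧ ∀ v : ℕ, v < I.n + I.m → I.Edge u v → s.ints 6 v ≠ 0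

def Saturated (I : Input) (s : Memory) : Prop :=
  ∀ u : ℕ, u < I.n + I.m → s.ints 6 u ≠ 0 → s.ints 8 u ≠ 0

def doneCount (N : ℕ) (s : Memory) : ℕ := ((Finset.range N).filter fun u : ℕ => s.ints 8 u ≠ 0).card

/-- Each round flags one more node unless all marked nodes are flagged already, so as many rounds as
there are nodes suffice. A round costs linear time: one scan for a node and one scan of its possible
neighbours. -/
theorem propagate_spec (c : ℤ) : ∃ C, ∀ (I : Input) (s : Memory), Loaded I s → Pending I c s →
    Ev (propagate c) s (C * (I.n + I.m + 1) ^ 2) (fun s' =>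
      Grow I c s s' ∧ Pending I c s' ∧ Saturated I s') := by
  obtain ⟨C₁, hC₁⟩ := findNode_spec
  obtain ⟨C₂, hC₂⟩ := visit_spec c
  refine ⟨C₁ + C₂ + 40, fun I s H hP => ?_⟩
  set N := I.n + I.m with hN
  refine forLoop_ev N ((C₁ + C₂ + 10) * (N + 1)) (fun k s' => Grow I c s s' ∧ Pending I c s' ∧
    (Saturated I s' ∨ k ≤ doneCount N s'))
    (fun s' h => by simp [IExpr.eval, (H.of_agree h).n, (H.of_agree h).m, hN])
    (fun k s z h => ⟨h.1.trans (Grow.of_eq (by simp) (by simp) (by simp)),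
      ⟨by simpa using h.2.1.cls, by simpa using h.2.1.done⟩,
      by simpa [Saturated, doneCount] using h.2.2⟩)
    ⟨Grow.of_eq rfl rfl rfl, hP, Or.inr (Nat.zero_le _)⟩ ?_ ?_ ?_
  · intro k hk s' ha _ ⟨g, hP', hk'⟩
    have H' : Loaded I s' := H.of_agree ha
    refine Ev.seq' (T' := C₂ * (N + 1) + 9) (hC₁ I s' H') (fun s1 ha1 h1 => ?_)
      (by rw [← hN]; nlinarith)
    · have e6 : s1.ints 6 = s'.ints 6 := ha1.int 6
      have e7 : s1.ints 7 = s'.ints 7 := ha1.int 7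
      have e8 : s1.ints 8 = s'.ints 8 := ha1.int 8
      have e4 : s1.reals 4 = s'.reals 4 := ha1.real 4
      have g1 : Grow I c s' s1 := Grow.of_eq e6 e7 e4
      refine Ev.ite (T := C₂ * (N + 1) + 1) (fun hb => ?_) (fun hb => ?_)
        (by simp only [Cond.cost, IExpr.cost]; omega)
      · simp only [Cond.Holds, IExpr.eval] at hb
        rcases h1 with ⟨h1, _⟩ | ⟨u, hu, h12, h6, h8⟩
        · omega
        have hc := hP'.cls u hu h6 h8
        refine (hC₂ I s1 u (H'.of_agree ha1) hu h12 (by rwa [e6]) (by rwa [e7])).mono (Nat.le_succ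
            _)
          fun s2 ⟨g2, f8, hnb⟩ => ?_
        have g3 : Grow I c s' s2 := g1.trans g2
        rw [e8] at f8
        refine ⟨g.trans g3, ⟨fun v hv hv6 hv8 => ?_, fun v hv hv8 => ?_⟩, Or.inr ?_⟩
        · have hvu : (v : ℤ) ≠ u := fun h => by
            rw [f8, h, Function.update_self] at hv8; omega
          rw [f8, Function.update_of_ne hvu] at hv8
          by_cases h0 : s'.ints 6 v = 0
          · rcases g3.new v hv h0 with h | h
            · exact absurd h.1 hv6
            · exact h.2
          · rw [(g3.old v hv h0).2.1]; exact hP'.cls v hv h0 hv8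
        · by_cases hvu : v = u
          · subst hvu
            exact ⟨by rwa [(g3.old v hv h6).1], hnb⟩
          · rw [f8, Function.update_of_ne (by exact_mod_cast hvu)] at hv8
            obtain ⟨a, b⟩ := hP'.done v hv hv8
            refine ⟨by rwa [(g3.old v hv a).1], fun w hw hE => ?_⟩
            have := b w hw hE
            rwa [(g3.old w hw this).1]
        -- The node `u` was not flagged before, so the set of flagged nodes grows strictly.
        · have hk2 : k ≤ doneCount N s' := hk'.resolve_left fun h => h u hu h6 h8
          refine Nat.succ_le_of_lt (lt_of_le_of_lt hk2 (Finset.card_lt_card ?_))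
          rw [Finset.ssubset_iff_of_subset]
          · refine ⟨u, ?_, by simp [h8]⟩
            rw [Finset.mem_filter, f8, Function.update_self]
            exact ⟨Finset.mem_range.2 hu, by decide⟩
          · intro v hv
            rw [Finset.mem_filter] at hv ⊢
            refine ⟨hv.1, ?_⟩
            rw [f8]
            by_cases hvu : (v : ℤ) = u
            · rw [hvu, Function.update_self]; decide
            · rw [Function.update_of_ne hvu]; exact hv.2
      · simp only [Cond.Holds, IExpr.eval] at hb
        rcases h1 with ⟨h1, h2⟩ | ⟨u, hu, h12, h6, h8⟩
        swap
        · omega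
        refine ⟨_, _, Runs.skip _, by omega, g.trans g1, ⟨?_, ?_⟩, Or.inl ?_⟩
        · rw [e6, e7, e8]; exact hP'.cls
        · rw [e6, e8]; exact hP'.done
        · unfold Saturated; rw [e6, e8]; exact h2
  · intro s' _ ⟨g, hP', h⟩
    refine ⟨g, hP', h.elim id fun h => ?_⟩
    have : (Finset.range N).filter (fun u : ℕ => s'.ints 8 u ≠ 0) = Finset.range N :=
      Finset.eq_of_subset_of_card_le (Finset.filter_subset _ _) (by rw [Finset.card_range]; exact h)
    intro u hu _
    have hu' := Finset.mem_range.2 hu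
    rw [← hN, ← this] at hu'
    exact (Finset.mem_filter.1 hu').2
  · simp only [IExpr.cost]; nlinarith

/-! ### Loops over the cells -/

/-- Executes `c` for all columns `i` and rows `j`, the values of the variables `10` and `11`. -/
def forCells (c : Program) : Program := forLoop 10 numN (forLoop 11 numM c)

/-- The invariant is indexed by the next cell; `hrow` passes from the end of a column of the diagram
to the start of the following one. -/
theorem forCells_ev {I : Input} {c : Program} {s : Memory} {T : ℕ} {Q : Memory → Prop} (H : Loaded
    I s)
    (B : ℕ) (Inv : ℕ → ℕ → Memory → Prop)
    (hInv : ∀ i j s A z, A = 10 ∨ A = 11 → Inv i j s → Inv i j (s.setInt A 0 z))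
    (h0 : Inv 0 0 s) (hrow : ∀ i s, Inv i I.m s → Inv (i + 1) 0 s)
    (hstep : ∀ i < I.n, ∀ j < I.m, ∀ s', Agree (forCells c).wI (forCells c).wR s s' →
      s'.ints 10 0 = i → s'.ints 11 0 = j → Inv i j s' → Ev c s' B (fun s'' => Inv i (j + 1) s''))
    (hQ : ∀ s', Agree (forCells c).wI (forCells c).wR s s' → Inv I.n 0 s' → Q s')
    (hT : (I.n + 1) * (I.m + 1) * (B + 60) ≤ T)
    (hv : c.wI.contains 10 = false := by rfl) (hv' : c.wI.contains 11 = false := by rfl)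
    (hW : (c.wI.all fun A => 4 ≤ A) = true := by rfl)
    (hR : (c.wR.all fun A => 2 ≤ A) = true := by rfl) :
    Ev (forCells c) s T Q := by
  have hv1 : 10 ∉ c.wI := fun h => by simp_all
  have hv2 : 11 ∉ c.wI := fun h => by simp_all
  have sub : ∀ s', Agree (10 :: (forLoop 11 numM c).wI) (forLoop 11 numM c).wR s s' →
      Agree (forCells c).wI (forCells c).wR s s' := fun s' h =>
    h.mono (by intro A; simp [forCells, forLoop, Program.wI]; tauto)
      (by intro A; simp [forCells, forLoop, Program.wR])
  have hl : ∀ s', Agree (forCells c).wI (forCells c).wR s s' → Loaded I s' :=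
    fun s' h => H.of_agree h
      (by simpa [forCells, forLoop, Program.wI] using hW)
      (by simpa [forCells, forLoop, Program.wR] using hR)
  refine forLoop_ev I.n ((I.m + 1) * (B + 3 + 20)) (fun i s' => Inv i 0 s')
    (fun s' h => by simp [IExpr.eval, (hl s' (sub s' h)).n])
    (fun i s z h => hInv _ _ _ _ _ (Or.inl rfl) h) h0 ?_
    (fun s' h hi => hQ s' (sub s' h) hi) (le_trans ?_ hT) (by simp [forLoop, Program.wI, hv1])
  · intro i hi s' h h10 hinv
    have sub' : ∀ s'', Agree (11 :: c.wI) c.wR s' s'' →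
        Agree (forCells c).wI (forCells c).wR s s'' := fun s'' h' =>
      (sub s' h).trans (h'.mono
        (by intro A; simp only [forCells, forLoop, Program.wI]; simp; tauto)
        (by intro A; simp [forCells, forLoop, Program.wR]))
    refine forLoop_ev I.m B (fun j s' => Inv i j s')
      (fun s'' h' => by simp [IExpr.eval, (hl s'' (sub' s'' h')).m])
      (fun j s z h => hInv _ _ _ _ _ (Or.inr rfl) h) hinv (fun j hj s'' h' h11 hinv' => ?_)
      (fun s'' _ hi => hrow i s'' hi)
      (Nat.mul_le_mul_left _ (by simp only [IExpr.cost]; omega)) hv'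
    refine hstep i hi j hj s'' (sub' s'' h') ?_ h11 hinv'
    rw [h'.ints 10 (by simp [hv1]), h10]
  · simp only [IExpr.cost]
    rw [mul_assoc]
    refine Nat.mul_le_mul_left _ ?_
    nlinarith

/-! ### Marking -/

/-- Marks the row of a mixed cell whose column is not marked. -/
def seed (c lbl : ℤ) : Program :=
  .seq (.setInt 14 (.const 0) (.const 0))
    (forCells
      (.ite (.and (ieq (.var 14) (.const 0)) (.and (ieq (.get 6 (.var 10)) (.const 0))
          (mixedC (.var 10) (.var 11))))
        (.seq (.setInt 14 (.const 0) (.const 1))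
          (.ite (upperC (.var 10) (.var 11))
            (setMarks (.add numN (.var 11)) c (.const lbl) (real (.const 0)))
            (setMarks (.add numN (.var 11)) c (.const (-lbl)) (real (.const 0)))))
        .skip))

/-- The result of `seed`: the row of some mixed cell has been marked. -/
def SeedSet (I : Input) (c lbl : ℤ) (s s' : Memory) : Prop :=
  ∃ i < I.n, ∃ j < I.m, s.ints 6 i = 0 ∧ I.Mixed i j ∧
    s'.ints 6 = Function.update (s.ints 6) ((I.n + j : ℕ) : ℤ) (lbl * I.upSign i j) ∧
    s'.ints 7 = Function.update (s.ints 7) ((I.n + j : ℕ) : ℤ) c ∧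
    s'.reals 4 = Function.update (s.reals 4) ((I.n + j : ℕ) : ℤ) 0

/-- `P` is the set of cells that have been examined, so that the same predicate serves as the loop
invariant and as the final result. -/
def SeedNone (I : Input) (P : ℕ → ℕ → Prop) (s s' : Memory) : Prop :=
  (s'.ints 6 = s.ints 6 ∧ s'.ints 7 = s.ints 7 ∧ s'.reals 4 = s.reals 4) ∧
    ∀ i < I.n, ∀ j < I.m, P i j → I.Mixed i j → s.ints 6 i ≠ 0

theorem seed_spec (c lbl : ℤ) : ∃ C, ∀ (I : Input) (s : Memory), Loaded I s →
    Ev (seed c lbl) s (C * ((I.n + 1) * (I.m + 1))) (fun s' =>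
      (s'.ints 14 0 = 1 ∧ SeedSet I c lbl s s') ∨
      (s'.ints 14 0 = 0 ∧ SeedNone I (fun _ _ => True) s s')) := by
  obtain ⟨B, hB⟩ : ∃ B, B = (Program.ite (.and (ieq (.var 14) (.const 0)) (.and (ieq (.get 6 (.var
      10)) (.const 0))
          (mixedC (.var 10) (.var 11))))
        (.seq (.setInt 14 (.const 0) (.const 1))
          (.ite (upperC (.var 10) (.var 11))
            (setMarks (.add numN (.var 11)) c (.const lbl) (real (.const 0)))
            (setMarks (.add numN (.var 11)) c (.const (-lbl)) (real (.const 0)))))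
        .skip).bound := ⟨_, rfl⟩
  refine ⟨B + 70, fun I s H => ?_⟩
  refine Ev.seq' (P := fun s' => s'.ints 14 0 = 0) (T := 10)
    (T' := (I.n + 1) * (I.m + 1) * (B + 60))
    (Ev.straight (by rfl) (by simp [Program.exec, IExpr.eval]) (by decide)) (fun s1 ha h1 => ?_) ?_
  · have H1 : Loaded I s1 := H.of_agree ha
    have e6 : s1.ints 6 = s.ints 6 := ha.int 6
    have e7 : s1.ints 7 = s.ints 7 := ha.int 7
    have e4 : s1.reals 4 = s.reals 4 := ha.real 4
    refine forCells_ev H1 B (fun i j s' =>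
      (s'.ints 14 0 = 1 ∧ SeedSet I c lbl s s') ∨
      (s'.ints 14 0 = 0 ∧ SeedNone I (fun i' j' => i' < i ∨ i' = i ∧ j' < j) s s'))
      ?_ (Or.inr ⟨h1, ⟨e6, e7, e4⟩, fun i _ j _ h => by omega⟩) ?_ ?_ ?_ le_rfl
    · rintro i j s A z (rfl | rfl) h
      all_goals simpa [SeedSet, SeedNone] using h
    · rintro i s (h | ⟨h, hs, h'⟩)
      · exact Or.inl h
      · refine Or.inr ⟨h, hs, fun i' hi j' hj hP hM => h' i' hi j' hj ?_ hM⟩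
        omega
    · intro i hi j hj s' ha' h10 h11 hinv
      have H' : Loaded I s' := H1.of_agree ha'
      have hei : (IExpr.var 10).eval s' = (i : ℤ) := by simp only [IExpr.eval, h10]
      have hej : (IExpr.var 11).eval s' = (j : ℤ) := by simp only [IExpr.eval, h11]
      have hmx := mixedC_holds H' hi hj hei hej
      have hup := upperC_holds H' hi hj hei hej
      refine Ev.straight (by rfl) ?_ hB.ge
      by_cases hb : s'.ints 14 0 = 0 ∧ s'.ints 6 i = 0 ∧ I.Mixed i j
      · obtain ⟨b1, b2, b3⟩ := hb
        have hb' : (Cond.and (ieq (.var 14) (.const 0)) (.and (ieq (.get 6 (.var 10)) (.const 0))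
            (mixedC (.var 10) (.var 11)))).Holds s' :=
          ⟨by simp [Cond.Holds, IExpr.eval, b1], by simp [Cond.Holds, IExpr.eval, h10, b2], hmx.2
              b3⟩
        rcases hinv with h | ⟨_, ⟨f6, f7, f4⟩, _⟩
        · omega
        left
        rw [Program.exec_ite_pos hb', Program.exec]
        have H'' : Loaded I ((Program.setInt 14 (.const 0) (.const 1)).exec s') :=
          H'.agree (fun A hA => by simp [Program.exec]; omega) (fun A hA => by simp [Program.exec])
        have hup' := upperC_holds H'' hi hj (ei := .var 10) (ej := .var 11)
          (by simp [Program.exec, IExpr.eval, h10]) (by simp [Program.exec, IExpr.eval, h11])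
        by_cases hU : I.Upper i j
        · rw [Program.exec_ite_pos (hup'.2 hU)]
          simp only [setMarks, Program.exec, IExpr.eval, RExpr.eval]
          refine ⟨by simp, i, hi, j, hj, by rwa [← f6], b3, ?_, ?_, ?_⟩ <;>
            simp [H'.n, h11, f6, f7, f4, Input.upSign, hU]
        · rw [Program.exec_ite_neg (by rwa [hup'])]
          simp only [setMarks, Program.exec, IExpr.eval, RExpr.eval]
          refine ⟨by simp, i, hi, j, hj, by rwa [← f6], b3, ?_, ?_, ?_⟩ <;>
            simp [H'.n, h11, f6, f7, f4, Input.upSign, hU]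
      · have hb' : ¬ (Cond.and (ieq (.var 14) (.const 0)) (.and (ieq (.get 6 (.var 10)) (.const 0))
            (mixedC (.var 10) (.var 11)))).Holds s' := by
          rintro ⟨c1, c2, c3⟩
          simp only [Cond.Holds, IExpr.eval, h10] at c1 c2
          exact hb ⟨by omega, by omega, hmx.1 c3⟩
        rw [Program.exec_ite_neg hb', Program.exec]
        rcases hinv with h | ⟨h, hs, h'⟩
        · exact Or.inl h
        · refine Or.inr ⟨h, hs, fun i' hi' j' hj' hP hM => ?_⟩
          by_cases heq : i' = i ∧ j' = j
          · obtain ⟨rfl, rfl⟩ := heq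
            intro h0
            exact hb ⟨h, by rwa [hs.1], hM⟩
          · exact h' i' hi' j' hj' (by omega) hM
    · rintro s' _ (h | ⟨h0, hs, h⟩)
      · exact Or.inl h
      · exact Or.inr ⟨h0, hs, fun i hi j hj _ hM => h i hi j hj (Or.inl hi) hM⟩
  · nlinarith

end RealRAM

namespace FreeSpace.Input

theorem Edge.symm {I : Input} {u v : ℕ} (h : I.Edge u v) : I.Edge v u := by
  rcases h with ⟨a, b, c⟩ | ⟨a, b, c⟩
  · exact Or.inr ⟨b, a, c⟩
  · exact Or.inl ⟨b, a, c⟩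

theorem Mixed.edge {I : Input} {i j : ℕ} (hi : i < I.n) (h : I.Mixed i j) : I.Edge i (I.n + j) :=
  Or.inl ⟨hi, Nat.le_add_right _ _, by rwa [Nat.add_sub_cancel_left]⟩

end FreeSpace.Input

namespace RealRAM

open FreeSpace

/-- Every marked node is flagged, and all neighbours of flagged nodes are marked. -/
structure Settled (I : Input) (s : Memory) : Prop where
  flag : Saturated I s
  done : ∀ u : ℕ, u < I.n + I.m → s.ints 8 u ≠ 0 →
    s.ints 6 u ≠ 0 ∧ ∀ v : ℕ, v < I.n + I.m → I.Edge u v → s.ints 6 v ≠ 0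

theorem Settled.known_iff {I : Input} {s : Memory} (h : Settled I s) {u v : ℕ}
    (hu : u < I.n + I.m) (hv : v < I.n + I.m) (hE : I.Edge u v) :
    s.ints 6 u ≠ 0 ↔ s.ints 6 v ≠ 0 :=
  ⟨fun h' => (h.done u hu (h.flag u hu h')).2 v hv hE,
    fun h' => (h.done v hv (h.flag v hv h')).2 u hu hE.symm⟩

def markClass (c lbl : ℤ) : Program :=
  .seq (seed c lbl) (.ite (.ile (.const 1) (.var 14)) (propagate c) .skip)

/-- From `s` to `s'`, a new class `c` has been marked. -/
structure NewClass (I : Input) (c lbl : ℤ) (s s' : Memory) : Prop where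
  settled : Settled I s'
  old : ∀ u : ℕ, u < I.n + I.m → s.ints 6 u ≠ 0 →
    s'.ints 6 u = s.ints 6 u ∧ s'.ints 7 u = s.ints 7 u ∧ s'.reals 4 u = s.reals 4 u
  new : ∀ u : ℕ, u < I.n + I.m → s.ints 6 u = 0 →
    (s'.ints 6 u = 0 ∧ s'.ints 7 u = s.ints 7 u) ∨ (s'.ints 6 u ≠ 0 ∧ s'.ints 7 u = c)
  seeded : ((∀ u : ℕ, u < I.n + I.m → s'.ints 7 u ≠ c) ∧
      ∀ i < I.n, ∀ j < I.m, I.Mixed i j → s.ints 6 i ≠ 0) ∨ I.Seeded (marks I s') c lbl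

/-- The marked nodes are closed under edges before the seed is chosen, so the new class is disjoint
from the old ones. The seed row gets position `0`, hence the new marks agree with any solution of
the right sign up to the position of that row. -/
theorem markClass_spec {c lbl : ℤ} (hl : lbl ≠ 0) : ∃ C, ∀ (I : Input) (s : Memory), Loaded I s →
    Settled I s → (∀ u : ℕ, u < I.n + I.m → s.ints 7 u ≠ c) →
    Ev (markClass c lbl) s (C * (I.n + I.m + 1) ^ 2) (fun s' => NewClass I c lbl s s') := by
  obtain ⟨C₁, hC₁⟩ := seed_spec c lbl
  obtain ⟨C₂, hC₂⟩ := propagate_spec c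
  refine ⟨C₁ + C₂ + 10, fun I s H hS hc => ?_⟩
  refine Ev.seq' (T' := 5 + (C₂ * (I.n + I.m + 1) ^ 2 + 1)) (hC₁ I s H) (fun s1 ha h1 => ?_) ?_
  swap
  · have : (I.n + 1) * (I.m + 1) ≤ (I.n + I.m + 1) ^ 2 := by nlinarith
    nlinarith
  have H1 : Loaded I s1 := H.of_agree ha
  have e8 : s1.ints 8 = s.ints 8 := ha.int 8
  refine Ev.ite (T := C₂ * (I.n + I.m + 1) ^ 2 + 1) (fun hb => ?_) (fun hb => ?_) le_rfl
  all_goals simp only [Cond.Holds, IExpr.eval] at hb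
  · obtain ⟨-, i, hi, j, hj, h0, hM, f6, f7, f4⟩ := h1.resolve_right (by omega)
    have hr : I.n + j < I.n + I.m := by omega
    have hiN : i < I.n + I.m := by omega
    have hE := hM.edge hi
    -- The search only tested the column of the seed; its row is unmarked because the two are
    -- adjacent.
    have hj0 : s.ints 6 ((I.n + j : ℕ) : ℤ) = 0 := by
      by_contra h
      exact (hS.known_iff hiN hr hE).2 h h0
    have hlu : lbl * I.upSign i j ≠ 0 := by
      rcases I.upSign_unit i j with h | h <;> rw [h] <;> omega
    have g6 : ∀ u : ℕ, u ≠ I.n + j → s1.ints 6 u = s.ints 6 u := fun u hu => by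
      rw [f6, Function.update_of_ne (by exact_mod_cast hu)]
    have g7 : ∀ u : ℕ, u ≠ I.n + j → s1.ints 7 u = s.ints 7 u := fun u hu => by
      rw [f7, Function.update_of_ne (by exact_mod_cast hu)]
    have g4 : ∀ u : ℕ, u ≠ I.n + j → s1.reals 4 u = s.reals 4 u := fun u hu => by
      rw [f4, Function.update_of_ne (by exact_mod_cast hu)]
    have n6 : s1.ints 6 ((I.n + j : ℕ) : ℤ) = lbl * I.upSign i j := by
      rw [f6, Function.update_self]
    have n7 : s1.ints 7 ((I.n + j : ℕ) : ℤ) = c := by rw [f7, Function.update_self]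
    have n4 : s1.reals 4 ((I.n + j : ℕ) : ℤ) = 0 := by rw [f4, Function.update_self]
    have hP : Pending I c s1 := by
      constructor
      · intro u hu h6 h8
        by_cases h : u = I.n + j
        · rw [h]; exact n7
        · rw [g6 u h] at h6
          rw [e8] at h8
          exact absurd h8 (hS.flag u hu h6)
      · intro u hu h8
        rw [e8] at h8
        obtain ⟨a, b⟩ := hS.done u hu h8
        have key : ∀ v : ℕ, s.ints 6 v ≠ 0 → s1.ints 6 v ≠ 0 := fun v hv => by
          rwa [g6 v (fun h => hv (by rw [h]; exact hj0))]
        exact ⟨key u a, fun v hv hE => key v (b v hv hE)⟩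
    refine (hC₂ I s1 H1 hP).mono (Nat.le_succ _) fun s2 ⟨g, hP2, hS2⟩ => ?_
    have st : Settled I s2 := ⟨hS2, hP2.done⟩
    obtain ⟨o6, o7, o4⟩ := g.old _ hr (by rwa [n6])
    refine ⟨st, fun u hu h => ?_, fun u hu h => ?_, Or.inr ⟨i, hi, j, hj, hM, ?_, ?_, ?_⟩⟩
    · have hne : u ≠ I.n + j := fun h' => h (by rw [h']; exact hj0)
      obtain ⟨a, b, d⟩ := g.old u hu (by rwa [g6 u hne])
      rw [a, b, d, g6 u hne, g7 u hne, g4 u hne]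
      exact ⟨rfl, rfl, rfl⟩
    · by_cases hne : u = I.n + j
      · right
        rw [hne, o6, o7, n6, n7]; exact ⟨hlu, rfl⟩
      · have := g.new u hu (by rwa [g6 u hne])
        rwa [g7 u hne] at this
    -- The column of the seed was unmarked and is adjacent to the marked row, so it has been marked
    -- in the course of this propagation and belongs to class `c`.
    · have hne : i ≠ I.n + j := by omega
      rcases g.new i hiN (by rwa [g6 i hne]) with h | h
      · exact absurd h.1 ((st.known_iff hiN hr hE).2 (by rwa [o6, n6]))
      · exact h.2
    · change s2.ints 7 _ = c
      rw [o7, n7]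
    · intro p q σ τ hSol hτ
      refine g.agrees p q σ τ _ hSol (agrees_iff.2 fun u hu h => ?_)
      by_cases hne : u = I.n + j
      · rw [hne, n6, n4]
        unfold Input.nodeSign Input.nodePos
        rw [if_neg (by omega), if_neg (by omega), Nat.add_sub_cancel_left, hτ]
        simp
      · rw [g7 u hne] at h
        exact absurd h (hc u hu)
  · obtain ⟨-, ⟨f6, f7, f4⟩, hM⟩ := h1.resolve_left (by omega)
    refine Ev.straight (by rfl) ?_ (Nat.le_add_left _ _)
    simp only [Program.exec]
    refine ⟨⟨?_, ?_⟩, fun u _ _ => by rw [f6, f7, f4]; exact ⟨rfl, rfl, rfl⟩,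
      fun u _ h => Or.inl (by rw [f6, f7]; exact ⟨h, rfl⟩),
      Or.inl ⟨by rwa [f7], fun i hi j hj h => hM i hi j hj trivial h⟩⟩
    · unfold Saturated; rw [e8, f6]; exact hS.flag
    · rw [e8, f6]; exact hS.done

/-- Marks the nodes that belong to an empty column or row. -/
def classify : Program :=
  .seq
    (forLoop 10 numN
      (.ite (.and (ieq (.get 6 (.var 10)) (.const 0)) (.not (fullC (.var 10) (.const 0))))
        (.setInt 7 (.var 10) (.const 3)) .skip))
    (forLoop 11 numM
      (.ite (.and (ieq (.get 6 (.add numN (.var 11))) (.const 0))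
          (.not (fullC (.const 0) (.var 11))))
        (.setInt 7 (.add numN (.var 11)) (.const 3)) .skip))

/-- The test for an empty column or row. -/
def NodeFull (I : Input) (u : ℕ) : Prop := if u < I.n then I.Full u 0 else I.Full 0 (u - I.n)

theorem classify_spec : ∃ C, ∀ (I : Input) (s : Memory), Loaded I s →
    Ev classify s (C * (I.n + I.m + 1)) (fun s' => ∀ u : ℕ, u < I.n + I.m →
      (s.ints 6 u = 0 ∧ ¬ NodeFull I u → s'.ints 7 u = 3) ∧
      (¬ (s.ints 6 u = 0 ∧ ¬ NodeFull I u) → s'.ints 7 u = s.ints 7 u)) := by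
  refine ⟨300, fun I s H => ?_⟩
  refine Ev.seq' (T := (I.n + 1) * (100 + 22)) (T' := (I.m + 1) * (100 + 22))
    (P := fun s' => ∀ u : ℕ, (u < I.n ∧ s.ints 6 u = 0 ∧ ¬ NodeFull I u → s'.ints 7 u = 3) ∧
      (¬ (u < I.n ∧ s.ints 6 u = 0 ∧ ¬ NodeFull I u) → s'.ints 7 u = s.ints 7 u))
    (forLoop_ev I.n 100 (fun k s' =>
      ∀ u : ℕ, (u < k ∧ s.ints 6 u = 0 ∧ ¬ NodeFull I u → s'.ints 7 u = 3) ∧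
      (¬ (u < k ∧ s.ints 6 u = 0 ∧ ¬ NodeFull I u) → s'.ints 7 u = s.ints 7 u))
      (fun s' h => by simp [IExpr.eval, (H.of_agree h).n]) (fun k s z h => by simpa using h)
      (fun u => ⟨by omega, fun _ => rfl⟩) ?_ (fun s' _ h => h) (Nat.mul_le_mul_left _ (by decide)))
    (fun s1 ha h1 => ?_) (by nlinarith)
  · intro k hk s' h h10 hi
    have H' : Loaded I s' := H.of_agree h
    have f6 : s'.ints 6 = s.ints 6 := h.int 6
    have hf := fullC_holds H' hk I.m_pos (ei := .var 10) (ej := .const 0) (by simp [IExpr.eval,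
        h10])
      (by simp [IExpr.eval])
    refine Ev.straight (by rfl) ?_ (by decide)
    have hb : (Cond.and (ieq (.get 6 (.var 10)) (.const 0))
        (.not (fullC (.var 10) (.const 0)))).Holds s' ↔ s.ints 6 k = 0 ∧ ¬ NodeFull I k := by
      unfold NodeFull
      rw [if_pos hk, ← hf]
      refine and_congr ?_ Iff.rfl
      simp only [Cond.Holds, IExpr.eval, h10, f6]; omega
    intro u
    have hlt : u < k + 1 ↔ u < k ∨ u = k := Nat.lt_succ_iff_lt_or_eq
    by_cases hb' : s.ints 6 k = 0 ∧ ¬ NodeFull I k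
    · rw [Program.exec_ite_pos (hb.2 hb')]
      simp only [Program.exec, IExpr.eval, h10, Memory.setInt_ints, if_true]
      by_cases huk : u = k
      · subst huk
        rw [Function.update_self]
        exact ⟨fun _ => rfl, fun hn => absurd ⟨Nat.lt_succ_self _, hb'⟩ hn⟩
      · rw [Function.update_of_ne (by exact_mod_cast huk), hlt]
        simpa [huk] using hi u
    · rw [Program.exec_ite_neg (by rwa [hb]), Program.exec]
      by_cases huk : u = k
      · subst huk
        exact ⟨fun h => absurd h.2 hb', fun _ => (hi u).2 (fun h => by omega)⟩
      · rw [hlt]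
        simpa [huk] using hi u
  · have H1 : Loaded I s1 := H.of_agree ha
    have e6 : s1.ints 6 = s.ints 6 := ha.int 6
    refine forLoop_ev I.m 100 (fun k s' =>
      ∀ u : ℕ, (u < I.n + k ∧ s.ints 6 u = 0 ∧ ¬ NodeFull I u → s'.ints 7 u = 3) ∧
      (¬ (u < I.n + k ∧ s.ints 6 u = 0 ∧ ¬ NodeFull I u) → s'.ints 7 u = s.ints 7 u))
      (fun s' h => by simp [IExpr.eval, (H1.of_agree h).m]) (fun k s z h => by simpa using h)
      h1 ?_ (fun s' _ h u hu => ⟨fun h' => (h u).1 ⟨hu, h'⟩, fun h' => (h u).2 fun h'' => h' h''.2⟩)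
      (Nat.mul_le_mul_left _ (by decide))
    intro k hk s' h h11 hi
    have H' : Loaded I s' := H1.of_agree h
    have f6 : s'.ints 6 = s.ints 6 := (h.int 6).trans e6
    have hf := fullC_holds H' I.n_pos hk (ei := .const 0) (ej := .var 11) (by simp [IExpr.eval])
      (by simp [IExpr.eval, h11])
    refine Ev.straight (by rfl) ?_ (by decide)
    have hu0 : (IExpr.add numN (.var 11)).eval s' = ((I.n + k : ℕ) : ℤ) := by
      simp only [IExpr.eval, h11, H'.n]; push_cast; rfl
    have hb : (Cond.and (ieq (.get 6 (.add numN (.var 11))) (.const 0))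
        (.not (fullC (.const 0) (.var 11)))).Holds s' ↔
        s.ints 6 ((I.n + k : ℕ) : ℤ) = 0 ∧ ¬ NodeFull I (I.n + k) := by
      unfold NodeFull
      rw [if_neg (by omega), Nat.add_sub_cancel_left, ← hf]
      refine and_congr ?_ Iff.rfl
      change s'.ints 6 ((IExpr.add numN (.var 11)).eval s') ≤ 0 ∧
        0 ≤ s'.ints 6 ((IExpr.add numN (.var 11)).eval s') ↔ _
      rw [hu0, f6]; omega
    intro u
    have hlt : u < I.n + (k + 1) ↔ u < I.n + k ∨ u = I.n + k := by omega
    by_cases hb' : s.ints 6 ((I.n + k : ℕ) : ℤ) = 0 ∧ ¬ NodeFull I (I.n + k)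
    · rw [Program.exec_ite_pos (hb.2 hb')]
      simp only [Program.exec, hu0, Memory.setInt_ints, if_true]
      by_cases huk : u = I.n + k
      · subst huk
        rw [Function.update_self]
        exact ⟨fun _ => rfl, fun hn => absurd ⟨by omega, hb'⟩ hn⟩
      · rw [Function.update_of_ne (by exact_mod_cast huk), hlt]
        simpa [huk] using hi u
    · rw [Program.exec_ite_neg (by rwa [hb]), Program.exec]
      by_cases huk : u = I.n + k
      · subst huk
        exact ⟨fun h => absurd h.2 hb', fun _ => (hi _).2 (fun h => by omega)⟩
      · rw [hlt]
        simpa [huk] using hi u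

theorem seeded_congr {I : Input} {c lbl : ℤ} {s s' : Memory} (h : I.Seeded (marks I s) c lbl)
    (h7 : ∀ u : ℕ, u < I.n + I.m → (s'.ints 7 u = c ↔ s.ints 7 u = c))
    (h64 : ∀ u : ℕ, u < I.n + I.m → s.ints 7 u = c →
      s'.ints 6 u = s.ints 6 u ∧ s'.reals 4 u = s.reals 4 u) :
    I.Seeded (marks I s') c lbl := by
  obtain ⟨i, hi, j, hj, hM, hc, hr, hA⟩ := h
  refine ⟨i, hi, j, hj, hM, (h7 i (by omega)).2 hc, (h7 (I.n + j) (by omega)).2 hr,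
    fun p q σ τ hS hτ => agrees_iff.2 fun u hu hu7 => ?_⟩
  have hu7' := (h7 u hu).1 hu7
  rw [(h64 u hu hu7').1, (h64 u hu hu7').2]
  exact agrees_iff.1 (hA p q σ τ hS hτ) u hu hu7'

/-- Two classes suffice: by `boundaryCell_connected` a realizable diagram has no further components
of mixed cells. Further components need not be detected, since the curves are verified in the end.
-/
def mark : Program := .seq (markClass 1 1) (.seq (markClass 2 (-1)) classify)

theorem mark_spec : ∃ C, ∀ (I : Input) (s : Memory), Loaded I s → s.ints 6 = 0 → s.ints 7 = 0 →
    s.ints 8 = 0 → Ev mark s (C * (I.n + I.m + 1) ^ 2) (fun s' => I.Marked (marks I s')) := by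
  obtain ⟨C₁, hC₁⟩ := markClass_spec (c := 1) (lbl := 1) (by decide)
  obtain ⟨C₂, hC₂⟩ := markClass_spec (c := 2) (lbl := -1) (by decide)
  obtain ⟨C₃, hC₃⟩ := classify_spec
  refine ⟨C₁ + C₂ + C₃, fun I s H z6 z7 z8 => ?_⟩
  set N := I.n + I.m with hN
  refine Ev.seq' (T' := (C₂ + C₃) * (N + 1) ^ 2) (hC₁ I s H ⟨?_, ?_⟩ ?_) (fun s1 a1 h1 => ?_)
    (by rw [← hN]; nlinarith)
  · intro u _ h; simp [z6] at h
  · intro u _ h; simp [z8] at h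
  · intro u _; simp [z7]
  have H1 : Loaded I s1 := H.of_agree a1
  have k1 : ∀ u : ℕ, u < N → (s1.ints 6 u = 0 ∧ s1.ints 7 u = 0) ∨
      (s1.ints 6 u ≠ 0 ∧ s1.ints 7 u = 1) := fun u hu => by
    have := h1.new u hu (by simp [z6])
    simpa [z7] using this
  refine Ev.seq' (T' := C₃ * (N + 1) ^ 2) (hC₂ I s1 H1 h1.settled ?_) (fun s2 a2 h2 => ?_)
    (by rw [← hN]; nlinarith)
  · intro u hu; rcases k1 u hu with h | h <;> omega
  have H2 : Loaded I s2 := H1.of_agree a2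
  have k2 : ∀ u : ℕ, u < N → (s2.ints 6 u = 0 ∧ s2.ints 7 u = 0) ∨
      (s2.ints 6 u ≠ 0 ∧ (s2.ints 7 u = 1 ∨ s2.ints 7 u = 2)) := fun u hu => by
    rcases k1 u hu with ⟨a, b⟩ | ⟨a, b⟩
    · rcases h2.new u hu a with ⟨d, e⟩ | ⟨d, e⟩
      · exact Or.inl ⟨d, e.trans b⟩
      · exact Or.inr ⟨d, Or.inr e⟩
    · obtain ⟨d, e, -⟩ := h2.old u hu a
      exact Or.inr ⟨by rwa [d], Or.inl (e.trans b)⟩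
  have one2 : ∀ u : ℕ, u < N → (s2.ints 7 u = 1 ↔ s1.ints 6 u ≠ 0) := fun u hu => by
    rcases k1 u hu with ⟨a, b⟩ | ⟨a, b⟩
    · refine ⟨fun h => ?_, fun h => absurd a h⟩
      rcases h2.new u hu a with ⟨d, e⟩ | ⟨d, e⟩ <;> omega
    · exact ⟨fun _ => a, fun _ => (h2.old u hu a).2.1.trans b⟩
  refine (hC₃ I s2 H2).agree.mono (Nat.mul_le_mul_left _ (Nat.le_self_pow two_ne_zero _)) fun s3
      ⟨h3, a3⟩ => ?_
  have f6 : s3.ints 6 = s2.ints 6 := a3.int 6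
  have f4 : s3.reals 4 = s2.reals 4 := a3.real 4
  have k3 : ∀ u : ℕ, u < N → (s3.ints 6 u = 0 ∧ s3.ints 7 u = 0 ∧ NodeFull I u) ∨
      (s3.ints 6 u = 0 ∧ s3.ints 7 u = 3 ∧ ¬ NodeFull I u) ∨
      (s3.ints 6 u ≠ 0 ∧ s3.ints 7 u = s2.ints 7 u ∧ (s2.ints 7 u = 1 ∨ s2.ints 7 u = 2)) :=
    fun u hu => by
      rw [f6]
      obtain ⟨b1, b2⟩ := h3 u hu
      rcases k2 u hu with ⟨d, e⟩ | ⟨d, e⟩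
      · by_cases hf : NodeFull I u
        · exact Or.inl ⟨d, (b2 fun h => h.2 hf).trans e, hf⟩
        · exact Or.inr (Or.inl ⟨d, b1 ⟨d, hf⟩, hf⟩)
      · exact Or.inr (Or.inr ⟨d, b2 fun h => d h.1, e⟩)
  have one3 : ∀ u : ℕ, u < N → (s3.ints 7 u = 1 ↔ s2.ints 7 u = 1) := fun u hu => by
    have := k3 u hu; have := k2 u hu; rw [f6] at *; omega
  have two3 : ∀ u : ℕ, u < N → (s3.ints 7 u = 2 ↔ s2.ints 7 u = 2) := fun u hu => by
    have := k3 u hu; have := k2 u hu; rw [f6] at *; omega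
  -- Both propagations ended with a set of nodes that is closed under edges, so adjacent nodes
  -- belong to the same class.
  have hedge : ∀ u v : ℕ, u < N → v < N → I.Edge u v →
      (s3.ints 7 u = 1 ↔ s3.ints 7 v = 1) ∧ (s3.ints 7 u = 2 ↔ s3.ints 7 v = 2) := by
    intro u v hu hv hE
    have e1 := h1.settled.known_iff hu hv hE
    have e2 := h2.settled.known_iff hu hv hE
    have o1 := one2 u hu
    have o2 := one2 v hv
    rw [one3 u hu, one3 v hv, two3 u hu, two3 v hv]
    have := k2 u hu
    have := k2 v hv
    omega
  have col : ∀ i, i < I.n → (NodeFull I i ↔ I.Full i 0) := fun i hi => by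
    unfold NodeFull; rw [if_pos hi]
  have row : ∀ j, NodeFull I (I.n + j) ↔ I.Full 0 j := fun j => by
    unfold NodeFull; rw [if_neg (by omega), Nat.add_sub_cancel_left]
  constructor
  · intro i hi
    change s3.ints 7 i = 0 ∨ s3.ints 7 i = 1 ∨ s3.ints 7 i = 2 ∨ s3.ints 7 i = 3
    have := k3 i (by omega); omega
  · intro j hj
    change s3.ints 7 ((I.n + j : ℕ) : ℤ) = 0 ∨ s3.ints 7 ((I.n + j : ℕ) : ℤ) = 1 ∨
      s3.ints 7 ((I.n + j : ℕ) : ℤ) = 2 ∨ s3.ints 7 ((I.n + j : ℕ) : ℤ) = 3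
    have := k3 (I.n + j) (by omega); omega
  · intro i hi
    change s3.ints 7 i = 0 ∨ s3.ints 7 i = 3 → s3.ints 6 i = 0
    have := k3 i (by omega); omega
  · intro j hj
    change s3.ints 7 ((I.n + j : ℕ) : ℤ) = 0 ∨ s3.ints 7 ((I.n + j : ℕ) : ℤ) = 3 →
      s3.ints 6 ((I.n + j : ℕ) : ℤ) = 0
    have := k3 (I.n + j) (by omega); omega
  · intro i hi
    change (s3.ints 7 i = 0 → I.Full i 0) ∧ (s3.ints 7 i = 3 → ¬ I.Full i 0)
    rw [← col i hi]
    rcases k3 i (by omega) with ⟨-, b, d⟩ | ⟨-, b, d⟩ | ⟨-, b, d⟩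
    · exact ⟨fun _ => d, fun h => by omega⟩
    · exact ⟨fun h => by omega, fun _ => d⟩
    · exact ⟨fun h => by omega, fun h => by omega⟩
  · intro j hj
    change (s3.ints 7 ((I.n + j : ℕ) : ℤ) = 0 → I.Full 0 j) ∧
      (s3.ints 7 ((I.n + j : ℕ) : ℤ) = 3 → ¬ I.Full 0 j)
    rw [← row j]
    rcases k3 (I.n + j) (by omega) with ⟨-, b, d⟩ | ⟨-, b, d⟩ | ⟨-, b, d⟩
    · exact ⟨fun _ => d, fun h => by omega⟩
    · exact ⟨fun h => by omega, fun _ => d⟩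
    · exact ⟨fun h => by omega, fun h => by omega⟩
  · intro i hi j hj hM
    exact hedge i (I.n + j) (by omega) (by omega) (hM.edge hi)
  · rcases h1.seeded with ⟨b1, b2⟩ | h
    · left
      have none : ∀ u : ℕ, u < N → s3.ints 7 u ≠ 1 := fun u hu h => by
        have h6 := (one2 u hu).1 ((one3 u hu).1 h)
        have := k1 u hu
        have := b1 u hu
        omega
      exact ⟨fun i hi => none i (by omega), fun j hj => none (I.n + j) (by omega),
        fun i hi j hj hM => absurd (by simp [z6]) (b2 i hi j hj hM)⟩
    · right
      refine seeded_congr h (fun u hu => ?_) (fun u hu hc => ?_)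
      · rw [one3 u hu, one2 u hu]
        have := k1 u hu; omega
      · have h6 : s1.ints 6 u ≠ 0 := by have := k1 u hu; omega
        obtain ⟨b, -, d⟩ := h2.old u hu h6
        rw [f6, f4]; exact ⟨b, d⟩
  · rcases h2.seeded with ⟨b1, b2⟩ | h
    · left
      have none : ∀ u : ℕ, u < N → s3.ints 7 u ≠ 2 := fun u hu h =>
        b1 u hu ((two3 u hu).1 h)
      exact ⟨fun i hi => none i (by omega), fun j hj => none (I.n + j) (by omega),
        fun i hi j hj hM => (one3 i (by omega)).2 ((one2 i (by omega)).2 (b2 i hi j hj hM))⟩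
    · right
      exact seeded_congr h (fun u hu => two3 u hu) (fun u _ _ => by rw [f6, f4]; exact ⟨rfl, rfl⟩)

end RealRAM

/-! ### Updating the extremes of a class segment by segment -/

namespace FreeSpace.Line

variable {L : Line} {c : ℤ} {mn mx d₁ d₂ : ℝ} {k : ℕ}

/-- The first `k` segments. -/
def take (L : Line) (k : ℕ) : Line := { L with N := k }

theorem Extremes.skip (H : (L.take k).Extremes c mn mx d₁ d₂) (hc : L.cls k ≠ c) :
    (L.take (k + 1)).Extremes c mn mx d₁ d₂ := by
  have key : ∀ i, i < k + 1 → L.cls i = c → i < k := fun i hi h => by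
    rcases Nat.lt_succ_iff_lt_or_eq.1 hi with h' | rfl
    · exact h'
    · exact absurd h hc
  constructor
  · rintro ⟨i, hi, h⟩
    obtain ⟨a, ⟨i1, hi1, b⟩, ⟨i2, hi2, d⟩⟩ := H.1 ⟨i, key i hi h, h⟩
    exact ⟨fun i hi h => a i (key i hi h) h, ⟨i1, Nat.lt_succ_of_lt hi1, b⟩,
      ⟨i2, Nat.lt_succ_of_lt hi2, d⟩⟩
  · exact fun h => H.2 fun i hi => h i (Nat.lt_succ_of_lt hi)

theorem Extremes.first (hn : ∀ i < k, L.cls i ≠ c) (hc : L.cls k = c) :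
    (L.take (k + 1)).Extremes c (min (L.pos k) (L.pos k + L.sg k * L.len k))
      (max (L.pos k) (L.pos k + L.sg k * L.len k)) d₁ d₂ := by
  refine ⟨fun _ => ⟨fun i hi h => ?_, ⟨k, Nat.lt_succ_self k, hc, min_choice _ _⟩,
    ⟨k, Nat.lt_succ_self k, hc, max_choice _ _⟩⟩, fun h => absurd hc (h k (Nat.lt_succ_self k))⟩
  rcases Nat.lt_succ_iff_lt_or_eq.1 hi with h' | rfl
  · exact absurd h (hn i h')
  · exact ⟨⟨min_le_left _ _, min_le_right _ _⟩, le_max_left _ _, le_max_right _ _⟩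

theorem Extremes.next (H : (L.take k).Extremes c mn mx d₁ d₂) (hn : ∃ i < k, L.cls i = c)
    (hc : L.cls k = c) :
    (L.take (k + 1)).Extremes c (min mn (min (L.pos k) (L.pos k + L.sg k * L.len k)))
      (max mx (max (L.pos k) (L.pos k + L.sg k * L.len k))) d₁ d₂ := by
  obtain ⟨a, ⟨i1, hi1, hc1, b⟩, ⟨i2, hi2, hc2, d⟩⟩ := H.1 hn
  refine ⟨fun _ => ⟨fun i hi h => ?_, ?_, ?_⟩, fun h => absurd hc (h k (Nat.lt_succ_self k))⟩
  · rcases Nat.lt_succ_iff_lt_or_eq.1 hi with h' | rfl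
    · obtain ⟨⟨a1, a2⟩, a3, a4⟩ := a i h' h
      exact ⟨⟨(min_le_left _ _).trans a1, (min_le_left _ _).trans a2⟩,
        a3.trans (le_max_left _ _), a4.trans (le_max_left _ _)⟩
    · exact ⟨⟨(min_le_right _ _).trans (min_le_left _ _),
        (min_le_right _ _).trans (min_le_right _ _)⟩,
        (le_max_left _ _).trans (le_max_right _ _), (le_max_right _ _).trans (le_max_right _ _)⟩
  · rcases min_choice mn (min (L.pos k) (L.pos k + L.sg k * L.len k)) with h | h <;> rw [h]
    · exact ⟨i1, Nat.lt_succ_of_lt hi1, hc1, b⟩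
    · exact ⟨k, Nat.lt_succ_self k, hc, min_choice _ _⟩
  · rcases max_choice mx (max (L.pos k) (L.pos k + L.sg k * L.len k)) with h | h <;> rw [h]
    · exact ⟨i2, Nat.lt_succ_of_lt hi2, hc2, d⟩
    · exact ⟨k, Nat.lt_succ_self k, hc, max_choice _ _⟩

end FreeSpace.Line

namespace RealRAM

open FreeSpace

/-- The line `L` is stored in the memory, with its lengths in the array `A` and the remaining data
in the arrays of the marks, starting at `off`. -/
structure Reads (L : Line) (N off : IExpr) (A : ℕ) (s : Memory) : Prop where
  arr : A < 4
  N_eval : ∀ s' : Memory, s'.ints 0 = s.ints 0 → N.eval s' = L.N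
  off_eval : ∀ s' : Memory, s'.ints 0 = s.ints 0 → off.eval s' = off.eval s
  len : ∀ i < L.N, s.ints A i = L.len i
  cls : ∀ i < L.N, s.ints 7 (off.eval s + i) = L.cls i
  sg : ∀ i < L.N, s.ints 6 (off.eval s + i) = L.sg i
  pos : ∀ i < L.N, s.reals 4 (off.eval s + i) = L.pos i

theorem Reads.agree {L : Line} {N off : IExpr} {A : ℕ} {s s' : Memory} (H : Reads L N off A s)
    (h03 : ∀ B < 4, s'.ints B = s.ints B) (h6 : s'.ints 6 = s.ints 6) (h7 : s'.ints 7 = s.ints 7)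
    (h4 : s'.reals 4 = s.reals 4) : Reads L N off A s' := by
  have h0 := h03 0 (by omega)
  have hA := h03 A H.arr
  have ho := H.off_eval s' h0
  refine ⟨H.arr, fun s'' h => H.N_eval s'' (h.trans h0), fun s'' h => ?_, ?_, ?_, ?_, ?_⟩
  · rw [H.off_eval s'' (h.trans h0), ho]
  · rw [hA]; exact H.len
  · rw [h7, ho]; exact H.cls
  · rw [h6, ho]; exact H.sg
  · rw [h4, ho]; exact H.pos

theorem Reads.of_agree {L : Line} {N off : IExpr} {A : ℕ} {s s' : Memory} {W R : List ℕ}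
    (H : Reads L N off A s) (ha : Agree W R s s')
    (hW : (W.all fun B => 4 ≤ B && B != 6 && B != 7) = true := by rfl)
    (hR : (R.contains 4) = false := by rfl) : Reads L N off A s' := by
  rw [List.all_eq_true] at hW
  have hr : 4 ∉ R := fun h => by simp_all
  refine H.agree (fun B hB => ha.ints B fun h => ?_) (ha.ints 6 fun h => ?_) (ha.ints 7 fun h => ?_)
    (ha.reals 4 hr)
  · have := hW B h
    simp only [Bool.and_eq_true, decide_eq_true_eq] at this
    omega
  · simpa using hW 6 h
  · simpa using hW 7 h

theorem Loaded.reads_col {I : Input} {s : Memory} (H : Loaded I s) :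
    Reads (I.colLine (marks I s)) numN (.const 0) 1 s where
  arr := by decide
  N_eval s' h := by simp only [IExpr.eval, h, H.n, Input.colLine]
  off_eval s' _ := rfl
  len := H.w
  cls i _ := by simp only [IExpr.eval, zero_add, Input.colLine, marks]
  sg i _ := by simp only [IExpr.eval, zero_add, Input.colLine, marks]
  pos i _ := by simp only [IExpr.eval, zero_add, Input.colLine, marks]

theorem Loaded.reads_row {I : Input} {s : Memory} (H : Loaded I s) :
    Reads (I.rowLine (marks I s)) numM numN 2 s where
  arr := by decide
  N_eval s' h := by simp only [IExpr.eval, h, H.m, Input.rowLine]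
  off_eval s' h := by simp only [IExpr.eval, h]
  len := H.h
  cls i _ := by simp only [IExpr.eval, H.n, Input.rowLine, marks]; push_cast; rfl
  sg i _ := by simp only [IExpr.eval, H.n, Input.rowLine, marks]; push_cast; rfl
  pos i _ := by simp only [IExpr.eval, H.n, Input.rowLine, marks]; push_cast; rfl

/-! ### Extremes and sums -/

def absorb (x : RExpr) : Program :=
  .seq (.ite (.rle x (.var 20)) (.setReal 20 (.const 0) x) .skip)
    (.ite (.rle (.var 21) x) (.setReal 21 (.const 0) x) .skip)

theorem absorb_exec {x : RExpr} {s : Memory} {v : ℝ}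
    (hx : ∀ s', Agree [] [20, 21] s s' → x.eval s' = v) :
    ((absorb x).exec s).reals 20 0 = min (s.reals 20 0) v ∧
    ((absorb x).exec s).reals 21 0 = max (s.reals 21 0) v ∧
    Agree [] [20, 21] s ((absorb x).exec s) := by
  have h1 : ∀ s', Agree [] [20, 21] s s' → s'.reals 21 = s.reals 21 →
      ((Program.ite (.rle (.var 21) x) (.setReal 21 (.const 0) x) .skip).exec s').reals 20 =
        s'.reals 20 ∧
      ((Program.ite (.rle (.var 21) x) (.setReal 21 (.const 0) x) .skip).exec s').reals 21 0 =
        max (s.reals 21 0) v ∧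
      Agree [] [20, 21] s
        ((Program.ite (.rle (.var 21) x) (.setReal 21 (.const 0) x) .skip).exec s') := by
    intro s' ha h21
    have e := hx s' ha
    by_cases h : s.reals 21 0 ≤ v
    · rw [Program.exec_ite_pos (by simpa only [Cond.Holds, e, RExpr.eval, IExpr.eval, h21] using h)]
      simp only [Program.exec, IExpr.eval, e]
      refine ⟨by simp, by simp [h], ha.trans ⟨fun A _ => by simp, fun A hA => ?_⟩⟩
      simp only [List.mem_cons, not_or] at hA
      simp [hA.2.1]
    · rw [Program.exec_ite_neg (by simpa only [Cond.Holds, e, RExpr.eval, IExpr.eval, h21] using h)]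
      rw [Program.exec]
      exact ⟨rfl, by rw [h21, max_eq_left (le_of_not_ge h)], ha⟩
  have e := hx s (Agree.refl _ _ _)
  obtain ⟨s₁, hs₁⟩ : ∃ s₁, s₁ =
    (Program.ite (.rle x (.var 20)) (.setReal 20 (.const 0) x) .skip).exec s := ⟨_, rfl⟩
  have h0 : s₁.reals 20 0 = min (s.reals 20 0) v ∧ s₁.reals 21 = s.reals 21 ∧
      Agree [] [20, 21] s s₁ := by
    rw [hs₁]
    by_cases h : v ≤ s.reals 20 0
    · rw [Program.exec_ite_pos (by simpa only [Cond.Holds, e, RExpr.eval, IExpr.eval] using h)]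
      simp only [Program.exec, IExpr.eval, e]
      refine ⟨by simp [h], by simp, fun A _ => rfl, fun A hA => ?_⟩
      simp only [List.mem_cons, not_or] at hA
      simp [hA.1]
    · rw [Program.exec_ite_neg (by simpa only [Cond.Holds, e, RExpr.eval, IExpr.eval] using h),
        Program.exec]
      exact ⟨by rw [min_eq_left (le_of_not_ge h)], rfl, Agree.refl _ _ _⟩
  obtain ⟨a, b, d⟩ := h1 s₁ h0.2.2 h0.2.1
  rw [absorb, Program.exec, ← hs₁]
  exact ⟨by rw [a]; exact h0.1, b, d⟩

abbrev startE (off : IExpr) : RExpr := .get 4 (.add off (.var 10))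
abbrev stopE (off : IExpr) (A : ℕ) : RExpr :=
  .add (startE off) (.mul (real (.get 6 (.add off (.var 10)))) (real (.get A (.var 10))))

/-- Computes the extremes of class `c` in the real variables `20` and `21`. -/
def extremes (c : ℤ) (N off : IExpr) (A : ℕ) (d₁ d₂ : RExpr) : Program :=
  .seq (.seq (.setReal 20 (.const 0) d₁) (.setReal 21 (.const 0) d₂))
    (.seq (.setInt 20 (.const 0) (.const 0))
    (forLoop 10 N
      (.ite (ieq (.get 7 (.add off (.var 10))) (.const c))
        (.seq
          (.ite (ieq (.var 20) (.const 0))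
            (.seq (.setInt 20 (.const 0) (.const 1))
              (.seq (.setReal 20 (.const 0) (startE off)) (.setReal 21 (.const 0) (startE off))))
            .skip)
          (.seq (absorb (startE off)) (absorb (stopE off A))))
        .skip)))

theorem extremes_spec (c : ℤ) (N off : IExpr) (A : ℕ) (d₁ d₂ : RExpr) : ∃ C, ∀ (L : Line)
    (s : Memory) (v₁ v₂ : ℝ), Reads L N off A s →
    (∀ s', Agree [] [20, 21] s s' → d₁.eval s' = v₁ ∧ d₂.eval s' = v₂) →
    Ev (extremes c N off A d₁ d₂) s (C * (L.N + 1))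
      (fun s' => L.Extremes c (s'.reals 20 0) (s'.reals 21 0) v₁ v₂) := by
  obtain ⟨B, hB⟩ : ∃ B, B = (Program.ite (ieq (.get 7 (.add off (.var 10))) (.const c))
        (.seq
          (.ite (ieq (.var 20) (.const 0))
            (.seq (.setInt 20 (.const 0) (.const 1))
              (.seq (.setReal 20 (.const 0) (startE off)) (.setReal 21 (.const 0) (startE off))))
            .skip)
          (.seq (absorb (startE off)) (absorb (stopE off A))))
        .skip).bound := ⟨_, rfl⟩
  refine ⟨(d₁.cost + d₂.cost + 20) + (B + N.cost + 20), fun L s v₁ v₂ H hd => ?_⟩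
  refine Ev.seq' (T := d₁.cost + d₂.cost + 10) (T' := 5 + (L.N + 1) * (B + N.cost + 20))
    (P := fun s' => s'.reals 20 0 = v₁ ∧ s'.reals 21 0 = v₂)
    (Ev.straight (by rfl) ?_ (by simp only [Program.bound, IExpr.cost]; omega))
    (fun s1 a1 h1 => ?_) (by nlinarith)
  · simp only [Program.exec, IExpr.eval]
    rw [(hd s (Agree.refl _ _ _)).1, (hd (s.setReal 20 0 v₁) ⟨fun B _ => rfl, fun B hB => by
      simp only [List.mem_cons, not_or] at hB
      simp [hB.1]⟩).2]
    simp
  refine Ev.seq' (T := 5) (P := fun s' => s'.ints 20 0 = 0)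
    (Ev.straight (by rfl) (by simp [Program.exec, IExpr.eval]) (by decide))
    (fun s2 a2 h2 => ?_) le_rfl
  have H2 : Reads L N off A s2 := (H.of_agree a1).of_agree a2
  have e20 : s2.reals 20 0 = v₁ := by rw [a2.real 20]; exact h1.1
  have e21 : s2.reals 21 0 = v₂ := by rw [a2.real 21]; exact h1.2
  -- The integer variable `20` tells whether a segment of the class has been met. The first such
  -- segment replaces the default values instead of being compared with them.
  refine forLoop_ev L.N B (fun k s' => (s'.ints 20 0 = 0 ↔ ∀ i < k, L.cls i ≠ c) ∧
    (L.take k).Extremes c (s'.reals 20 0) (s'.reals 21 0) v₁ v₂)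
    (fun s' h => H2.N_eval s' (h.int 0)) (fun k s z h => by simpa using h) ?_ ?_
    (fun s' _ h => h.2) le_rfl
  · refine ⟨by simp [h2], fun ⟨i, hi, _⟩ => absurd hi (Nat.not_lt_zero i), fun _ => ⟨e20, e21⟩⟩
  intro k hk s3 a3 h10 ⟨hf, hE⟩
  have H3 : Reads L N off A s3 := H2.of_agree a3
  refine Ev.straight (by rfl) ?_ hB.ge
  have hb : (ieq (.get 7 (.add off (.var 10))) (.const c)).Holds s3 ↔ L.cls k = c := by
    simp only [Cond.Holds, IExpr.eval, h10, H3.cls k hk]; omega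
  by_cases hc : L.cls k = c
  swap
  · rw [Program.exec_ite_neg (by rwa [hb]), Program.exec]
    refine ⟨hf.trans ⟨fun h i hi => ?_, fun h i hi => h i (Nat.lt_succ_of_lt hi)⟩, hE.skip hc⟩
    rcases Nat.lt_succ_iff_lt_or_eq.1 hi with h' | rfl
    · exact h i h'
    · exact hc
  rw [Program.exec_ite_pos (hb.2 hc)]
  have hv : ∀ s' : Memory, Agree [20] [20, 21] s3 s' → (startE off).eval s' = L.pos k ∧
      (stopE off A).eval s' = L.pos k + L.sg k * L.len k := by
    intro s' a
    have H' : Reads L N off A s' := H3.of_agree a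
    have e10 : s'.ints 10 0 = k := by rw [a.int 10]; exact h10
    simp only [RExpr.eval, IExpr.eval, e10, H'.pos k hk, H'.sg k hk, H'.len k hk]
    simp
  have fin : ∀ s' : Memory, Agree [20] [20, 21] s3 s' →
      (((absorb (startE off)).seq (absorb (stopE off A))).exec s').ints 20 = s'.ints 20 ∧
      (((absorb (startE off)).seq (absorb (stopE off A))).exec s').reals 20 0 =
        min (s'.reals 20 0) (min (L.pos k) (L.pos k + L.sg k * L.len k)) ∧
      (((absorb (startE off)).seq (absorb (stopE off A))).exec s').reals 21 0 =
        max (s'.reals 21 0) (max (L.pos k) (L.pos k + L.sg k * L.len k)) := by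
    intro s' a
    have sub : ∀ s'', Agree [] [20, 21] s' s'' → Agree [20] [20, 21] s3 s'' := fun s'' h =>
      a.trans (h.mono (by simp) (List.Subset.refl _))
    obtain ⟨b1, b2, b3⟩ := absorb_exec (x := startE off) (s := s') (v := L.pos k)
      (fun s'' h => (hv s'' (sub s'' h)).1)
    obtain ⟨c1, c2, c3⟩ := absorb_exec (x := stopE off A)
      (s := (absorb (startE off)).exec s') (v := L.pos k + L.sg k * L.len k)
      (fun s'' h => (hv s'' (sub s'' (b3.trans h))).2)
    rw [Program.exec, c1, c2, b1, b2, (b3.trans c3).ints 20 (by simp), min_assoc, max_assoc]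
    exact ⟨rfl, rfl, rfl⟩
  rw [Program.exec]
  by_cases h0 : s3.ints 20 0 = 0
  · rw [Program.exec_ite_pos (by simp [Cond.Holds, IExpr.eval, h0])]
    simp only [Program.exec]
    have q1 := (hv (s3.setInt 20 0 1) ⟨fun A hA => by
      simp only [List.mem_singleton] at hA; simp [hA], fun A _ => rfl⟩).1
    have a4 : Agree [20] [20, 21] s3 ((s3.setInt 20 0 1).setReal 20 0 (L.pos k)) :=
      ⟨fun A hA => by simp only [List.mem_singleton] at hA; simp [hA], fun A hA => by
        simp only [List.mem_cons, not_or] at hA; simp [hA.1]⟩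
    have q2 := (hv _ a4).1
    have a5 : Agree [20] [20, 21] s3
        (((s3.setInt 20 0 1).setReal 20 0 (L.pos k)).setReal 21 0 (L.pos k)) :=
      ⟨fun A hA => by simp only [List.mem_singleton] at hA; simp [hA], fun A hA => by
        simp only [List.mem_cons, not_or] at hA; simp [hA.1, hA.2.1]⟩
    obtain ⟨f1, f2, f3⟩ := fin _ a5
    simp only [Program.exec] at f1 f2 f3
    simp only [IExpr.eval, q1, q2]
    rw [f1, f2, f3]
    have hn := hf.1 h0
    constructor
    · simp only [Memory.setReal_ints, Memory.setInt_ints, if_true, Function.update_self]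
      exact ⟨fun h => by omega, fun h => absurd hc (h k (Nat.lt_succ_self k))⟩
    · have := Line.Extremes.first (d₁ := v₁) (d₂ := v₂) hn hc
      simpa using this
  · rw [Program.exec_ite_neg (by simp only [Cond.Holds, IExpr.eval]; omega)]
    obtain ⟨f1, f2, f3⟩ := fin s3 (Agree.refl _ _ _)
    simp only [Program.exec] at f1 f2 f3 ⊢
    rw [f1, f2, f3]
    rw [hf] at h0
    push Not at h0
    refine ⟨⟨fun h => ?_, fun h => absurd hc (h k (Nat.lt_succ_self k))⟩, hE.next h0 hc⟩
    obtain ⟨i, hi, hci⟩ := h0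
    exact absurd hci (hf.1 h i hi)

/-- Computes the sum of the lengths in the integer variable `21`. -/
def sumLen (N : IExpr) (A : ℕ) : Program :=
  .seq (.setInt 21 (.const 0) (.const 0))
    (forLoop 10 N (.setInt 21 (.const 0) (.add (.var 21) (.get A (.var 10)))))

theorem sumLen_spec (N : IExpr) (A : ℕ) : ∃ C, ∀ (L : Line) (s : Memory) (off : IExpr),
    Reads L N off A s → Ev (sumLen N A) s (C * (L.N + 1))
      (fun s' => s'.ints 21 0 = ((∑ i ∈ Finset.range L.N, L.len i : ℕ) : ℤ)) := by
  refine ⟨N.cost + 100, fun L s off H => ?_⟩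
  refine Ev.seq' (T := 10) (T' := (L.N + 1) * (20 + N.cost + 20)) (P := fun s' => s'.ints 21 0 = 0)
    (Ev.straight (by rfl) (by simp [Program.exec, IExpr.eval]) (by decide))
    (fun s1 a1 h1 => ?_) (by nlinarith)
  have H1 : Reads L N off A s1 := H.of_agree a1
  refine forLoop_ev L.N 20 (fun k s' => s'.ints 21 0 = ((∑ i ∈ Finset.range k, L.len i : ℕ) : ℤ))
    (fun s' h => H1.N_eval s' (h.int 0)) (fun k s z h => by simpa using h) (by simpa using h1) ?_
    (fun s' _ h => h) le_rfl
  intro k hk s2 a2 h10 h2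
  have H2 : Reads L N off A s2 := H1.of_agree a2
  refine Ev.straight (by rfl) ?_ (by simp only [Program.bound, IExpr.cost]; omega)
  simp only [Program.exec, IExpr.eval, h10, h2, H2.len k hk, Finset.sum_range_succ]
  simp

end RealRAM

/-! ### Dynamic programming for lattice paths -/

namespace FreeSpace.Line

variable (L : Line) (W : Walls) (base : ℝ) (M : ℤ)

/-- The last `d` segments can be placed such that the first of them starts at `x`. -/
def Feasible : ℕ → ℤ → Prop
  | 0, x => 0 ≤ x ∧ x < M
  | d + 1, x => (0 ≤ x ∧ x < M) ∧ ∃ s : ℤ, (s = 1 ∨ s = -1) ∧ L.Move W base M (L.N - (d + 1)) x s ∧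
      Feasible d (x + s * L.len (L.N - (d + 1)))

variable {L W base M}

theorem Feasible.range {d : ℕ} {x : ℤ} (h : L.Feasible W base M d x) : 0 ≤ x ∧ x < M := by
  cases d with
  | zero => exact h
  | succ d => exact h.1

theorem IsPath.feasible {x s : ℕ → ℤ} (H : L.IsPath W base M x s) :
    ∀ d ≤ L.N, L.Feasible W base M d (x (L.N - d)) := by
  intro d
  induction d with
  | zero => exact fun _ => H.range _ (Nat.sub_le _ _)
  | succ d ih =>
    intro hd
    obtain ⟨h1, h2, h3⟩ := H.move (L.N - (d + 1)) (by omega)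
    refine ⟨H.range _ (Nat.sub_le _ _), s (L.N - (d + 1)), h1, h2, ?_⟩
    rw [← h3, show L.N - (d + 1) + 1 = L.N - d by omega]
    exact ih (by omega)

/-- The value `g` records a first step that keeps the last `d` segments feasible. -/
def Entry (L : Line) (W : Walls) (base : ℝ) (M : ℤ) (d : ℕ) (x g : ℤ) : Prop :=
  (g ≠ 0 ↔ L.Feasible W base M d x) ∧
    (0 < d → g ≠ 0 → (g = 1 ∨ g = -1) ∧ L.Move W base M (L.N - d) x g ∧
      L.Feasible W base M (d - 1) (x + g * L.len (L.N - d)))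

/-- An initial part of a path that can be completed. -/
structure Partial (L : Line) (W : Walls) (base : ℝ) (M : ℤ) (i : ℕ) (x s : ℕ → ℤ) : Prop where
  range : ∀ k ≤ i, 0 ≤ x k ∧ x k < M
  move : ∀ k < i, (s k = 1 ∨ s k = -1) ∧ L.Move W base M k (x k) (s k) ∧
    x (k + 1) = x k + s k * L.len k
  rest : L.Feasible W base M (L.N - i) (x i)

/-- The entry of the table at the current position is a step after which the remaining segments are
still feasible, so following the table never needs to backtrack. -/
theorem Partial.step {i : ℕ} {x s : ℕ → ℤ} (H : L.Partial W base M i x s) (hi : i < L.N) {g : ℤ}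
    (hg : L.Entry W base M (L.N - i) (x i) g) :
    L.Partial W base M (i + 1) (Function.update x (i + 1) (x i + g * L.len i))
      (Function.update s i g) := by
  obtain ⟨h1, h2, h3⟩ := hg.2 (by omega) (hg.1.2 H.rest)
  rw [show L.N - (L.N - i) = i by omega] at h2 h3
  have hx : ∀ k ≤ i, Function.update x (i + 1) (x i + g * L.len i) k = x k := fun k hk =>
    Function.update_of_ne (by omega) _ _
  refine ⟨fun k hk => ?_, fun k hk => ?_, ?_⟩
  · rcases Nat.le_succ_iff.1 hk with h | rfl
    · rw [hx k h]; exact H.range k h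
    · rw [Function.update_self]; exact h3.range
  · rcases Nat.lt_succ_iff_lt_or_eq.1 hk with h | rfl
    · rw [hx k h.le, hx (k + 1) h, Function.update_of_ne (by omega)]; exact H.move k h
    · rw [hx k le_rfl, Function.update_self, Function.update_self]; exact ⟨h1, h2, rfl⟩
  · rw [Function.update_self, show L.N - (i + 1) = L.N - i - 1 by omega]; exact h3

end FreeSpace.Line

namespace RealRAM

open FreeSpace

/-- The walls in the real arrays `30`, …, `34`. -/
def walls (s : Memory) : Walls := ⟨s.reals 30, s.reals 31, s.reals 32, s.reals 33, s.reals 34⟩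

section
variable (off i x : IExpr) (A : ℕ) (sg : ℤ)

abbrev nextE : IExpr := .add x (.mul (.const sg) (.get A i))
abbrev classE : IExpr := .get 7 (.add off i)
abbrev placeE (y : IExpr) : RExpr := .add (.var 35) (real y)

/-- The test for `Line.Move`. -/
def moveC : Cond :=
  .and (.ile (.const 0) (nextE i x A sg)) (.and (ilt (nextE i x A sg) (.var 22))
    (.and (.or (ieq (.get 6 (.add off i)) (.const 0)) (.and (ieq (.get 6 (.add off i)) (.const sg))
        (req (placeE x) (.add (.get 4 (.add off i)) (.get 34 (classE off i))))))
      (.or (.and (.rle (.get 30 (classE off i)) (placeE x))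
          (.and (.rle (placeE x) (.get 31 (classE off i)))
          (.and (.rle (.get 30 (classE off i)) (placeE (nextE i x A sg)))
          (.rle (placeE (nextE i x A sg)) (.get 31 (classE off i))))))
        (.or (.and (rlt (placeE x) (.get 32 (classE off i)))
            (rlt (placeE (nextE i x A sg)) (.get 32 (classE off i))))
          (.and (rlt (.get 33 (classE off i)) (placeE x))
            (rlt (.get 33 (classE off i)) (placeE (nextE i x A sg))))))))

variable {off i x A sg}

theorem moveC_holds {L : Line} {N : IExpr} {s : Memory} {M : ℤ} (H : Reads L N off A s) {k : ℕ}
    (hk : k < L.N) {z : ℤ} (hi : i.eval s = k) (hx : x.eval s = z) (hM : s.ints 22 0 = M) :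
    (moveC off i x A sg).Holds s ↔ L.Move (walls s) (s.reals 35 0) M k z sg := by
  simp only [moveC, Cond.Holds, IExpr.eval, RExpr.eval, hi, hx, hM, H.cls k hk, H.len k hk,
    H.sg k hk, H.pos k hk, Line.Move, Walls.Allows, walls, not_le]
  have e1 : ∀ a b : ℤ, a ≤ b ∧ b ≤ a ↔ a = b := fun a b => le_antisymm_iff.symm
  have e2 : ∀ a b : ℝ, a ≤ b ∧ b ≤ a ↔ a = b := fun a b => le_antisymm_iff.symm
  simp only [e1, e2]

end

/-- Fills the row `i` (the variable `16`) of the table in the integer array `9`. -/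
def tableRow (off : IExpr) (A : ℕ) : Program :=
  let i : IExpr := .var 16
  let x : IExpr := .var 17
  let M : IExpr := .var 22
  let here : IExpr := .add (.mul i M) x
  let there (sg : ℤ) : IExpr := .add (.mul (.add i (.const 1)) M) (nextE i x A sg)
  forLoop 17 M
    (.ite (.and (moveC off i x A 1) (.not (ieq (.get 9 (there 1)) (.const 0))))
      (.setInt 9 here (.const 1))
      (.ite (.and (moveC off i x A (-1)) (.not (ieq (.get 9 (there (-1))) (.const 0))))
        (.setInt 9 here (.const (-1))) (.setInt 9 here (.const 0))))

/-- The rows `i` with `N - k ≤ i` of the table are correct. -/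
def TableOK (L : Line) (W : Walls) (base : ℝ) (M : ℤ) (k : ℕ) (s : Memory) : Prop :=
  ∀ d : ℕ, d < k → d ≤ L.N → ∀ x, 0 ≤ x → x < M →
    L.Entry W base M d x (s.ints 9 (((L.N - d : ℕ) : ℤ) * M + x))

/-- The table is stored row by row with rows of length `M`; distinct entries have distinct
addresses, so writing one entry leaves the others intact. -/
theorem index_inj {a b : ℕ} {M x y : ℤ} (hx : 0 ≤ x) (hx' : x < M) (hy : 0 ≤ y) (hy' : y < M)
    (h : (a : ℤ) * M + x = b * M + y) : a = b ∧ x = y := by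
  have hab : (a : ℤ) = b := by
    rcases lt_trichotomy (a : ℤ) b with h' | h' | h'
    · nlinarith
    · exact h'
    · nlinarith
  refine ⟨by exact_mod_cast hab, ?_⟩
  rw [hab] at h
  linarith

theorem tableRow_spec (off : IExpr) (A : ℕ) : ∃ C, ∀ (L : Line) (N : IExpr) (s : Memory) (M d : ℕ),
    Reads L N off A s → s.ints 22 0 = M → d < L.N → s.ints 16 0 = ((L.N - (d + 1) : ℕ) : ℤ) →
    TableOK L (walls s) (s.reals 35 0) M (d + 1) s →
    Ev (tableRow off A) s (C * (M + 1)) (TableOK L (walls s) (s.reals 35 0) M (d + 2)) := by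
  obtain ⟨B, hB⟩ : ∃ B, B = (Program.ite (.and (moveC off (.var 16) (.var 17) A 1) (.not (ieq (.get
      9
      (.add (.mul (.add (.var 16) (.const 1)) (.var 22)) (nextE (.var 16) (.var 17) A 1))) (.const
          0))))
      (.setInt 9 (.add (.mul (.var 16) (.var 22)) (.var 17)) (.const 1))
      (.ite (.and (moveC off (.var 16) (.var 17) A (-1)) (.not (ieq (.get 9
      (.add (.mul (.add (.var 16) (.const 1)) (.var 22)) (nextE (.var 16) (.var 17) A (-1))))
      (.const 0))))
        (.setInt 9 (.add (.mul (.var 16) (.var 22)) (.var 17)) (.const (-1)))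
        (.setInt 9 (.add (.mul (.var 16) (.var 22)) (.var 17)) (.const 0)))).bound := ⟨_, rfl⟩
  refine ⟨B + 22, fun L N s M d H hM hd h16 hT => ?_⟩
  refine forLoop_ev M B (fun k s' => TableOK L (walls s) (s.reals 35 0) M (d + 1) s' ∧
    ∀ x : ℤ, 0 ≤ x → x < k →
      L.Entry (walls s) (s.reals 35 0) M (d + 1) x
        (s'.ints 9 (((L.N - (d + 1) : ℕ) : ℤ) * M + x)))
    (fun s' h => by simp only [IExpr.eval]; rw [h.int 22, hM])
    (fun k s z h => by simpa [TableOK] using h) ⟨hT, fun x h1 h2 => by omega⟩ ?_ ?_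
    (by simp only [IExpr.cost]; rw [mul_comm])
  · intro k hk s' a h17 ⟨h1, h2⟩
    have H' : Reads L N off A s' := H.of_agree a
    have e16 : s'.ints 16 0 = ((L.N - (d + 1) : ℕ) : ℤ) := by rw [a.int 16]; exact h16
    have e22 : s'.ints 22 0 = M := by rw [a.int 22]; exact hM
    have ew : walls s' = walls s := by
      simp only [walls, a.real 30, a.real 31, a.real 32, a.real 33, a.real 34]
    have eb : s'.reals 35 0 = s.reals 35 0 := by rw [a.real 35]
    have hi : L.N - (d + 1) < L.N := by omega
    have mv : ∀ sg, (moveC off (.var 16) (.var 17) A sg).Holds s' ↔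
        L.Move (walls s) (s.reals 35 0) M (L.N - (d + 1)) k sg := fun sg => by
      rw [moveC_holds H' hi (z := k) (by simp only [IExpr.eval, e16]) (by simp only [IExpr.eval,
          h17])
        e22, ew, eb]
    have tst : ∀ sg, (Cond.and (moveC off (.var 16) (.var 17) A sg) (.not (ieq (.get 9
        (.add (.mul (.add (.var 16) (.const 1)) (.var 22)) (nextE (.var 16) (.var 17) A sg)))
        (.const 0)))).Holds s' ↔ (L.Move (walls s) (s.reals 35 0) M (L.N - (d + 1)) k sg ∧
        L.Feasible (walls s) (s.reals 35 0) M d (k + sg * L.len (L.N - (d + 1)))) := by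
      intro sg
      change (_ ∧ _) ↔ _
      rw [mv sg]
      -- Only for a move that stays in the window is the address that of an entry of the next row;
      -- otherwise the content of the cell is irrelevant.
      refine and_congr_right fun hmv => ?_
      rw [← (h1 d (by omega) (by omega) (k + sg * L.len (L.N - (d + 1))) hmv.1 hmv.2.1).1]
      have e : (IExpr.add (.mul (.add (.var 16) (.const 1)) (.var 22))
          (nextE (.var 16) (.var 17) A sg)).eval s' =
          ((L.N - d : ℕ) : ℤ) * M + (k + sg * L.len (L.N - (d + 1))) := by
        simp only [IExpr.eval, e16, e22, h17, H'.len _ hi]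
        rw [show ((L.N - d : ℕ) : ℤ) = ((L.N - (d + 1) : ℕ) : ℤ) + 1 by omega]
      change ¬ (s'.ints 9 (IExpr.eval s' _) ≤ 0 ∧ 0 ≤ s'.ints 9 (IExpr.eval s' _)) ↔ _
      rw [e]
      omega
    have here : (IExpr.add (.mul (.var 16) (.var 22)) (.var 17)).eval s' =
        ((L.N - (d + 1) : ℕ) : ℤ) * M + k := by simp only [IExpr.eval, e16, e22, h17]
    have fin : ∀ g : ℤ, L.Entry (walls s) (s.reals 35 0) M (d + 1) k g →
        TableOK L (walls s) (s.reals 35 0) M (d + 1)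
          (s'.setInt 9 (((L.N - (d + 1) : ℕ) : ℤ) * M + k) g) ∧
        ∀ x : ℤ, 0 ≤ x → x < (k + 1 : ℕ) → L.Entry (walls s) (s.reals 35 0) M (d + 1) x
          ((s'.setInt 9 (((L.N - (d + 1) : ℕ) : ℤ) * M + k) g).ints 9
            (((L.N - (d + 1) : ℕ) : ℤ) * M + x)) := by
      intro g hg
      simp only [TableOK, Memory.setInt_ints, if_true]
      constructor
      · intro d' hd' hdN x hx hxM
        rw [Function.update_of_ne]
        · exact h1 d' hd' hdN x hx hxM
        · intro h
          have := (index_inj hx hxM (by omega) (by omega) h).1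
          omega
      · intro x hx hxk
        by_cases hxe : x = k
        · rw [hxe, Function.update_self]; exact hg
        · rw [Function.update_of_ne (by omega)]
          exact h2 x hx (by omega)
    refine Ev.straight (by rfl) ?_ hB.ge
    have hr : (0 : ℤ) ≤ k ∧ (k : ℤ) < M := by omega
    by_cases t1 : L.Move (walls s) (s.reals 35 0) M (L.N - (d + 1)) k 1 ∧
        L.Feasible (walls s) (s.reals 35 0) M d (k + 1 * L.len (L.N - (d + 1)))
    · rw [Program.exec_ite_pos ((tst 1).2 t1), Program.exec, here]
      exact fin 1 ⟨⟨fun _ => ⟨hr, 1, Or.inl rfl, t1⟩, fun _ => one_ne_zero⟩,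
        fun _ _ => ⟨Or.inl rfl, t1⟩⟩
    rw [Program.exec_ite_neg (by rwa [tst 1])]
    by_cases t2 : L.Move (walls s) (s.reals 35 0) M (L.N - (d + 1)) k (-1) ∧
        L.Feasible (walls s) (s.reals 35 0) M d (k + (-1) * L.len (L.N - (d + 1)))
    · rw [Program.exec_ite_pos ((tst (-1)).2 t2), Program.exec, here]
      exact fin (-1) ⟨⟨fun _ => ⟨hr, -1, Or.inr rfl, t2⟩, fun _ => by decide⟩,
        fun _ _ => ⟨Or.inr rfl, t2⟩⟩
    rw [Program.exec_ite_neg (by rwa [tst (-1)]), Program.exec, here]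
    refine fin 0 ⟨⟨fun h => absurd rfl h, fun ⟨_, sg, hsg, h⟩ => ?_⟩, fun _ h => absurd rfl h⟩
    rcases hsg with rfl | rfl
    · exact absurd h t1
    · exact absurd h t2
  · intro s' _ ⟨h1, h2⟩ d' hd' hdN x hx hxM
    rcases Nat.lt_succ_iff_lt_or_eq.1 hd' with h | rfl
    · exact h1 d' h hdN x hx hxM
    · exact h2 x hx hxM

/-- Fills the whole table. -/
def table (N off : IExpr) (A : ℕ) : Program :=
  .seq (forLoop 17 (.var 22) (.setInt 9 (.add (.mul N (.var 22)) (.var 17)) (.const 1)))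
    (forLoop 15 N (.seq (.setInt 16 (.const 0) (.sub N (.add (.var 15) (.const 1))))
      (tableRow off A)))

theorem table_spec (N off : IExpr) (A : ℕ) : ∃ C, ∀ (L : Line) (s : Memory) (M : ℕ),
    Reads L N off A s → s.ints 22 0 = M →
    Ev (table N off A) s (C * ((L.N + 1) * (M + 1)))
      (TableOK L (walls s) (s.reals 35 0) M (L.N + 1)) := by
  obtain ⟨C, hC⟩ := tableRow_spec off A
  refine ⟨(N.cost + 60) + (C + 2 * N.cost + 50), fun L s M H hM => ?_⟩
  refine Ev.seq' (T := (M + 1) * (N.cost + 40))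
    (T' := (L.N + 1) * ((C * (M + 1) + N.cost + 20) + N.cost + 20))
    (forLoop_ev M (N.cost + 15) (fun k s' => ∀ x : ℤ, 0 ≤ x → x < k →
      s'.ints 9 ((L.N : ℤ) * M + x) = 1)
      (fun s' h => by simp only [IExpr.eval]; rw [h.int 22, hM]) (fun k s z h => by simpa using h)
      (fun x h1 h2 => by omega) ?_ (fun s' _ h => h)
      (Nat.mul_le_mul_left _ (by simp only [IExpr.cost]; omega)))
    (fun s1 a1 h1 => ?_) ?_
  · intro k hk s' a h17 hi
    refine Ev.straight (by rfl) ?_ (by simp only [Program.bound, IExpr.cost]; omega)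
    have e22 : s'.ints 22 0 = M := by rw [a.int 22]; exact hM
    simp only [Program.exec, IExpr.eval, H.N_eval s' (a.int 0), e22, h17, Memory.setInt_ints,
      if_true]
    intro x hx hxk
    by_cases hxe : x = k
    · rw [hxe, Function.update_self]
    · rw [Function.update_of_ne (by omega)]
      exact hi x hx (by omega)
  · have H1 : Reads L N off A s1 := H.of_agree a1
    have ew : ∀ s', Agree (table N off A).wI (table N off A).wR s s' →
        walls s' = walls s ∧ s'.reals 35 0 = s.reals 35 0 ∧ s'.ints 22 0 = M ∧
        Reads L N off A s' := fun s' a => by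
      refine ⟨?_, by rw [a.real 35], by rw [a.int 22, hM], H.of_agree a⟩
      simp only [walls, a.real 30, a.real 31, a.real 32, a.real 33, a.real 34]
    refine forLoop_ev L.N (C * (M + 1) + N.cost + 20)
      (fun k s' => TableOK L (walls s) (s.reals 35 0) M (k + 1) s')
      (fun s' h => H1.N_eval s' (h.int 0)) (fun k s z h => by simpa [TableOK] using h) ?_ ?_
      (fun s' _ h => h) le_rfl
    -- With no segments left every position in the window is feasible; the last row was filled with
    -- `1` as an arbitrary nonzero value.
    · intro d hd hdN x hx hxM
      obtain rfl : d = 0 := by omega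
      rw [Nat.sub_zero, h1 x hx hxM]
      exact ⟨⟨fun _ => ⟨hx, hxM⟩, fun _ => one_ne_zero⟩, fun h => absurd h (lt_irrefl 0)⟩
    · intro d hd s2 a2 h15 hT
      refine Ev.seq' (T := N.cost + 15) (T' := C * (M + 1))
        (P := fun s' => s'.ints 16 0 = ((L.N - (d + 1) : ℕ) : ℤ) ∧ s'.ints 9 = s2.ints 9)
        (Ev.straight (by rfl) ?_ (by simp only [Program.bound, IExpr.cost]; omega))
        (fun s3 a3 h3 => ?_) (by omega)
      · have e := H1.N_eval s2 (a2.int 0)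
        simp only [Program.exec, IExpr.eval, e, h15, Memory.setInt_ints, if_true,
          Function.update_self]
        constructor
        · omega
        · simp
      · have a4 : Agree (table N off A).wI (table N off A).wR s s3 :=
          a1.widen.trans (a2.widen.trans a3.widen)
        obtain ⟨w1, w2, w3, w4⟩ := ew s3 a4
        have := hC L N s3 M d w4 w3 hd h3.1
        rw [w1, w2] at this
        exact this (by unfold TableOK; rw [h3.2]; exact hT)
  · have e1 : (M + 1) * (N.cost + 40) ≤ (L.N + 1) * (M + 1) * (N.cost + 40) :=
      Nat.mul_le_mul_right _ (Nat.le_mul_of_pos_left _ (by omega))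
    have e2 : (L.N + 1) * (2 * N.cost + 40) ≤ (L.N + 1) * (M + 1) * (2 * N.cost + 40) :=
      Nat.mul_le_mul_right _ (Nat.le_mul_of_pos_right _ (by omega))
    have e3 : (L.N + 1) * ((C * (M + 1) + N.cost + 20) + N.cost + 20) =
        C * ((L.N + 1) * (M + 1)) + (L.N + 1) * (2 * N.cost + 40) := by ring
    rw [e3]
    nlinarith

/-- Looks for a feasible start of the curve in the first row of the table. -/
def findStart : Program :=
  .seq (.setInt 18 (.const 0) (.const (-1)))
    (forLoop 17 (.var 22)
      (.ite (ieq (.get 9 (.var 17)) (.const 0)) .skip (.setInt 18 (.const 0) (.var 17))))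

theorem findStart_spec : ∃ C, ∀ (s : Memory) (M : ℕ), s.ints 22 0 = M →
    Ev findStart s (C * (M + 1)) (fun s' =>
      (s'.ints 18 0 = -1 ∧ ∀ x : ℤ, 0 ≤ x → x < M → s.ints 9 x = 0) ∨
      (0 ≤ s'.ints 18 0 ∧ s'.ints 18 0 < M ∧ s.ints 9 (s'.ints 18 0) ≠ 0)) := by
  refine ⟨100, fun s M hM => ?_⟩
  refine Ev.seq' (T := 10) (T' := (M + 1) * 80) (P := fun s' => s'.ints 18 0 = -1)
    (Ev.straight (by rfl) (by simp [Program.exec, IExpr.eval]) (by decide))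
    (fun s1 a1 h1 => ?_) (by nlinarith)
  have e9 : s1.ints 9 = s.ints 9 := a1.int 9
  have e22 : s1.ints 22 0 = M := by rw [a1.int 22, hM]
  refine forLoop_ev M 40 (fun k s' =>
    (s'.ints 18 0 = -1 ∧ ∀ x : ℤ, 0 ≤ x → x < k → s.ints 9 x = 0) ∨
      (0 ≤ s'.ints 18 0 ∧ s'.ints 18 0 < M ∧ s.ints 9 (s'.ints 18 0) ≠ 0))
    (fun s' h => by simp only [IExpr.eval]; rw [h.int 22, e22]) (fun k s z h => by simpa using h)
    (Or.inl ⟨h1, fun x h1 h2 => by omega⟩) ?_ (fun s' _ h => h) (Nat.mul_le_mul_left _ (by decide))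
  intro k hk s2 a2 h17 hi
  have f9 : s2.ints 9 = s.ints 9 := (a2.int 9).trans e9
  have hb : (ieq (.get 9 (.var 17)) (.const 0)).Holds s2 ↔ s.ints 9 k = 0 := by
    simp only [Cond.Holds, IExpr.eval, h17, f9]; omega
  refine Ev.straight (by rfl) ?_ (by decide)
  by_cases h0 : s.ints 9 k = 0
  · rw [Program.exec_ite_pos (hb.2 h0), Program.exec]
    refine hi.imp (fun ⟨b1, b2⟩ => ⟨b1, fun x hx hxk => ?_⟩) id
    by_cases hxe : x = k
    · rw [hxe, h0]
    · exact b2 x hx (by omega)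
  · rw [Program.exec_ite_neg (by rwa [hb])]
    right
    simp only [Program.exec, IExpr.eval, h17, Memory.setInt_ints, if_true, Function.update_self]
    exact ⟨by omega, by omega, h0⟩

/-- Follows the table and writes the vertices to the real array `9`. -/
def follow (N : IExpr) (A : ℕ) : Program :=
  .seq (.setReal 9 (.const 0) (placeE (.var 18)))
    (forLoop 16 N
      (.seq (.setInt 18 (.const 0) (.add (.var 18)
          (.mul (.get 9 (.add (.mul (.var 16) (.var 22)) (.var 18))) (.get A (.var 16)))))
        (.setReal 9 (.add (.var 16) (.const 1)) (placeE (.var 18)))))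

theorem follow_spec (N : IExpr) (A : ℕ) : ∃ C, ∀ (L : Line) (off : IExpr) (s : Memory) (M : ℕ),
    Reads L N off A s → s.ints 22 0 = M →
    TableOK L (walls s) (s.reals 35 0) M (L.N + 1) s → 0 ≤ s.ints 18 0 → s.ints 18 0 < M →
    s.ints 9 (s.ints 18 0) ≠ 0 →
    Ev (follow N A) s (C * (L.N + 1)) (fun s' =>
      ∃ x sg, L.IsPath (walls s) (s.reals 35 0) M x sg ∧
        ∀ i : ℕ, i ≤ L.N → s'.reals 9 i = s.reals 35 0 + x i) := by
  refine ⟨N.cost + 100, fun L off s M H hM hT h0 h1 h9 => ?_⟩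
  refine Ev.seq' (T := 10) (T' := (L.N + 1) * (50 + N.cost + 20))
    (P := fun s' => s'.reals 9 0 = s.reals 35 0 + s.ints 18 0)
    (Ev.straight (by rfl) (by simp [Program.exec, IExpr.eval, RExpr.eval]) (by decide))
    (fun s1 a1 k1 => ?_) (by nlinarith)
  have H1 : Reads L N off A s1 := H.of_agree a1
  refine forLoop_ev L.N 50 (fun k s' => ∃ x sg, L.Partial (walls s) (s.reals 35 0) M k x sg ∧
      s'.ints 18 0 = x k ∧ ∀ i : ℕ, i ≤ k → s'.reals 9 i = s.reals 35 0 + x i)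
    (fun s' h => H1.N_eval s' (h.int 0)) (fun k s z h => by simpa using h) ?_ ?_ ?_ le_rfl
  · have e18 : s1.ints 18 0 = s.ints 18 0 := by rw [a1.int 18]
    refine ⟨fun _ => s.ints 18 0, fun _ => 0, ⟨fun _ _ => ⟨h0, h1⟩, fun k hk => by omega, ?_⟩, e18,
      fun i hi => ?_⟩
    -- Row `0` of the table belongs to `d = L.N`, with all segments still to be placed; a nonzero
    -- entry there is a feasible start.
    · have := (hT L.N (by omega) le_rfl (s.ints 18 0) h0 h1).1
      rw [Nat.sub_self, Nat.cast_zero, zero_mul, zero_add] at this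
      exact this.1 h9
    · obtain rfl : i = 0 := by omega
      exact k1
  · rintro k hk s2 a2 h16 ⟨x, sg, hP, h18, hr⟩
    have H2 : Reads L N off A s2 := H1.of_agree a2
    have e22 : s2.ints 22 0 = M := by rw [a2.int 22, a1.int 22, hM]
    have e9 : s2.ints 9 = s.ints 9 := (a2.int 9).trans (a1.int 9)
    have eb : s2.reals 35 0 = s.reals 35 0 := by rw [a2.real 35, a1.real 35]
    have hxk := hP.range k le_rfl
    have hent := hT (L.N - k) (by omega) (by omega) (x k) hxk.1 hxk.2
    rw [show L.N - (L.N - k) = k by omega] at hent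
    refine Ev.straight (by rfl) ?_ (by simp only [Program.bound, IExpr.cost, RExpr.cost]; omega)
    refine ⟨_, _, hP.step hk hent, ?_, fun i hi => ?_⟩
    · simp only [Program.exec, IExpr.eval, h16, e22, h18, e9, H2.len k hk, Memory.setInt_ints,
        Memory.setReal_ints, if_true, Function.update_self]
    · simp only [Program.exec, IExpr.eval, RExpr.eval, h16, e22, h18, e9, H2.len k hk,
        Memory.setInt_ints, Memory.setInt_reals, Memory.setReal_reals, if_true,
        Function.update_self, if_neg (show ¬ ((16 : ℕ) = 18) by decide), eb]
      by_cases hik : i = k + 1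
      · subst hik
        push_cast
        rw [Function.update_self, Function.update_self]
        push_cast
        ring
      · have hik' : (i : ℤ) ≠ k + 1 := by omega
        rw [Function.update_of_ne hik', Function.update_of_ne hik]
        exact hr i (by omega)
  · rintro s' _ ⟨x, sg, hP, _, hr⟩
    exact ⟨x, sg, ⟨hP.range, hP.move⟩, hr⟩

/-- Looks for a path; the flag is the integer variable `19`. -/
def findPath (N off : IExpr) (A : ℕ) : Program :=
  .seq (table N off A) (.seq findStart
    (.ite (.ile (.const 0) (.var 18))
      (.seq (.setInt 19 (.const 0) (.const 1)) (follow N A))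
      (.setInt 19 (.const 0) (.const 0))))

theorem findPath_spec (N off : IExpr) (A : ℕ) : ∃ C, ∀ (L : Line) (s : Memory) (M : ℕ),
    Reads L N off A s → s.ints 22 0 = M →
    Ev (findPath N off A) s (C * ((L.N + 1) * (M + 1))) (fun s' =>
      (s'.ints 19 0 = 1 ∧ ∃ x sg, L.IsPath (walls s) (s.reals 35 0) M x sg ∧
        ∀ i : ℕ, i ≤ L.N → s'.reals 9 i = s.reals 35 0 + x i) ∨
      (s'.ints 19 0 = 0 ∧ ¬ ∃ x sg, L.IsPath (walls s) (s.reals 35 0) M x sg)) := by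
  obtain ⟨C₁, hC₁⟩ := table_spec N off A
  obtain ⟨C₂, hC₂⟩ := findStart_spec
  obtain ⟨C₃, hC₃⟩ := follow_spec N A
  refine ⟨C₁ + C₂ + C₃ + 20, fun L s M H hM => ?_⟩
  refine Ev.seq' (T' := C₂ * (M + 1) + (10 + (10 + C₃ * (L.N + 1)))) (hC₁ L s M H hM)
    (fun s1 a1 h1 => ?_) ?_
  swap
  · have : M + 1 ≤ (L.N + 1) * (M + 1) := Nat.le_mul_of_pos_left _ (by omega)
    have : L.N + 1 ≤ (L.N + 1) * (M + 1) := Nat.le_mul_of_pos_right _ (by omega)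
    nlinarith
  have H1 : Reads L N off A s1 := H.of_agree a1
  refine Ev.seq' (hC₂ s1 M (by rw [a1.int 22, hM])) (fun s2 a2 h2 => ?_) le_rfl
  have H2 : Reads L N off A s2 := H1.of_agree a2
  have e9 : s2.ints 9 = s1.ints 9 := a2.int 9
  have ew : walls s2 = walls s := by
    simp only [walls, a2.real 30, a2.real 31, a2.real 32, a2.real 33, a2.real 34,
      a1.real 30, a1.real 31, a1.real 32, a1.real 33, a1.real 34]
  have eb : s2.reals 35 0 = s.reals 35 0 := by rw [a2.real 35, a1.real 35]
  refine Ev.ite (T := 10 + C₃ * (L.N + 1)) (fun hb => ?_) (fun hb => ?_)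
    (by simp only [Cond.cost, IExpr.cost]; omega)
  · simp only [Cond.Holds, IExpr.eval] at hb
    obtain ⟨b1, b2, b3⟩ := h2.resolve_left (by omega)
    refine Ev.seq' (T := 10) (P := fun s' => s'.ints 19 0 = 1)
      (Ev.straight (by rfl) (by simp [Program.exec, IExpr.eval]) (by decide))
      (fun s3 a3 h3 => ?_) le_rfl
    have e18 : s3.ints 18 0 = s2.ints 18 0 := by rw [a3.int 18]
    have f9 : s3.ints 9 = s1.ints 9 := (a3.int 9).trans e9
    have ew3 : walls s3 = walls s := by
      rw [← ew]; simp only [walls, a3.real 30, a3.real 31, a3.real 32, a3.real 33, a3.real 34]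
    have eb3 : s3.reals 35 0 = s.reals 35 0 := by rw [a3.real 35, eb]
    have := hC₃ L off s3 M (H2.of_agree a3) (by rw [a3.int 22, a2.int 22, a1.int 22, hM])
      (by rw [ew3, eb3]; unfold TableOK; rw [f9]; exact h1) (by rwa [e18]) (by rwa [e18])
      (by rwa [e18, f9])
    refine this.agree.mono le_rfl fun s4 ⟨h4, a4⟩ => Or.inl ⟨by rw [a4.int 19]; exact h3, ?_⟩
    rwa [ew3, eb3] at h4
  · simp only [Cond.Holds, IExpr.eval] at hb
    obtain ⟨b1, b2⟩ := h2.resolve_right (by omega)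
    refine Ev.straight (by rfl) (Or.inr ⟨by simp [Program.exec, IExpr.eval], ?_⟩)
      (by simp only [Program.bound, IExpr.cost]; omega)
    rintro ⟨x, sg, hP⟩
    have hf := hP.feasible L.N le_rfl
    rw [Nat.sub_self] at hf
    have := (h1 L.N (by omega) le_rfl (x 0) hf.range.1 hf.range.2).1
    rw [Nat.sub_self, Nat.cast_zero, zero_mul, zero_add] at this
    exact this.2 hf (b2 _ hf.range.1 hf.range.2)

end RealRAM

/-! ### A finite criterion for the correctness of a cell -/

namespace FreeSpace

theorem below_iff {ε : ℝ} {p q : ℕ → ℝ} {i j : ℕ} : Below ε p q i j ↔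
    (p i + ε < q j ∧ p i + ε < q (j + 1)) ∧ (p (i + 1) + ε < q j ∧ p (i + 1) + ε < q (j + 1)) := by
  unfold Below segMin segMax
  rw [max_add, max_lt_iff, lt_min_iff, lt_min_iff]

theorem segMax_le_iff {ε : ℝ} {p q : ℕ → ℝ} {i j : ℕ} : segMax q j ≤ segMin p i + ε ↔
    (q j ≤ p i + ε ∧ q (j + 1) ≤ p i + ε) ∧ (q j ≤ p (i + 1) + ε ∧ q (j + 1) ≤ p (i + 1) + ε) := by
  unfold segMin segMax
  rw [min_add, le_min_iff, max_le_iff, max_le_iff]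

/-- Two intervals that cut the same nonempty piece out of `[a, b]` have the same end on each side,
unless both ends reach or pass the end of `[a, b]` there. -/
theorem interval_eq {lo hi lo' hi' a b : ℝ}
    (h : ∀ f, a ≤ f → f ≤ b → (lo ≤ f ∧ f ≤ hi ↔ lo' ≤ f ∧ f ≤ hi'))
    (hne : ∃ f, a ≤ f ∧ f ≤ b ∧ lo ≤ f ∧ f ≤ hi) :
    (hi = hi' ∨ b ≤ hi ∧ b ≤ hi') ∧ (lo = lo' ∨ lo ≤ a ∧ lo' ≤ a) := by
  obtain ⟨f, h1, h2, h3, h4⟩ := hne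
  obtain ⟨h5, h6⟩ := (h f h1 h2).1 ⟨h3, h4⟩
  constructor
  · by_contra hc
    push Not at hc
    obtain ⟨hne, hb⟩ := hc
    rcases lt_or_gt_of_ne hne with hlt | hlt
    · have hbh : hi < b := by
        by_contra hc
        linarith [hb (not_lt.1 hc)]
      have h7 : hi < min hi' b := lt_min hlt hbh
      have := (h (min hi' b) (by linarith) (min_le_right _ _)).2 ⟨by linarith, min_le_left _ _⟩
      linarith [this.2]
    · have hbh : hi' < b := by
        by_contra hc
        have := hb (by linarith)
        linarith
      have h7 : hi' < min hi b := lt_min hlt hbh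
      have := (h (min hi b) (by linarith) (min_le_right _ _)).1 ⟨by linarith, min_le_left _ _⟩
      linarith [this.2]
  · by_contra hc
    push Not at hc
    obtain ⟨hne, hb⟩ := hc
    rcases lt_or_gt_of_ne hne with hlt | hlt
    · have hbh : a < lo' := by
        by_contra hc
        have := hb (by linarith)
        linarith
      have h7 : max lo a < lo' := max_lt hlt hbh
      have := (h (max lo a) (le_max_right _ _) (by linarith)).1 ⟨le_max_left _ _, by linarith⟩
      linarith [this.1]
    · have hbh : a < lo := by
        by_contra hc
        linarith [hb (not_lt.1 hc)]
      have h7 : max lo' a < lo := max_lt hlt hbh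
      have := (h (max lo' a) (le_max_right _ _) (by linarith)).2 ⟨le_max_left _ _, by linarith⟩
      linarith [this.1]

theorem abs_le_iff_slab {c x y σ τ s ε : ℝ} (hτ : IsUnit1 τ) (h : σ * τ = s) :
    |c + τ * y - σ * x| ≤ ε ↔ -ε - τ * c ≤ y - s * x ∧ y - s * x ≤ ε - τ * c := by
  rw [← h, abs_le]
  rcases hτ with rfl | rfl
  · constructor <;> rintro ⟨h1, h2⟩ <;> constructor <;> linarith
  · constructor <;> rintro ⟨h1, h2⟩ <;> constructor <;> linarith

namespace Input

/-- The white part of the cell, as given by the data, is that of the curves `p` and `q`. -/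
def CellOK (I : Input) (p q : ℕ → ℝ) (i j : ℕ) : Prop :=
  ((I.hi i j < I.lo i j ∨ I.hi i j < slabMin (I.sl i j) (I.w i) ∨
      slabMax (I.sl i j) (I.w i) (I.h j) < I.lo i j) ∧
    (Below I.e p q i j ∨ Below I.e q p j i)) ∨
  (I.Full i j ∧ CellFull I.e p q i j) ∨
  ((p (i + 1) - p i) * (q (j + 1) - q j) = I.sl i j * (I.w i * I.h j) ∧
    (I.hi i j = I.e - (q (j + 1) - q j) / I.h j * (q j - p i) ∨
      slabMax (I.sl i j) (I.w i) (I.h j) ≤ I.hi i j ∧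
      slabMax (I.sl i j) (I.w i) (I.h j) ≤ I.e - (q (j + 1) - q j) / I.h j * (q j - p i)) ∧
    (I.lo i j = -I.e - (q (j + 1) - q j) / I.h j * (q j - p i) ∨
      I.lo i j ≤ slabMin (I.sl i j) (I.w i) ∧
      -I.e - (q (j + 1) - q j) / I.h j * (q j - p i) ≤ slabMin (I.sl i j) (I.w i)))

variable {I : Input} {p q : ℕ → ℝ} {σ τ : ℕ → ℤ}

/-- `CellMatch` quantifies over all points of the cell, while `CellOK` consists of finitely many
comparisons of input data and vertices. The directions are not stored: `τ j` is recovered as a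
quotient, and `σ i * τ j = sl i j` is tested after multiplication by width and height. -/
theorem cellOK_iff (hp : Chain I.n I.w p σ) (hq : Chain I.m I.h q τ) {i j : ℕ} (hi : i < I.n)
    (hj : j < I.m) : (I.CellOK p q i j ↔ CellMatch I.e (I.w i) (I.h j) (q j - p i) (σ i) (τ j)
      (I.sl i j) (I.lo i j) (I.hi i j)) := by
  have hs := sl_unit' hi hj
  have hw := w_pos' hi
  have hh := h_pos' hj
  have hτ := isUnit1_cast (hq j hj).1
  have e1 : p (i + 1) - p i = σ i * I.w i := by rw [(hp i hi).2]; ring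
  have e2 : (q (j + 1) - q j) / I.h j = τ j := by rw [(hq j hj).2]; field_simp; ring
  have e3 : q (j + 1) - q j = τ j * I.h j := by rw [(hq j hj).2]; ring
  have e4 : (p (i + 1) - p i) * (q (j + 1) - q j) = I.sl i j * (I.w i * I.h j) ↔
      (σ i : ℝ) * τ j = I.sl i j := by
    rw [e1, e3, show (σ i : ℝ) * I.w i * (τ j * I.h j) = (σ i * τ j) * (I.w i * I.h j) by ring]
    exact mul_left_inj' (mul_pos hw hh).ne'
  unfold CellOK
  rw [e4, e2]
  constructor
  · rintro (⟨h1, h2⟩ | ⟨h1, h2⟩ | ⟨h1, h2, h3⟩) x y hx hy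
    · have n1 := mt (exists_white_iff hp hq hi hj).1 (not_not.2 h2)
      have n2 := mt (white_iff (lo := I.lo i j) (hi := I.hi i j) hs hw hh).1 (by
        rintro ⟨a, b, c⟩
        rcases h1 with h | h | h <;> linarith)
      exact ⟨fun h => absurd ⟨x, y, hx, hy, h⟩ n1, fun h => absurd ⟨x, y, hx, hy, h⟩ n2⟩
    · exact ⟨fun _ => (full_iff_white hs hw hh).1 h1 x y hx hy,
        fun _ => (forall_white_iff hp hq hi hj).2 h2 x y hx hy⟩
    · rw [abs_le_iff_slab hτ h1]
      obtain ⟨b1, b2⟩ := slab_bounds hs hx hy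
      constructor
      · rintro ⟨c1, c2⟩
        constructor
        · rcases h3 with h | ⟨h, _⟩ <;> linarith
        · rcases h2 with h | ⟨h, _⟩ <;> linarith
      · rintro ⟨c1, c2⟩
        constructor
        · rcases h3 with h | ⟨_, h⟩ <;> linarith
        · rcases h2 with h | ⟨_, h⟩ <;> linarith
  · intro H
    by_cases hE : Below I.e p q i j ∨ Below I.e q p j i
    · refine Or.inl ⟨?_, hE⟩
      have n1 := mt (exists_white_iff hp hq hi hj).1 (not_not.2 hE)
      have n2 : ¬ _ := mt (white_iff (lo := I.lo i j) (hi := I.hi i j) hs hw hh).2 (by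
        rintro ⟨x, y, hx, hy, h⟩
        exact n1 ⟨x, y, hx, hy, (H x y hx hy).2 h⟩)
      by_contra hc
      push Not at hc
      exact n2 ⟨hc.1, hc.2.1, hc.2.2⟩
    right
    by_cases hF : CellFull I.e p q i j
    · refine Or.inl ⟨(full_iff_white hs hw hh).2 fun x y hx hy => ?_, hF⟩
      exact (H x y hx hy).1 ((forall_white_iff hp hq hi hj).2 hF x y hx hy)
    right
    obtain ⟨x₀, y₀, hx₀, hy₀, h₀⟩ := (exists_white_iff hp hq hi hj).2 hE
    -- A cell that is neither empty nor full has a visible boundary, which determines the slope.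
    -- After that both descriptions are intervals in the coordinate `y - s * x`, and `interval_eq`
    -- applies.
    have hst : (σ i : ℝ) * τ j = I.sl i j := by
      have w0 := (white_iff (lo := I.lo i j) (hi := I.hi i j) hs hw hh).1
        ⟨x₀, y₀, hx₀, hy₀, (H x₀ y₀ hx₀ hy₀).1 h₀⟩
      have hM : I.Mixed i j := by
        rw [mixed_iff_data]
        refine ⟨fun h => hF ((forall_white_iff hp hq hi hj).1 fun x y hx hy =>
          (H x y hx hy).2 ((full_iff_white hs hw hh).1 h x y hx hy)), fun h => ?_⟩
        rcases h with h | h | h <;> linarith [w0.1, w0.2.1, w0.2.2]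
      rcases hM with h | h
      · exact (H.upper hw hh (isUnit1_cast (hp i hi).1) hτ hs h).1
      · exact (H.lower hw hh (isUnit1_cast (hp i hi).1) hτ hs h).1
    refine ⟨hst, interval_eq (fun f h1 h2 => ?_) ⟨y₀ - I.sl i j * x₀, (slab_bounds hs hx₀ hy₀).1,
      (slab_bounds hs hx₀ hy₀).2, (H x₀ y₀ hx₀ hy₀).1 h₀⟩⟩
    obtain ⟨x, y, hx, hy, rfl⟩ := slab_surj hs hw hh h1 h2
    rw [← H x y hx hy, abs_le_iff_slab hτ hst]

theorem Sol.congr (S : I.Sol p q σ τ) {p' q' : ℕ → ℝ} (hp : ∀ i ≤ I.n, p' i = p i)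
    (hq : ∀ j ≤ I.m, q' j = q j) : I.Sol p' q' σ τ where
  chain_p i hi := by rw [hp i hi.le, hp (i + 1) hi]; exact S.chain_p i hi
  chain_q j hj := by rw [hq j hj.le, hq (j + 1) hj]; exact S.chain_q j hj
  cell i hi j hj := by rw [hp i hi.le, hq j hj.le]; exact S.cell i hi j hj

theorem exists_chain {N : ℕ} {len : ℕ → ℕ} {p : ℕ → ℝ} :
    (∀ i < N, p (i + 1) = p i + len i ∨ p (i + 1) = p i - len i) ↔ ∃ σ, Chain N len p σ := by
  classical
  constructor
  · intro h
    refine ⟨fun i => if p (i + 1) = p i + len i then 1 else -1, fun i hi => ?_⟩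
    dsimp only
    split_ifs with h1
    · exact ⟨Or.inl rfl, by rw [h1]; push_cast; ring⟩
    · exact ⟨Or.inr rfl, by rw [(h i hi).resolve_left h1]; push_cast; ring⟩
  · rintro ⟨σ, h⟩ i hi
    obtain ⟨h1 | h1, h2⟩ := h i hi
    · left; rw [h2, h1]; push_cast; ring
    · right; rw [h2, h1]; push_cast; ring

theorem exists_sol_iff : (∃ σ τ, I.Sol p q σ τ) ↔
    (∀ i < I.n, p (i + 1) = p i + I.w i ∨ p (i + 1) = p i - I.w i) ∧
    (∀ j < I.m, q (j + 1) = q j + I.h j ∨ q (j + 1) = q j - I.h j) ∧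
    ∀ i < I.n, ∀ j < I.m, I.CellOK p q i j := by
  rw [exists_chain, exists_chain]
  constructor
  · rintro ⟨σ, τ, S⟩
    exact ⟨⟨σ, S.chain_p⟩, ⟨τ, S.chain_q⟩, fun i hi j hj =>
      (cellOK_iff S.chain_p S.chain_q hi hj).2 (S.cell i hi j hj)⟩
  · rintro ⟨⟨σ, hp⟩, ⟨τ, hq⟩, h⟩
    exact ⟨σ, τ, hp, hq, fun i hi j hj => (cellOK_iff hp hq hi hj).1 (h i hi j hj)⟩

end Input

end FreeSpace

namespace RealRAM

open FreeSpace

/-! ### Verification -/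

section

abbrev belowC (A B : ℕ) (i j : IExpr) : Cond :=
  .and (.and (rlt (.add (.get A i) (real numE)) (.get B j))
      (rlt (.add (.get A i) (real numE)) (.get B (.add j (.const 1)))))
    (.and (rlt (.add (.get A (.add i (.const 1))) (real numE)) (.get B j))
      (rlt (.add (.get A (.add i (.const 1))) (real numE)) (.get B (.add j (.const 1)))))

abbrev aboveC (A B : ℕ) (i j : IExpr) : Cond :=
  .and (.and (.rle (.get B j) (.add (.get A i) (real numE)))
      (.rle (.get B (.add j (.const 1))) (.add (.get A i) (real numE))))
    (.and (.rle (.get B j) (.add (.get A (.add i (.const 1))) (real numE)))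
      (.rle (.get B (.add j (.const 1))) (.add (.get A (.add i (.const 1))) (real numE))))

abbrev stepE (A : ℕ) (i : IExpr) : RExpr := .sub (.get A (.add i (.const 1))) (.get A i)

abbrev shiftE (i j : IExpr) : RExpr :=
  .mul (.div (stepE 3 j) (real (.get 2 j))) (.sub (.get 3 j) (.get 2 i))

abbrev hiE' (i j : IExpr) : RExpr := .sub (real numE) (shiftE i j)
abbrev loE' (i j : IExpr) : RExpr := .sub (.sub (real (.const 0)) (real numE)) (shiftE i j)

/-- The test for `Input.CellOK`, for the curves in the real arrays `2` and `3`. -/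
def cellC (i j : IExpr) : Cond :=
  .or (.and (.or (rlt (hiE i j) (loE i j)) (.or (rlt (hiE i j) (slabMinE i j))
      (rlt (slabMaxE i j) (loE i j)))) (.or (belowC 2 3 i j) (belowC 3 2 j i)))
    (.or (.and (fullC i j) (.and (aboveC 2 3 i j) (aboveC 3 2 j i)))
    (.and (req (.mul (stepE 2 i) (stepE 3 j)) (.mul (real (slopeE i j))
        (.mul (real (.get 1 i)) (real (.get 2 j)))))
      (.and (.or (req (hiE i j) (hiE' i j))
          (.and (.rle (slabMaxE i j) (hiE i j)) (.rle (slabMaxE i j) (hiE' i j))))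
        (.or (req (loE i j) (loE' i j))
          (.and (.rle (loE i j) (slabMinE i j)) (.rle (loE' i j) (slabMinE i j)))))))

theorem cellC_holds {I : Input} {s : Memory} (H : Loaded I s) {i j : ℕ} (hi : i < I.n)
    (hj : j < I.m) {ei ej : IExpr} (hei : ei.eval s = i) (hej : ej.eval s = j) :
    (cellC ei ej).Holds s ↔
      I.CellOK (fun k => s.reals 2 (k : ℕ)) (fun k => s.reals 3 (k : ℕ)) i j := by
  have e2 : ∀ a b : ℝ, a ≤ b ∧ b ≤ a ↔ a = b := fun a b => le_antisymm_iff.symm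
  have hf := fullC_holds H hi hj hei hej
  unfold cellC Input.CellOK CellFull
  rw [below_iff, below_iff, segMax_le_iff, segMax_le_iff, ← hf]
  simp only [Cond.Holds, RExpr.eval, IExpr.eval, hei, hej, H.m, H.e, H.sl i hi j hj,
    H.lo i hi j hj, H.hi i hi j hj, H.w i hi, H.h j hj, FreeSpace.slabMin, FreeSpace.slabMax,
    not_le, e2]
  push_cast
  simp only [zero_sub]

end

def checkSteps (v A B : ℕ) (N : IExpr) : Program :=
  forLoop v N (.ite
    (.or (req (.get A (.add (.var v) (.const 1))) (.add (.get A (.var v)) (real (.get B (.var v)))))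
      (req (.get A (.add (.var v) (.const 1))) (.sub (.get A (.var v)) (real (.get B (.var v))))))
    .skip (.setInt 4 (.const 0) (.const 0)))

/-- Decides whether the curves in the real arrays `2` and `3` realize the diagram. -/
def verify : Program :=
  .seq (.setInt 4 (.const 0) (.const 1))
    (.seq (checkSteps 10 2 1 numN) (.seq (checkSteps 11 3 2 numM)
      (forCells (.ite (cellC (.var 10) (.var 11)) .skip (.setInt 4 (.const 0) (.const 0))))))

/-- The answer is `1` if `P` holds, and `0` otherwise. -/
def Says (P : Prop) (s : Memory) : Prop := (s.ints 4 0 = 1 ∧ P) ∨ (s.ints 4 0 = 0 ∧ ¬ P)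

theorem Says.congr {P P' : Prop} {s s' : Memory} (h : Says P s) (h4 : s'.ints 4 = s.ints 4)
    (hP : P ↔ P') : Says P' s' := by
  unfold Says at *
  rwa [h4, ← hP]

theorem checkSteps_spec {v A B : ℕ} (hv : v ≠ 4 ∧ v ≠ 0 ∧ v ≠ B) (hB : B ≠ 4) {N : IExpr}
    {s : Memory} {K : ℕ} {len : ℕ → ℕ} {P : Prop} {T : ℕ}
    (hN : ∀ s', s'.ints 0 = s.ints 0 → N.eval s' = K) (hl : ∀ i < K, s.ints B i = len i)
    (hP : Says P s) (hT : (K + 1) * (120 + N.cost) ≤ T) :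
    Ev (checkSteps v A B N) s T (Says (P ∧ ∀ i < K, s.reals A ((i + 1 : ℕ) : ℤ) =
      s.reals A i + len i ∨ s.reals A ((i + 1 : ℕ) : ℤ) = s.reals A i - len i)) := by
  obtain ⟨h4, h0, hvB⟩ := hv
  refine forLoop_ev K 100 (fun k => Says (P ∧ ∀ i < k, s.reals A ((i + 1 : ℕ) : ℤ) =
      s.reals A i + len i ∨ s.reals A ((i + 1 : ℕ) : ℤ) = s.reals A i - len i))
    (fun s' h => hN s' (h.ints 0 (by simp [Program.wI, h0.symm])))
    (fun k s z h => h.congr (by simp [h4.symm]) Iff.rfl)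
    (hP.congr rfl (by simp)) ?_ (fun s' _ h => h) (le_trans (by rw [show 100 + N.cost + 20 = 120 +
        N.cost by ring]) hT) (by simp [Program.wI, h4])
  intro k hk s' a hvk hi
  have eA : s'.reals A = s.reals A := a.reals A (by simp [Program.wR])
  have eB : s'.ints B = s.ints B := a.ints B (by simp [Program.wI, hB, Ne.symm hvB])
  have hb : (Cond.or
      (req (.get A (.add (.var v) (.const 1))) (.add (.get A (.var v)) (real (.get B (.var v)))))
      (req (.get A (.add (.var v) (.const 1)))
        (.sub (.get A (.var v)) (real (.get B (.var v)))))).Holds s' ↔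
      (s.reals A ((k + 1 : ℕ) : ℤ) = s.reals A k + len k ∨
        s.reals A ((k + 1 : ℕ) : ℤ) = s.reals A k - len k) := by
    have e2 : ∀ a b : ℝ, a ≤ b ∧ b ≤ a ↔ a = b := fun a b => le_antisymm_iff.symm
    simp only [Cond.Holds, RExpr.eval, IExpr.eval, hvk, eA, eB, hl k hk, e2]
    push_cast
    rfl
  refine Ev.straight (by rfl) ?_
    (by simp only [Program.bound, Cond.cost, RExpr.cost, IExpr.cost]; omega)
  by_cases hb' : s.reals A ((k + 1 : ℕ) : ℤ) = s.reals A k + len k ∨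
        s.reals A ((k + 1 : ℕ) : ℤ) = s.reals A k - len k
  · rw [Program.exec_ite_pos (hb.2 hb'), Program.exec]
    refine hi.congr rfl (and_congr_right fun _ => ⟨fun h i hi => ?_, fun h i hi => h i (by omega)⟩)
    rcases Nat.lt_succ_iff_lt_or_eq.1 hi with h' | rfl
    · exact h i h'
    · exact hb'
  · rw [Program.exec_ite_neg (by rwa [hb])]
    exact Or.inr ⟨by simp [Program.exec, IExpr.eval], fun h => hb' (h.2 k (Nat.lt_succ_self k))⟩

/-- The curves in the output arrays realize the diagram. -/
def Solved (I : Input) (s : Memory) : Prop :=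
  ∃ σ τ, I.Sol (fun k => s.reals 2 (k : ℕ)) (fun k => s.reals 3 (k : ℕ)) σ τ

theorem verify_spec : ∃ C, ∀ (I : Input) (s : Memory), Loaded I s →
    Ev verify s (C * ((I.n + 1) * (I.m + 1))) (fun s' => Says (Solved I s) s') := by
  obtain ⟨B, hB⟩ : ∃ B, B = (Program.ite (cellC (.var 10) (.var 11)) .skip
    (.setInt 4 (.const 0) (.const 0))).bound := ⟨_, rfl⟩
  refine ⟨B + 400, fun I s H => ?_⟩
  have h1 : I.n + 1 ≤ (I.n + 1) * (I.m + 1) := Nat.le_mul_of_pos_right _ (by omega)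
  have h2 : I.m + 1 ≤ (I.n + 1) * (I.m + 1) := Nat.le_mul_of_pos_left _ (by omega)
  refine Ev.seq' (T := 10) (T' := (I.n + 1) * 130 + ((I.m + 1) * 130 +
    (I.n + 1) * (I.m + 1) * (B + 60))) (P := Says True)
    (Ev.straight (by rfl) (Or.inl ⟨by simp [Program.exec, IExpr.eval], trivial⟩) (by decide))
    (fun s1 a1 k1 => ?_) (by nlinarith)
  have H1 : Loaded I s1 := H.of_agree a1
  refine Ev.seq' (checkSteps_spec (by decide) (by decide) (fun s' h => by
    simp only [IExpr.eval, h, H1.n]) H1.w k1 (Nat.mul_le_mul_left _ (by decide)))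
    (fun s2 a2 k2 => ?_) le_rfl
  have H2 : Loaded I s2 := H1.of_agree a2
  refine Ev.seq' (checkSteps_spec (by decide) (by decide) (fun s' h => by
    simp only [IExpr.eval, h, H2.m]) H2.h k2 (Nat.mul_le_mul_left _ (by decide)))
    (fun s3 a3 k3 => ?_) le_rfl
  have H3 : Loaded I s3 := H2.of_agree a3
  have e2 : s3.reals 2 = s.reals 2 := (a3.real 2).trans ((a2.real 2).trans (a1.real 2))
  have e3 : s3.reals 3 = s.reals 3 := (a3.real 3).trans ((a2.real 3).trans (a1.real 3))
  rw [show s1.reals 2 = s.reals 2 from a1.real 2,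
    show s2.reals 3 = s.reals 3 from (a2.real 3).trans (a1.real 3)] at k3
  set P₀ := (True ∧ ∀ i < I.n, s.reals 2 ((i + 1 : ℕ) : ℤ) =
      s.reals 2 i + I.w i ∨ s.reals 2 ((i + 1 : ℕ) : ℤ) = s.reals 2 i - I.w i) ∧
    ∀ i < I.m, s.reals 3 ((i + 1 : ℕ) : ℤ) =
      s.reals 3 i + I.h i ∨ s.reals 3 ((i + 1 : ℕ) : ℤ) = s.reals 3 i - I.h i with hP₀
  refine forCells_ev H3 B (fun i j => Says (P₀ ∧ ∀ i' < I.n, ∀ j' < I.m, (i' < i ∨ i' = i ∧ j' < j)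
      →
    I.CellOK (fun k => s.reals 2 (k : ℕ)) (fun k => s.reals 3 (k : ℕ)) i' j'))
    (fun i j s A z hA h => h.congr (by rcases hA with rfl | rfl <;> simp) Iff.rfl)
    (k3.congr rfl ⟨fun h => ⟨h, fun i _ j _ h => by omega⟩, fun h => h.1⟩)
    (fun i s h => h.congr rfl (and_congr_right fun _ => ⟨fun h i' hi' j' hj' hlt =>
      h i' hi' j' hj' (by omega), fun h i' hi' j' hj' hlt => h i' hi' j' hj' (by omega)⟩)) ?_ ?_
          le_rfl
  · intro i hi j hj s4 a4 h10 h11 hinv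
    have H4 : Loaded I s4 := H3.of_agree a4
    have hb := cellC_holds H4 hi hj (ei := .var 10) (ej := .var 11) (by simp only [IExpr.eval, h10])
      (by simp only [IExpr.eval, h11])
    rw [show s4.reals 2 = s.reals 2 from (a4.real 2).trans e2,
      show s4.reals 3 = s.reals 3 from (a4.real 3).trans e3] at hb
    refine Ev.straight (by rfl) ?_ hB.ge
    by_cases hb' : I.CellOK (fun k => s.reals 2 (k : ℕ)) (fun k => s.reals 3 (k : ℕ)) i j
    · rw [Program.exec_ite_pos (hb.2 hb'), Program.exec]
      refine hinv.congr rfl (and_congr_right fun _ => ⟨fun h i' hi' j' hj' hlt => ?_,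
        fun h i' hi' j' hj' hlt => h i' hi' j' hj' (by omega)⟩)
      by_cases heq : i' = i ∧ j' = j
      · rw [heq.1, heq.2]; exact hb'
      · exact h i' hi' j' hj' (by omega)
    · rw [Program.exec_ite_neg (by rwa [hb])]
      exact Or.inr ⟨by simp [Program.exec, IExpr.eval], fun h => hb' (h.2 i hi j hj (by omega))⟩
  · intro s' _ h
    refine h.congr rfl ?_
    unfold Solved
    rw [Input.exists_sol_iff, hP₀]
    constructor
    · rintro ⟨⟨⟨_, c1⟩, c2⟩, c3⟩
      exact ⟨c1, c2, fun i hi j hj => c3 i hi j hj (Or.inl hi)⟩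
    · rintro ⟨c1, c2, c3⟩
      exact ⟨⟨⟨trivial, c1⟩, c2⟩, fun i hi j hj _ => c3 i hi j hj⟩

/-- Copies a curve to the real array `dst`. -/
def copyOut (dst : ℕ) (N : IExpr) : Program :=
  forLoop 10 (.add N (.const 1)) (.setReal dst (.var 10) (.get 9 (.var 10)))

theorem copyOut_spec {dst : ℕ} {N : IExpr} {s : Memory} {K T : ℕ} (hd : dst ≠ 9)
    (hN : ∀ s', s'.ints 0 = s.ints 0 → N.eval s' = K) (hT : (K + 2) * (40 + N.cost) ≤ T) :
    Ev (copyOut dst N) s T (fun s' => ∀ i : ℕ, i ≤ K → s'.reals dst i = s.reals 9 i) := by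
  refine forLoop_ev (K + 1) 10 (fun k s' => ∀ i : ℕ, i < k → s'.reals dst i = s.reals 9 i)
    (fun s' h => by simp [IExpr.eval, hN s' (h.int 0)]) (fun k s z h => by simpa using h)
    (fun i hi => by omega) ?_ (fun s' _ h i hi => h i (by omega))
    (le_trans (Nat.mul_le_mul_left _ (by simp only [IExpr.cost]; omega)) hT)
  intro k hk s' a h10 hi
  have e9 : s'.reals 9 = s.reals 9 := a.reals 9 (by simp [Program.wR, hd.symm])
  refine Ev.straight (by rfl) ?_ (by simp only [Program.bound, RExpr.cost, IExpr.cost]; omega)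
  simp only [Program.exec, IExpr.eval, RExpr.eval, h10, e9, Memory.setReal_reals, if_true]
  intro i hik
  by_cases h : i = k
  · rw [h, Function.update_self]
  · rw [Function.update_of_ne (by exact_mod_cast h)]
    exact hi i (by omega)

end RealRAM

namespace RealRAM

open FreeSpace

/-! ### Writing lists of values -/

/-- The real arrays that an expression reads. -/
def RExpr.reads : RExpr → List ℕ
  | ofInt _ => []
  | get A _ => [A]
  | add a b => a.reads ++ b.reads
  | sub a b => a.reads ++ b.reads
  | mul a b => a.reads ++ b.reads
  | div a b => a.reads ++ b.reads

theorem IExpr.eval_congr {s s' : Memory} (h : s'.ints = s.ints) (e : IExpr) :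
    e.eval s' = e.eval s := by
  induction e with
  | const z => rfl
  | get A e ih => simp only [eval, ih, h]
  | add e f ih1 ih2 => simp only [eval, ih1, ih2]
  | sub e f ih1 ih2 => simp only [eval, ih1, ih2]
  | mul e f ih1 ih2 => simp only [eval, ih1, ih2]

theorem RExpr.eval_congr {s s' : Memory} (h : s'.ints = s.ints) (a : RExpr)
    (hr : ∀ B ∈ a.reads, s'.reals B = s.reals B) : a.eval s' = a.eval s := by
  induction a with
  | ofInt e => simp only [eval, IExpr.eval_congr h]
  | get A e => simp only [eval, IExpr.eval_congr h, hr A (by simp [reads])]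
  | add a b ih1 ih2 | sub a b ih1 ih2 | mul a b ih1 ih2 | div a b ih1 ih2 =>
    simp only [reads, List.mem_append] at hr
    simp only [eval, ih1 fun B hB => hr B (Or.inl hB), ih2 fun B hB => hr B (Or.inr hB)]

/-- Writes the values of the expressions to the cells `k`, `k + 1`, … of the real array `A`. -/
def setCells (A : ℕ) : ℕ → List RExpr → Program
  | _, [] => .skip
  | k, x :: l => .seq (.setReal A (.const k) x) (setCells A (k + 1) l)

/-- In `s'` the cells `k`, `k + 1`, … of the real array `A` hold the values of the expressions. -/
def Cells (s s' : Memory) (A : ℕ) : ℕ → List RExpr → Prop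
  | _, [] => True
  | k, x :: l => s'.reals A k = x.eval s ∧ Cells s s' A (k + 1) l

theorem setCells_straight (A : ℕ) (l : List RExpr) : ∀ k, (setCells A k l).straight = true := by
  induction l with
  | nil => exact fun _ => rfl
  | cons x l ih => exact fun k => by simp [setCells, Program.straight, ih]

/-- No expression reads the array that is being written, so all of them have the values they had in
the initial memory. -/
theorem setCells_exec {A : ℕ} {l : List RExpr} {s : Memory} :
    ∀ (k : ℕ) (s₁ : Memory), Agree [] [A] s s₁ → (∀ x ∈ l, A ∉ x.reads) →
      Cells s ((setCells A k l).exec s₁) A k l ∧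
      ∀ z : ℤ, z < k → ((setCells A k l).exec s₁).reals A z = s₁.reals A z := by
  induction l with
  | nil => exact fun k s₁ _ _ => ⟨trivial, fun _ _ => rfl⟩
  | cons x l ih =>
    intro k s₁ ha hl
    have hx : x.eval s₁ = x.eval s := RExpr.eval_congr (funext fun B => ha.ints B (by simp)) x
      fun B hB => ha.reals B fun h => hl x (by simp) (by rw [List.mem_singleton.1 h] at hB; exact
          hB)
    simp only [setCells, Program.exec, IExpr.eval, hx]
    obtain ⟨h1, h2⟩ := ih (k + 1) (s₁.setReal A k (x.eval s)) (ha.trans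
      ⟨fun _ _ => rfl, fun B hB => by simp at hB; simp [hB]⟩) fun y hy => hl y (by simp [hy])
    refine ⟨⟨?_, h1⟩, fun z hz => ?_⟩
    · rw [h2 k (by push_cast; omega)]; simp
    · rw [h2 z (by push_cast; omega)]; simp [Function.update_of_ne hz.ne]

theorem setCells_ev {A : ℕ} {l : List RExpr} {s : Memory} {T : ℕ}
    (hT : (setCells A 0 l).bound ≤ T)
    (hl : (l.all fun x => !x.reads.contains A) = true := by rfl) :
    Ev (setCells A 0 l) s T (fun s' => Cells s s' A 0 l) :=
  Ev.straight (setCells_straight A l 0) (setCells_exec 0 s (Agree.refl _ _ _) fun x hx h => by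
    have := List.all_eq_true.1 hl x hx
    simp_all).1 hT

/-! ### Looking for a pair of curves -/

/-- The walls described by the real array `A`. -/
def WallsFrom (s : Memory) (A : ℕ) (M : ℤ) (W : Walls) : Prop :=
  W.Interval 0 (s.reals A 1) (s.reals A 2) (s.reals A 3) (s.reals A 0) (s.reals A 0 + M) ∧
  W.Interval 1 (s.reals A 4) (s.reals A 5) (s.reals A 6) (s.reals A 0) (s.reals A 0 + M) ∧
  W.Interval 2 (s.reals A 7) (s.reals A 8) (s.reals A 9) (s.reals A 0) (s.reals A 0 + M) ∧
  W.Outside 3 (s.reals A 10) (s.reals A 11)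

theorem WallsFrom.congr {s s' : Memory} {A : ℕ} {M : ℤ} {W : Walls} (h : WallsFrom s A M W)
    (hs : s'.reals A = s.reals A) : WallsFrom s' A M W := by
  unfold WallsFrom at *
  rwa [hs]

/-- When the search for one curve fails, nothing has been said about the other one, but
`ShortMissed` requires walls for both. -/
theorem exists_wallsFrom (s : Memory) (A : ℕ) (M : ℤ) : ∃ W, WallsFrom s A M W := by
  -- The values for class `c` are stored from cell `3 * c + 1` on. For class `3` the inner interval
  -- is made empty by `1 > 0`.
  refine ⟨⟨fun c => if c = 3 then 1 else s.reals A (3 * c + 1),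
    fun c => if c = 3 then 0 else s.reals A (3 * c + 2),
    fun c => if c = 3 then s.reals A 10 else s.reals A 0,
    fun c => if c = 3 then s.reals A 11 else s.reals A 0 + M, fun c => s.reals A (3 * c + 3)⟩, ?_⟩
  simp [WallsFrom, Walls.Interval, Walls.Outside]

section
variable (A : ℕ)

abbrev cellE (k : ℤ) : RExpr := .get A (.const k)
abbrev topE : RExpr := .add (cellE A 0) (real (.var 22))

/-- Installs the walls described by the real array `A`. -/
def install (mc : ℤ) : Program :=
  .seq (.setInt 22 (.const 0) (.get 27 (.const mc)))
  (.seq (setCells 35 0 [cellE A 0])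
  (.seq (setCells 30 0 [cellE A 1, cellE A 4, cellE A 7, real (.const 1)])
  (.seq (setCells 31 0 [cellE A 2, cellE A 5, cellE A 8, real (.const 0)])
  (.seq (setCells 32 0 [cellE A 0, cellE A 0, cellE A 0, cellE A 10])
  (.seq (setCells 33 0 [topE A, topE A, topE A, cellE A 11])
  (setCells 34 0 [cellE A 3, cellE A 6, cellE A 9]))))))

end

theorem install_spec {A : ℕ} (hA : A = 40 ∨ A = 41) (mc : ℤ) (s : Memory) :
    Ev (install A mc) s 500 (fun s' => s'.ints 22 0 = s.ints 27 mc ∧ s'.reals 35 0 = s.reals A 0 ∧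
      WallsFrom s A (s.ints 27 mc) (walls s')) := by
  refine Ev.seq' (T := 10) (T' := 490) (P := fun s' => s'.ints 22 0 = s.ints 27 mc)
    (Ev.straight (by rfl) (by simp [Program.exec, IExpr.eval])
      (by simp [Program.bound, IExpr.cost])) (fun s1 a1 h1 => ?_) (by decide)
  refine Ev.seq' (T := 10) (T' := 480) (setCells_ev (by rcases hA with rfl | rfl <;> decide)
    (by rcases hA with rfl | rfl <;> rfl)) (fun s2 a2 h2 => ?_) (by decide)
  refine Ev.seq' (T := 90) (T' := 390) (setCells_ev (by rcases hA with rfl | rfl <;> decide)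
    (by rcases hA with rfl | rfl <;> rfl)) (fun s3 a3 h3 => ?_) (by decide)
  refine Ev.seq' (T := 90) (T' := 300) (setCells_ev (by rcases hA with rfl | rfl <;> decide)
    (by rcases hA with rfl | rfl <;> rfl)) (fun s4 a4 h4 => ?_) (by decide)
  refine Ev.seq' (T := 90) (T' := 210) (setCells_ev (by rcases hA with rfl | rfl <;> decide)
    (by rcases hA with rfl | rfl <;> rfl)) (fun s5 a5 h5 => ?_) (by decide)
  refine Ev.seq' (T := 120) (T' := 90) (setCells_ev (by rcases hA with rfl | rfl <;> decide)
    (by rcases hA with rfl | rfl <;> rfl)) (fun s6 a6 h6 => ?_) (by decide)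
  refine (setCells_ev (by rcases hA with rfl | rfl <;> decide)
    (by rcases hA with rfl | rfl <;> rfl)).agree.mono le_rfl fun s7 ⟨h7, a7⟩ => ?_
  have eA : ∀ B, B = 40 ∨ B = 41 → s2.reals B = s.reals B ∧ s3.reals B = s.reals B ∧
      s4.reals B = s.reals B ∧ s5.reals B = s.reals B ∧ s6.reals B = s.reals B ∧
      s1.reals B = s.reals B := by
    rintro B (rfl | rfl)
    · simp only [a6.real 40, a5.real 40, a4.real 40, a3.real 40, a2.real 40, a1.real 40, and_self]
    · simp only [a6.real 41, a5.real 41, a4.real 41, a3.real 41, a2.real 41, a1.real 41, and_self]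
  obtain ⟨q2, q3, q4, q5, q6, q1⟩ := eA A hA
  have e22 : s5.ints 22 0 = s.ints 27 mc := by
    rw [a5.int 22, a4.int 22, a3.int 22, a2.int 22, h1]
  simp only [Cells, RExpr.eval, IExpr.eval, q1, q2, q3, q4, q5, q6, e22, Nat.cast_zero, zero_add,
    Nat.cast_one, and_true, Nat.reduceAdd, Nat.cast_ofNat, Int.cast_one, Int.cast_zero]
    at h2 h3 h4 h5 h6 h7
  have w30 : s7.reals 30 = s3.reals 30 := by
    rw [a7.real 30, a6.real 30, a5.real 30, a4.real 30]
  have w31 : s7.reals 31 = s4.reals 31 := by rw [a7.real 31, a6.real 31, a5.real 31]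
  have w32 : s7.reals 32 = s5.reals 32 := by rw [a7.real 32, a6.real 32]
  have w33 : s7.reals 33 = s6.reals 33 := a7.real 33
  refine ⟨by rw [a7.int 22, a6.int 22, e22], ?_, ?_⟩
  · rw [a7.real 35, a6.real 35, a5.real 35, a4.real 35, a3.real 35, h2]
  · simp only [WallsFrom, Walls.Interval, Walls.Outside, walls, w30, w31, w32, w33, h3, h4, h5, h6,
        h7]
    simp

/-- Looks for a pair of curves within the walls described by the real arrays `40` and `41`. -/
def trial : Program :=
  .seq (.setInt 26 (.const 0) (.const 0))
  (.seq (install 40 0)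
  (.seq (findPath numN (.const 0) 1)
  (.ite (.ile (.const 1) (.var 19))
    (.seq (copyOut 2 numN)
    (.seq (install 41 1)
    (.seq (findPath numM numN 2)
    (.ite (.ile (.const 1) (.var 19))
      (.seq (copyOut 3 numM) (.setInt 26 (.const 0) (.const 1)))
      .skip))))
    .skip)))

def TrialOK (I : Input) (s s' : Memory) (M M' : ℕ) : Prop :=
  ∃ W W' x sg x' sg', WallsFrom s 40 M W ∧ WallsFrom s 41 M' W' ∧
    (I.colLine (marks I s)).IsPath W (s.reals 40 0) M x sg ∧
    (I.rowLine (marks I s)).IsPath W' (s.reals 41 0) M' x' sg' ∧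
    (∀ i : ℕ, i ≤ I.n → s'.reals 2 i = s.reals 40 0 + x i) ∧
    ∀ j : ℕ, j ≤ I.m → s'.reals 3 j = s.reals 41 0 + x' j

def TrialFail (I : Input) (s : Memory) (M M' : ℕ) : Prop :=
  (∃ W, WallsFrom s 40 M W ∧ ¬ ∃ x sg, (I.colLine (marks I s)).IsPath W (s.reals 40 0) M x sg) ∨
  ∃ W, WallsFrom s 41 M' W ∧ ¬ ∃ x sg, (I.rowLine (marks I s)).IsPath W (s.reals 41 0) M' x sg

theorem marks_congr {I : Input} {s s' : Memory} (h6 : s'.ints 6 = s.ints 6)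
    (h7 : s'.ints 7 = s.ints 7) (h4 : s'.reals 4 = s.reals 4) : marks I s' = marks I s := by
  unfold marks
  rw [h6, h7, h4]

/-- The walls do not couple the two curves, so these are searched one after the other and the sizes
of the two tables add up instead of being multiplied. -/
theorem trial_spec : ∃ C, ∀ (I : Input) (s : Memory) (M M' : ℕ), Loaded I s → s.ints 27 0 = M →
    s.ints 27 1 = M' →
    Ev trial s (C * ((I.n + 1) * (M + 1) + (I.m + 1) * (M' + 1))) (fun s' =>
      (s'.ints 26 0 = 1 ∧ TrialOK I s s' M M') ∨ (s'.ints 26 0 = 0 ∧ TrialFail I s M M')) := by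
  obtain ⟨C₁, hC₁⟩ := findPath_spec numN (.const 0) 1
  obtain ⟨C₂, hC₂⟩ := findPath_spec numM numN 2
  refine ⟨C₁ + C₂ + 2000, fun I s M M' H hM hM' => ?_⟩
  have t1 : I.n + 1 ≤ (I.n + 1) * (M + 1) := Nat.le_mul_of_pos_right _ (by omega)
  have t2 : I.m + 1 ≤ (I.m + 1) * (M' + 1) := Nat.le_mul_of_pos_right _ (by omega)
  refine Ev.seq' (T := 10) (T' := 500 + (C₁ * ((I.n + 1) * (M + 1)) + (10 + ((I.n + 2) * 50 +
    (500 + (C₂ * ((I.m + 1) * (M' + 1)) + (10 + ((I.m + 2) * 50 + 10))))))))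
    (P := fun s' => s'.ints 26 0 = 0)
    (Ev.straight (by rfl) (by simp [Program.exec, IExpr.eval]) (by decide)) (fun s1 a1 h1 => ?_)
    (by nlinarith)
  refine Ev.seq' (install_spec (Or.inl rfl) 0 s1) (fun s2 a2 ⟨b1, b2, b3⟩ => ?_) le_rfl
  have H2 : Loaded I s2 := (H.of_agree a1).of_agree a2
  have a12 : Agree [22, 26] [30, 31, 32, 33, 34, 35] s s2 := a1.widen.trans a2.widen
  have mk2 : marks I s2 = marks I s := marks_congr (a12.int 6) (a12.int 7) (a12.real 4)
  rw [show s1.ints 27 = s.ints 27 from a1.int 27, hM] at b1 b3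
  rw [show s1.reals 40 = s.reals 40 from a1.real 40] at b2
  have b3' : WallsFrom s 40 M (walls s2) := b3.congr (a1.real 40).symm
  have L2 := H2.reads_col
  rw [mk2] at L2
  refine Ev.seq' (hC₁ _ s2 M L2 b1) (fun s3 a3 h3 => ?_) le_rfl
  rw [b2] at h3
  have e26 : s3.ints 26 0 = 0 := by rw [a3.int 26, a2.int 26, h1]
  refine Ev.ite (T := (I.n + 2) * 50 +
    (500 + (C₂ * ((I.m + 1) * (M' + 1)) + (10 + ((I.m + 2) * 50 + 10))))) (fun hb => ?_)
    (fun hb => ?_) (by simp only [Cond.cost, IExpr.cost]; omega)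
  all_goals simp only [Cond.Holds, IExpr.eval] at hb
  swap
  · obtain ⟨-, h3⟩ := h3.resolve_left (by omega)
    exact Ev.straight (by rfl) (Or.inr ⟨e26, Or.inl ⟨_, b3', h3⟩⟩)
      (by simp only [Program.bound]; omega)
  obtain ⟨-, x, sg, hP, hx⟩ := h3.resolve_right (by omega)
  have H3 : Loaded I s3 := H2.of_agree a3
  refine Ev.seq' (copyOut_spec (by decide) (K := I.n) (fun s' h => by
    simp only [IExpr.eval, h, H3.n]) (Nat.mul_le_mul_left _ (by decide))) (fun s4 a4 h4 => ?_)
        le_rfl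
  refine Ev.seq' (install_spec (Or.inr rfl) 1 s4) (fun s5 a5 ⟨c1, c2, c3⟩ => ?_) le_rfl
  have H5 : Loaded I s5 := (H3.of_agree a4).of_agree a5
  have a15 : Agree [9, 10, 15, 16, 17, 18, 19, 22, 26] [2, 9, 30, 31, 32, 33, 34, 35] s s5 :=
    a12.widen.trans (a3.widen.trans (a4.widen.trans a5.widen))
  have a14 : Agree [9, 10, 15, 16, 17, 18, 19, 22, 26] [2, 9, 30, 31, 32, 33, 34, 35] s s4 :=
    a12.widen.trans (a3.widen.trans a4.widen)
  have mk5 : marks I s5 = marks I s := marks_congr (a15.int 6) (a15.int 7) (a15.real 4)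
  rw [show s4.ints 27 = s.ints 27 from a14.int 27, hM'] at c1 c3
  rw [show s4.reals 41 = s.reals 41 from a14.real 41] at c2
  have c3' : WallsFrom s 41 M' (walls s5) := c3.congr (a14.real 41).symm
  have L5 := H5.reads_row
  rw [mk5] at L5
  refine Ev.seq' (hC₂ _ s5 M' L5 c1) (fun s6 a6 h6 => ?_) le_rfl
  rw [c2] at h6
  have f26 : s6.ints 26 0 = 0 := by rw [a6.int 26, a5.int 26, a4.int 26, e26]
  refine Ev.ite (T := (I.m + 2) * 50 + 10) (fun hb => ?_)
    (fun hb => ?_) (by simp only [Cond.cost, IExpr.cost]; omega)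
  all_goals simp only [Cond.Holds, IExpr.eval] at hb
  swap
  · obtain ⟨-, h6⟩ := h6.resolve_left (by omega)
    exact Ev.straight (by rfl) (Or.inr ⟨f26, Or.inr ⟨_, c3', h6⟩⟩)
      (by simp only [Program.bound]; omega)
  obtain ⟨-, x', sg', hP', hx'⟩ := h6.resolve_right (by omega)
  have H6 : Loaded I s6 := H5.of_agree a6
  refine Ev.seq' (copyOut_spec (by decide) (K := I.m) (fun s' h => by
    simp only [IExpr.eval, h, H6.m]) (Nat.mul_le_mul_left _ (by decide))) (fun s7 a7 h7 => ?_)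
        le_rfl
  refine Ev.straight (by rfl) (Or.inl ⟨by simp [Program.exec, IExpr.eval], ?_⟩) (by decide)
  refine ⟨_, _, x, sg, x', sg', b3', c3', hP, hP', fun i hi => ?_, fun j hj => ?_⟩
  · change s7.reals 2 i = _
    rw [a7.real 2, a6.real 2, a5.real 2, h4 i hi, hx i hi]
  · change s7.reals 3 j = _
    rw [h7 j hj, hx' j hj]

end RealRAM

/-! ### Diagrams without white cells -/

namespace FreeSpace.Input

variable {I : Input} {p q : ℕ → ℝ} {σ τ : ℕ → ℤ}

/-- A diagram without white cells is realized by curves that move away from each other. -/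
theorem Sol.of_disjoint (S : I.Sol p q σ τ)
    (hd : ∀ i < I.n, ∀ j < I.m, Below I.e p q i j ∨ Below I.e q p j i) {p' q' : ℕ → ℝ}
    (hp0 : p' 0 = 0) (hp : ∀ i < I.n, p' (i + 1) = p' i + ((-1 : ℤ) : ℝ) * I.w i)
    (hq0 : q' 0 = I.e + 1) (hq : ∀ j < I.m, q' (j + 1) = q' j + ((1 : ℤ) : ℝ) * I.h j) :
    I.Sol p' q' (fun _ => -1) (fun _ => 1) := by
  have hp1 : ∀ i ≤ I.n, p' i ≤ 0 := by
    intro i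
    induction i with
    | zero => exact fun _ => hp0.le
    | succ i ih =>
      intro hi
      have := ih (by omega)
      have : (0 : ℝ) ≤ I.w i := Nat.cast_nonneg _
      rw [hp i (by omega)]
      push_cast
      linarith
  have hq1 : ∀ j ≤ I.m, (I.e : ℝ) + 1 ≤ q' j := by
    intro j
    induction j with
    | zero => exact fun _ => hq0.ge
    | succ j ih =>
      intro hj
      have := ih (by omega)
      have : (0 : ℝ) ≤ I.h j := Nat.cast_nonneg _
      rw [hq j (by omega)]
      push_cast
      linarith
  refine S.of_cells (fun i hi => ⟨Or.inr rfl, hp i hi⟩) (fun j hj => ⟨Or.inl rfl, hq j hj⟩)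
    fun i hi j hj => Or.inr (Or.inr ⟨hd i hi j hj, Or.inl ?_⟩)
  rw [below_iff]
  have := hp1 i hi.le
  have := hp1 (i + 1) hi
  have := hq1 j hj.le
  have := hq1 (j + 1) hj
  refine ⟨⟨?_, ?_⟩, ?_, ?_⟩ <;> linarith

end FreeSpace.Input

namespace RealRAM

open FreeSpace

/-- Writes to the real array `A` the monotone curve that starts at `z`, with the lengths in the
integer array `B` and the direction `d`. -/
def monotoneCurve (v A B : ℕ) (N z : IExpr) (d : ℤ) : Program :=
  .seq (.setReal A (.const 0) (real z))
    (forLoop v N (.setReal A (.add (.var v) (.const 1))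
      (.add (.get A (.var v)) (real (.mul (.const d) (.get B (.var v)))))))

theorem monotoneCurve_spec {v A B : ℕ} (hv : v ≠ 0 ∧ v ≠ B) {N z : IExpr} {d : ℤ} {s : Memory}
    {K T : ℕ} {len : ℕ → ℕ} (hN : ∀ s', s'.ints 0 = s.ints 0 → N.eval s' = K)
    (hl : ∀ i < K, s.ints B i = len i) (hT : (K + 1) * (100 + N.cost + z.cost) ≤ T) :
    Ev (monotoneCurve v A B N z d) s T (fun s' => s'.reals A 0 = z.eval s ∧
      ∀ i < K, s'.reals A ((i + 1 : ℕ) : ℤ) = s'.reals A i + (d : ℝ) * len i) := by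
  obtain ⟨h0, hvB⟩ := hv
  refine Ev.seq' (T := 10 + z.cost) (T' := (K + 1) * (50 + N.cost + 20))
    (P := fun s' => s'.reals A 0 = z.eval s)
    (Ev.straight (by rfl) (by simp [Program.exec, IExpr.eval, RExpr.eval])
      (by simp only [Program.bound, RExpr.cost, IExpr.cost]; omega)) (fun s1 a1 h1 => ?_)
    (by nlinarith)
  have i1 : ∀ C, s1.ints C = s.ints C := fun C => a1.ints C (by simp [Program.wI])
  refine forLoop_ev K 50 (fun k s' => s'.reals A 0 = z.eval s ∧
      ∀ i < k, s'.reals A ((i + 1 : ℕ) : ℤ) = s'.reals A i + (d : ℝ) * len i)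
    (fun s' h => hN s' ((h.ints 0 (by simp [Program.wI, h0.symm])).trans (i1 0)))
    (fun k s w h => by simpa using h) ⟨h1, fun i hi => by omega⟩ ?_ (fun s' _ h => h) le_rfl
  intro k hk s2 a2 h10 ⟨g0, g⟩
  have eB : s2.ints B = s.ints B := (a2.ints B (by simp [Program.wI, hvB.symm])).trans (i1 B)
  refine Ev.straight (by rfl) ?_ (by simp only [Program.bound, RExpr.cost, IExpr.cost]; omega)
  simp only [Program.exec, IExpr.eval, RExpr.eval, h10, eB, hl k hk, Memory.setReal_reals, if_true]
  push_cast
  refine ⟨?_, fun i hi => ?_⟩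
  · rw [Function.update_of_ne (by omega), g0]
  · rw [Function.update_of_ne (a := (i : ℤ)) (by omega)]
    by_cases h : i = k
    · subst h; simp
    · rw [Function.update_of_ne (by omega)]
      exact_mod_cast g i (by omega)

/-- Writes two curves that move away from each other. -/
def separate : Program :=
  .seq (monotoneCurve 10 2 1 numN (.const 0) (-1))
    (monotoneCurve 11 3 2 numM (.add numE (.const 1)) 1)

/-- The program does not test whether the diagram is empty; the verification that follows decides,
so only this conditional statement is needed. -/
theorem separate_spec : ∃ C, ∀ (I : Input) (s : Memory), Loaded I s →
    Ev separate s (C * (I.n + I.m + 1)) (fun s' => ∀ p q σ τ, I.Sol p q σ τ →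
      (∀ i < I.n, ∀ j < I.m, Below I.e p q i j ∨ Below I.e q p j i) → Solved I s') := by
  refine ⟨500, fun I s H => ?_⟩
  refine Ev.seq' (monotoneCurve_spec (by decide) (K := I.n) (fun s' h => by
    simp only [IExpr.eval, h, H.n]) H.w (Nat.mul_le_mul_left _ (show _ ≤ 120 by decide)))
    (fun s1 a1 ⟨h1, h1'⟩ => ?_) (T' := (I.m + 1) * 120) (by nlinarith)
  have H1 : Loaded I s1 := H.of_agree a1
  refine (monotoneCurve_spec (by decide) (K := I.m) (fun s' h => by
    simp only [IExpr.eval, h, H1.m]) H1.h (Nat.mul_le_mul_left _ (by decide))).agree.mono le_rfl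
    fun s2 ⟨⟨h2, h2'⟩, a2⟩ => ?_
  intro p q σ τ S hd
  rw [← show s2.reals 2 = s1.reals 2 from a2.real 2] at h1 h1'
  refine ⟨_, _, S.of_disjoint hd (by simpa [IExpr.eval] using h1) h1' ?_ h2'⟩
  refine h2.trans ?_
  simp only [IExpr.eval, H1.e]
  push_cast
  rfl

/-! ### Measuring the marked parts -/

def extremesTo (c : ℤ) (N off : IExpr) (A : ℕ) (d₁ d₂ : RExpr) (a b : ℕ) : Program :=
  .seq (extremes c N off A d₁ d₂)
    (.seq (.setReal a (.const 0) (.var 20)) (.setReal b (.const 0) (.var 21)))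

theorem extremesTo_spec (c : ℤ) (N off : IExpr) (A : ℕ) (d₁ d₂ : RExpr) {a b : ℕ} (hab : a ≠ b)
    (ha : a ≠ 21) : ∃ C, ∀ (L : Line) (s : Memory) (v₁ v₂ : ℝ), Reads L N off A s →
    (∀ s', Agree [] [20, 21] s s' → d₁.eval s' = v₁ ∧ d₂.eval s' = v₂) →
    Ev (extremesTo c N off A d₁ d₂ a b) s (C * (L.N + 1))
      (fun s' => L.Extremes c (s'.reals a 0) (s'.reals b 0) v₁ v₂) := by
  obtain ⟨C, hC⟩ := extremes_spec c N off A d₁ d₂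
  refine ⟨C + 20, fun L s v₁ v₂ H hd => ?_⟩
  refine Ev.seq' (hC L s v₁ v₂ H hd) (fun s1 _ h1 => ?_) (T' := 20) (by nlinarith)
  refine Ev.straight (by rfl) ?_ (by simp [Program.bound, RExpr.cost, IExpr.cost])
  simp only [Program.exec, IExpr.eval, RExpr.eval, Memory.setReal_reals, if_true, if_neg hab,
    if_neg ha.symm, Function.update_self]
  exact h1

def sumTo (N : IExpr) (A a : ℕ) : Program :=
  .seq (sumLen N A) (.setInt a (.const 0) (.var 21))

theorem sumTo_spec (N : IExpr) (A a : ℕ) : ∃ C, ∀ (L : Line) (s : Memory) (off : IExpr),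
    Reads L N off A s → Ev (sumTo N A a) s (C * (L.N + 1))
      (fun s' => s'.ints a 0 = ((∑ i ∈ Finset.range L.N, L.len i : ℕ) : ℤ)) := by
  obtain ⟨C, hC⟩ := sumLen_spec N A
  refine ⟨C + 20, fun L s off H => ?_⟩
  refine Ev.seq' (hC L s off H) (fun s1 _ h1 => ?_) (T' := 20) (by nlinarith)
  exact Ev.straight (by rfl) (by simpa [Program.exec, IExpr.eval] using h1)
    (by simp [Program.bound, IExpr.cost])

/-- Determines the extent of the marked parts of the curves and the lengths of the curves. -/
def measure : Program :=
  .seq (extremesTo 1 numN (.const 0) 1 (real (.const 0)) (real (.const 0)) 22 23)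
  (.seq (extremesTo 1 numM numN 2 (real (.const 0)) (real numE) 24 25)
  (.seq (extremesTo 2 numN (.const 0) 1 (real (.const 0)) (real (.const 0)) 28 26)
  (.seq (extremesTo 2 numM numN 2 (real (.sub (.const 0) numE)) (real (.sub (.const 0) numE)) 27 29)
  (.seq (sumTo numN 1 23) (sumTo numM 2 24)))))

/-- The default values for empty classes, `0` and `ε` for class 1 and `0` and `-ε` for class 2, are
those for which the walls of the short case are still correct, see `Fits.short_sides`. -/
structure Measured (I : Input) (s : Memory) : Prop where
  col1 : (I.colLine (marks I s)).Extremes 1 (s.reals 22 0) (s.reals 23 0) 0 0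
  row1 : (I.rowLine (marks I s)).Extremes 1 (s.reals 24 0) (s.reals 25 0) 0 I.e
  col2 : (I.colLine (marks I s)).Extremes 2 (s.reals 28 0) (s.reals 26 0) 0 0
  row2 : (I.rowLine (marks I s)).Extremes 2 (s.reals 27 0) (s.reals 29 0) (-I.e) (-I.e)
  lenP : s.ints 23 0 = ((∑ i ∈ Finset.range I.n, I.w i : ℕ) : ℤ)
  lenQ : s.ints 24 0 = ((∑ j ∈ Finset.range I.m, I.h j : ℕ) : ℤ)

theorem Measured.of_agree {I : Input} {s s' : Memory} {W R : List ℕ} (H : Measured I s)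
    (ha : Agree W R s s')
    (hW : ([6, 7, 23, 24].all fun B => !W.contains B) = true := by rfl)
    (hR : ([4, 22, 23, 24, 25, 26, 27, 28, 29].all fun B => !R.contains B) = true := by rfl) :
    Measured I s' := by
  have eI : ∀ B ∈ [6, 7, 23, 24], s'.ints B = s.ints B := fun B hB => ha.ints B fun h => by
    have := List.all_eq_true.1 hW B hB
    simp_all
  have eR : ∀ B ∈ [4, 22, 23, 24, 25, 26, 27, 28, 29], s'.reals B = s.reals B :=
    fun B hB => ha.reals B fun h => by
      have := List.all_eq_true.1 hR B hB
      simp_all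
  have mk : marks I s' = marks I s :=
    marks_congr (eI 6 (by decide)) (eI 7 (by decide)) (eR 4 (by decide))
  constructor <;> simp only [mk, eI 23 (by decide), eI 24 (by decide), eR 22 (by decide),
    eR 23 (by decide), eR 24 (by decide), eR 25 (by decide), eR 26 (by decide), eR 27 (by decide),
    eR 28 (by decide), eR 29 (by decide)]
  exacts [H.col1, H.row1, H.col2, H.row2, H.lenP, H.lenQ]

theorem measure_spec : ∃ C, ∀ (I : Input) (s : Memory), Loaded I s →
    Ev measure s (C * (I.n + I.m + 1)) (fun s' => marks I s' = marks I s ∧ Measured I s') := by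
  obtain ⟨C₁, h₁⟩ := extremesTo_spec 1 numN (.const 0) 1 (real (.const 0)) (real (.const 0))
    (a := 22) (b := 23) (by decide) (by decide)
  obtain ⟨C₂, h₂⟩ := extremesTo_spec 1 numM numN 2 (real (.const 0)) (real numE)
    (a := 24) (b := 25) (by decide) (by decide)
  obtain ⟨C₃, h₃⟩ := extremesTo_spec 2 numN (.const 0) 1 (real (.const 0)) (real (.const 0))
    (a := 28) (b := 26) (by decide) (by decide)
  obtain ⟨C₄, h₄⟩ := extremesTo_spec 2 numM numN 2 (real (.sub (.const 0) numE))
    (real (.sub (.const 0) numE)) (a := 27) (b := 29) (by decide) (by decide)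
  obtain ⟨C₅, h₅⟩ := sumTo_spec numN 1 23
  obtain ⟨C₆, h₆⟩ := sumTo_spec numM 2 24
  refine ⟨C₁ + C₂ + C₃ + C₄ + C₅ + C₆, fun I s H => ?_⟩
  refine Ev.seq' (T' := C₂ * (I.m + 1) + (C₃ * (I.n + 1) + (C₄ * (I.m + 1) +
    (C₅ * (I.n + 1) + C₆ * (I.m + 1))))) (h₁ _ s 0 0 H.reads_col fun s' _ => by
      simp [RExpr.eval, IExpr.eval]) (fun s1 a1 k1 => ?_) (by
      change C₁ * (I.n + 1) + _ ≤ _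
      nlinarith [Nat.zero_le (C₁ * I.m), Nat.zero_le (C₂ * I.n), Nat.zero_le (C₃ * I.m),
        Nat.zero_le (C₄ * I.n), Nat.zero_le (C₅ * I.m), Nat.zero_le (C₆ * I.n)])
  have H1 : Loaded I s1 := H.of_agree a1
  have m1 : marks I s1 = marks I s := marks_congr (a1.int 6) (a1.int 7) (a1.real 4)
  refine Ev.seq' (h₂ _ s1 0 I.e H1.reads_row fun s' a => by
      simp [RExpr.eval, IExpr.eval, a.int 0, H1.e]) (fun s2 a2 k2 => ?_) le_rfl
  have H2 : Loaded I s2 := H1.of_agree a2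
  have m2 : marks I s2 = marks I s1 := marks_congr (a2.int 6) (a2.int 7) (a2.real 4)
  refine Ev.seq' (h₃ _ s2 0 0 H2.reads_col fun s' _ => by
      simp [RExpr.eval, IExpr.eval]) (fun s3 a3 k3 => ?_) le_rfl
  have H3 : Loaded I s3 := H2.of_agree a3
  have m3 : marks I s3 = marks I s2 := marks_congr (a3.int 6) (a3.int 7) (a3.real 4)
  refine Ev.seq' (h₄ _ s3 (-I.e) (-I.e) H3.reads_row fun s' a => by
      simp [RExpr.eval, IExpr.eval, a.int 0, H3.e]) (fun s4 a4 k4 => ?_) le_rfl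
  have H4 : Loaded I s4 := H3.of_agree a4
  have m4 : marks I s4 = marks I s3 := marks_congr (a4.int 6) (a4.int 7) (a4.real 4)
  refine Ev.seq' (h₅ _ s4 _ H4.reads_col) (fun s5 a5 k5 => ?_) le_rfl
  have H5 : Loaded I s5 := H4.of_agree a5
  have m5 : marks I s5 = marks I s4 := marks_congr (a5.int 6) (a5.int 7) (a5.real 4)
  refine (h₆ _ s5 _ H5.reads_row).agree.mono le_rfl fun s6 ⟨k6, a6⟩ => ?_
  have m6 : marks I s6 = marks I s5 := marks_congr (a6.int 6) (a6.int 7) (a6.real 4)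
  have a56 : Agree [10, 21, 23, 24] [] s4 s6 := a5.widen.trans a6.widen
  have a46 : Agree [10, 20, 21, 23, 24] [20, 21, 27, 29] s3 s6 := a4.widen.trans a56.widen
  have a36 : Agree [10, 20, 21, 23, 24] [20, 21, 26, 27, 28, 29] s2 s6 := a3.widen.trans a46.widen
  have a26 : Agree [10, 20, 21, 23, 24] [20, 21, 24, 25, 26, 27, 28, 29] s1 s6 :=
    a2.widen.trans a36.widen
  refine ⟨by rw [m6, m5, m4, m3, m2, m1], ⟨?_, ?_, ?_, ?_, ?_, k6⟩⟩
  · rw [m6, m5, m4, m3, m2, m1, a26.real 22, a26.real 23]; exact k1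
  · rw [m6, m5, m4, m3, m2, a36.real 24, a36.real 25]; exact k2
  · rw [m6, m5, m4, m3, a46.real 28, a46.real 26]; exact k3
  · rw [m6, m5, m4, a56.real 27, a56.real 29]; exact k4
  · rw [a6.int 23]; exact k5

end RealRAM

namespace RealRAM

open FreeSpace

abbrev distE : RExpr := real numE

/-! ### Long curves -/

def longCols : List RExpr :=
  [.sub (.var 22) (real (.var 23)), .sub (.var 25) distE, .add (.var 24) distE, real (.const 0),
    .var 22, .var 23, real (.const 0), real (.const 0), real (.const 0), real (.const 0),
    .sub (.var 24) distE, .add (.var 25) distE]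

def longRows : List RExpr :=
  [.sub (.var 24) (real (.var 24)), .sub (.var 23) distE, .add (.var 22) distE, real (.const 0),
    .var 24, .var 25, real (.const 0), real (.const 0), real (.const 0), real (.const 0),
    .sub (.var 22) distE, .add (.var 23) distE]

/-- Verifies the curves found by `trial`. -/
def verifyFound : Program := .ite (.ile (.const 1) (.var 26)) verify .skip

theorem verifyFound_spec : ∃ C, ∀ (I : Input) (s : Memory), Loaded I s → s.ints 4 0 = 0 →
    Ev verifyFound s (C * ((I.n + 1) * (I.m + 1))) (fun s' =>
      Says (1 ≤ s.ints 26 0 ∧ Solved I s') s') := by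
  obtain ⟨C, hC⟩ := verify_spec
  refine ⟨C + 10, fun I s H h4 => ?_⟩
  have h1 : 1 ≤ (I.n + 1) * (I.m + 1) := Nat.mul_pos (by omega) (by omega)
  refine Ev.ite (T := C * ((I.n + 1) * (I.m + 1)) + 1) (fun hb => ?_) (fun hb => ?_)
    (by simp only [Cond.cost, IExpr.cost]; nlinarith)
  all_goals simp only [Cond.Holds, IExpr.eval] at hb
  · refine (hC I s H).agree.mono (by omega) fun s' ⟨h, a⟩ => h.congr rfl ?_
    rw [and_iff_right hb]
    unfold Solved
    rw [a.real 2, a.real 3]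
  · exact Ev.straight (by rfl) (Or.inr ⟨h4, fun h => hb h.1⟩) (by simp only [Program.bound]; omega)

def longPhase : Program :=
  .seq (.setInt 27 (.const 0) (.add (.mul (.const 2) (.var 23)) (.const 1)))
  (.seq (.setInt 27 (.const 1) (.add (.mul (.const 2) (.var 24)) (.const 1)))
  (.seq (setCells 40 0 longCols)
  (.seq (setCells 41 0 longRows)
  (.seq trial verifyFound))))

/-- The curves in the output arrays, unless there are no curves that fit the marks and have the
property `P`. -/
def Settles (I : Input) (K : Marks) (P : (ℕ → ℝ) → (ℕ → ℝ) → Prop) (s : Memory) : Prop :=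
  (s.ints 4 0 = 1 ∧ Solved I s) ∨ (s.ints 4 0 = 0 ∧ ¬ ∃ p q σ τ κ, I.Fits K p q σ τ κ ∧ P p q)

/-- A positive answer has been verified. Suppose the answer is `0` but some solution is long. Then
the true curves are admissible paths, so the search did not fail; and the curves it found are a
solution by `Fits.long_sol`, so the verification did not fail either. -/
theorem longPhase_spec : ∃ C, ∀ (I : Input) (s : Memory), Loaded I s → Measured I s →
    s.ints 4 0 = 0 → Ev longPhase s (C * ((I.n + 1) * (I.m + 1) +
      (I.n + 1) * (∑ i ∈ Finset.range I.n, I.w i + 1) +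
      (I.m + 1) * (∑ j ∈ Finset.range I.m, I.h j + 1))) (Settles I (marks I s) (I.Long (marks I
          s))) := by
  obtain ⟨C₁, hC₁⟩ := trial_spec
  obtain ⟨C₂, hC₂⟩ := verifyFound_spec
  refine ⟨2 * C₁ + C₂ + 1000, fun I s H E h4 => ?_⟩
  obtain ⟨LP, hLP⟩ : ∃ LP, LP = ∑ i ∈ Finset.range I.n, I.w i := ⟨_, rfl⟩
  obtain ⟨LQ, hLQ⟩ : ∃ LQ, LQ = ∑ j ∈ Finset.range I.m, I.h j := ⟨_, rfl⟩
  have eP := E.lenP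
  have eQ := E.lenQ
  rw [← hLP] at eP
  rw [← hLQ] at eQ
  rw [← hLP, ← hLQ]
  refine Ev.seq' (T := 20) (T' := 20 + (400 + (400 + (C₁ * ((I.n + 1) * (2 * LP + 1 + 1) +
    (I.m + 1) * (2 * LQ + 1 + 1)) + C₂ * ((I.n + 1) * (I.m + 1))))))
    (P := fun s' => s'.ints 27 0 = (2 * LP + 1 : ℕ))
    (Ev.straight (by rfl) (by simp [Program.exec, IExpr.eval, eP]) (by decide))
    (fun s1 a1 h1 => ?_) (by
      have := Nat.mul_pos (Nat.succ_pos I.n) (Nat.succ_pos I.m)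
      simp only [Nat.succ_eq_add_one] at this
      have e1 : (I.n + 1) * (2 * LP + 1 + 1) = 2 * ((I.n + 1) * (LP + 1)) := by ring
      have e2 : (I.m + 1) * (2 * LQ + 1 + 1) = 2 * ((I.m + 1) * (LQ + 1)) := by ring
      rw [e1, e2]
      nlinarith [Nat.zero_le ((I.n + 1) * (LP + 1)), Nat.zero_le ((I.m + 1) * (LQ + 1)),
        Nat.zero_le (C₁ * ((I.n + 1) * (I.m + 1))), Nat.zero_le (C₂ * ((I.n + 1) * (LP + 1))),
        Nat.zero_le (C₂ * ((I.m + 1) * (LQ + 1)))])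
  refine Ev.seq' (T := 20) (P := fun s' => s'.ints 27 1 = (2 * LQ + 1 : ℕ) ∧
    s'.ints 27 0 = (2 * LP + 1 : ℕ))
    (Ev.straight (by rfl) (by simp [Program.exec, IExpr.eval, a1.int 24, eQ, h1]) (by decide))
    (fun s2 a2 ⟨h2, h2'⟩ => ?_) le_rfl
  refine Ev.seq' (setCells_ev (by decide)) (fun s3 a3 k3 => ?_) le_rfl
  refine Ev.seq' (setCells_ev (by decide)) (fun s4 a4 k4 => ?_) le_rfl
  have a12 : Agree [27] [] s s2 := a1.widen.trans a2.widen
  have a13 : Agree [27] [40] s s3 := a12.widen.trans a3.widen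
  have a14 : Agree [27] [40, 41] s s4 := a13.widen.trans a4.widen
  have H4 : Loaded I s4 := H.of_agree a14
  have E4 : Measured I s4 := E.of_agree a14
  have mk4 : marks I s4 = marks I s := marks_congr (a14.int 6) (a14.int 7) (a14.real 4)
  have e27 : s4.ints 27 = s2.ints 27 := (a4.int 27).trans (a3.int 27)
  have e40 : s4.reals 40 = s3.reals 40 := a4.real 40
  obtain ⟨al, hal⟩ : ∃ al, al = s.reals 22 0 := ⟨_, rfl⟩
  obtain ⟨be, hbe⟩ : ∃ be, be = s.reals 23 0 := ⟨_, rfl⟩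
  obtain ⟨a, ha⟩ : ∃ a, a = s.reals 24 0 := ⟨_, rfl⟩
  obtain ⟨b, hb⟩ : ∃ b, b = s.reals 25 0 := ⟨_, rfl⟩
  have X1 := E.col1
  have X2 := E.row1
  rw [← hal, ← hbe] at X1
  rw [← ha, ← hb] at X2
  simp only [Cells, longCols, longRows, RExpr.eval, IExpr.eval, a12.real 22, a12.real 23,
    a12.real 24, a12.real 25, a12.int 23, a12.int 0, a13.real 22, a13.real 23,
    a13.real 24, a13.real 25, a13.int 24, a13.int 0, eP, eQ, H.e, ← hal, ← hbe, ← ha,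
    ← hb, Nat.cast_zero, zero_add, Nat.cast_one, Nat.reduceAdd, Nat.cast_ofNat, Int.cast_zero,
    Int.cast_natCast, and_true] at k3 k4
  have wc : ∀ W, WallsFrom s4 40 (2 * LP + 1 : ℕ) W →
      LongWalls I.e al be a b (al - LP) (al - LP + ((2 * LP + 1 : ℤ) : ℝ)) W := by
    intro W hW
    simp only [WallsFrom, e40, k3] at hW
    push_cast at hW ⊢
    exact ⟨hW.2.1, hW.1, hW.2.2.2⟩
  have wr : ∀ W, WallsFrom s4 41 (2 * LQ + 1 : ℕ) W →
      LongWalls I.e a b al be (a - LQ) (a - LQ + ((2 * LQ + 1 : ℤ) : ℝ)) W := by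
    intro W hW
    simp only [WallsFrom, k4] at hW
    push_cast at hW ⊢
    exact ⟨hW.2.1, hW.1, hW.2.2.2⟩
  refine Ev.seq' (hC₁ I s4 (2 * LP + 1) (2 * LQ + 1) H4 (by rw [e27, h2']) (by rw [e27, h2]))
    (fun s5 a5 h5 => ?_) le_rfl
  have H5 : Loaded I s5 := H4.of_agree a5
  refine (hC₂ I s5 H5 (by rw [a5.int 4, a14.int 4, h4])).agree.mono le_rfl fun s6 ⟨h6, a6⟩ => ?_
  rcases h6 with ⟨g4, -, g⟩ | ⟨g4, g⟩
  · exact Or.inl ⟨g4, g⟩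
  refine Or.inr ⟨g4, ?_⟩
  rintro ⟨p, q, σ, τ, κ, F, T⟩
  obtain ⟨L1, L2, -⟩ := F.long_lines T X1 X2
  unfold TrialOK TrialFail at h5
  rw [mk4, e40, k3.1, k4.1] at h5
  rcases h5 with ⟨h26, W, W', x, sg, x', sg', hW, hW', P1, P2, o1, o2⟩ |
    ⟨-, ⟨W, hW, hn⟩ | ⟨W, hW, hn⟩⟩
  · refine g ⟨h26.ge, sg, sg', (F.long_sol T X1 X2 (wc W hW) (wr W' hW') (by exact_mod_cast P1)
      (by exact_mod_cast P2)).congr (fun i hi => ?_) (fun j hj => ?_)⟩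
    · rw [a6.real 2]; exact o1 i hi
    · rw [a6.real 3]; exact o2 j hj
  · obtain ⟨x, sg, hx⟩ := L1.exists_path hLP (wc W hW)
    exact hn ⟨x, sg, by exact_mod_cast hx⟩
  · obtain ⟨x, sg, hx⟩ := L2.exists_path hLQ (wr W hW)
    exact hn ⟨x, sg, by exact_mod_cast hx⟩

/-! ### Short curves -/

abbrev topP : RExpr := .add (.var 22) (real (.var 25))
abbrev shiftQ : RExpr := .sub topP (.var 26)
abbrev lowQ : RExpr := .add (.var 27) shiftQ

def shortCols : List RExpr :=
  [.var 22, .sub (.var 25) distE, .add lowQ distE, real (.const 0),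
    .var 22, .add lowQ distE, real (.const 0),
    .sub (.var 25) distE, topP, shiftQ, real (.const 0), real (.const 0)]

def shortRows : List RExpr :=
  [.sub (.var 25) (.mul (real (.const 2)) distE), .sub topP distE, .add (.var 22) distE,
    real (.const 0), .sub topP distE, .var 25, real (.const 0),
    lowQ, .add (.var 22) distE, shiftQ, real (.const 0), real (.const 0)]

abbrev sideE : IExpr := .add (.mul (.const 2) numE) (.const 1)

def shortStep : Program :=
  .ite (.ile (.var 26) (.const 0))
    (.seq (setCells 40 0 shortCols) (.seq (setCells 41 0 shortRows) trial)) .skip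

def shortPhase : Program :=
  .seq (.setInt 26 (.const 0) (.const 0))
  (.seq (.setInt 27 (.const 0) sideE)
  (.seq (.setInt 27 (.const 1) sideE)
  (.seq (forLoop 25 sideE shortStep) verifyFound)))

def ShortFound (I : Input) (s s' : Memory) (t : ℕ) : Prop :=
  ∃ W W' x sg x' sg',
    ColWalls I.e (s.reals 22 0) (s.reals 25 0) (s.reals 26 0) (s.reals 27 0) t W ∧
    RowWalls I.e (s.reals 22 0) (s.reals 25 0) (s.reals 26 0) (s.reals 27 0) t W' ∧
    (I.colLine (marks I s)).IsPath W (s.reals 22 0) (2 * I.e + 1) x sg ∧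
    (I.rowLine (marks I s)).IsPath W' (s.reals 25 0 - 2 * I.e) (2 * I.e + 1) x' sg' ∧
    (∀ i : ℕ, i ≤ I.n → s'.reals 2 i = s.reals 22 0 + x i) ∧
    ∀ j : ℕ, j ≤ I.m → s'.reals 3 j = s.reals 25 0 - 2 * I.e + x' j

def ShortMissed (I : Input) (s : Memory) (t : ℕ) : Prop :=
  ∃ W W', ColWalls I.e (s.reals 22 0) (s.reals 25 0) (s.reals 26 0) (s.reals 27 0) t W ∧
    RowWalls I.e (s.reals 22 0) (s.reals 25 0) (s.reals 26 0) (s.reals 27 0) t W' ∧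
    ¬ ((∃ x sg, (I.colLine (marks I s)).IsPath W (s.reals 22 0) (2 * I.e + 1) x sg) ∧
      ∃ x sg, (I.rowLine (marks I s)).IsPath W' (s.reals 25 0 - 2 * I.e) (2 * I.e + 1) x sg)

/-- The memory `s` is that before the loop over `t`. The walls are expressed through it, which makes
the results of different rounds comparable; a round after a success does nothing. -/
theorem shortStep_spec : ∃ C, ∀ (I : Input) (s s₁ : Memory) (t : ℕ), Loaded I s →
    Agree (shortStep.wI ++ [25, 27]) shortStep.wR s s₁ → s₁.ints 27 0 = (2 * I.e + 1 : ℕ) →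
    s₁.ints 27 1 = (2 * I.e + 1 : ℕ) → s₁.ints 25 0 = t →
    Ev shortStep s₁ (C * ((I.n + 1) * (2 * I.e + 2) + (I.m + 1) * (2 * I.e + 2))) (fun s' =>
      (0 < s₁.ints 26 0 ∧ s' = s₁) ∨ (s₁.ints 26 0 ≤ 0 ∧ ((s'.ints 26 0 = 1 ∧ ShortFound I s s' t) ∨
      (s'.ints 26 0 = 0 ∧ ShortMissed I s t)))) := by
  obtain ⟨C, hC⟩ := trial_spec
  refine ⟨C + 1000, fun I s s1 t H a1 h0 h1 ht => ?_⟩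
  have hpos : 1 ≤ (I.n + 1) * (2 * I.e + 2) := Nat.mul_pos (by omega) (by omega)
  have H1 : Loaded I s1 := H.of_agree a1
  refine Ev.ite (T := 400 + (400 + C * ((I.n + 1) * (2 * I.e + 1 + 1) +
    (I.m + 1) * (2 * I.e + 1 + 1)))) (fun hb => ?_) (fun hb => ?_)
    (by simp only [Cond.cost, IExpr.cost]; nlinarith)
  all_goals simp only [Cond.Holds, IExpr.eval] at hb
  swap
  · exact Ev.straight (by rfl) (Or.inl ⟨by omega, rfl⟩) (by simp only [Program.bound]; omega)
  refine Ev.seq' (setCells_ev (by decide)) (fun s2 a2 k2 => ?_) le_rfl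
  refine Ev.seq' (setCells_ev (by decide)) (fun s3 a3 k3 => ?_) le_rfl
  have a12 : Agree (shortStep.wI ++ [25, 27]) shortStep.wR s s2 := a1.trans a2.widen
  have a13 : Agree (shortStep.wI ++ [25, 27]) shortStep.wR s s3 := a12.trans a3.widen
  have H3 : Loaded I s3 := H.of_agree a13
  have mk3 : marks I s3 = marks I s := marks_congr (a13.int 6) (a13.int 7) (a13.real 4)
  have e40 : s3.reals 40 = s2.reals 40 := a3.real 40
  obtain ⟨al, hal⟩ : ∃ al, al = s.reals 22 0 := ⟨_, rfl⟩
  obtain ⟨b, hB⟩ : ∃ b, b = s.reals 25 0 := ⟨_, rfl⟩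
  obtain ⟨be₂, hbe⟩ : ∃ be₂, be₂ = s.reals 26 0 := ⟨_, rfl⟩
  obtain ⟨a₂, ha⟩ : ∃ a₂, a₂ = s.reals 27 0 := ⟨_, rfl⟩
  simp only [Cells, shortCols, shortRows, RExpr.eval, IExpr.eval, a1.real 22, a1.real 25,
    a1.real 26, a1.real 27, a1.int 0, a12.real 22, a12.real 25, a12.real 26, a12.real 27,
    a12.int 0, a2.int 25, ht, H.e, ← hal, ← hbe, ← ha, ← hB, Nat.cast_zero, zero_add, Nat.cast_one,
    Nat.reduceAdd, Nat.cast_ofNat, Int.cast_zero, Int.cast_natCast, and_true, Int.cast_ofNat]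
    at k2 k3
  have wc : ∀ W, WallsFrom s3 40 (2 * I.e + 1 : ℕ) W → ColWalls I.e al b be₂ a₂ t W := by
    intro W hW
    simp only [WallsFrom, e40, k2] at hW
    unfold ColWalls
    push_cast at hW ⊢
    exact ⟨hW.2.1, hW.2.2.1, hW.1⟩
  have wr : ∀ W, WallsFrom s3 41 (2 * I.e + 1 : ℕ) W → RowWalls I.e al b be₂ a₂ t W := by
    intro W hW
    simp only [WallsFrom, k3] at hW
    unfold RowWalls
    push_cast at hW ⊢
    exact ⟨hW.2.1, hW.2.2.1, hW.1⟩
  have e27 : s3.ints 27 = s1.ints 27 := (a3.int 27).trans (a2.int 27)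
  refine (hC I s3 (2 * I.e + 1) (2 * I.e + 1) H3 (by rw [e27, h0]) (by rw [e27, h1])).mono
    le_rfl fun s4 h4 => Or.inr ⟨hb, ?_⟩
  unfold TrialOK TrialFail at h4
  rw [mk3, e40, k2.1, k3.1] at h4
  unfold ShortFound ShortMissed
  rw [← hal, ← hB, ← hbe, ← ha]
  rcases h4 with ⟨h26, W, W', x, sg, x', sg', hW, hW', P1, P2, o1, o2⟩ |
    ⟨h26, ⟨W, hW, hn⟩ | ⟨W', hW', hn⟩⟩
  · exact Or.inl ⟨h26, W, W', x, sg, x', sg', wc W hW, wr W' hW', by exact_mod_cast P1,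
      by exact_mod_cast P2, o1, o2⟩
  · obtain ⟨W', hW'⟩ := exists_wallsFrom s3 41 (2 * I.e + 1 : ℕ)
    exact Or.inr ⟨h26, W, W', wc W hW, wr W' hW', fun h => hn (by exact_mod_cast h.1)⟩
  · obtain ⟨W, hW⟩ := exists_wallsFrom s3 40 (2 * I.e + 1 : ℕ)
    exact Or.inr ⟨h26, W, W', wc W hW, wr W' hW', fun h => hn (by exact_mod_cast h.2)⟩


/-- Only the first successful `t` is pursued, and the curves are verified once, after the loop. This
is enough: by `Fits.short_sol` the first success is already a solution if there is a short one.
Verifying in each round would cost an additional factor `ε` in the term `nm`. -/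
theorem shortPhase_spec : ∃ C, ∀ (I : Input) (s : Memory), Loaded I s → Measured I s →
    s.ints 4 0 = 0 → Ev shortPhase s (C * ((I.n + 1) * (I.m + 1) +
      (I.n + I.m + 2) * (I.e + 1) ^ 2)) (Settles I (marks I s) (I.Short (marks I s))) := by
  obtain ⟨C₁, hC₁⟩ := shortStep_spec
  obtain ⟨C₂, hC₂⟩ := verifyFound_spec
  refine ⟨4 * C₁ + C₂ + 1000, fun I s H E h4 => ?_⟩
  refine Ev.seq' (T := 20) (T' := 20 + (20 + ((2 * I.e + 1 + 1) *
      (C₁ * ((I.n + 1) * (2 * I.e + 2) + (I.m + 1) * (2 * I.e + 2)) + 6 + 20) +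
      C₂ * ((I.n + 1) * (I.m + 1)))))
    (P := fun s' => s'.ints 26 0 = 0)
    (Ev.straight (by rfl) (by simp [Program.exec, IExpr.eval]) (by decide))
    (fun s1 a1 h1 => ?_) (by
      have e1 : (2 * I.e + 1 + 1) * (C₁ * ((I.n + 1) * (2 * I.e + 2) + (I.m + 1) * (2 * I.e + 2)) +
        6 + 20) = 4 * C₁ * ((I.n + I.m + 2) * (I.e + 1) ^ 2) + 52 * (I.e + 1) := by ring
      have e2 : I.e + 1 ≤ (I.n + I.m + 2) * (I.e + 1) ^ 2 := by
        rw [show (I.n + I.m + 2) * (I.e + 1) ^ 2 = ((I.n + I.m + 2) * (I.e + 1)) * (I.e + 1)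
            by ring]
        exact Nat.le_mul_of_pos_left _ (Nat.mul_pos (by omega) (by omega))
      rw [e1]
      generalize (I.n + I.m + 2) * (I.e + 1) ^ 2 = X at *
      have := Nat.mul_pos (Nat.succ_pos I.n) (Nat.succ_pos I.m)
      simp only [Nat.succ_eq_add_one] at this
      generalize (I.n + 1) * (I.m + 1) = Y at *
      nlinarith [Nat.zero_le (C₁ * Y), Nat.zero_le (C₂ * X)])
  refine Ev.seq' (T := 20) (P := fun s' => s'.ints 27 0 = (2 * I.e + 1 : ℕ))
    (Ev.straight (by rfl) (by simp [Program.exec, IExpr.eval, a1.int 0, H.e]) (by decide))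
    (fun s2 a2 h2 => ?_) le_rfl
  have a12 : Agree [26, 27] [] s s2 := a1.widen.trans a2.widen
  refine Ev.seq' (T := 20) (P := fun s' => s'.ints 27 1 = (2 * I.e + 1 : ℕ) ∧
    s'.ints 27 0 = (2 * I.e + 1 : ℕ))
    (Ev.straight (by rfl) (by simp [Program.exec, IExpr.eval, a12.int 0, H.e, h2]) (by decide))
    (fun s3 a3 ⟨h3, h3'⟩ => ?_) le_rfl
  have a13 : Agree [26, 27] [] s s3 := a12.trans a3.widen
  have h26 : s3.ints 26 0 = 0 := by rw [a3.int 26, a2.int 26, h1]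
  have H3 : Loaded I s3 := H.of_agree a13
  refine Ev.seq' (P := fun s' => (s'.ints 26 0 = 1 ∧ ∃ t, ShortFound I s s' t) ∨
      (s'.ints 26 0 = 0 ∧ ∀ t < 2 * I.e + 1, ShortMissed I s t))
    (forLoop_ev (2 * I.e + 1) (C₁ * ((I.n + 1) * (2 * I.e + 2) + (I.m + 1) * (2 * I.e + 2)))
      (fun k s' => (s'.ints 26 0 = 1 ∧ ∃ t, ShortFound I s s' t) ∨
        (s'.ints 26 0 = 0 ∧ ∀ t < k, ShortMissed I s t))
      (fun s' a => by simp [IExpr.eval, a.int 0, H3.e])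
      (fun k s' z h => by simpa [ShortFound] using h)
      (Or.inr ⟨h26, fun t ht => by omega⟩) ?_ (fun s' _ h => h) le_rfl)
    (fun s5 a5 h5 => ?_) le_rfl
  · intro k hk s4 a4 h25 h
    refine (hC₁ I s s4 k H (a13.widen.trans a4.widen) (by rw [a4.int 27, h3']) (by rw [a4.int 27,
        h3])
      h25).mono le_rfl fun s5 h5 => ?_
    rcases h5 with ⟨g, rfl⟩ | ⟨g0, ⟨g, g'⟩ | ⟨g, g'⟩⟩
    · exact Or.inl (h.resolve_right fun h => by omega)
    · exact Or.inl ⟨g, k, g'⟩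
    · obtain ⟨-, h⟩ := h.resolve_left fun h => by omega
      refine Or.inr ⟨g, fun t ht => ?_⟩
      rcases Nat.lt_succ_iff_lt_or_eq.1 ht with h' | rfl
      · exact h t h'
      · exact g'
  · have H5 : Loaded I s5 := H3.of_agree a5
    refine (hC₂ I s5 H5 (by rw [a5.int 4, a13.int 4, h4])).agree.mono le_rfl fun s6 ⟨h6, a6⟩ => ?_
    rcases h6 with ⟨g4, -, g⟩ | ⟨g4, g⟩
    · exact Or.inl ⟨g4, g⟩
    refine Or.inr ⟨g4, ?_⟩
    rintro ⟨p, q, σ, τ, κ, F, T⟩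
    rcases h5 with ⟨g26, t, W, W', x, sg, x', sg', hW, hW', P1, P2, o1, o2⟩ | ⟨-, hm⟩
    · refine g ⟨g26.ge, sg, sg', (F.short_sol T E.col1 E.row1 E.col2 E.row2 hW hW' P1
        P2).congr (fun i hi => ?_) (fun j hj => ?_)⟩
      · rw [a6.real 2]; exact o1 i hi
      · rw [a6.real 3]; exact o2 j hj
    · obtain ⟨t, ht, h⟩ := F.short_exists T E.col1 E.row1 E.col2 E.row2
      obtain ⟨W, W', hW, hW', hn⟩ := hm t ht
      exact hn (h W W' hW hW')

end RealRAM

/-! ### The whole algorithm -/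

namespace RealRAM

open FreeSpace

/-- Constructs curves that realize the given diagram, if there are any. -/
def realize : Program :=
  .seq separate (.seq verify
    (.ite (.ile (.var 4) (.const 0))
      (.seq mark (.seq measure (.seq longPhase
        (.ite (.ile (.var 4) (.const 0)) shortPhase .skip))))
      .skip))

theorem realize_spec : ∃ C, ∀ (I : Input) (s : Memory), Loaded I s → s.ints 6 = 0 →
    s.ints 7 = 0 → s.ints 8 = 0 →
    Ev realize s (C * ((I.n + I.m + 1) ^ 2 + (I.n + 1) * (∑ i ∈ Finset.range I.n, I.w i + 1) +
      (I.m + 1) * (∑ j ∈ Finset.range I.m, I.h j + 1) + (I.n + I.m + 2) * (I.e + 1) ^ 2))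
      (fun s' => (s'.ints 4 0 = 1 ∧ Solved I s') ∨
        (s'.ints 4 0 = 0 ∧ ¬ ∃ p q σ τ, I.Sol p q σ τ)) := by
  obtain ⟨C₁, h₁⟩ := separate_spec
  obtain ⟨C₂, h₂⟩ := verify_spec
  obtain ⟨C₃, h₃⟩ := mark_spec
  obtain ⟨C₄, h₄⟩ := measure_spec
  obtain ⟨C₅, h₅⟩ := longPhase_spec
  obtain ⟨C₆, h₆⟩ := shortPhase_spec
  refine ⟨C₁ + C₂ + C₃ + C₄ + C₅ + C₆ + 20, fun I s H h6 h7 h8 => ?_⟩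
  obtain ⟨X, hX⟩ : ∃ X, X = (I.n + I.m + 1) ^ 2 := ⟨_, rfl⟩
  obtain ⟨Y, hY⟩ : ∃ Y, Y = (I.n + 1) * (∑ i ∈ Finset.range I.n, I.w i + 1) +
    (I.m + 1) * (∑ j ∈ Finset.range I.m, I.h j + 1) := ⟨_, rfl⟩
  obtain ⟨Z, hZ⟩ : ∃ Z, Z = (I.n + I.m + 2) * (I.e + 1) ^ 2 := ⟨_, rfl⟩
  have b1 : I.n + I.m + 1 ≤ X := by rw [hX]; exact Nat.le_self_pow (by decide) _
  have b2 : (I.n + 1) * (I.m + 1) ≤ X := by rw [hX]; nlinarith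
  have hS : (I.n + I.m + 1) ^ 2 + (I.n + 1) * (∑ i ∈ Finset.range I.n, I.w i + 1) +
      (I.m + 1) * (∑ j ∈ Finset.range I.m, I.h j + 1) + (I.n + I.m + 2) * (I.e + 1) ^ 2 =
      X + Y + Z := by rw [hX, hY, hZ]; ring
  rw [hS]
  have t5 : C₅ * ((I.n + 1) * (I.m + 1) + (I.n + 1) * (∑ i ∈ Finset.range I.n, I.w i + 1) +
      (I.m + 1) * (∑ j ∈ Finset.range I.m, I.h j + 1)) ≤ C₅ * (X + Y) := by
    rw [add_assoc, ← hY]; exact Nat.mul_le_mul_left _ (by omega)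
  have t6 : C₆ * ((I.n + 1) * (I.m + 1) + (I.n + I.m + 2) * (I.e + 1) ^ 2) ≤ C₆ * (X + Z) := by
    rw [← hZ]; exact Nat.mul_le_mul_left _ (by omega)
  refine Ev.seq' (T := C₁ * X) (T' := C₂ * X + (10 + (C₃ * X + (C₄ * X + (C₅ * (X + Y) +
    (10 + C₆ * (X + Z))))))) ((h₁ I s H).mono (Nat.mul_le_mul_left _ b1) fun _ h => h)
    (fun s1 a1 k1 => ?_) (by
      nlinarith [Nat.zero_le (C₁ * Y), Nat.zero_le (C₁ * Z), Nat.zero_le (C₂ * Y),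
        Nat.zero_le (C₂ * Z), Nat.zero_le (C₃ * Y), Nat.zero_le (C₃ * Z), Nat.zero_le (C₄ * Y),
        Nat.zero_le (C₄ * Z), Nat.zero_le (C₅ * Z), Nat.zero_le (C₆ * Y)])
  have H1 : Loaded I s1 := H.of_agree a1
  refine Ev.seq' (T := C₂ * X) ((h₂ I s1 H1).mono (Nat.mul_le_mul_left _ b2) fun _ h => h)
    (fun s2 a2 k2 => ?_) le_rfl
  have H2 : Loaded I s2 := H1.of_agree a2
  have a12 : Agree [4, 10, 11] [2, 3] s s2 := a1.widen.trans a2.widen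
  refine Ev.ite (T := C₃ * X + (C₄ * X + (C₅ * (X + Y) + (10 + C₆ * (X + Z))))) (fun hb => ?_)
    (fun hb => ?_) (by simp only [Cond.cost, IExpr.cost]; omega)
  all_goals simp only [Cond.Holds, IExpr.eval] at hb
  swap
  · refine Ev.straight (by rfl) (Or.inl ?_) (by simp only [Program.bound]; omega)
    obtain ⟨k4, k⟩ := k2.resolve_right fun h => hb h.1.le
    refine ⟨k4, ?_⟩
    change Solved I s2
    unfold Solved at k ⊢
    rwa [a2.real 2, a2.real 3]
  obtain ⟨k4, k2⟩ := k2.resolve_left fun h => by omega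
  refine Ev.seq' (T := C₃ * X) ((h₃ I s2 H2 ((a12.int 6).trans h6) ((a12.int 7).trans h7)
    ((a12.int 8).trans h8)).mono (Nat.mul_le_mul_left _ hX.ge) fun _ h => h) (fun s3 a3 k3 => ?_)
        le_rfl
  have H3 : Loaded I s3 := H2.of_agree a3
  refine Ev.seq' (T := C₄ * X) ((h₄ I s3 H3).mono (Nat.mul_le_mul_left _ b1) fun _ h => h)
    (fun s4 a4 ⟨mk4, E4⟩ => ?_) le_rfl
  have H4 : Loaded I s4 := H3.of_agree a4
  have i4 : s4.ints 4 0 = 0 := by rw [a4.int 4, a3.int 4, k4]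
  refine Ev.seq' (T := C₅ * (X + Y)) ((h₅ I s4 H4 E4 i4).mono t5 fun _ h => h)
    (fun s5 a5 k5 => ?_) le_rfl
  have H5 : Loaded I s5 := H4.of_agree a5
  refine Ev.ite (T := C₆ * (X + Z) + 1) (fun hb => ?_) (fun hb => ?_)
    (by simp only [Cond.cost, IExpr.cost]; omega)
  all_goals simp only [Cond.Holds, IExpr.eval] at hb
  swap
  · exact Ev.straight (by rfl) (Or.inl (k5.resolve_right fun h => hb h.1.le))
      (by simp only [Program.bound]; omega)
  obtain ⟨i5, nl⟩ := k5.resolve_left fun h => by omega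
  have mk5 : marks I s5 = marks I s4 := marks_congr (a5.int 6) (a5.int 7) (a5.real 4)
  refine (h₆ I s5 H5 (E4.of_agree a5) i5).mono (t6.trans (Nat.le_succ _)) fun s6 k6 => ?_
  rcases k6 with k6 | ⟨i6, ns⟩
  · exact Or.inl k6
  refine Or.inr ⟨i6, ?_⟩
  rintro ⟨p, q, σ, τ, S⟩
  rw [← mk4] at k3
  rw [mk5] at ns
  -- Each of the three cases contradicts one failure: of the curves that move apart, of the short
  -- phase, of the long phase.
  rcases k3.complete S with ⟨p, q, σ, τ, S, hd⟩ | h | h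
  · exact k2 (k1 p q σ τ S hd)
  · exact ns h
  · exact nl h

end RealRAM

/-! ### Diagrams as inputs -/

namespace FreeSpace

open RealRAM

theorem arrayOf_coe {α : Type} [Zero α] {N : ℕ} (f : Fin N → α) (k : Fin N) :
    arrayOf f ((k : ℕ) : ℤ) = f k := by
  rw [arrayOf, dif_pos ⟨Int.natCast_nonneg _, by simp⟩]
  simp

theorem arrayOf_cell {α : Type} [Zero α] {n m : ℕ} (g : Fin n × Fin m → α) (i : Fin n) (j : Fin m) :
    arrayOf (fun k : Fin (n * m) => g (finProdFinEquiv.symm k)) ((j : ℤ) + m * i) = g (i, j) := by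
  have := arrayOf_coe (fun k : Fin (n * m) => g (finProdFinEquiv.symm k)) (finProdFinEquiv (i, j))
  rw [Equiv.symm_apply_apply] at this
  rw [← this]
  simp [finProdFinEquiv]

section
variable {n m : ℕ} {d : DiagramData n m} {D : FreeSpaceDiagram n m} {ε : ℕ}

/-- The input for the given diagram. -/
def toInput (hD : d.Describes D) (hn : 0 < n) (hm : 0 < m) (hε : 0 < ε) : Input where
  n := n
  m := m
  e := ε
  w i := if h : i < n then d.width ⟨i, h⟩ else 0
  h j := if h : j < m then d.height ⟨j, h⟩ else 0
  sl i j := if h : i < n ∧ j < m then (d.slope (⟨i, h.1⟩, ⟨j, h.2⟩) : ℤ) else 0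
  lo i j := if h : i < n ∧ j < m then d.lo (⟨i, h.1⟩, ⟨j, h.2⟩) else 0
  hi i j := if h : i < n ∧ j < m then d.hi (⟨i, h.1⟩, ⟨j, h.2⟩) else 0
  m_pos := hm
  n_pos := hn
  e_pos := hε
  w_pos i h := by rw [dif_pos h]; exact hD.width_pos _
  h_pos j h := by rw [dif_pos h]; exact hD.height_pos _
  sl_unit i hi j hj := by
    rw [dif_pos ⟨hi, hj⟩]
    rcases Int.units_eq_one_or (d.slope (⟨i, hi⟩, ⟨j, hj⟩)) with h | h <;> simp [h]

variable (hD : d.Describes D) (hn : 0 < n) (hm : 0 < m) (hε : 0 < ε)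

theorem loaded_toInput : Loaded (toInput hD hn hm hε) (d.initialMemory ε) where
  n := by simp [DiagramData.initialMemory, toInput, arrayOf]
  m := by simp [DiagramData.initialMemory, toInput, arrayOf]
  e := by simp [DiagramData.initialMemory, toInput, arrayOf]
  w i hi := by
    change i < n at hi
    simp only [DiagramData.initialMemory, toInput, dif_pos hi]
    exact arrayOf_coe (fun i => (d.width i : ℤ)) ⟨i, hi⟩
  h j hj := by
    change j < m at hj
    simp only [DiagramData.initialMemory, toInput, dif_pos hj]
    exact arrayOf_coe (fun i => (d.height i : ℤ)) ⟨j, hj⟩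
  sl i hi j hj := by
    change i < n at hi
    change j < m at hj
    simp only [DiagramData.initialMemory, toInput, dif_pos (And.intro hi hj)]
    exact arrayOf_cell (fun k => (d.slope k : ℤ)) ⟨i, hi⟩ ⟨j, hj⟩
  lo i hi j hj := by
    change i < n at hi
    change j < m at hj
    simp only [DiagramData.initialMemory, toInput, dif_pos (And.intro hi hj)]
    exact arrayOf_cell d.lo ⟨i, hi⟩ ⟨j, hj⟩
  hi i hi j hj := by
    change i < n at hi
    change j < m at hj
    simp only [DiagramData.initialMemory, toInput, dif_pos (And.intro hi hj)]
    exact arrayOf_cell d.hi ⟨i, hi⟩ ⟨j, hj⟩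

theorem Chain.arcLength {n : ℕ} {len : ℕ → ℕ} {p : ℕ → ℝ} {σ : ℕ → ℤ} (H : Chain n len p σ)
    (i : Fin n) : arcLength (fun k : Fin (n + 1) => p k) i.succ =
      arcLength (fun k : Fin (n + 1) => p k) i.castSucc + len i := by
  obtain ⟨h1, h2⟩ := H i i.2
  rw [arcLength_succ]
  simp only [Fin.val_succ, Fin.val_castSucc, h2, add_sub_cancel_left, abs_mul, Nat.abs_cast]
  rcases h1 with h | h <;> simp [h]

theorem Chain.curvePoint {n : ℕ} {len : ℕ → ℕ} {p : ℕ → ℝ} {σ : ℕ → ℤ} (H : Chain n len p σ)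
    (i : Fin n) (hl : 0 < len i) {x : ℝ} (hx : 0 ≤ x ∧ x ≤ len i) :
    curvePoint (fun k : Fin (n + 1) => p k) (_root_.arcLength (fun k : Fin (n + 1) => p k)
        i.castSucc + x) =
      p i + σ i * x := by
  obtain ⟨h1, h2⟩ := H i i.2
  rw [curvePoint_eq _ i (by linarith) (by rw [H.arcLength]; linarith)]
  have hl' : (0 : ℝ) < len i := by exact_mod_cast hl
  simp only [Fin.val_succ, Fin.val_castSucc, h2, add_sub_cancel_left]
  rcases h1 with h | h
  · rw [h, Real.sign_of_pos (by simpa using hl')]; simp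
  · rw [h, Real.sign_of_neg (by simpa using hl')]; simp

theorem exists_cell {n : ℕ} (hn : 0 < n) (f : Fin (n + 1) → ℝ) {x : ℝ} (h0 : f 0 ≤ x)
    (h1 : x ≤ f (Fin.last n)) : ∃ i : Fin n, f i.castSucc ≤ x ∧ x ≤ f i.succ := by
  by_contra! hc
  have : ∀ k, f k ≤ x := fun k => by
    induction k using Fin.induction with
    | zero => exact h0
    | succ i ih => exact (hc i ih).le
  obtain ⟨n, rfl⟩ : ∃ n', n = n' + 1 := ⟨n - 1, by omega⟩
  have := hc (Fin.last n) (this _)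
  rw [Fin.succ_last] at this
  linarith

theorem chain_of_arcLength {n : ℕ} {len : ℕ → ℕ} {p : ℕ → ℝ}
    (h : ∀ i : Fin n, _root_.arcLength (fun k : Fin (n + 1) => p k) i.succ =
      _root_.arcLength (fun k : Fin (n + 1) => p k) i.castSucc + len i) : ∃ σ, Chain n len p σ := by
  refine Input.exists_chain.1 fun i hi => ?_
  have := h ⟨i, hi⟩
  rw [arcLength_succ] at this
  simp only [Fin.val_succ, Fin.val_castSucc] at this
  rcases abs_choice (p (i + 1) - p i) with h' | h' <;> rw [h'] at this
  · exact Or.inl (by linarith)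
  · exact Or.inr (by linarith)

/-- Passing to coordinates with origin at the lower left corner of the cell, where the curves are `p
i + σ i * x` and `q j + τ j * y`. The statement with closed cells is needed because adjacent cells
share edges. -/
theorem cellMatch_iff {p q : ℕ → ℝ} {σ τ : ℕ → ℤ} (hp : Chain n (toInput hD hn hm hε).w p σ)
    (hq : Chain m (toInput hD hn hm hε).h q τ)
    (hx : _root_.arcLength (fun i : Fin (n + 1) => p i) = D.xs)
    (hy : _root_.arcLength (fun j : Fin (m + 1) => q j) = D.ys) (i : Fin n) (j : Fin m) :
    CellMatch ε ((toInput hD hn hm hε).w i) ((toInput hD hn hm hε).h j) (q j - p i) (σ i) (τ j)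
        ((toInput hD hn hm hε).sl i j) ((toInput hD hn hm hε).lo i j)
        ((toInput hD hn hm hε).hi i j) ↔
      ∀ x ∈ Set.Icc (D.xs i.castSucc) (D.xs i.succ), ∀ y ∈ Set.Icc (D.ys j.castSucc) (D.ys j.succ),
        (|_root_.curvePoint (fun i : Fin (n + 1) => p i) x -
          _root_.curvePoint (fun j : Fin (m + 1) => q j) y| ≤ ε ↔ (x, y) ∈ D.white) := by
  have cx : ∀ x : ℝ, 0 ≤ x ∧ x ≤ (toInput hD hn hm hε).w i →
      _root_.curvePoint (fun i : Fin (n + 1) => p i) (D.xs i.castSucc + x) = p i + σ i * x := by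
    intro x h
    rw [← hx]
    exact hp.curvePoint i ((toInput hD hn hm hε).w_pos i i.2) h
  have cy : ∀ y : ℝ, 0 ≤ y ∧ y ≤ (toInput hD hn hm hε).h j →
      _root_.curvePoint (fun j : Fin (m + 1) => q j) (D.ys j.castSucc + y) = q j + τ j * y := by
    intro y h
    rw [← hy]
    exact hq.curvePoint j ((toInput hD hn hm hε).h_pos j j.2) h
  have ew : (toInput hD hn hm hε).w i = d.width i := dif_pos i.2
  have eh : (toInput hD hn hm hε).h j = d.height j := dif_pos j.2
  have esl : (toInput hD hn hm hε).sl i j = d.slope (i, j) := dif_pos ⟨i.2, j.2⟩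
  have elo : (toInput hD hn hm hε).lo i j = d.lo (i, j) := dif_pos ⟨i.2, j.2⟩
  have ehi : (toInput hD hn hm hε).hi i j = d.hi (i, j) := dif_pos ⟨i.2, j.2⟩
  rw [ew] at cx ⊢
  rw [eh] at cy ⊢
  rw [esl, elo, ehi]
  have key : ∀ x y : ℝ, 0 ≤ x ∧ x ≤ d.width i → 0 ≤ y ∧ y ≤ d.height j →
      ((|q j - p i + τ j * y - σ i * x| ≤ ε ↔ d.lo (i, j) ≤ y - ((d.slope (i, j) : ℤ) : ℝ) * x ∧
        y - ((d.slope (i, j) : ℤ) : ℝ) * x ≤ d.hi (i, j)) ↔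
      (|_root_.curvePoint (fun i : Fin (n + 1) => p i) (D.xs i.castSucc + x) -
          _root_.curvePoint (fun j : Fin (m + 1) => q j) (D.ys j.castSucc + y)| ≤ ε ↔
        (D.xs i.castSucc + x, D.ys j.castSucc + y) ∈ D.white)) := by
    intro x y hx hy
    rw [cx x hx, cy y hy, hD.white_cell i j _ ⟨by linarith, by rw [hD.xs_succ]; linarith⟩ _
      ⟨by linarith, by rw [hD.ys_succ]; linarith⟩, add_sub_cancel_left, add_sub_cancel_left,
      abs_sub_comm (p i + _), show q j + τ j * y - (p i + σ i * x) = q j - p i + τ j * y - σ i * x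
          by ring]
  constructor
  · intro H x hx y hy
    rw [Set.mem_Icc, hD.xs_succ] at hx
    rw [Set.mem_Icc, hD.ys_succ] at hy
    have hx' : 0 ≤ x - D.xs i.castSucc ∧ x - D.xs i.castSucc ≤ d.width i := by
      constructor <;> linarith
    have hy' : 0 ≤ y - D.ys j.castSucc ∧ y - D.ys j.castSucc ≤ d.height j := by
      constructor <;> linarith
    have := (key _ _ hx' hy').1 (H _ _ hx' hy')
    rwa [add_sub_cancel, add_sub_cancel] at this
  · intro H x y hx hy
    exact (key x y hx hy).2 (H _ ⟨by linarith, by rw [hD.xs_succ]; linarith⟩ _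
      ⟨by linarith, by rw [hD.ys_succ]; linarith⟩)

/-- Equal grid lines mean that the segments have the prescribed lengths, hence signs `σ`, `τ` with
`Chain`; equal white sets can be tested cell by cell, because the closed cells cover the rectangle
and neither white set reaches beyond it. -/
theorem realizes_iff {p q : ℕ → ℝ} :
    Realizes (ε : ℝ) (fun i : Fin (n + 1) => p i) (fun j : Fin (m + 1) => q j) D ↔
      ∃ σ τ, (toInput hD hn hm hε).Sol p q σ τ := by
  have ew : ∀ i : Fin n, (toInput hD hn hm hε).w i = d.width i := fun i => dif_pos i.2
  have eh : ∀ j : Fin m, (toInput hD hn hm hε).h j = d.height j := fun j => dif_pos j.2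
  constructor
  · intro H
    have hx : _root_.arcLength (fun i : Fin (n + 1) => p i) = D.xs :=
      congrArg FreeSpaceDiagram.xs H
    have hy : _root_.arcLength (fun j : Fin (m + 1) => q j) = D.ys :=
      congrArg FreeSpaceDiagram.ys H
    have hw := congrArg FreeSpaceDiagram.white H
    obtain ⟨σ, hp⟩ : ∃ σ, Chain n (toInput hD hn hm hε).w p σ :=
      chain_of_arcLength fun i => by rw [hx, hD.xs_succ, ew]
    obtain ⟨τ, hq⟩ : ∃ τ, Chain m (toInput hD hn hm hε).h q τ :=
      chain_of_arcLength fun j => by rw [hy, hD.ys_succ, eh]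
    refine ⟨σ, τ, hp, hq, fun i hi j hj => ?_⟩
    refine (cellMatch_iff hD hn hm hε hp hq hx hy ⟨i, hi⟩ ⟨j, hj⟩).2 fun x hxi y hyj => ?_
    rw [← hw]
    have mx := arcLength_mono (fun i : Fin (n + 1) => p i)
    have my := arcLength_mono (fun j : Fin (m + 1) => q j)
    rw [hx] at mx
    rw [hy] at my
    refine ⟨fun h => ⟨⟨?_, ?_⟩, ⟨?_, ?_⟩, h⟩, fun h => h.2.2⟩
    · exact (hD.xs_zero.symm.le.trans (mx (Fin.zero_le _))).trans hxi.1
    · rw [hx]; exact hxi.2.trans (mx (Fin.le_last _))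
    · exact (hD.ys_zero.symm.le.trans (my (Fin.zero_le _))).trans hyj.1
    · rw [hy]; exact hyj.2.trans (my (Fin.le_last _))
  · rintro ⟨σ, τ, hp, hq, hc⟩
    have hp' : Chain n (toInput hD hn hm hε).w p σ := hp
    have hq' : Chain m (toInput hD hn hm hε).h q τ := hq
    have hx : _root_.arcLength (fun i : Fin (n + 1) => p i) = D.xs := by
      funext i
      induction i using Fin.induction with
      | zero => rw [hD.xs_zero]; simp [_root_.arcLength]
      | succ i ih => rw [hp'.arcLength, hD.xs_succ, ih, ew]
    have hy : _root_.arcLength (fun j : Fin (m + 1) => q j) = D.ys := by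
      funext j
      induction j using Fin.induction with
      | zero => rw [hD.ys_zero]; simp [_root_.arcLength]
      | succ j ih => rw [hq'.arcLength, hD.ys_succ, ih, eh]
    refine FreeSpaceDiagram.ext hx hy (Set.ext fun ⟨x, y⟩ => ?_)
    have key : x ∈ Set.Icc 0 (D.xs (Fin.last n)) → y ∈ Set.Icc 0 (D.ys (Fin.last m)) →
        (|_root_.curvePoint (fun i : Fin (n + 1) => p i) x -
          _root_.curvePoint (fun j : Fin (m + 1) => q j) y| ≤ ε ↔ (x, y) ∈ D.white) := by
      intro h1 h2
      obtain ⟨i, hi⟩ := exists_cell hn D.xs (by rw [hD.xs_zero]; exact h1.1) h1.2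
      obtain ⟨j, hj⟩ := exists_cell hm D.ys (by rw [hD.ys_zero]; exact h2.1) h2.2
      exact (cellMatch_iff hD hn hm hε hp' hq' hx hy i j).1 (hc i i.2 j j.2) x hi y hj
    change (x ∈ Set.Icc 0 (_root_.arcLength (fun i : Fin (n + 1) => p i) (Fin.last n)) ∧
      y ∈ Set.Icc 0 (_root_.arcLength (fun j : Fin (m + 1) => q j) (Fin.last m)) ∧
      |_root_.curvePoint (fun i : Fin (n + 1) => p i) x -
        _root_.curvePoint (fun j : Fin (m + 1) => q j) y| ≤ ε) ↔ _
    rw [hx, hy]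
    exact ⟨fun h => (key h.1 h.2.1).1 h.2.2, fun h =>
      have hr := hD.white_subset h
      ⟨hr.1, hr.2, (key hr.1 hr.2).2 h⟩⟩

end

end FreeSpace

theorem mainTheorem7 :
    ∃ (prog : RealRAM.Program) (C : ℕ),
      ∀ (n m W ε : ℕ), 1 ≤ m → m ≤ n → 1 ≤ ε →
      ∀ (D : FreeSpaceDiagram n m) (d : DiagramData n m), d.Describes D →
        (∀ i, d.width i ≤ W) → (∀ j, d.height j ≤ W) →
        ∃ (t : ℕ) (s : RealRAM.Memory),
          RealRAM.Runs prog (d.initialMemory ε) t s ∧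
          t ≤ C * max (n * ε ^ 2) (n ^ 2 * W) ∧
          ((s.answer = 1 ∧ Realizes (ε : ℝ) (s.curveP n) (s.curveQ m) D) ∨
            (s.answer = 0 ∧
              ∀ (p : Fin (n + 1) → ℝ) (q : Fin (m + 1) → ℝ), ¬ Realizes (ε : ℝ) p q D)) := by
  obtain ⟨C, hC⟩ := RealRAM.realize_spec
  -- The bounds `t1`, …, `t4` below add up to at most `33` times the maximum.
  refine ⟨RealRAM.realize, C * 50, fun n m W ε hm hmn hε D d hD hw hh => ?_⟩
  have hn : 0 < n := by omega
  obtain ⟨t, s, hr, ht, h⟩ := hC (FreeSpace.toInput hD hn hm hε) _ (FreeSpace.loaded_toInput hD hn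
      hm hε) rfl rfl rfl
  refine ⟨t, s, hr, ht.trans ?_, ?_⟩
  · rw [mul_assoc]
    refine Nat.mul_le_mul_left _ ?_
    have hW : 1 ≤ W := (hD.width_pos ⟨0, hn⟩).trans_le (hw _)
    have lp : ∑ i ∈ Finset.range n, (FreeSpace.toInput hD hn hm hε).w i ≤ n * W := by
      refine (Finset.sum_le_card_nsmul _ _ W fun i hi => ?_).trans (by simp)
      have hi := Finset.mem_range.1 hi
      exact (dif_pos hi).trans_le (hw _)
    have lq : ∑ j ∈ Finset.range m, (FreeSpace.toInput hD hn hm hε).h j ≤ m * W := by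
      refine (Finset.sum_le_card_nsmul _ _ W fun j hj => ?_).trans (by simp)
      have hj := Finset.mem_range.1 hj
      exact (dif_pos hj).trans_le (hh _)
    have lq' : m * W ≤ n * W := Nat.mul_le_mul_right _ hmn
    have hnW : 1 ≤ n * W := Nat.mul_pos hn hW
    change (n + m + 1) ^ 2 + (n + 1) * (∑ i ∈ Finset.range n, (FreeSpace.toInput hD hn hm hε).w i +
        1) +
      (m + 1) * (∑ j ∈ Finset.range m, (FreeSpace.toInput hD hn hm hε).h j + 1) +
      (n + m + 2) * (ε + 1) ^ 2 ≤ _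
    -- The quadratic cost of marking and verifying is absorbed by `n ^ 2 * W`, as widths are
    -- positive and so `W ≥ 1`.
    have t1 : (n + m + 1) ^ 2 ≤ 9 * (n ^ 2 * W) := by
      calc (n + m + 1) ^ 2 ≤ (3 * n) ^ 2 := Nat.pow_le_pow_left (by omega) 2
        _ = 9 * (n ^ 2 * 1) := by ring
        _ ≤ _ := by gcongr
    have t2 : (n + 1) * (∑ i ∈ Finset.range n, (FreeSpace.toInput hD hn hm hε).w i + 1) ≤ 4 * (n ^
        2 * W) := by
      calc _ ≤ (2 * n) * (2 * (n * W)) := Nat.mul_le_mul (by omega) (by omega)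
        _ = _ := by ring
    have t3 : (m + 1) * (∑ j ∈ Finset.range m, (FreeSpace.toInput hD hn hm hε).h j + 1) ≤ 4 * (n ^
        2 * W) := by
      calc _ ≤ (2 * n) * (2 * (n * W)) := Nat.mul_le_mul (by omega) (by omega)
        _ = _ := by ring
    have t4 : (n + m + 2) * (ε + 1) ^ 2 ≤ 16 * (n * ε ^ 2) := by
      calc _ ≤ (4 * n) * (2 * ε) ^ 2 := Nat.mul_le_mul (by omega) (Nat.pow_le_pow_left (by omega) 2)
        _ = _ := by ring
    have m1 := le_max_left (n * ε ^ 2) (n ^ 2 * W)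
    have m2 := le_max_right (n * ε ^ 2) (n ^ 2 * W)
    omega
  · rcases h with ⟨h1, h2⟩ | ⟨h1, h2⟩
    · exact Or.inl ⟨h1, (FreeSpace.realizes_iff hD hn hm hε).2 h2⟩
    · refine Or.inr ⟨h1, fun p q hR => h2 ?_⟩
      -- Finite vertex sequences are extended by zeros, since solutions are indexed by all natural
      -- numbers.
      obtain ⟨p', rfl⟩ : ∃ p' : ℕ → ℝ, (fun i : Fin (n + 1) => p' i) = p :=
        ⟨fun k => if h : k < n + 1 then p ⟨k, h⟩ else 0, funext fun i => dif_pos i.2⟩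
      obtain ⟨q', rfl⟩ : ∃ q' : ℕ → ℝ, (fun j : Fin (m + 1) => q' j) = q :=
        ⟨fun k => if h : k < m + 1 then q ⟨k, h⟩ else 0, funext fun j => dif_pos j.2⟩
      exact ⟨p', q', (FreeSpace.realizes_iff hD hn hm hε).1 hR⟩
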